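/- A $G_2$ structure on a smooth $7$-manifold $M$ is a smooth $3$-form $\varphi$ which is positive, i.e. at each $x\in M$ one has $\varphi_x=u^*\phi$ for some linear isomorphism $u:T_xM\to\mathbb R^7$, where $\phi=e^{123}+e^{145}+e^{167}+e^{246}-e^{257}-e^{347}-e^{356}$. It determines a metric $g$ and an orientation by $g(u,v)\,vol_g=\frac16(u\lrcorner\varphi)\wedge(v\lrcorner\varphi)\wedge\varphi$; let $\nabla$, $Rm$ and $*_\varphi$ be the Levi-Civita connection, the Riemann curvature tensor and the Hodge star of $g$, let $\Delta_\varphi=dd^*+d^*d$ be the Hodge Laplacian, $\psi=*_\varphi\varphi$, and let $T_{ij}=\frac1{24}\nabla_i\varphi_{lmn}\psi_j{}^{lmn}$ be the full torsion tensor. A solution of the Laplacian flow on $[0,\epsilon]$, $\epsilon>0$, is a family $\varphi(t)$, $t\in[0,\epsilon]$, of $G_2$ structures on $M$, smooth on $M\times[0,\epsilon]$, with $$\frac{\partial}{\partial t}\varphi=\Delta_\varphi\varphi,\qquad d\varphi=0 .$$ Put $$\Lambda(x,t)=\left(|\nabla T(x,t)|_{g(t)}^2+|Rm(x,t)|_{g(t)}^2\right)^{1/2},\qquad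 \Lambda(t)=\sup_{x\in M}\Lambda(x,t).$$ Proposition 4.1 (doubling-time estimate). There is a universal constant $C>0$ such that for every compact smooth $7$-manifold $M$, every $\epsilon>0$ and every solution $\varphi(t)$ of the Laplacian flow on $M$ for $t\in[0,\epsilon]$, $$\Lambda(t)\le 2\Lambda(0)\qquad\text{for all } t \text{ with } 0\le t\le\min\Big\{\epsilon,\frac1{C\Lambda(0)}\Big\},$$ where $\frac1{C\Lambda(0)}$ is read as $+\infty$ if $\Lambda(0)=0$. -/

import Mathlib

open scoped Manifold ContDiff

noncomputable section

namespace G2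

/-- The model space `ℝ⁷`. -/
abbrev E7 := EuclideanSpace ℝ (Fin 7)

/-! ### Tensor calculus in a coordinate chart

A covariant `k`-tensor field on (an open subset of) `ℝ⁷` is given by its components
`α_{i₁ … i_k}` with respect to the coordinate frame. A `k`-form is such a tensor field with
skew-symmetric components, `α = (1 / k!) α_{i₁ … i_k} dx^{i₁} ∧ … ∧ dx^{i_k}`. -/

/-- Components of a covariant `k`-tensor field in a coordinate chart. -/
abbrev CoordTensor (k : ℕ) := E7 → (Fin k → Fin 7) → ℝ

/-- The partial derivative `∂_i f` at `y`. -/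
def pderiv (i : Fin 7) (f : E7 → ℝ) (y : E7) : ℝ :=
  fderiv ℝ f y (EuclideanSpace.single i 1)

/-- The exterior derivative,
`(dα)_{j₀ … j_k} = ∑ₛ (-1)ˢ ∂_{jₛ} α_{j₀ … ĵₛ … j_k}`. -/
def extD {k : ℕ} (α : CoordTensor k) : CoordTensor (k + 1) := fun y J =>
  ∑ s : Fin (k + 1), (-1) ^ (s : ℕ) * pderiv (J s) (fun z => α z (fun r => J (s.succAbove r))) y

/-- The Levi-Civita symbol: the sign of `f` if `f` is a permutation, and `0` otherwise. -/
def leviCivita (f : Fin 7 → Fin 7) : ℝ :=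
  ((1 : Matrix (Fin 7) (Fin 7) ℝ).submatrix f id).det

/-- The coefficient of `dx¹ ∧ … ∧ dx⁷` in `B_φ(∂_i, ∂_j)`, where
`B_φ(u, v) = (1/6) (u ⌟ φ) ∧ (v ⌟ φ) ∧ φ`. (The wedge product of two `2`-forms and a `3`-form
contributes the factor `1 / (2! 2! 3!)`.) -/
def bForm (φ : CoordTensor 3) (y : E7) : Matrix (Fin 7) (Fin 7) ℝ := Matrix.of fun i j =>
  (1 / 6) * ((1 / 24) * ∑ σ : Equiv.Perm (Fin 7), ((Equiv.Perm.sign σ : ℤ) : ℝ) *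
    (φ y ![i, σ 0, σ 1] * φ y ![j, σ 2, σ 3] * φ y ![σ 4, σ 5, σ 6]))

/-- The coefficient `v` of the volume form `vol_g = v dx¹ ∧ … ∧ dx⁷` determined by a positive
`3`-form. The equation `g(u, v) vol_g = B_φ(u, v)` with `v = ± √(det g)` gives `det B = v⁹`. -/
def volCoeff (φ : CoordTensor 3) (y : E7) : ℝ :=
  Real.sign (bForm φ y).det * |(bForm φ y).det| ^ (1 / 9 : ℝ)

/-- The metric `g_{ij}` determined by a positive `3`-form through
`g(u, v) vol_g = B_φ(u, v)`. -/
def metric (φ : CoordTensor 3) (y : E7) : Matrix (Fin 7) (Fin 7) ℝ :=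
  (volCoeff φ y)⁻¹ • bForm φ y

/-- The inverse metric `g^{ij}`. -/
def metricInv (φ : CoordTensor 3) (y : E7) : Matrix (Fin 7) (Fin 7) ℝ := (metric φ y)⁻¹

/-- The full contraction `α_{i₁ … i_k} β_{j₁ … j_k} g^{i₁ j₁} ⋯ g^{i_k j_k}` at a point. -/
def contract (φ : CoordTensor 3) (y : E7) {k : ℕ} (a b : (Fin k → Fin 7) → ℝ) : ℝ :=
  ∑ I : Fin k → Fin 7, ∑ J : Fin k → Fin 7, a I * b J * ∏ s, metricInv φ y (I s) (J s)

/-- The Hodge star of the metric and orientation determined by `φ`,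
`(*α)_{j₁ … j_l} = (1 / k!) α^{i₁ … i_k} vol_{i₁ … i_k j₁ … j_l}` for a `k`-form `α`. -/
def hodgeStar (φ : CoordTensor 3) {k l : ℕ} (h : k + l = 7) (α : CoordTensor k) :
    CoordTensor l := fun y J =>
  (1 / (k.factorial : ℝ)) * contract φ y (α y)
    (fun I => volCoeff φ y * leviCivita (Fin.append I J ∘ Fin.cast h.symm))

/-- The codifferential `d* = (-1)^p * d *` on `p`-forms, `p = k + 1`, in dimension `7`. -/
def codiff (φ : CoordTensor 3) {k l : ℕ} (h : k + 1 + l = 7) (α : CoordTensor (k + 1)) :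
    CoordTensor k := fun y J =>
  (-1) ^ (k + 1) * hodgeStar φ (k := l + 1) (l := k) (by omega) (extD (hodgeStar φ h α)) y J

/-- The Hodge Laplacian `Δ_φ φ = d d* φ + d* d φ` of `φ`. -/
def hodgeLaplacian (φ : CoordTensor 3) : CoordTensor 3 := fun y J =>
  extD (codiff φ (k := 2) (l := 4) rfl φ) y J + codiff φ (k := 3) (l := 3) rfl (extD φ) y J

/-- The Christoffel symbol `Γ^k_{ij}` of the Levi-Civita connection of the metric of `φ`. -/
def christoffel (φ : CoordTensor 3) (k i j : Fin 7) (y : E7) : ℝ :=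
  (1 / 2) * ∑ l, metricInv φ y k l *
    (pderiv i (fun z => metric φ z j l) y + pderiv j (fun z => metric φ z i l) y
      - pderiv l (fun z => metric φ z i j) y)

/-- The covariant derivative of a covariant tensor field; the first index of the result is the
direction of differentiation:
`∇_i α_{j₁ … j_k} = ∂_i α_{j₁ … j_k} - ∑ₛ Γ^m_{i jₛ} α_{j₁ … m … j_k}`. -/
def covDeriv (φ : CoordTensor 3) {k : ℕ} (α : CoordTensor k) : CoordTensor (k + 1) := fun y J =>
  pderiv (J 0) (fun z => α z (Fin.tail J)) y
    - ∑ s : Fin k, ∑ m : Fin 7,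
        christoffel φ m (J 0) (Fin.tail J s) y * α y (Function.update (Fin.tail J) s m)

/-- The Riemann curvature tensor of the metric of `φ`: `R_{ijkl} = g(R(∂_i, ∂_j) ∂_l, ∂_k)` with
`R(X, Y) Z = ∇_X ∇_Y Z - ∇_Y ∇_X Z - ∇_{[X, Y]} Z`. -/
def riemann (φ : CoordTensor 3) : CoordTensor 4 := fun y J =>
  ∑ m, metric φ y (J 2) m *
    (pderiv (J 0) (christoffel φ m (J 1) (J 3)) y - pderiv (J 1) (christoffel φ m (J 0) (J 3)) y
      + ∑ p, (christoffel φ m (J 0) p y * christoffel φ p (J 1) (J 3) y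
          - christoffel φ m (J 1) p y * christoffel φ p (J 0) (J 3) y))

/-- The `4`-form `ψ = *_φ φ`. -/
def psi (φ : CoordTensor 3) : CoordTensor 4 := hodgeStar φ (k := 3) (l := 4) rfl φ

/-- The full torsion tensor `T_{ij} = (1/24) ∇_i φ_{lmn} ψ_j^{lmn}`. -/
def torsion (φ : CoordTensor 3) : CoordTensor 2 := fun y J =>
  (1 / 24) * contract φ y (fun L : Fin 3 → Fin 7 => covDeriv φ φ y (Matrix.vecCons (J 0) L))
    (fun L : Fin 3 → Fin 7 => psi φ y (Matrix.vecCons (J 1) L))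

/-- `(|∇T|² + |Rm|²)^{1/2}` in a coordinate chart. -/
def coordLambda (φ : CoordTensor 3) (y : E7) : ℝ :=
  Real.sqrt (contract φ y (covDeriv φ (torsion φ) y) (covDeriv φ (torsion φ) y)
    + contract φ y (riemann φ y) (riemann φ y))

/-! ### `G₂` structures and the Laplacian flow on a manifold -/

/-- The `3`-form `e^{ijk} = e^i ∧ e^j ∧ e^k` on `ℝ⁷`. -/
def wedge3 (i j k : Fin 7) (u v w : E7) : ℝ :=
  Matrix.det !![u i, u j, u k; v i, v j, v k; w i, w j, w k]

/-- The standard `3`-form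
`e^{123} + e^{145} + e^{167} + e^{246} - e^{257} - e^{347} - e^{356}` on `ℝ⁷`
(the indices are shifted by one, as `Fin 7` starts at `0`). -/
def stdForm (u v w : E7) : ℝ :=
  wedge3 0 1 2 u v w + wedge3 0 3 4 u v w + wedge3 0 5 6 u v w + wedge3 1 3 5 u v w
    - wedge3 1 4 6 u v w - wedge3 2 3 6 u v w - wedge3 2 4 5 u v w

section Manifold

variable {M : Type*} [TopologicalSpace M] [ChartedSpace E7 M]

/-- A (not necessarily smooth) `3`-form on `M`. -/
abbrev ThreeForm (M : Type*) [TopologicalSpace M] [ChartedSpace E7 M] :=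
  (x : M) → (TangentSpace (𝓡 7) x) [⋀^Fin 3]→L[ℝ] ℝ

/-- `η` is positive at `x`: `η_x = u^* φ₀` for an invertible linear map `u : T_x M → ℝ⁷`, where
`φ₀` is the standard `3`-form. -/
def IsPositiveAt (η : ThreeForm M) (x : M) : Prop :=
  ∃ u : TangentSpace (𝓡 7) x ≃ₗ[ℝ] E7, ∀ a : Fin 3 → TangentSpace (𝓡 7) x,
    η x a = stdForm (u (a 0)) (u (a 1)) (u (a 2))

/-- The coordinate vector field `∂_i` of the chart `e` at the point with coordinates `y`. -/
def coordVector (e : OpenPartialHomeomorph M E7) (y : E7) (i : Fin 7) :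
    TangentSpace (𝓡 7) (e.symm y) :=
  mfderiv (𝓡 7) (𝓡 7) e.symm y (EuclideanSpace.single i 1 : E7)

/-- The components `η_{ijk} = η(∂_i, ∂_j, ∂_k)` of a `3`-form in the chart `e`. -/
def components (e : OpenPartialHomeomorph M E7) (η : ThreeForm M) : CoordTensor 3 := fun y J =>
  η (e.symm y) (fun r => coordVector e y (J r))

/-- `φ` is a (smooth) solution on `[0, ε]` of the Laplacian flow of closed `G₂` structures:
`∂φ/∂t = Δ_φ φ`, `dφ = 0`. -/
structure IsLaplacianFlow (ε : ℝ) (φ : ℝ → ThreeForm M) : Prop where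
  /-- `φ` is smooth in space and time. -/
  smooth : ∀ e ∈ atlas E7 M, ∀ J : Fin 3 → Fin 7,
    ContDiffOn ℝ ∞ (fun p : ℝ × E7 => components e (φ p.1) p.2 J) (Set.Icc 0 ε ×ˢ e.target)
  /-- Each `φ(t)` is a `G₂` structure. -/
  positive : ∀ t ∈ Set.Icc 0 ε, ∀ x : M, IsPositiveAt (φ t) x
  /-- Each `φ(t)` is closed. -/
  closed : ∀ t ∈ Set.Icc 0 ε, ∀ e ∈ atlas E7 M, ∀ y ∈ e.target, ∀ J : Fin 4 → Fin 7,
    extD (components e (φ t)) y J = 0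
  /-- The evolution equation (with one-sided time derivatives at the ends of `[0, ε]`). -/
  evolution : ∀ t ∈ Set.Icc 0 ε, ∀ e ∈ atlas E7 M, ∀ y ∈ e.target, ∀ J : Fin 3 → Fin 7,
    HasDerivWithinAt (fun s => components e (φ s) y J)
      (hodgeLaplacian (components e (φ t)) y J) (Set.Icc 0 ε) t

/-- `Λ(x) = (|∇T(x)|² + |Rm(x)|²)^{1/2}` for a `G₂` structure `η`, computed in the preferred chart
at `x`. -/
def Lambda (η : ThreeForm M) (x : M) : ℝ :=
  coordLambda (components (chartAt E7 x) η) (chartAt E7 x x)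

/-- `sup_M Λ`. -/
def LambdaSup (η : ThreeForm M) : ℝ := ⨆ x : M, Lambda η x

end Manifold

end G2

end

open scoped Matrix

noncomputable section

namespace G2

section

/-! ### The standard `3`-form and its dual `4`-form: contraction identities -/

/-! Reduction to an ordinary differential inequality. It is enough to find a universal `C` such that
the time derivative of `Λ²` is at most `C Λ³` at every spatial local maximum of `Λ`
(`exists_reaction_bound`). For any `L > Λ(0)`, the function `Λ` then stays below the solution `b = L
/ (1 - κ L t)` of `b' = κ b²`, where `2 κ > C`: at a first contact `Λ² - b²` would have a
nonnegative time derivative, while the bound makes it at most `(C - 2 κ) b³ < 0` (`Lambda_lt`).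
Letting `L` tend to `Λ(0)` gives the factor `2` as long as `4 κ Λ(0) t ≤ 1`.

The reaction bound is found without the exact evolution equations. The geometric quantities are
differential polynomials in `φ` (`DPoly`): the coefficients are smooth functions of `φ`, and a
derivative of order `m` has weight `m`, which is the scaling behaviour. Both `∇T` and `Rm` have
order and weight `2`, and a time derivative along the flow raises order and weight by `2`. Hence
only the part linear in fourth derivatives, with coefficients frozen at the standard form, has to be
computed; all the rest is a weight `4` expression in derivatives of order at most `3`, up to terms
whose coefficient vanishes at the standard form (`Low`, `LEq`).

The linear computation. Every `3`-form is `A · φ₀` for a matrix `A` (`act_sec`). The symmetric part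
of `A` is half the variation of the metric, and of the skew part only a vector acts. Linearly, `dφ =
0` says that the torsion is skew and lies in the `14`-dimensional part of the `2`-forms
(`torsion_algebra`), `d*φ` is `-2T`, and the curl of `T` taken with `φ` is `-Ric`. So the velocity
`d d* φ` moves the metric by `-2 Ric` and has no vector part: to leading order it is linearized
Ricci flow, under which curvature and torsion satisfy the flat heat equation exactly (`lcur_lflow`,
`ltor_lflow`). At a point where `φ` is standard and its derivatives of order `m ≤ 3` are at most `ρ
^ m`, this yields `∂ₜ Λ² ≤ ΔΛ² - 2 G + C ρ⁴ Λ`, where `G` is the squared norm of the first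
derivatives of `∇T` and `Rm` (`exists_hasTD_lambdaSq`).

The choice of `ρ`. Every construction is natural under changes of coordinates, so a point may be
studied in coordinates where `φ` is standard and where the linearized Christoffel symbols, together
with the symmetrizations of their first and second derivatives, vanish (`exists_gauge`). There the
jets of order at most `3` are controlled by `T`, `∇T`, `Rm` and first derivatives of the last two.
The torsion itself is controlled by `|T|² ≲ |∇T|`, which comes from differentiating `T_{ij} φ_{kij}
= 0` (`GaugeAt.sum_torsion_sq`). Hence `ρ ≈ Λ^{1/2} + G^{1/6}` is admissible (`exists_jetBound`). At
a maximum `ΔΛ² ≤ 0`, and the term `G^{2/3} Λ` of `ρ⁴ Λ` is absorbed by `-2 G` and a multiple of `Λ³`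
(`absorb_gradient`). -/

/-- The cross product of `ℝ⁷` on the standard basis, as a table of digits in base `16`: the digit
of index `7 * i + j` is `k + 1` if `e_i × e_j = e_k`, it is `k + 9` if `e_i × e_j = -e_k`, and `0`
if `i = j`. -/
def crossTable (i j : Fin 7) : ℕ :=
  (3585736532366560250674900838741267230413820654853388261936 >>> (4 * (7 * i.val + j.val))) % 16

/-- The components of the standard `3`-form. -/
def phiZ (i j k : Fin 7) : ℤ :=
  if crossTable i j = k.val + 1 then 1 else if crossTable i j = k.val + 9 then -1 else 0

/-- The Kronecker symbol. -/
def deltaZ (i j : Fin 7) : ℤ := if i = j then 1 else 0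

/-- The components of the dual `4`-form of the standard `3`-form. -/
def psiZ (i j k l : Fin 7) : ℤ :=
  -- Flipping the bit `8` of a nonzero digit changes the sign of the basis vector. The nested
  -- conditional is thus the inner product of `e_i × e_j` with `e_k × e_l`, and subtracting its `δδ`
  -- part leaves `ψ`.
  (if crossTable i j = 0 then 0 else if crossTable i j = crossTable k l then 1
    else if crossTable i j ^^^ 8 = crossTable k l then -1 else 0)
    - deltaZ i k * deltaZ j l + deltaZ i l * deltaZ j k

/-- A sum over `Fin 7`, written out for evaluation. -/
def sumZ (f : Fin 7 → ℤ) : ℤ := f 0 + f 1 + f 2 + f 3 + f 4 + f 5 + f 6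

theorem sumZ_eq (f : Fin 7 → ℤ) : sumZ f = ∑ i, f i := by
  rw [Fin.sum_univ_seven]; rfl

theorem phiZ_swap12 : ∀ i j k : Fin 7, phiZ j i k = -phiZ i j k := by decide +kernel
theorem phiZ_swap23 : ∀ i j k : Fin 7, phiZ i k j = -phiZ i j k := by decide +kernel
theorem psiZ_swap12 : ∀ i j k l : Fin 7, psiZ j i k l = -psiZ i j k l := by decide +kernel
theorem psiZ_swap23 : ∀ i j k l : Fin 7, psiZ i k j l = -psiZ i j k l := by decide +kernel
theorem psiZ_swap34 : ∀ i j k l : Fin 7, psiZ i j l k = -psiZ i j k l := by decide +kernel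

/-- The basic identity of the cross product, from which most later contractions follow. Integer
tables and `sumZ` keep it within reach of kernel evaluation. -/
theorem phiZ_phiZ : ∀ i j a b : Fin 7, sumZ (fun k => phiZ i j k * phiZ a b k) =
    deltaZ i a * deltaZ j b - deltaZ i b * deltaZ j a + psiZ i j a b := by decide +kernel

/-- A skew function of three indices vanishes if it vanishes on increasing indices. -/
theorem eq_zero_of_skew3 {f : Fin 7 → Fin 7 → Fin 7 → ℤ}
    (h12 : ∀ a b c, f b a c = -f a b c) (h23 : ∀ a b c, f a c b = -f a b c)
    (h : ∀ a b c, a < b → b < c → f a b c = 0) (a b c : Fin 7) : f a b c = 0 := by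
  have e1 : ∀ a c, f a a c = 0 := fun a c => by have := h12 a a c; omega
  have e2 : ∀ a b, f a b b = 0 := fun a b => by have := h23 a b b; omega
  rcases lt_trichotomy a b with hab | rfl | hab
  · rcases lt_trichotomy b c with hbc | rfl | hbc
    · exact h _ _ _ hab hbc
    · exact e2 _ _
    · rcases lt_trichotomy a c with hac | rfl | hac
      · have := h _ _ _ hac hbc; have := h23 a b c; omega
      · have := h12 a b a; have := e2 b a; omega
      · have := h _ _ _ hac hab; have := h23 a b c; have := h12 a c b; omega
  · exact e1 _ _
  · rcases lt_trichotomy b c with hbc | rfl | hbc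
    · rcases lt_trichotomy a c with hac | rfl | hac
      · have := h _ _ _ hab hac; have := h12 a b c; omega
      · have := h23 a b a; have := e1 a b; omega
      · have := h _ _ _ hbc hac; have := h12 a b c; have := h23 b a c; omega
    · exact e2 _ _
    · have := h _ _ _ hbc hab; have := h12 a b c; have := h23 b a c; have := h12 b c a; omega

/-- A skew function of four indices vanishes if it vanishes on increasing indices. -/
theorem eq_zero_of_skew4 {f : Fin 7 → Fin 7 → Fin 7 → Fin 7 → ℤ}
    (h12 : ∀ a b c d, f b a c d = -f a b c d) (h23 : ∀ a b c d, f a c b d = -f a b c d)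
    (h34 : ∀ a b c d, f a b d c = -f a b c d)
    (h : ∀ a b, a < b → ∀ c, b < c → ∀ d, c < d → f a b c d = 0) (a b c d : Fin 7) :
    f a b c d = 0 := by
  refine eq_zero_of_skew3 (h23 a) (h34 a) (fun b c d hbc hcd => ?_) b c d
  have e1 : ∀ a c d, f a a c d = 0 := fun a c d => by have := h12 a a c d; omega
  rcases lt_trichotomy a b with hab | rfl | hab
  · exact h _ _ hab _ hbc _ hcd
  · exact e1 _ _ _
  have k1 := h12 a b c d
  rcases lt_trichotomy a c with hac | rfl | hac
  · have := h _ _ hab _ hac _ hcd; omega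
  · have := h23 b a a d; omega
  have k2 := h23 b a c d
  rcases lt_trichotomy a d with had | rfl | had
  · have := h _ _ hbc _ hac _ had; omega
  · have := h34 b c a a; omega
  · have := h _ _ hbc _ hcd _ had; have := h34 b c a d; omega

theorem phiZ_psiZ_sorted : ∀ i j : Fin 7, i < j → ∀ a b : Fin 7, a < b → ∀ c, b < c →
    sumZ (fun k => phiZ i j k * psiZ a b c k) +
    (deltaZ i a * phiZ j b c + deltaZ i b * phiZ a j c + deltaZ i c * phiZ a b j
      - deltaZ j a * phiZ i b c - deltaZ j b * phiZ a i c - deltaZ j c * phiZ a b i) = 0 := by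
  decide +kernel

/-- Both sides are skew in `i, j` and in `a, b, c`, so only increasing indices have to be evaluated.
-/
theorem phiZ_psiZ (i j a b c : Fin 7) : sumZ (fun k => phiZ i j k * psiZ a b c k) =
    -(deltaZ i a * phiZ j b c + deltaZ i b * phiZ a j c + deltaZ i c * phiZ a b j
      - deltaZ j a * phiZ i b c - deltaZ j b * phiZ a i c - deltaZ j c * phiZ a b i) := by
  have key : ∀ i j, i < j → ∀ a b c, sumZ (fun k => phiZ i j k * psiZ a b c k) +
    (deltaZ i a * phiZ j b c + deltaZ i b * phiZ a j c + deltaZ i c * phiZ a b j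
      - deltaZ j a * phiZ i b c - deltaZ j b * phiZ a i c - deltaZ j c * phiZ a b i) = 0 := by
    intro i j hij
    apply eq_zero_of_skew3
    · intro a b c
      simp only [psiZ_swap12 a b c, phiZ_swap12 a b, sumZ]
      rw [phiZ_swap12 b j c, phiZ_swap12 a j c, phiZ_swap12 b i c, phiZ_swap12 a i c]
      ring
    · intro a b c
      simp only [psiZ_swap23 a b c, phiZ_swap23 j b c, phiZ_swap23 i b c, sumZ]
      rw [phiZ_swap23 a c j, phiZ_swap23 a j b, phiZ_swap23 a c i, phiZ_swap23 a i b]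
      ring
    · exact fun a b c ha => phiZ_psiZ_sorted i j hij a b ha c
  rcases lt_trichotomy i j with hij | rfl | hij
  · linarith [key i j hij a b c]
  · have : ∀ k, phiZ i i k = 0 := fun k => by have := phiZ_swap12 i i k; omega
    simp only [this, sumZ]; ring
  · have := key j i hij a b c
    simp only [phiZ_swap12 j i, sumZ] at *
    linarith

/-- Partial antisymmetrization of `∑ p, φ_{pbc} φ_{pmn}`. -/
def gZ (b c m n : Fin 7) : ℤ := deltaZ b m * deltaZ c n - deltaZ b n * deltaZ c m + psiZ b c m n

/-- The kernel of the composition of `36` times the section of the action of `𝔤𝔩₇` on the standard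
form with that action. -/
def sectionKer (l m n a b c : Fin 7) : ℤ :=
  3 * (phiZ l b c * phiZ a m n + phiZ m b c * phiZ l a n + phiZ n b c * phiZ l m a)
  + 6 * (deltaZ l a * gZ b c m n + deltaZ m a * gZ b c n l + deltaZ n a * gZ b c l m)
  - 3 * phiZ a b c * phiZ l m n

/-- Six times the projection onto skew `3`-tensors: its contraction with a skew `χ` is `6 χ`. -/
def det3Z (l m n a b c : Fin 7) : ℤ :=
  deltaZ l a * (deltaZ m b * deltaZ n c - deltaZ m c * deltaZ n b)
      - deltaZ l b * (deltaZ m a * deltaZ n c - deltaZ m c * deltaZ n a)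
      + deltaZ l c * (deltaZ m a * deltaZ n b - deltaZ m b * deltaZ n a)

theorem sectionKer_sorted : ∀ l m : Fin 7, l < m → ∀ n, m < n → ∀ a b : Fin 7, a < b → ∀ c, b < c →
    sectionKer l m n a b c + sectionKer l m n b c a + sectionKer l m n c a b
      - 18 * det3Z l m n a b c = 0 := by decide +kernel

theorem gZ_swap12 (b c m n : Fin 7) : gZ c b m n = -gZ b c m n := by
  simp only [gZ, psiZ_swap12 b c]; ring

theorem gZ_swap34 (b c m n : Fin 7) : gZ b c n m = -gZ b c m n := by
  simp only [gZ, psiZ_swap34 b c m]; ring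

theorem sectionKer_swap23 (l m n a b c : Fin 7) :
    sectionKer l m n a c b = -sectionKer l m n a b c := by
  simp only [sectionKer, phiZ_swap23 _ b c, gZ_swap12 b c]; ring

theorem sectionKer_swap_left (l m n a b c : Fin 7) :
    sectionKer m l n a b c = -sectionKer l m n a b c := by
  simp only [sectionKer, gZ_swap34 _ _ m n, gZ_swap34 _ _ n l, gZ_swap34 _ _ l m, phiZ_swap12 l m]
  rw [phiZ_swap12 m a n, phiZ_swap12 l a n]
  ring

theorem sectionKer_swap_right (l m n a b c : Fin 7) :
    sectionKer l n m a b c = -sectionKer l m n a b c := by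
  simp only [sectionKer, gZ_swap34 _ _ m n, gZ_swap34 _ _ n l, gZ_swap34 _ _ l m, phiZ_swap23 _ m n]
  rw [phiZ_swap23 l n a, phiZ_swap23 l a m]
  ring

/-- This is the coefficient form of `act_sec`. The kernel is already skew in `b, c`, so its cyclic
sum is skew in `a, b, c`; it is also skew in `l, m, n`, and the identity is evaluated on increasing
triples. -/
theorem sectionKer_cyclic (l m n a b c : Fin 7) :
    sectionKer l m n a b c + sectionKer l m n b c a + sectionKer l m n c a b =
      18 * det3Z l m n a b c := by
  have key : ∀ l m n, l < m → m < n → ∀ a b c,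
      sectionKer l m n a b c + sectionKer l m n b c a + sectionKer l m n c a b
      - 18 * det3Z l m n a b c = 0 := by
    intro l m n hl hm
    apply eq_zero_of_skew3
    · intro a b c
      rw [sectionKer_swap23 l m n b c a, sectionKer_swap23 l m n a b c,
        sectionKer_swap23 l m n c a b]
      simp only [det3Z]; ring
    · intro a b c
      rw [sectionKer_swap23 l m n b c a, sectionKer_swap23 l m n a b c,
        sectionKer_swap23 l m n c a b]
      simp only [det3Z]; ring
    · exact fun a b c ha => sectionKer_sorted l m hl n hm a b ha c
  have := eq_zero_of_skew3 (f := fun l m n => sectionKer l m n a b c + sectionKer l m n b c a +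
    sectionKer l m n c a b - 18 * det3Z l m n a b c)
    (fun l m n => by simp only [sectionKer_swap_left l m n, det3Z]; ring)
    (fun l m n => by simp only [sectionKer_swap_right l m n, det3Z]; ring)
    (fun l m n hl hm => key l m n hl hm a b c) l m n
  linarith

/-- The sign of `j - i`. -/
def ltSign (i j : Fin 7) : ℤ := if i < j then 1 else if j < i then -1 else 0

/-- The Levi-Civita symbol as a product of signs. -/
def epsZ (a b c d e f g : Fin 7) : ℤ :=
  (ltSign a b * ltSign a c * ltSign a d * ltSign a e * ltSign a f * ltSign a g) *
  (ltSign b c * ltSign b d * ltSign b e * ltSign b f * ltSign b g) *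
  (ltSign c d * ltSign c e * ltSign c f * ltSign c g) *
  (ltSign d e * ltSign d f * ltSign d g) * (ltSign e f * ltSign e g) * ltSign f g

theorem phiZ_epsZ_sorted : ∀ a b : Fin 7, a < b → ∀ c, b < c → ∀ d, c < d →
    (sumZ fun i => sumZ fun j => sumZ fun k =>
      if phiZ i j k = 0 then 0 else phiZ i j k * epsZ i j k a b c d) - 6 * psiZ a b c d = 0 := by
  decide +kernel

theorem ltSign_swap (i j : Fin 7) : ltSign j i = -ltSign i j := by
  revert i j; decide

/-- This is `*φ = ψ` for the standard form, where `6 = 3!`. The evaluated version skips the terms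
with `phiZ i j k = 0`, which are most of them. -/
theorem phiZ_epsZ (a b c d : Fin 7) :
    ∑ i, ∑ j, ∑ k, phiZ i j k * epsZ i j k a b c d = 6 * psiZ a b c d := by
  have h0 : ∀ a b c d : Fin 7, (sumZ fun i => sumZ fun j => sumZ fun k =>
      if phiZ i j k = 0 then 0 else phiZ i j k * epsZ i j k a b c d) =
      ∑ i, ∑ j, ∑ k, phiZ i j k * epsZ i j k a b c d := by
    intro a b c d
    simp only [sumZ_eq]
    refine Finset.sum_congr rfl fun i _ => Finset.sum_congr rfl fun j _ =>
      Finset.sum_congr rfl fun k _ => ?_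
    split_ifs with h <;> simp [h]
  have := eq_zero_of_skew4
    (f := fun a b c d => ∑ i, ∑ j, ∑ k, phiZ i j k * epsZ i j k a b c d - 6 * psiZ a b c d)
    (fun a b c d => by
      have : ∀ i j k, epsZ i j k b a c d = -epsZ i j k a b c d := fun i j k => by
        simp only [epsZ, ltSign_swap a b]; ring
      simp only [this, psiZ_swap12 a b, mul_neg, Finset.sum_neg_distrib]; ring)
    (fun a b c d => by
      have : ∀ i j k, epsZ i j k a c b d = -epsZ i j k a b c d := fun i j k => by
        simp only [epsZ, ltSign_swap b c]; ring
      simp only [this, psiZ_swap23 a b c, mul_neg, Finset.sum_neg_distrib]; ring)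
    (fun a b c d => by
      have : ∀ i j k, epsZ i j k a b d c = -epsZ i j k a b c d := fun i j k => by
        simp only [epsZ, ltSign_swap c d]; ring
      simp only [this, psiZ_swap34 a b c, mul_neg, Finset.sum_neg_distrib]; ring)
    (fun a b ha c hb d hc => by rw [← h0]; exact phiZ_epsZ_sorted a b ha c hb d hc) a b c d
  linarith

/-- For distinct indices the product of the signs of differences is the sign of the permutation, as
for a Vandermonde product; for a repeated index both sides vanish. It links the determinant in
`leviCivita` to the integer symbol that can be evaluated. -/
theorem leviCivita_eq (a b c d e f g : Fin 7) :
    leviCivita ![a, b, c, d, e, f, g] = epsZ a b c d e f g := by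
  set v : Fin 7 → Fin 7 := ![a, b, c, d, e, f, g] with hv
  have hprod : (∏ i : Fin 7, ∏ j ∈ Finset.Ioi i, ltSign (v i) (v j)) = epsZ a b c d e f g := by
    have h0 : Finset.Ioi (0 : Fin 7) = {1, 2, 3, 4, 5, 6} := by decide
    have h1 : Finset.Ioi (1 : Fin 7) = {2, 3, 4, 5, 6} := by decide
    have h2 : Finset.Ioi (2 : Fin 7) = {3, 4, 5, 6} := by decide
    have h3 : Finset.Ioi (3 : Fin 7) = {4, 5, 6} := by decide
    have h4 : Finset.Ioi (4 : Fin 7) = {5, 6} := by decide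
    have h5 : Finset.Ioi (5 : Fin 7) = {6} := by decide
    have h6 : Finset.Ioi (6 : Fin 7) = ∅ := by decide
    rw [Fin.prod_univ_seven, h0, h1, h2, h3, h4, h5, h6]
    simp [hv, epsZ, -mul_eq_mul_left_iff, -mul_eq_mul_right_iff]
    ring
  rw [← hprod]
  by_cases hinj : Function.Injective v
  · let σ : Equiv.Perm (Fin 7) := Equiv.ofBijective v (Finite.injective_iff_bijective.1 hinj)
    have h1 : leviCivita v = ((Equiv.Perm.sign σ : ℤ) : ℝ) := by
      have := Matrix.det_permute σ (1 : Matrix (Fin 7) (Fin 7) ℝ)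
      simpa [leviCivita, σ] using this
    have h2 := σ.prod_Ioi_comp_eq_sign_mul_prod (R := ℤ) (f := fun i j => ltSign i j)
      (fun i j => by simpa using ltSign_swap j i)
    have h3 : (∏ i : Fin 7, ∏ j ∈ Finset.Ioi i, ltSign i j) = 1 := by
      refine Finset.prod_eq_one fun i _ => Finset.prod_eq_one fun j hj => ?_
      simp [ltSign, Finset.mem_Ioi.1 hj]
    rw [h3, mul_one, Int.cast_id] at h2
    rw [h1, ← h2]; rfl
  · obtain ⟨i, j, hij, hne⟩ := Function.not_injective_iff.1 hinj
    have h1 : leviCivita v = 0 := by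
      refine Matrix.det_zero_of_row_eq hne ?_
      ext x; rw [Matrix.submatrix_apply, Matrix.submatrix_apply, hij]
    rw [h1]
    symm
    norm_cast
    rcases lt_or_gt_of_ne hne with h | h
    · exact Finset.prod_eq_zero (Finset.mem_univ i) (Finset.prod_eq_zero (Finset.mem_Ioi.2 h)
        (by simp [ltSign, hij]))
    · exact Finset.prod_eq_zero (Finset.mem_univ j) (Finset.prod_eq_zero (Finset.mem_Ioi.2 h)
        (by simp [ltSign, hij]))

end

section

/-! ### Linear pullback of the pointwise constructions -/

/-- The pullback of a covariant tensor by a linear map. -/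
def pullT (A : Matrix (Fin 7) (Fin 7) ℝ) {k : ℕ} (a : (Fin k → Fin 7) → ℝ) :
    (Fin k → Fin 7) → ℝ := fun J => ∑ I : Fin k → Fin 7, a I * ∏ s, A (I s) (J s)

theorem sum_prod_pi {k : ℕ} (f : Fin k → Fin 7 → ℝ) :
    ∑ I : Fin k → Fin 7, ∏ s, f s (I s) = ∏ s, ∑ i, f s i := by
  rw [Finset.prod_univ_sum, Fintype.piFinset_univ]

theorem pullT_mul (A B : Matrix (Fin 7) (Fin 7) ℝ) {k : ℕ} (a : (Fin k → Fin 7) → ℝ) :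
    pullT (A * B) a = pullT B (pullT A a) := by
  ext J
  simp only [pullT, Matrix.mul_apply, Finset.sum_mul]
  rw [Finset.sum_comm]
  refine Finset.sum_congr rfl fun I _ => ?_
  rw [← sum_prod_pi (fun s i => A (I s) i * B i (J s)), Finset.mul_sum]
  exact Finset.sum_congr rfl fun K _ => by rw [Finset.prod_mul_distrib]; ring

theorem prod_one_apply {k : ℕ} (I J : Fin k → Fin 7) :
    ∏ s, (1 : Matrix (Fin 7) (Fin 7) ℝ) (I s) (J s) = if I = J then 1 else 0 := by
  split_ifs with h
  · subst h; simp
  · obtain ⟨s, hs⟩ := Function.ne_iff.1 h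
    exact Finset.prod_eq_zero (Finset.mem_univ s) (Matrix.one_apply_ne hs)

theorem pullT_one {k : ℕ} (a : (Fin k → Fin 7) → ℝ) : pullT 1 a = a := by
  ext J
  simp [pullT, prod_one_apply]

theorem pullT_smul (A : Matrix (Fin 7) (Fin 7) ℝ) {k : ℕ} (c : ℝ) (a : (Fin k → Fin 7) → ℝ) :
    pullT A (fun I => c * a I) = fun J => c * pullT A a J := by
  ext J; simp [pullT, mul_assoc, Finset.mul_sum]

theorem pullT_sum (A : Matrix (Fin 7) (Fin 7) ℝ) {k : ℕ} {ι : Type*} (S : Finset ι)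
    (a : ι → (Fin k → Fin 7) → ℝ) (J : Fin k → Fin 7) :
    pullT A (fun I => ∑ i ∈ S, a i I) J = ∑ i ∈ S, pullT A (a i) J := by
  simp only [pullT, Finset.sum_mul]; rw [Finset.sum_comm]

theorem sum_cons {k : ℕ} (f : (Fin (k + 1) → Fin 7) → ℝ) :
    ∑ I, f I = ∑ a, ∑ I : Fin k → Fin 7, f (Matrix.vecCons a I) := by
  rw [← (Fin.consEquiv fun _ => Fin 7).sum_comp, Fintype.sum_prod_type]
  rfl

theorem pullT_cons (A : Matrix (Fin 7) (Fin 7) ℝ) {k : ℕ} (a : (Fin (k + 1) → Fin 7) → ℝ)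
    (i : Fin 7) (L : Fin k → Fin 7) :
    pullT A a (Matrix.vecCons i L) =
      ∑ b, A b i * pullT A (fun I => a (Matrix.vecCons b I)) L := by
  simp only [pullT, sum_cons, Finset.mul_sum]
  refine Finset.sum_congr rfl fun b _ => Finset.sum_congr rfl fun I _ => ?_
  rw [Fin.prod_univ_succ]
  simp [Matrix.vecCons]
  ring

theorem pullT_zero_index (A : Matrix (Fin 7) (Fin 7) ℝ) (a : (Fin 0 → Fin 7) → ℝ)
    (J : Fin 0 → Fin 7) : pullT A a J = a J := by
  simp [pullT, Subsingleton.elim _ J]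

theorem sum_append {k l : ℕ} (f : (Fin (k + l) → Fin 7) → ℝ) :
    ∑ I, f I = ∑ I : Fin k → Fin 7, ∑ J : Fin l → Fin 7, f (Fin.append I J) := by
  rw [← (Fin.appendEquiv k l).sum_comp, Fintype.sum_prod_type]
  rfl

theorem pullT_append (A : Matrix (Fin 7) (Fin 7) ℝ) {k l : ℕ} (p : (Fin k → Fin 7) → ℝ)
    (q : (Fin l → Fin 7) → ℝ) (J : Fin (k + l) → Fin 7) :
    pullT A (fun g : Fin (k + l) → Fin 7 => p (fun s => g (Fin.castAdd l s)) *
      q (fun s => g (Fin.natAdd k s))) J =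
    pullT A p (fun s => J (Fin.castAdd l s)) * pullT A q (fun s => J (Fin.natAdd k s)) := by
  simp only [pullT, sum_append, Finset.sum_mul_sum, Fin.prod_univ_add, Fin.append_left,
    Fin.append_right]
  exact Finset.sum_congr rfl fun b _ => Finset.sum_congr rfl fun I _ => by ring

theorem det_of_sum_smul {n : Type*} [Fintype n] [DecidableEq n] (c : n → n → ℝ)
    (row : n → n → ℝ) : (Matrix.of fun s => ∑ i, c s i • row i).det =
      ∑ I : n → n, (∏ s, c s (I s)) * (Matrix.of fun s => row (I s)).det := by
  have h := (Matrix.detRowAlternating (n := n) (R := ℝ)).toMultilinearMap.map_sum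
    (fun s i => c s i • row i)
  refine Eq.trans h (Finset.sum_congr rfl fun I _ => ?_)
  exact (Matrix.detRowAlternating (n := n) (R := ℝ)).toMultilinearMap.map_smul_univ
    (fun s => c s (I s)) (fun s => row (I s))

/-- A top form is multiplied by the determinant. The sum over index maps is the multilinear
expansion of the determinant of the matrix whose rows are the columns `J s` of `A`. -/
theorem pull_leviCivita (A : Matrix (Fin 7) (Fin 7) ℝ) : pullT A leviCivita =
    fun J => A.det * leviCivita J := by
  ext J
  have h1 : A.det * leviCivita J = (Aᵀ.submatrix J id).det := by
    have : Aᵀ.submatrix J id = (1 : Matrix (Fin 7) (Fin 7) ℝ).submatrix J id * Aᵀ := by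
      ext a b; simp [Matrix.mul_apply, Matrix.one_apply]
    rw [this, Matrix.det_mul, Matrix.det_transpose, leviCivita, mul_comm]
  let row : Fin 7 → Fin 7 → ℝ := fun i b => if i = b then 1 else 0
  have h2 : Aᵀ.submatrix J id = Matrix.of fun s => ∑ i, A i (J s) • row i := by
    ext a b; simp [row]
  rw [h1, h2, det_of_sum_smul (fun s i => A i (J s)) row, pullT]
  refine Finset.sum_congr rfl fun I _ => ?_
  have hI : Matrix.of (fun s => row (I s)) = (1 : Matrix (Fin 7) (Fin 7) ℝ).submatrix I id := by
    ext a b; simp [row, Matrix.one_apply]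
  rw [hI, leviCivita, mul_comm]

theorem leviCivita_perm (σ : Equiv.Perm (Fin 7)) :
    leviCivita σ = ((Equiv.Perm.sign σ : ℤ) : ℝ) := by
  have := Matrix.det_permute σ (1 : Matrix (Fin 7) (Fin 7) ℝ)
  simpa [leviCivita] using this

theorem leviCivita_of_not_injective {f : Fin 7 → Fin 7} (hf : ¬Function.Injective f) :
    leviCivita f = 0 := by
  obtain ⟨i, j, hij, hne⟩ := Function.not_injective_iff.1 hf
  refine Matrix.det_zero_of_row_eq hne ?_
  ext x; rw [Matrix.submatrix_apply, Matrix.submatrix_apply, hij]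

/-- Index maps that are not injective contribute nothing. Sums over permutations thereby become sums
over all index maps, on which `pullT` can act. -/
theorem sum_leviCivita (T : (Fin 7 → Fin 7) → ℝ) :
    ∑ σ : Equiv.Perm (Fin 7), ((Equiv.Perm.sign σ : ℤ) : ℝ) * T σ = ∑ f, leviCivita f * T f := by
  refine Finset.sum_bij_ne_zero (fun σ _ _ => (σ : Fin 7 → Fin 7)) (fun _ _ _ => Finset.mem_univ _)
    (fun σ _ _ τ _ _ h => DFunLike.coe_injective h) ?_ ?_
  · intro f _ hf
    have hinj : Function.Injective f := by
      by_contra h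
      rw [leviCivita_of_not_injective h, zero_mul] at hf
      exact hf rfl
    refine ⟨Equiv.ofBijective f (Finite.injective_iff_bijective.1 hinj), Finset.mem_univ _, ?_, rfl⟩
    rw [← leviCivita_perm]
    exact hf
  · intro σ _ _
    rw [leviCivita_perm]

theorem sum_leviCivita_pull (A : Matrix (Fin 7) (Fin 7) ℝ) (T : (Fin 7 → Fin 7) → ℝ) :
    ∑ f, leviCivita f * pullT A T f = A.det * ∑ f, leviCivita f * T f := by
  have h := pull_leviCivita Aᵀ
  simp only [pullT, Finset.mul_sum]
  rw [Finset.sum_comm]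
  refine Finset.sum_congr rfl fun I _ => ?_
  have := congrFun h I
  simp only [pullT, Matrix.transpose_apply, Matrix.det_transpose] at this
  rw [← mul_assoc, ← this, Finset.sum_mul]
  exact Finset.sum_congr rfl fun J _ => by ring

/-! ### The bilinear form, volume, metric and Hodge star under linear pullback -/

/-- The value of the `3`-tensor with its first index contracted against the column `i`. -/
theorem bForm_eq (φ : CoordTensor 3) (y : E7) (i j : Fin 7) :
    bForm φ y i j = (1 / 144) * ∑ f : Fin 7 → Fin 7, leviCivita f *
      (φ y ![i, f 0, f 1] * φ y ![j, f 2, f 3] * φ y ![f 4, f 5, f 6]) := by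
  rw [← sum_leviCivita (fun f => φ y ![i, f 0, f 1] * φ y ![j, f 2, f 3] * φ y ![f 4, f 5, f 6])]
  simp only [bForm, Matrix.of_apply]
  ring

variable {φ φ' : CoordTensor 3} {y y' : E7} {A : Matrix (Fin 7) (Fin 7) ℝ}

/-- In each of the first two factors one index is a free slot of the bilinear form and produces `Aᵀ`
and `A`. The other seven indices form one `7`-tensor contracted with the Levi-Civita symbol and
produce `det A`. -/
theorem bForm_pull (h : φ' y' = pullT A (φ y)) :
    bForm φ' y' = A.det • (Aᵀ * bForm φ y * A) := by
  ext i j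
  rw [bForm_eq, h]
  let p : Fin 7 → (Fin 2 → Fin 7) → ℝ := fun i L => ∑ b, A b i * φ y (Matrix.vecCons b L)
  have hp : ∀ i a b, pullT A (φ y) ![i, a, b] = pullT A (p i) ![a, b] := by
    intro i a b
    rw [pullT_cons]
    simp only [p]
    rw [pullT_sum]
    refine Finset.sum_congr rfl fun c _ => ?_
    rw [pullT_smul]
  have hT : ∀ f : Fin 7 → Fin 7, pullT A (φ y) ![i, f 0, f 1] * pullT A (φ y) ![j, f 2, f 3] *
      pullT A (φ y) ![f 4, f 5, f 6] =
      pullT A (fun g : Fin 7 → Fin 7 => p i ![g 0, g 1] * p j ![g 2, g 3] *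
        φ y ![g 4, g 5, g 6]) f := by
    intro f
    have h1 := pullT_append A (fun g : Fin (2 + 2) → Fin 7 => p i (fun s => g (Fin.castAdd 2 s)) *
      p j (fun s => g (Fin.natAdd 2 s))) (φ y) f
    rw [pullT_append] at h1
    have e2 : ∀ (g : Fin 2 → Fin 7), g = ![g 0, g 1] := fun g => by ext s; fin_cases s <;> rfl
    have e3 : ∀ (g : Fin 3 → Fin 7), g = ![g 0, g 1, g 2] := fun g => by
      ext s; fin_cases s <;> rfl
    rw [hp, hp]
    rw [e2 (fun s => f _), e2 (fun s => f _), e3 (fun s => f _)] at h1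
    refine Eq.trans h1.symm ?_
    congr 1
    ext g
    rw [e2 (fun s => g _), e2 (fun s => g _), e3 (fun s => g _)]
    rfl
  simp only [hT, sum_leviCivita_pull]
  simp only [Matrix.smul_apply, Matrix.mul_apply, Matrix.transpose_apply, smul_eq_mul, bForm_eq]
  simp only [p, Finset.mul_sum, Finset.sum_mul]
  conv_lhs =>
    rw [Finset.sum_comm]
    enter [2, b]
    rw [Finset.sum_comm]
  refine Finset.sum_congr rfl fun b _ => Finset.sum_congr rfl fun c _ =>
    Finset.sum_congr rfl fun f _ => ?_
  simp only [Matrix.vecCons, Matrix.vecEmpty]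
  ring

/-- The determinant of the bilinear form scales by `(det A) ^ 9`: seven factors from the scalar in
front of a `7 × 7` matrix and two from `Aᵀ` and `A`. The signed ninth root is multiplicative, so the
result also holds for orientation-reversing `A`. -/
theorem volCoeff_pull (h : φ' y' = pullT A (φ y)) :
    volCoeff φ' y' = A.det * volCoeff φ y := by
  have hd : (bForm φ' y').det = A.det ^ 9 * (bForm φ y).det := by
    rw [bForm_pull h, Matrix.det_smul, Matrix.det_mul, Matrix.det_mul, Matrix.det_transpose]
    simp; ring
  rw [volCoeff, volCoeff, hd]
  have hs : Real.sign (A.det ^ 9 * (bForm φ y).det) =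
      Real.sign A.det * Real.sign (bForm φ y).det := by
    rcases lt_trichotomy A.det 0 with h | h | h
    · have h9 : A.det ^ 9 < 0 := Odd.pow_neg (by decide) h
      rw [Real.sign_of_neg h]
      rcases lt_trichotomy (bForm φ y).det 0 with hb | hb | hb
      · rw [Real.sign_of_neg hb, Real.sign_of_pos (mul_pos_of_neg_of_neg h9 hb)]; norm_num
      · simp [hb]
      · rw [Real.sign_of_pos hb, Real.sign_of_neg (mul_neg_of_neg_of_pos h9 hb)]; norm_num
    · simp [h]
    · have h9 : 0 < A.det ^ 9 := by positivity
      rw [Real.sign_of_pos h, one_mul]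
      rcases lt_trichotomy (bForm φ y).det 0 with hb | hb | hb
      · rw [Real.sign_of_neg hb, Real.sign_of_neg (mul_neg_of_pos_of_neg h9 hb)]
      · simp [hb]
      · rw [Real.sign_of_pos hb, Real.sign_of_pos (mul_pos h9 hb)]
  have ha : |A.det ^ 9 * (bForm φ y).det| ^ (1 / 9 : ℝ) =
      |A.det| * |(bForm φ y).det| ^ (1 / 9 : ℝ) := by
    rw [abs_mul, Real.mul_rpow (abs_nonneg _) (abs_nonneg _), abs_pow, ← Real.rpow_natCast,
      ← Real.rpow_mul (abs_nonneg _)]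
    norm_num
  have : Real.sign A.det * |A.det| = A.det := by
    rcases lt_trichotomy A.det 0 with h | h | h
    · rw [Real.sign_of_neg h, abs_of_neg h]; ring
    · simp [h]
    · rw [Real.sign_of_pos h, abs_of_pos h]; ring
  rw [hs, ha]
  linear_combination (Real.sign (bForm φ y).det * |(bForm φ y).det| ^ (1 / 9 : ℝ)) * this

theorem metric_pull (hA : A.det ≠ 0) (h : φ' y' = pullT A (φ y)) :
    metric φ' y' = Aᵀ * metric φ y * A := by
  rw [metric, metric, bForm_pull h, volCoeff_pull h, smul_smul, mul_inv, mul_right_comm,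
    inv_mul_cancel₀ hA, one_mul, Matrix.mul_smul, Matrix.smul_mul]

theorem metricInv_pull (hA : A.det ≠ 0) (h : φ' y' = pullT A (φ y)) :
    A * metricInv φ' y' * Aᵀ = metricInv φ y := by
  rw [metricInv, metricInv, metric_pull hA h, Matrix.mul_inv_rev, Matrix.mul_inv_rev]
  have h1 : A * A⁻¹ = 1 := Matrix.mul_nonsing_inv _ (isUnit_iff_ne_zero.2 hA)
  have h2 : Aᵀ⁻¹ * Aᵀ = 1 := Matrix.nonsing_inv_mul _ (by
    rw [Matrix.det_transpose]; exact isUnit_iff_ne_zero.2 hA)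
  calc A * (A⁻¹ * ((metric φ y)⁻¹ * Aᵀ⁻¹)) * Aᵀ = (A * A⁻¹) * (metric φ y)⁻¹ * (Aᵀ⁻¹ * Aᵀ) := by
        simp only [Matrix.mul_assoc]
    _ = _ := by rw [h1, h2]; simp

theorem contract_pull (hA : A.det ≠ 0) (h : φ' y' = pullT A (φ y)) {k : ℕ}
    (a b : (Fin k → Fin 7) → ℝ) :
    contract φ' y' (pullT A a) (pullT A b) = contract φ y a b := by
  have hg := metricInv_pull hA h
  have key : ∀ I I' : Fin k → Fin 7, ∏ s, metricInv φ y (I s) (I' s) =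
      ∑ J : Fin k → Fin 7, ∑ J' : Fin k → Fin 7, (∏ s, A (I s) (J s)) * (∏ s, A (I' s) (J' s)) *
        ∏ s, metricInv φ' y' (J s) (J' s) := by
    intro I I'
    rw [← hg]
    simp only [Matrix.mul_apply, Matrix.transpose_apply, Finset.sum_mul]
    rw [← sum_prod_pi (fun s i => ∑ j, A (I s) j * metricInv φ' y' j i * A (I' s) i),
      Finset.sum_comm]
    refine Finset.sum_congr rfl fun J' _ => ?_
    rw [← sum_prod_pi (fun s i => A (I s) i * metricInv φ' y' i (J' s) * A (I' s) (J' s))]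
    refine Finset.sum_congr rfl fun J _ => ?_
    simp only [Finset.prod_mul_distrib]
    ring
  simp only [contract, pullT]
  simp only [key, Finset.mul_sum, Finset.sum_mul]
  calc _ = ∑ J : Fin k → Fin 7, ∑ J' : Fin k → Fin 7, ∑ I : Fin k → Fin 7, ∑ I' : Fin k → Fin 7,
        a I * b I' * ((∏ s, A (I s) (J s)) * (∏ s, A (I' s) (J' s)) *
          ∏ s, metricInv φ' y' (J s) (J' s)) := by
        refine Finset.sum_congr rfl fun J _ => Finset.sum_congr rfl fun J' _ => ?_
        rw [Finset.sum_comm]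
        exact Finset.sum_congr rfl fun I _ => Finset.sum_congr rfl fun I' _ => by ring
    _ = _ := by
        conv_lhs =>
          enter [2, J]
          rw [Finset.sum_comm]
          enter [2, I]
          rw [Finset.sum_comm]
        rw [Finset.sum_comm]
        refine Finset.sum_congr rfl fun I _ => ?_
        rw [Finset.sum_comm]

theorem contract_sum_right {k : ℕ} {ι : Type*} (S : Finset ι) (a : (Fin k → Fin 7) → ℝ)
    (b : ι → (Fin k → Fin 7) → ℝ) :
    contract φ y a (fun I => ∑ i ∈ S, b i I) = ∑ i ∈ S, contract φ y a (b i) := by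
  simp only [contract, Finset.mul_sum, Finset.sum_mul]
  conv_lhs =>
    enter [2, I]
    rw [Finset.sum_comm]
  rw [Finset.sum_comm]

theorem contract_sum_left {k : ℕ} {ι : Type*} (S : Finset ι) (a : ι → (Fin k → Fin 7) → ℝ)
    (b : (Fin k → Fin 7) → ℝ) :
    contract φ y (fun I => ∑ i ∈ S, a i I) b = ∑ i ∈ S, contract φ y (a i) b := by
  simp only [contract, Finset.sum_mul]
  conv_lhs =>
    enter [2, I]
    rw [Finset.sum_comm]
  rw [Finset.sum_comm]

theorem contract_smul_right {k : ℕ} (c : ℝ) (a b : (Fin k → Fin 7) → ℝ) :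
    contract φ y a (fun I => c * b I) = c * contract φ y a b := by
  simp only [contract, Finset.mul_sum]
  exact Finset.sum_congr rfl fun I _ => Finset.sum_congr rfl fun I' _ => by ring

theorem contract_smul_left {k : ℕ} (c : ℝ) (a b : (Fin k → Fin 7) → ℝ) :
    contract φ y (fun I => c * a I) b = c * contract φ y a b := by
  simp only [contract, Finset.mul_sum]
  exact Finset.sum_congr rfl fun I _ => Finset.sum_congr rfl fun I' _ => by ring

/-- Splitting the seven indices into the contracted block `I` and the free block `J` turns the rule
for the top form into a rule for the Hodge star kernel. -/
theorem pull_leviCivita_append (A : Matrix (Fin 7) (Fin 7) ℝ) {k l : ℕ} (h : k + l = 7)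
    (I : Fin k → Fin 7) (J : Fin l → Fin 7) :
    A.det * leviCivita (Fin.append I J ∘ Fin.cast h.symm) =
      ∑ L : Fin l → Fin 7, (∏ s, A (L s) (J s)) *
        pullT A (fun I => leviCivita (Fin.append I L ∘ Fin.cast h.symm)) I := by
  have h0 := congrFun (pull_leviCivita A) (Fin.append I J ∘ Fin.cast h.symm)
  rw [← h0, pullT, ← ((finCongr h).arrowCongr (Equiv.refl (Fin 7))).sum_comp, sum_append,
    Finset.sum_comm]
  refine Finset.sum_congr rfl fun L _ => ?_
  rw [pullT, Finset.mul_sum]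
  refine Finset.sum_congr rfl fun K _ => ?_
  have : ∏ s, A (((finCongr h).arrowCongr (Equiv.refl (Fin 7))) (Fin.append K L) s)
      ((Fin.append I J ∘ Fin.cast h.symm) s) =
      ∏ s, A (Fin.append K L s) (Fin.append I J s) := by
    rw [← (finCongr h).prod_comp]
    rfl
  rw [this, Fin.prod_univ_add]
  simp only [Fin.append_left, Fin.append_right]
  have : ((finCongr h).arrowCongr (Equiv.refl (Fin 7))) (Fin.append K L) =
      Fin.append K L ∘ Fin.cast h.symm := rfl
  rw [this]
  ring

/-- No sign of `det A` appears, because `volCoeff` carries the orientation and changes by `det A`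
itself rather than by its absolute value. -/
theorem hodgeStar_pull (hA : A.det ≠ 0) (hφ : φ' y' = pullT A (φ y)) {k l : ℕ} (h : k + l = 7)
    {α α' : CoordTensor k} (hα : α' y' = pullT A (α y)) :
    hodgeStar φ' h α' y' = pullT A (hodgeStar φ h α y) := by
  ext J
  rw [hodgeStar, hα, volCoeff_pull hφ]
  have h1 : (fun I : Fin k → Fin 7 => A.det * volCoeff φ y *
      leviCivita (Fin.append I J ∘ Fin.cast h.symm)) = fun I =>
      ∑ L : Fin l → Fin 7, (∏ s, A (L s) (J s)) * pullT A (fun I => volCoeff φ y *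
        leviCivita (Fin.append I L ∘ Fin.cast h.symm)) I := by
    ext I
    rw [mul_right_comm, pull_leviCivita_append A h, Finset.sum_mul]
    refine Finset.sum_congr rfl fun L _ => ?_
    rw [pullT_smul]
    ring
  rw [h1, contract_sum_right, Finset.mul_sum, pullT]
  refine Finset.sum_congr rfl fun L _ => ?_
  rw [contract_smul_right, contract_pull hA hφ, hodgeStar]
  ring

end

section

/-! ### Partial derivatives of smooth functions on open sets -/

section Calculus

variable {Ω : Set E7} {f g : E7 → ℝ} {y : E7} {i j : Fin 7}

theorem pderiv_congr (hΩ : IsOpen Ω) (hy : y ∈ Ω) (h : ∀ z ∈ Ω, f z = g z) :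
    pderiv i f y = pderiv i g y := by
  have : f =ᶠ[nhds y] g := Filter.eventuallyEq_of_mem (hΩ.mem_nhds hy) h
  rw [pderiv, pderiv, this.fderiv_eq]

theorem differentiableAt_of_contDiffOn (hΩ : IsOpen Ω) (hf : ContDiffOn ℝ ∞ f Ω) (hy : y ∈ Ω) :
    DifferentiableAt ℝ f y :=
  (hf.contDiffAt (hΩ.mem_nhds hy)).differentiableAt (by simp)

theorem contDiffOn_pderiv (hΩ : IsOpen Ω) (hf : ContDiffOn ℝ ∞ f Ω) :
    ContDiffOn ℝ ∞ (pderiv i f) Ω :=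
  (hf.fderiv_of_isOpen hΩ (m := ∞) (by simp)).clm_apply contDiffOn_const

theorem pderiv_comm (hΩ : IsOpen Ω) (hf : ContDiffOn ℝ ∞ f Ω) (hy : y ∈ Ω) :
    pderiv i (pderiv j f) y = pderiv j (pderiv i f) y := by
  have hfy := hf.contDiffAt (hΩ.mem_nhds hy)
  have hs : IsSymmSndFDerivAt ℝ f y := hfy.isSymmSndFDerivAt (by
    simp only [minSmoothness_of_isRCLikeNormedField]; exact ENat.LEInfty.out)
  have hd : DifferentiableAt ℝ (fderiv ℝ f) y :=
    (hfy.fderiv_right (m := ∞) (by simp)).differentiableAt (by simp)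
  have key : ∀ a b : Fin 7, pderiv a (pderiv b f) y =
      fderiv ℝ (fderiv ℝ f) y (EuclideanSpace.single a 1) (EuclideanSpace.single b 1) := by
    intro a b
    have : pderiv b f = fun z => fderiv ℝ f z (EuclideanSpace.single b 1) := rfl
    rw [this, pderiv, fderiv_clm_apply hd (differentiableAt_const _)]
    simp
  rw [key, key]
  exact hs _ _

theorem pderiv_const (c : ℝ) : pderiv i (fun _ => c) y = 0 := by simp [pderiv]

theorem pderiv_add (hf : DifferentiableAt ℝ f y) (hg : DifferentiableAt ℝ g y) :
    pderiv i (fun z => f z + g z) y = pderiv i f y + pderiv i g y := by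
  simp [pderiv, fderiv_fun_add hf hg]

theorem pderiv_sub (hf : DifferentiableAt ℝ f y) (hg : DifferentiableAt ℝ g y) :
    pderiv i (fun z => f z - g z) y = pderiv i f y - pderiv i g y := by
  simp [pderiv, fderiv_fun_sub hf hg]

theorem pderiv_mul (hf : DifferentiableAt ℝ f y) (hg : DifferentiableAt ℝ g y) :
    pderiv i (fun z => f z * g z) y = pderiv i f y * g y + f y * pderiv i g y := by
  simp [pderiv, fderiv_fun_mul hf hg]; ring

theorem pderiv_const_mul (c : ℝ) (hf : DifferentiableAt ℝ f y) :
    pderiv i (fun z => c * f z) y = c * pderiv i f y := by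
  rw [pderiv_mul (differentiableAt_const c) hf, pderiv_const]; ring

theorem pderiv_neg : pderiv i (fun z => -f z) y = -pderiv i f y := by
  simp [pderiv, fderiv_fun_neg]

theorem pderiv_sum {ι : Type*} (S : Finset ι) {f : ι → E7 → ℝ}
    (hf : ∀ a ∈ S, DifferentiableAt ℝ (f a) y) :
    pderiv i (fun z => ∑ a ∈ S, f a z) y = ∑ a ∈ S, pderiv i (f a) y := by
  rw [pderiv, fderiv_fun_sum hf]
  simp [pderiv]

theorem pderiv_prod {ι : Type*} [DecidableEq ι] (S : Finset ι) {f : ι → E7 → ℝ}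
    (hf : ∀ a ∈ S, DifferentiableAt ℝ (f a) y) :
    pderiv i (fun z => ∏ a ∈ S, f a z) y =
      ∑ a ∈ S, pderiv i (f a) y * ∏ b ∈ S.erase a, f b y := by
  rw [pderiv, (HasFDerivAt.finsetProd fun a ha => (hf a ha).hasFDerivAt).fderiv]
  simp [pderiv, mul_comm]

theorem sum_coord_single (v : E7) : v = ∑ a, v a • (EuclideanSpace.single a (1 : ℝ) : E7) := by
  ext b
  simp [Pi.single_apply]

theorem fderiv_eq_sum_pderiv (v : E7) : fderiv ℝ f y v = ∑ a, v a * pderiv a f y := by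
  conv_lhs => rw [sum_coord_single v]
  simp [pderiv]

theorem pderiv_comp {F : E7 → E7} (hf : DifferentiableAt ℝ f (F y)) (hF : DifferentiableAt ℝ F y) :
    pderiv i (fun z => f (F z)) y = ∑ a, pderiv a f (F y) * pderiv i (fun z => F z a) y := by
  have h1 : pderiv i (fun z => f (F z)) y =
      fderiv ℝ f (F y) (fderiv ℝ F y (EuclideanSpace.single i 1)) := by
    have := fderiv_comp y hf hF
    simp only [pderiv]
    change fderiv ℝ (f ∘ F) y _ = _
    rw [this]; rfl
  rw [h1, fderiv_eq_sum_pderiv]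
  refine Finset.sum_congr rfl fun a _ => ?_
  have h2 : pderiv i (fun z => F z a) y = fderiv ℝ F y (EuclideanSpace.single i 1) a := by
    have h3 := ((EuclideanSpace.proj a : E7 →L[ℝ] ℝ).hasFDerivAt.comp y hF.hasFDerivAt).fderiv
    have h4 : (fun z => F z a) = (EuclideanSpace.proj a : E7 →L[ℝ] ℝ) ∘ F := rfl
    rw [pderiv, h4, h3]; rfl
  rw [h2, mul_comm]

theorem contDiffOn_coord {F : E7 → E7} (hF : ContDiffOn ℝ ∞ F Ω) (a : Fin 7) :
    ContDiffOn ℝ ∞ (fun z => F z a) Ω :=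
  (EuclideanSpace.proj a : E7 →L[ℝ] ℝ).contDiff.comp_contDiffOn hF

end Calculus

/-! ### Smoothness of the metric as a function of the `3`-form -/

/-- Components of a covariant `3`-tensor at a point. -/
abbrev V3 := (Fin 3 → Fin 7) → ℝ

section Smooth

variable {E : Type*} [NormedAddCommGroup E] [NormedSpace ℝ E] {n : WithTop ℕ∞} {s : Set E}

theorem contDiffOn_det {ι : Type*} [Fintype ι] [DecidableEq ι] {M : E → Matrix ι ι ℝ}
    (hM : ∀ i j, ContDiffOn ℝ n (fun x => M x i j) s) : ContDiffOn ℝ n (fun x => (M x).det) s := by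
  simp only [Matrix.det_apply]
  refine ContDiffOn.sum fun σ _ => ?_
  exact (contDiffOn_prod fun i _ => hM _ _).const_smul _

theorem contDiffOn_inv_apply {ι : Type*} [Fintype ι] [DecidableEq ι] {M : E → Matrix ι ι ℝ}
    (hM : ∀ i j, ContDiffOn ℝ n (fun x => M x i j) s) (h0 : ∀ x ∈ s, (M x).det ≠ 0) (i j : ι) :
    ContDiffOn ℝ n (fun x => (M x)⁻¹ i j) s := by
  simp only [Matrix.inv_def, Ring.inverse_eq_inv', Matrix.smul_apply, smul_eq_mul,
    Matrix.adjugate_apply]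
  refine ((contDiffOn_det hM).inv h0).mul (contDiffOn_det fun a b => ?_)
  by_cases ha : a = j
  · subst ha; simp only [Matrix.updateRow_self]; exact contDiffOn_const
  · simp only [Matrix.updateRow_ne ha]; exact hM _ _

/-- Away from zero the function is locally `x ^ p` or `-(-x) ^ p`. This is what makes the ninth root
in the volume harmless. -/
theorem contDiffOn_sign_mul_rpow {f : E → ℝ} (hf : ContDiffOn ℝ ∞ f s) (h0 : ∀ x ∈ s, f x ≠ 0)
    (p : ℝ) : ContDiffOn ℝ ∞ (fun x => Real.sign (f x) * |f x| ^ p) s := by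
  have key : ∀ r : ℝ, r ≠ 0 → ContDiffAt ℝ ∞ (fun r => Real.sign r * |r| ^ p) r := by
    intro r hr
    rcases lt_or_gt_of_ne hr with h | h
    · have h1 : ContDiffAt ℝ ∞ (fun r : ℝ => -((-r) ^ p)) r :=
        (contDiffAt_id.neg.rpow_const_of_ne (by simpa using hr)).neg
      refine h1.congr_of_eventuallyEq ?_
      filter_upwards [Iio_mem_nhds h] with x hx
      rw [Real.sign_of_neg hx, abs_of_neg hx]; ring
    · have h1 : ContDiffAt ℝ ∞ (fun r : ℝ => r ^ p) r := contDiffAt_id.rpow_const_of_ne hr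
      refine h1.congr_of_eventuallyEq ?_
      filter_upwards [Ioi_mem_nhds h] with x hx
      rw [Real.sign_of_pos hx, abs_of_pos hx]; ring
  intro x hx
  exact (key _ (h0 x hx)).comp_contDiffWithinAt x (hf x hx)

end Smooth

/-- The `3`-tensors with nondegenerate associated bilinear form. -/
def nondegSet : Set V3 := {v | (bForm (fun _ => v) 0).det ≠ 0}

theorem contDiff_bForm (i j : Fin 7) : ContDiff ℝ ∞ (fun v : V3 => bForm (fun _ => v) 0 i j) := by
  simp only [bForm, Matrix.of_apply]
  fun_prop

theorem isOpen_nondegSet : IsOpen nondegSet := by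
  have : Continuous fun v : V3 => (bForm (fun _ => v) 0).det :=
    contDiffOn_univ.1 (contDiffOn_det (n := ∞) fun i j => (contDiff_bForm i j).contDiffOn)
      |>.continuous
  exact isOpen_ne_fun this continuous_const

theorem contDiffOn_volCoeff : ContDiffOn ℝ ∞ (fun v : V3 => volCoeff (fun _ => v) 0) nondegSet :=
  contDiffOn_sign_mul_rpow (contDiffOn_det fun i j => (contDiff_bForm i j).contDiffOn)
    (fun _ h => h) _

theorem volCoeff_ne_zero {φ : CoordTensor 3} {y : E7} (h : (bForm φ y).det ≠ 0) :
    volCoeff φ y ≠ 0 := by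
  refine mul_ne_zero ?_ (by positivity)
  rcases lt_or_gt_of_ne h with h | h
  · rw [Real.sign_of_neg h]; norm_num
  · rw [Real.sign_of_pos h]; norm_num

theorem contDiffOn_metric (i j : Fin 7) :
    ContDiffOn ℝ ∞ (fun v : V3 => metric (fun _ => v) 0 i j) nondegSet := by
  simp only [metric, Matrix.smul_apply, smul_eq_mul]
  exact (contDiffOn_volCoeff.inv fun v hv => volCoeff_ne_zero hv).mul
    (contDiff_bForm i j).contDiffOn

theorem det_metric_ne_zero {φ : CoordTensor 3} {y : E7} (h : (bForm φ y).det ≠ 0) :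
    (metric φ y).det ≠ 0 := by
  rw [metric, Matrix.det_smul]
  exact mul_ne_zero (pow_ne_zero _ (inv_ne_zero (volCoeff_ne_zero h))) h

theorem contDiffOn_metricInv (i j : Fin 7) :
    ContDiffOn ℝ ∞ (fun v : V3 => metricInv (fun _ => v) 0 i j) nondegSet :=
  contDiffOn_inv_apply contDiffOn_metric (fun _ hv => det_metric_ne_zero hv) i j

theorem contDiffOn_hodgeStar_self {l : ℕ} (h : 3 + l = 7) (J : Fin l → Fin 7) :
    ContDiffOn ℝ ∞ (fun v : V3 => hodgeStar (fun _ => v) h (fun _ => v) 0 J) nondegSet := by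
  simp only [hodgeStar, contract]
  refine contDiffOn_const.mul (ContDiffOn.sum fun I _ => ContDiffOn.sum fun I' _ => ?_)
  refine ((contDiff_apply ℝ ℝ I).contDiffOn.mul (contDiffOn_volCoeff.mul contDiffOn_const)).mul ?_
  exact contDiffOn_prod fun s _ => contDiffOn_metricInv _ _

/-! ### The standard `3`-form -/

/-- The components of the standard `3`-form. -/
def std : V3 := fun J => phiZ (J 0) (J 1) (J 2)

theorem vec2_eta (g : Fin 2 → Fin 7) : g = ![g 0, g 1] := by ext s; fin_cases s <;> rfl
theorem vec3_eta (g : Fin 3 → Fin 7) : g = ![g 0, g 1, g 2] := by ext s; fin_cases s <;> rfl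
theorem vec4_eta (g : Fin 4 → Fin 7) : g = ![g 0, g 1, g 2, g 3] := by ext s; fin_cases s <;> rfl

theorem sum_index3 (f : (Fin 3 → Fin 7) → ℝ) : ∑ I, f I = ∑ a, ∑ b, ∑ c, f ![a, b, c] := by
  simp only [sum_cons, Finset.univ_unique, Finset.sum_singleton]
  rfl

theorem sum_index2 (f : (Fin 2 → Fin 7) → ℝ) : ∑ I, f I = ∑ a, ∑ b, f ![a, b] := by
  simp only [sum_cons, Finset.univ_unique, Finset.sum_singleton]
  rfl

theorem sum_index4 (f : (Fin 4 → Fin 7) → ℝ) :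
    ∑ I, f I = ∑ a, ∑ b, ∑ c, ∑ d, f ![a, b, c, d] := by
  simp only [sum_cons, Finset.univ_unique, Finset.sum_singleton]
  rfl

theorem sum_index7 (f : (Fin 7 → Fin 7) → ℝ) :
    ∑ I, f I = ∑ a, ∑ b, ∑ c, ∑ d, ∑ e, ∑ p, ∑ q, f ![a, b, c, d, e, p, q] := by
  simp only [sum_cons, Finset.univ_unique, Finset.sum_singleton]
  rfl

theorem epsZ_rotate (a b c d i j k : Fin 7) : epsZ a b c d i j k = epsZ i j k a b c d := by
  simp only [epsZ, ltSign_swap a i, ltSign_swap a j, ltSign_swap a k, ltSign_swap b i,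
    ltSign_swap b j, ltSign_swap b k, ltSign_swap c i, ltSign_swap c j, ltSign_swap c k,
    ltSign_swap d i, ltSign_swap d j, ltSign_swap d k]
  ring

theorem phiZ_psiZ_two (i a b : Fin 7) :
    ∑ c, ∑ d, phiZ i c d * psiZ a b c d = 4 * phiZ i a b := by
  have h : ∀ c, ∑ d, phiZ i c d * psiZ a b c d =
      -(deltaZ i a * phiZ c b c + deltaZ i b * phiZ a c c + deltaZ i c * phiZ a b c
      - deltaZ c a * phiZ i b c - deltaZ c b * phiZ a i c - deltaZ c c * phiZ a b i) := by
    intro c; rw [← sumZ_eq, phiZ_psiZ]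
  have z1 : ∀ a b, phiZ a b b = 0 := fun a b => by have := phiZ_swap23 a b b; omega
  have z2 : ∀ a b, phiZ a b a = 0 := fun a b => by
    have := phiZ_swap12 b a a; have := z1 b a; omega
  have z3 : phiZ a b i = phiZ i a b := by
    have := phiZ_swap23 a b i; have := phiZ_swap12 i a b; omega
  simp only [h, z1, z2]
  simp only [deltaZ, Finset.sum_neg_distrib, Finset.sum_sub_distrib, Finset.sum_add_distrib,
    ite_mul, zero_mul, one_mul, Finset.sum_ite_eq, Finset.sum_ite_eq', Finset.mem_univ, if_true,
    mul_zero, Finset.sum_const, Finset.card_univ, Fintype.card_fin]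
  have := phiZ_swap23 i a b
  have := phiZ_swap12 a i b
  have e1 : phiZ a i b = - phiZ i a b := by have := phiZ_swap12 i a b; omega
  have e2 : phiZ i b a = - phiZ i a b := by have := phiZ_swap23 i a b; omega
  rw [z3, e1, e2]
  simp
  ring

theorem phiZ_phiZ_two (i j : Fin 7) : ∑ a, ∑ b, phiZ i a b * phiZ j a b = 6 * deltaZ i j := by
  have h : ∀ a, ∑ b, phiZ i a b * phiZ j a b =
      deltaZ i j * deltaZ a a - deltaZ i a * deltaZ a j + psiZ i a j a := by
    intro a; rw [← sumZ_eq, phiZ_phiZ]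
  have z : ∀ a, psiZ i a j a = 0 := fun a => by
    have := psiZ_swap23 i j a a; have := psiZ_swap34 i j a a; omega
  simp only [h, z]
  simp only [deltaZ, Finset.sum_sub_distrib, Finset.sum_add_distrib]
  simp
  split_ifs <;> norm_num

/-- Contracting the last three indices gives `6 ψ`, the next two give `4 φ`, and the remaining two
give `6 δ`. The product `144` cancels the normalization in `bForm_eq`. -/
theorem bForm_std {φ : CoordTensor 3} {y : E7} (h : φ y = std) : bForm φ y = 1 := by
  ext i j
  rw [bForm_eq, h, sum_index7]
  have e : ∀ a b c d p q r : Fin 7, (leviCivita ![a, b, c, d, p, q, r] *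
      (std ![i, ![a, b, c, d, p, q, r] 0, ![a, b, c, d, p, q, r] 1] *
        std ![j, ![a, b, c, d, p, q, r] 2, ![a, b, c, d, p, q, r] 3] *
        std ![![a, b, c, d, p, q, r] 4, ![a, b, c, d, p, q, r] 5, ![a, b, c, d, p, q, r] 6])) =
      ((phiZ i a b * phiZ j c d * (phiZ p q r * epsZ p q r a b c d) : ℤ) : ℝ) := by
    intro a b c d p q r
    rw [leviCivita_eq, epsZ_rotate]
    simp [std]
    ring
  simp only [e]
  have e2 : ∑ a, ∑ b, ∑ c, ∑ d, ∑ p, ∑ q, ∑ r,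
      phiZ i a b * phiZ j c d * (phiZ p q r * epsZ p q r a b c d) = 144 * deltaZ i j := by
    simp only [← Finset.mul_sum, phiZ_epsZ]
    have : ∀ a b, ∑ c, ∑ d, phiZ i a b * phiZ j c d * (6 * psiZ a b c d) =
        24 * (phiZ i a b * phiZ j a b) := by
      intro a b
      have := phiZ_psiZ_two j a b
      calc _ = ∑ c, ∑ d, 6 * phiZ i a b * (phiZ j c d * psiZ a b c d) := by
            exact Finset.sum_congr rfl fun c _ => Finset.sum_congr rfl fun d _ => by ring
        _ = _ := by simp only [← Finset.mul_sum, this]; ring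
    simp only [this, ← Finset.mul_sum, phiZ_phiZ_two]; ring
  have e3 := congrArg (fun z : ℤ => (z : ℝ)) e2
  push_cast at e3 ⊢
  rw [e3, deltaZ, Matrix.one_apply]
  split_ifs <;> norm_num

theorem metric_std {φ : CoordTensor 3} {y : E7} (h : φ y = std) : metric φ y = 1 := by
  simp [metric, volCoeff, bForm_std h]

theorem volCoeff_std {φ : CoordTensor 3} {y : E7} (h : φ y = std) : volCoeff φ y = 1 := by
  simp [volCoeff, bForm_std h]

theorem metricInv_std {φ : CoordTensor 3} {y : E7} (h : φ y = std) : metricInv φ y = 1 := by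
  simp [metricInv, metric_std h]

theorem contract_std {φ : CoordTensor 3} {y : E7} (h : φ y = std) {k : ℕ}
    (a b : (Fin k → Fin 7) → ℝ) : contract φ y a b = ∑ I, a I * b I := by
  simp [contract, metricInv_std h, prod_one_apply]

/-- The components of the dual of the standard `3`-form. -/
def stdPsi : (Fin 4 → Fin 7) → ℝ := fun J => psiZ (J 0) (J 1) (J 2) (J 3)

theorem append_three_four (i j k a b c d : Fin 7) :
    (Fin.append ![i, j, k] ![a, b, c, d] ∘ Fin.cast rfl : Fin 7 → Fin 7) =
      ![i, j, k, a, b, c, d] := by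
  ext s; fin_cases s <;> rfl

theorem psi_std {φ : CoordTensor 3} {y : E7} (h : φ y = std) : psi φ y = stdPsi := by
  ext J
  rw [vec4_eta J, psi, hodgeStar, contract_std h, h, volCoeff_std h, sum_index3]
  have e : ∀ i j k, std ![i, j, k] * (1 * leviCivita (Fin.append ![i, j, k] ![J 0, J 1, J 2, J 3] ∘
      Fin.cast rfl)) = ((phiZ i j k * epsZ i j k (J 0) (J 1) (J 2) (J 3) : ℤ) : ℝ) := by
    intro i j k
    rw [append_three_four, leviCivita_eq]
    simp [std]
  have e2 := congrArg (fun z : ℤ => (z : ℝ)) (phiZ_epsZ (J 0) (J 1) (J 2) (J 3))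
  simp only [e]
  push_cast at e2 ⊢
  rw [e2]
  simp [stdPsi, Nat.factorial]

end

section

/-! ### `G₂` structures on open subsets of `ℝ⁷` and changes of coordinates -/

/-- The Jacobian matrix of a map `ℝ⁷ → ℝ⁷`. -/
def jac (F : E7 → E7) (y : E7) : Matrix (Fin 7) (Fin 7) ℝ :=
  Matrix.of fun a j => pderiv j (fun z => F z a) y

/-- The pullback of a covariant tensor field. -/
def pullF (F : E7 → E7) {k : ℕ} (α : CoordTensor k) : CoordTensor k :=
  fun y => pullT (jac F y) (α (F y))

/-- `F` is a smooth map from `Ω'` to `Ω` with invertible differential. -/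
structure IsChange (F : E7 → E7) (Ω' Ω : Set E7) : Prop where
  isOpen_source : IsOpen Ω'
  isOpen_target : IsOpen Ω
  smooth : ContDiffOn ℝ ∞ F Ω'
  maps : ∀ y ∈ Ω', F y ∈ Ω
  det_ne_zero : ∀ y ∈ Ω', (jac F y).det ≠ 0

/-- `α` has smooth components on `Ω`. -/
def SmoothOn (Ω : Set E7) {k : ℕ} (α : CoordTensor k) : Prop :=
  ∀ J, ContDiffOn ℝ ∞ (fun y => α y J) Ω

/-- `φ` is a `G₂` structure on the open set `Ω`. -/
structure IsG2On (Ω : Set E7) (φ : CoordTensor 3) : Prop where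
  isOpen : IsOpen Ω
  smooth : SmoothOn Ω φ
  pos : ∀ y ∈ Ω, ∃ A : Matrix (Fin 7) (Fin 7) ℝ, A.det ≠ 0 ∧ φ y = pullT A std

variable {Ω Ω' : Set E7} {φ : CoordTensor 3} {F : E7 → E7} {y : E7}

theorem IsChange.diffAt (h : IsChange F Ω' Ω) (hy : y ∈ Ω') : DifferentiableAt ℝ F y :=
  (h.smooth.contDiffAt (h.isOpen_source.mem_nhds hy)).differentiableAt (by simp)

theorem IsChange.smooth_jac (h : IsChange F Ω' Ω) (a j : Fin 7) :
    ContDiffOn ℝ ∞ (fun z => jac F z a j) Ω' :=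
  contDiffOn_pderiv h.isOpen_source (contDiffOn_coord h.smooth a)

theorem IsChange.smooth_comp (h : IsChange F Ω' Ω) {f : E7 → ℝ} (hf : ContDiffOn ℝ ∞ f Ω) :
    ContDiffOn ℝ ∞ (fun z => f (F z)) Ω' := hf.comp h.smooth h.maps

theorem IsChange.smooth_pullF (h : IsChange F Ω' Ω) {k : ℕ} {α : CoordTensor k}
    (hα : SmoothOn Ω α) : SmoothOn Ω' (pullF F α) := fun _ =>
  ContDiffOn.sum fun I _ => (h.smooth_comp (hα I)).mul
    (contDiffOn_prod fun _ _ => h.smooth_jac _ _)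

theorem IsG2On.pull (h : IsChange F Ω' Ω) (hφ : IsG2On Ω φ) : IsG2On Ω' (pullF F φ) where
  isOpen := h.isOpen_source
  smooth := h.smooth_pullF hφ.smooth
  pos := fun y hy => by
    obtain ⟨A, hA, hA'⟩ := hφ.pos _ (h.maps y hy)
    refine ⟨A * jac F y, ?_, ?_⟩
    · rw [Matrix.det_mul]; exact mul_ne_zero hA (h.det_ne_zero y hy)
    · rw [pullT_mul, ← hA', pullF]

theorem IsG2On.mem_nondegSet (hφ : IsG2On Ω φ) (hy : y ∈ Ω) : φ y ∈ nondegSet := by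
  obtain ⟨A, hA, hA'⟩ := hφ.pos y hy
  have := bForm_pull (φ := fun _ => std) (φ' := φ) (y := 0) (y' := y) hA'
  change (bForm φ y).det ≠ 0
  rw [this, bForm_std rfl]
  simp [hA]

theorem IsG2On.contDiff (hφ : IsG2On Ω φ) : ContDiffOn ℝ ∞ φ Ω :=
  contDiffOn_pi.2 hφ.smooth

theorem IsG2On.smooth_metric (hφ : IsG2On Ω φ) (i j : Fin 7) :
    ContDiffOn ℝ ∞ (fun z => metric φ z i j) Ω :=
  (contDiffOn_metric i j).comp hφ.contDiff fun _ hy => hφ.mem_nondegSet hy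

theorem IsG2On.smooth_metricInv (hφ : IsG2On Ω φ) (i j : Fin 7) :
    ContDiffOn ℝ ∞ (fun z => metricInv φ z i j) Ω :=
  (contDiffOn_metricInv i j).comp hφ.contDiff fun _ hy => hφ.mem_nondegSet hy

theorem IsG2On.smooth_psi (hφ : IsG2On Ω φ) : SmoothOn Ω (psi φ) := fun J =>
  (contDiffOn_hodgeStar_self rfl J).comp hφ.contDiff fun _ hy => hφ.mem_nondegSet hy

theorem IsG2On.metric_symm (hφ : IsG2On Ω φ) (hy : y ∈ Ω) (i j : Fin 7) :
    metric φ y i j = metric φ y j i := by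
  obtain ⟨A, hA, hA'⟩ := hφ.pos y hy
  have h1 := metric_pull (φ := fun _ => std) (φ' := φ) (y := 0) (y' := y) hA hA'
  rw [metric_std (φ := fun _ => std) (y := 0) rfl, Matrix.mul_one] at h1
  rw [h1]
  simp only [Matrix.mul_apply, Matrix.transpose_apply]
  exact Finset.sum_congr rfl fun a _ => mul_comm _ _

theorem IsG2On.metric_mul_inv (hφ : IsG2On Ω φ) (hy : y ∈ Ω) :
    metric φ y * metricInv φ y = 1 :=
  Matrix.mul_nonsing_inv _ (isUnit_iff_ne_zero.2 (det_metric_ne_zero (hφ.mem_nondegSet hy)))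

theorem IsG2On.metric_inv_mul (hφ : IsG2On Ω φ) (hy : y ∈ Ω) :
    metricInv φ y * metric φ y = 1 :=
  Matrix.nonsing_inv_mul _ (isUnit_iff_ne_zero.2 (det_metric_ne_zero (hφ.mem_nondegSet hy)))

theorem IsG2On.smooth_christoffel (hφ : IsG2On Ω φ) (k i j : Fin 7) :
    ContDiffOn ℝ ∞ (christoffel φ k i j) Ω := by
  refine contDiffOn_const.mul (ContDiffOn.sum fun l _ => (hφ.smooth_metricInv k l).mul ?_)
  exact ((contDiffOn_pderiv hφ.isOpen (hφ.smooth_metric _ _)).add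
    (contDiffOn_pderiv hφ.isOpen (hφ.smooth_metric _ _))).sub
    (contDiffOn_pderiv hφ.isOpen (hφ.smooth_metric _ _))

/-! ### Matrix-valued functions -/

/-- The entrywise partial derivative of a matrix-valued function. -/
def mderiv (i : Fin 7) (M : E7 → Matrix (Fin 7) (Fin 7) ℝ) (y : E7) : Matrix (Fin 7) (Fin 7) ℝ :=
  Matrix.of fun a b => pderiv i (fun z => M z a b) y

/-- The entries of `M` are smooth on `Ω`. -/
def MSmooth (Ω : Set E7) (M : E7 → Matrix (Fin 7) (Fin 7) ℝ) : Prop :=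
  ∀ a b, ContDiffOn ℝ ∞ (fun z => M z a b) Ω

section MatrixCalculus

variable {M N : E7 → Matrix (Fin 7) (Fin 7) ℝ} {i : Fin 7}

theorem MSmooth.diffAt (hM : MSmooth Ω M) (hΩ : IsOpen Ω) (hy : y ∈ Ω) (a b : Fin 7) :
    DifferentiableAt ℝ (fun z => M z a b) y := differentiableAt_of_contDiffOn hΩ (hM a b) hy

theorem mderiv_congr (hΩ : IsOpen Ω) (hy : y ∈ Ω) (h : ∀ z ∈ Ω, M z = N z) :
    mderiv i M y = mderiv i N y := by
  ext a b
  exact pderiv_congr hΩ hy fun z hz => by rw [h z hz]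

theorem MSmooth.mul (hM : MSmooth Ω M) (hN : MSmooth Ω N) : MSmooth Ω fun z => M z * N z :=
  fun a b => by
    simp only [Matrix.mul_apply]
    exact ContDiffOn.sum fun c _ => (hM a c).mul (hN c b)

theorem MSmooth.mderiv (hM : MSmooth Ω M) (hΩ : IsOpen Ω) : MSmooth Ω (mderiv i M) :=
  fun a b => contDiffOn_pderiv hΩ (hM a b)

theorem mderiv_mul (hM : MSmooth Ω M) (hN : MSmooth Ω N) (hΩ : IsOpen Ω) (hy : y ∈ Ω) :
    mderiv i (fun z => M z * N z) y = mderiv i M y * N y + M y * mderiv i N y := by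
  ext a b
  simp only [mderiv, Matrix.mul_apply, Matrix.add_apply, Matrix.of_apply]
  rw [pderiv_sum _ fun c _ => (hM.diffAt hΩ hy a c).fun_mul (hN.diffAt hΩ hy c b),
    ← Finset.sum_add_distrib]
  exact Finset.sum_congr rfl fun c _ => pderiv_mul (hM.diffAt hΩ hy a c) (hN.diffAt hΩ hy c b)

theorem mderiv_add (hM : MSmooth Ω M) (hN : MSmooth Ω N) (hΩ : IsOpen Ω) (hy : y ∈ Ω) :
    mderiv i (fun z => M z + N z) y = mderiv i M y + mderiv i N y := by
  ext a b
  exact pderiv_add (hM.diffAt hΩ hy a b) (hN.diffAt hΩ hy a b)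

theorem mderiv_transpose : mderiv i (fun z => (M z)ᵀ) y = (mderiv i M y)ᵀ := rfl

theorem mderiv_comp (h : IsChange F Ω' Ω) (hM : MSmooth Ω M) (hy : y ∈ Ω') :
    mderiv i (fun z => M (F z)) y = ∑ a, jac F y a i • mderiv a M (F y) := by
  ext b c
  simp only [Matrix.sum_apply, Matrix.smul_apply, smul_eq_mul]
  refine Eq.trans (pderiv_comp (f := fun z => M z b c)
    (hM.diffAt h.isOpen_target (h.maps y hy) b c) (h.diffAt hy)) ?_
  exact Finset.sum_congr rfl fun a _ => mul_comm _ _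

end MatrixCalculus

/-! ### The Levi-Civita connection -/

/-- The connection matrix `(Γ_i)^m_j`. -/
def conn (φ : CoordTensor 3) (i : Fin 7) (y : E7) : Matrix (Fin 7) (Fin 7) ℝ :=
  Matrix.of fun m j => christoffel φ m i j y

theorem IsG2On.smooth_conn (hφ : IsG2On Ω φ) (i : Fin 7) : MSmooth Ω (conn φ i) :=
  fun m j => hφ.smooth_christoffel m i j

theorem IsG2On.lower_christoffel (hφ : IsG2On Ω φ) (hy : y ∈ Ω) (a i j : Fin 7) :
    ∑ m, metric φ y a m * christoffel φ m i j y =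
      (1 / 2) * (pderiv i (fun z => metric φ z j a) y + pderiv j (fun z => metric φ z i a) y
      - pderiv a (fun z => metric φ z i j) y) := by
  have h := hφ.metric_mul_inv hy
  let x : Fin 7 → ℝ := fun l => (1 / 2) * (pderiv i (fun z => metric φ z j l) y +
    pderiv j (fun z => metric φ z i l) y - pderiv l (fun z => metric φ z i j) y)
  have h1 : (fun m => christoffel φ m i j y) = metricInv φ y *ᵥ x := by
    ext m
    simp only [christoffel, Matrix.mulVec, dotProduct, x, Finset.mul_sum]
    exact Finset.sum_congr rfl fun l _ => by ring
  have h2 : metric φ y *ᵥ (fun m => christoffel φ m i j y) = x := by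
    rw [h1, Matrix.mulVec_mulVec, h, Matrix.one_mulVec]
  exact congrFun h2 a

theorem IsG2On.pderiv_metric_symm (hφ : IsG2On Ω φ) (hy : y ∈ Ω) (a i j : Fin 7) :
    pderiv a (fun z => metric φ z i j) y = pderiv a (fun z => metric φ z j i) y :=
  pderiv_congr hφ.isOpen hy fun _ hz => hφ.metric_symm hz i j

theorem IsG2On.christoffel_symm (hφ : IsG2On Ω φ) (hy : y ∈ Ω) (k i j : Fin 7) :
    christoffel φ k i j y = christoffel φ k j i y := by
  simp only [christoffel]
  congr 1
  refine Finset.sum_congr rfl fun l _ => ?_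
  rw [hφ.pderiv_metric_symm hy l i j]
  ring

theorem IsG2On.mderiv_metric (hφ : IsG2On Ω φ) (hy : y ∈ Ω) (i : Fin 7) :
    mderiv i (metric φ) y = (conn φ i y)ᵀ * metric φ y + metric φ y * conn φ i y := by
  ext a b
  simp only [Matrix.add_apply, Matrix.mul_apply, Matrix.transpose_apply, conn, Matrix.of_apply,
    mderiv]
  have h1 : ∑ m, christoffel φ m i a y * metric φ y m b =
      ∑ m, metric φ y b m * christoffel φ m i a y :=
    Finset.sum_congr rfl fun m _ => by rw [hφ.metric_symm hy m b, mul_comm]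
  rw [h1, hφ.lower_christoffel hy, hφ.lower_christoffel hy]
  linear_combination (-1 / 2) * hφ.pderiv_metric_symm hy i b a

/-- The Koszul formula: a symmetric connection compatible with the metric is determined by first
derivatives of the metric. Naturality of the Christoffel symbols then needs no computation with
their definition. -/
theorem IsG2On.conn_unique (hφ : IsG2On Ω φ) (hy : y ∈ Ω)
    (Γ : Fin 7 → Matrix (Fin 7) (Fin 7) ℝ) (hs : ∀ i j m, Γ i m j = Γ j m i)
    (hΓ : ∀ i, mderiv i (metric φ) y = (Γ i)ᵀ * metric φ y + metric φ y * Γ i) (i : Fin 7) :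
    Γ i = conn φ i y := by
  let L : Fin 7 → Fin 7 → Fin 7 → ℝ := fun a i j => (metric φ y * Γ i) a j
  have hLs : ∀ a i j, L a i j = L a j i := fun a i j => by
    simp only [L, Matrix.mul_apply, hs i j]
  have hL : ∀ i a b, pderiv i (fun z => metric φ z a b) y = L b i a + L a i b := by
    intro i a b
    have := congrFun (congrFun (hΓ i) a) b
    simp only [Matrix.add_apply, mderiv, Matrix.of_apply] at this
    rw [this]
    congr 1
    simp only [L, Matrix.mul_apply, Matrix.transpose_apply]
    exact Finset.sum_congr rfl fun m _ => by rw [hφ.metric_symm hy m b, mul_comm]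
  have key : metric φ y * Γ i = metric φ y * conn φ i y := by
    ext a j
    have := hφ.lower_christoffel hy a i j
    have h0 : (metric φ y * conn φ i y) a j = ∑ m, metric φ y a m * christoffel φ m i j y :=
      Matrix.mul_apply
    rw [h0, this, hL, hL, hL, hLs a j i, hLs j a i, hLs i a j]
    simp only [L]
    ring
  calc Γ i = metricInv φ y * (metric φ y * Γ i) := by
        rw [← Matrix.mul_assoc, hφ.metric_inv_mul hy, Matrix.one_mul]
    _ = _ := by rw [key, ← Matrix.mul_assoc, hφ.metric_inv_mul hy, Matrix.one_mul]

/-! ### Naturality -/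

theorem metric_pullF (h : IsChange F Ω' Ω) (hy : y ∈ Ω') :
    metric (pullF F φ) y = (jac F y)ᵀ * metric φ (F y) * jac F y :=
  metric_pull (h.det_ne_zero y hy) rfl

theorem IsChange.mderiv_jac_symm (h : IsChange F Ω' Ω) (hy : y ∈ Ω') (i j m : Fin 7) :
    mderiv i (jac F) y m j = mderiv j (jac F) y m i :=
  pderiv_comm h.isOpen_source (contDiffOn_coord h.smooth m) hy

/-- The pullback of the connection matrix, as a matrix-valued `1`-form. -/
def pullConn (F : E7 → E7) (φ : CoordTensor 3) (i : Fin 7) (y : E7) : Matrix (Fin 7) (Fin 7) ℝ :=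
  ∑ a, jac F y a i • conn φ a (F y)

/-- The candidate `J⁻¹ (Γ J + ∂J)` is symmetric, because second derivatives of `F` commute, and it
is compatible with the pulled-back metric by the product rule. Uniqueness identifies it with the
connection of the pullback. -/
theorem jac_mul_conn (h : IsChange F Ω' Ω) (hφ : IsG2On Ω φ) (hy : y ∈ Ω') (i : Fin 7) :
    jac F y * conn (pullF F φ) i y = pullConn F φ i y * jac F y + mderiv i (jac F) y := by
  have hφ' := hφ.pull h
  have hu : IsUnit (jac F y).det := isUnit_iff_ne_zero.2 (h.det_ne_zero y hy)
  let X : Fin 7 → Matrix (Fin 7) (Fin 7) ℝ := fun i =>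
    pullConn F φ i y * jac F y + mderiv i (jac F) y
  let Γ : Fin 7 → Matrix (Fin 7) (Fin 7) ℝ := fun i => (jac F y)⁻¹ * X i
  have hJΓ : ∀ i, jac F y * Γ i = X i := fun i => by
    simp only [Γ]; rw [← Matrix.mul_assoc, Matrix.mul_nonsing_inv _ hu, Matrix.one_mul]
  have hXs : ∀ i j m, X i m j = X j m i := by
    intro i j m
    simp only [X, Matrix.add_apply, h.mderiv_jac_symm hy i j m, pullConn, Matrix.mul_apply,
      Matrix.sum_apply, Matrix.smul_apply, smul_eq_mul, Finset.sum_mul, conn, Matrix.of_apply]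
    congr 1
    rw [Finset.sum_comm]
    refine Finset.sum_congr rfl fun a _ => Finset.sum_congr rfl fun b _ => ?_
    rw [hφ.christoffel_symm (h.maps y hy)]
    ring
  have hs : ∀ i j m, Γ i m j = Γ j m i := fun i j m => by
    simp only [Γ, Matrix.mul_apply, hXs i j]
  clear_value Γ
  have hΓ : ∀ i, mderiv i (metric (pullF F φ)) y =
      (Γ i)ᵀ * metric (pullF F φ) y + metric (pullF F φ) y * Γ i := by
    intro i
    have hmF : MSmooth Ω' fun z => metric φ (F z) := fun a b =>
      h.smooth_comp (hφ.smooth_metric a b)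
    have hJ : MSmooth Ω' (jac F) := h.smooth_jac
    have hJt : MSmooth Ω' fun z => (jac F z)ᵀ := fun a b => hJ b a
    rw [mderiv_congr h.isOpen_source hy fun z hz => metric_pullF h hz, metric_pullF h hy,
      mderiv_mul (hJt.mul hmF) hJ h.isOpen_source hy, mderiv_mul hJt hmF h.isOpen_source hy,
      mderiv_transpose, mderiv_comp h (fun a b => hφ.smooth_metric a b) hy]
    have e1 : ∑ a, jac F y a i • mderiv a (metric φ) (F y) =
        (pullConn F φ i y)ᵀ * metric φ (F y) + metric φ (F y) * pullConn F φ i y := by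
      simp only [hφ.mderiv_metric (h.maps y hy), pullConn, smul_add, Finset.sum_add_distrib,
        Matrix.transpose_sum, Matrix.transpose_smul, Finset.sum_mul, Finset.mul_sum,
        Matrix.smul_mul, Matrix.mul_smul]
    rw [e1]
    have e2 : (Γ i)ᵀ * ((jac F y)ᵀ * metric φ (F y) * jac F y) =
        (X i)ᵀ * metric φ (F y) * jac F y := by
      rw [← hJΓ i, Matrix.transpose_mul]; simp only [Matrix.mul_assoc]
    have e3 : (jac F y)ᵀ * metric φ (F y) * jac F y * Γ i =
        (jac F y)ᵀ * metric φ (F y) * X i := by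
      rw [← hJΓ i]; simp only [Matrix.mul_assoc]
    rw [e2, e3]
    simp only [X, Matrix.transpose_add, Matrix.transpose_mul]
    noncomm_ring
  have := hφ'.conn_unique hy Γ hs hΓ i
  rw [← this, hJΓ]

theorem sum_update_swap {k : ℕ} (s : Fin k) (G : (Fin k → Fin 7) → Fin 7 → ℝ) :
    ∑ I : Fin k → Fin 7, ∑ m, G (Function.update I s m) (I s) = ∑ I, ∑ m, G I m := by
  rw [← Fintype.sum_prod_type', ← Fintype.sum_prod_type']
  refine Finset.sum_nbij' (fun p => (Function.update p.1 s p.2, p.1 s))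
    (fun p => (Function.update p.1 s p.2, p.1 s)) ?_ ?_ ?_ ?_ ?_ <;> simp

theorem prod_update {k : ℕ} (A : Matrix (Fin 7) (Fin 7) ℝ) (I L : Fin k → Fin 7) (s : Fin k)
    (m : Fin 7) : ∏ r, A (I r) (Function.update L s m r) =
      A (I s) m * ∏ r ∈ Finset.univ.erase s, A (I r) (L r) := by
  rw [← Finset.mul_prod_erase _ _ (Finset.mem_univ s)]
  simp only [Function.update_self]
  congr 1
  exact Finset.prod_congr rfl fun r hr => by
    rw [Function.update_of_ne (Finset.ne_of_mem_erase hr)]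

theorem covDeriv_cons (φ : CoordTensor 3) {k : ℕ} (α : CoordTensor k) (y : E7) (i : Fin 7)
    (L : Fin k → Fin 7) : covDeriv φ α y (Matrix.vecCons i L) = pderiv i (fun z => α z L) y
    - ∑ s : Fin k, ∑ m : Fin 7, christoffel φ m i (L s) y * α y (Function.update L s m) := rfl

theorem vecCons_eta {k : ℕ} (J : Fin (k + 1) → Fin 7) :
    Matrix.vecCons (J 0) (Fin.tail J) = J := Fin.cons_self_tail J

/-- Second derivatives of `F` arise twice: from differentiating the Jacobian factors of the
pullback, and from the inhomogeneous term in the transformation law of the Christoffel symbols. The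
two contributions cancel. -/
theorem covDeriv_pullF (h : IsChange F Ω' Ω) (hφ : IsG2On Ω φ) {k : ℕ} {α : CoordTensor k}
    (hα : SmoothOn Ω α) (hy : y ∈ Ω') :
    covDeriv (pullF F φ) (pullF F α) y = pullT (jac F y) (covDeriv φ α (F y)) := by
  ext J
  rw [← vecCons_eta J, pullT_cons, covDeriv_cons]
  generalize J 0 = i
  generalize (Fin.tail J : Fin k → Fin 7) = L
  set Jc := jac F y with hJc
  have hΩ := h.isOpen_source
  have hdα : ∀ I, DifferentiableAt ℝ (fun z => α z I) (F y) := fun I =>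
    differentiableAt_of_contDiffOn h.isOpen_target (hα I) (h.maps y hy)
  have hdJ : ∀ a b, DifferentiableAt ℝ (fun z => jac F z a b) y := fun a b =>
    differentiableAt_of_contDiffOn hΩ (h.smooth_jac a b) hy
  have hdp : ∀ I : Fin k → Fin 7, DifferentiableAt ℝ (fun z => ∏ s, jac F z (I s) (L s)) y :=
    fun I => (HasFDerivAt.finsetProd fun s _ => (hdJ (I s) (L s)).hasFDerivAt).differentiableAt
  have hdc : ∀ I, DifferentiableAt ℝ (fun z => α (F z) I) y := fun I =>
    (hdα I).comp y (h.diffAt hy)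
  have h1 : pderiv i (fun z => pullF F α z L) y =
      ∑ I, ((∑ a, pderiv a (fun z => α z I) (F y) * Jc a i) * ∏ s, Jc (I s) (L s) +
        α (F y) I * ∑ s, mderiv i (jac F) y (I s) (L s) *
          ∏ r ∈ Finset.univ.erase s, Jc (I r) (L r)) := by
    simp only [pullF, pullT]
    rw [pderiv_sum _ fun I _ => (hdc I).fun_mul (hdp I)]
    refine Finset.sum_congr rfl fun I _ => ?_
    rw [pderiv_mul (hdc I) (hdp I), pderiv_prod _ fun s _ => hdJ _ _,
      pderiv_comp (f := fun z => α z I) (hdα I) (h.diffAt hy)]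
    rfl
  have hconn : ∀ a j : Fin 7, ∑ m, Jc a m * christoffel (pullF F φ) m i j y =
      (∑ c, ∑ b, christoffel φ a c b (F y) * Jc c i * Jc b j) + mderiv i (jac F) y a j := by
    intro a j
    have := congrFun (congrFun (jac_mul_conn h hφ hy i) a) j
    simp only [Matrix.add_apply, Matrix.mul_apply, pullConn, conn, Matrix.of_apply,
      Matrix.sum_apply, Matrix.smul_apply, smul_eq_mul, Finset.sum_mul] at this
    rw [this]
    congr 1
    exact Finset.sum_congr rfl fun c _ => Finset.sum_congr rfl fun b _ => by ring
  have h2 : ∀ s : Fin k, ∑ m, christoffel (pullF F φ) m i (L s) y *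
      pullF F α y (Function.update L s m) = ∑ I, α (F y) I *
        ((∑ c, ∑ b, christoffel φ (I s) c b (F y) * Jc c i * Jc b (L s)) +
          mderiv i (jac F) y (I s) (L s)) * ∏ r ∈ Finset.univ.erase s, Jc (I r) (L r) := by
    intro s
    simp only [pullF, pullT, prod_update, Finset.mul_sum, ← hconn, Finset.sum_mul]
    rw [Finset.sum_comm]
    exact Finset.sum_congr rfl fun I _ => Finset.sum_congr rfl fun m _ => by ring
  have h3 : ∀ s : Fin k, ∑ a, Jc a i * pullT Jc (fun I => ∑ m, christoffel φ m a (I s) (F y) *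
      α (F y) (Function.update I s m)) L = ∑ I, α (F y) I *
        (∑ c, ∑ b, christoffel φ (I s) c b (F y) * Jc c i * Jc b (L s)) *
          ∏ r ∈ Finset.univ.erase s, Jc (I r) (L r) := by
    intro s
    have e : ∀ a, pullT Jc (fun I => ∑ m, christoffel φ m a (I s) (F y) *
        α (F y) (Function.update I s m)) L = ∑ I, ∑ b, christoffel φ (I s) a b (F y) * α (F y) I *
          (Jc b (L s) * ∏ r ∈ Finset.univ.erase s, Jc (I r) (L r)) := by
      intro a
      rw [← sum_update_swap s (fun I b => christoffel φ (I s) a b (F y) * α (F y) I *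
          (Jc b (L s) * ∏ r ∈ Finset.univ.erase s, Jc (I r) (L r))), pullT]
      refine Finset.sum_congr rfl fun I _ => ?_
      rw [Finset.sum_mul]
      refine Finset.sum_congr rfl fun m _ => ?_
      rw [← Finset.mul_prod_erase _ _ (Finset.mem_univ s), Function.update_self]
      congr 2
      exact Finset.prod_congr rfl fun r hr => by
        rw [Function.update_of_ne (Finset.ne_of_mem_erase hr)]
    simp only [e, Finset.mul_sum, Finset.sum_mul]
    rw [Finset.sum_comm]
    exact Finset.sum_congr rfl fun I _ => Finset.sum_congr rfl fun c _ =>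
      Finset.sum_congr rfl fun b _ => by ring
  have h4 : ∀ a, pullT Jc (fun I => covDeriv φ α (F y) (Matrix.vecCons a I)) L =
      (∑ I, pderiv a (fun z => α z I) (F y) * ∏ s, Jc (I s) (L s)) -
      ∑ s, pullT Jc (fun I => ∑ m, christoffel φ m a (I s) (F y) *
        α (F y) (Function.update I s m)) L := by
    intro a
    rw [← pullT_sum]
    simp only [pullT, covDeriv_cons, sub_mul, Finset.sum_sub_distrib]
  have h7 : ∑ a, Jc a i * ∑ s, pullT Jc (fun I => ∑ m, christoffel φ m a (I s) (F y) *
      α (F y) (Function.update I s m)) L = ∑ s, ∑ I, α (F y) I *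
        (∑ c, ∑ b, christoffel φ (I s) c b (F y) * Jc c i * Jc b (L s)) *
          ∏ r ∈ Finset.univ.erase s, Jc (I r) (L r) := by
    rw [← Finset.sum_congr rfl fun s _ => h3 s, Finset.sum_comm]
    exact Finset.sum_congr rfl fun a _ => Finset.mul_sum _ _ _
  have h5 : ∑ I, α (F y) I * ∑ s, mderiv i (jac F) y (I s) (L s) *
      ∏ r ∈ Finset.univ.erase s, Jc (I r) (L r) = ∑ s, ∑ I, α (F y) I *
        (mderiv i (jac F) y (I s) (L s)) * ∏ r ∈ Finset.univ.erase s, Jc (I r) (L r) := by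
    rw [Finset.sum_comm]
    refine Finset.sum_congr rfl fun I _ => ?_
    rw [Finset.mul_sum]
    exact Finset.sum_congr rfl fun s _ => by ring
  have h6 : ∑ I, (∑ a, pderiv a (fun z => α z I) (F y) * Jc a i) * ∏ s, Jc (I s) (L s) =
      ∑ a, Jc a i * ∑ I, pderiv a (fun z => α z I) (F y) * ∏ s, Jc (I s) (L s) := by
    simp only [Finset.sum_mul, Finset.mul_sum]
    rw [Finset.sum_comm]
    exact Finset.sum_congr rfl fun I _ => Finset.sum_congr rfl fun s _ => by ring
  simp only [h1, h2, h4, mul_sub, Finset.sum_sub_distrib]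
  rw [h7]
  simp only [mul_add, add_mul, Finset.sum_add_distrib]
  rw [h5, h6]
  ring

end

section

variable {Ω Ω' : Set E7} {φ : CoordTensor 3} {F : E7 → E7} {y : E7}

/-! ### Naturality of the curvature and of the torsion -/

/-- The curvature matrix `R(∂_i, ∂_j)`. -/
def curv (φ : CoordTensor 3) (i j : Fin 7) (y : E7) : Matrix (Fin 7) (Fin 7) ℝ :=
  mderiv i (conn φ j) y - mderiv j (conn φ i) y + conn φ i y * conn φ j y - conn φ j y * conn φ i y

theorem riemann_eq (φ : CoordTensor 3) (y : E7) (i j k l : Fin 7) :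
    riemann φ y ![i, j, k, l] = (metric φ y * curv φ i j y) k l := by
  have h : ∀ m, curv φ i j y m l = pderiv i (christoffel φ m j l) y - pderiv j (christoffel φ m i l) y
      + ∑ p, (christoffel φ m i p y * christoffel φ p j l y
          - christoffel φ m j p y * christoffel φ p i l y) := by
    intro m
    simp only [curv, Matrix.sub_apply, Matrix.add_apply, Matrix.mul_apply, Finset.sum_sub_distrib]
    simp only [mderiv, conn, Matrix.of_apply]
    ring
  simp only [Matrix.mul_apply, h]
  rfl

theorem IsChange.mderiv_pullConn (h : IsChange F Ω' Ω) (hφ : IsG2On Ω φ) (hy : y ∈ Ω')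
    (i j : Fin 7) : mderiv i (pullConn F φ j) y = ∑ b, mderiv i (jac F) y b j • conn φ b (F y) +
      ∑ b, ∑ a, (jac F y a i * jac F y b j) • mderiv a (conn φ b) (F y) := by
  ext p q
  have hc : ∀ b, DifferentiableAt ℝ (fun z => conn φ b (F z) p q) y := fun b =>
    differentiableAt_of_contDiffOn h.isOpen_source (h.smooth_comp (hφ.smooth_conn b p q)) hy
  have hJ : ∀ b, DifferentiableAt ℝ (fun z => jac F z b j) y := fun b =>
    differentiableAt_of_contDiffOn h.isOpen_source (h.smooth_jac b j) hy
  have e0 : (fun z => pullConn F φ j z p q) = fun z => ∑ b, jac F z b j * conn φ b (F z) p q := by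
    ext z; simp [pullConn, Matrix.sum_apply]
  have e1 : mderiv i (pullConn F φ j) y p q =
      ∑ b, (mderiv i (jac F) y b j * conn φ b (F y) p q +
        jac F y b j * mderiv i (fun z => conn φ b (F z)) y p q) := by
    change pderiv i (fun z => pullConn F φ j z p q) y = _
    rw [e0, pderiv_sum _ fun b _ => (hJ b).fun_mul (hc b)]
    exact Finset.sum_congr rfl fun b _ => pderiv_mul (hJ b) (hc b)
  rw [e1, Finset.sum_add_distrib]
  simp only [mderiv_comp h (hφ.smooth_conn _) hy, Matrix.add_apply, Matrix.sum_apply,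
    Matrix.smul_apply, smul_eq_mul, Finset.mul_sum]
  congr 1
  exact Finset.sum_congr rfl fun b _ => Finset.sum_congr rfl fun a _ => by ring

/-- The law `jac_mul_conn` is differentiated and antisymmetrized. The second derivatives of the
Jacobian cancel because they commute. -/
theorem jac_mul_curv (h : IsChange F Ω' Ω) (hφ : IsG2On Ω φ) (hy : y ∈ Ω') (i j : Fin 7) :
    jac F y * curv (pullF F φ) i j y =
      (∑ a, ∑ b, (jac F y a i * jac F y b j) • curv φ a b (F y)) * jac F y := by
  have hφ' := hφ.pull h
  have hΩ := h.isOpen_source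
  have hJ : MSmooth Ω' (jac F) := h.smooth_jac
  have hP : ∀ i, MSmooth Ω' (pullConn F φ i) := fun i p q => by
    have : (fun z => pullConn F φ i z p q) = fun z => ∑ b, jac F z b i * conn φ b (F z) p q := by
      ext z; simp [pullConn, Matrix.sum_apply]
    rw [this]
    exact ContDiffOn.sum fun b _ => (h.smooth_jac b i).mul (h.smooth_comp (hφ.smooth_conn b p q))
  have key : ∀ i j, mderiv i (jac F) y * conn (pullF F φ) j y +
      jac F y * mderiv i (conn (pullF F φ) j) y = mderiv i (pullConn F φ j) y * jac F y +
        pullConn F φ j y * mderiv i (jac F) y + mderiv i (mderiv j (jac F)) y := by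
    intro i j
    rw [← mderiv_mul hJ (hφ'.smooth_conn j) hΩ hy, ← mderiv_mul (hP j) hJ hΩ hy,
      ← mderiv_add ((hP j).mul hJ) (hJ.mderiv hΩ) hΩ hy]
    exact mderiv_congr hΩ hy fun z hz => jac_mul_conn h hφ hz j
  have hcomm : mderiv i (mderiv j (jac F)) y = mderiv j (mderiv i (jac F)) y := by
    ext p q
    exact pderiv_comm hΩ (hJ p q) hy
  have hcurv : ∑ a, ∑ b, (jac F y a i * jac F y b j) • curv φ a b (F y) =
      mderiv i (pullConn F φ j) y - mderiv j (pullConn F φ i) y +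
        pullConn F φ i y * pullConn F φ j y - pullConn F φ j y * pullConn F φ i y := by
    rw [h.mderiv_pullConn hφ hy, h.mderiv_pullConn hφ hy]
    have e1 : ∑ b, mderiv i (jac F) y b j • conn φ b (F y) =
        ∑ b, mderiv j (jac F) y b i • conn φ b (F y) :=
      Finset.sum_congr rfl fun b _ => by rw [h.mderiv_jac_symm hy i j b]
    have e2 : pullConn F φ i y * pullConn F φ j y =
        ∑ a, ∑ b, (jac F y a i * jac F y b j) • (conn φ a (F y) * conn φ b (F y)) := by
      simp only [pullConn, Finset.sum_mul_sum, Matrix.smul_mul, Matrix.mul_smul, smul_smul]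
      exact Finset.sum_congr rfl fun a _ => Finset.sum_congr rfl fun b _ => by rw [mul_comm]
    have e3 : pullConn F φ j y * pullConn F φ i y =
        ∑ a, ∑ b, (jac F y a i * jac F y b j) • (conn φ b (F y) * conn φ a (F y)) := by
      simp only [pullConn, Finset.sum_mul_sum, Matrix.smul_mul, Matrix.mul_smul, smul_smul]
      rw [Finset.sum_comm]
    have e4 : ∑ b, ∑ a, (jac F y a i * jac F y b j) • mderiv a (conn φ b) (F y) =
        ∑ a, ∑ b, (jac F y a i * jac F y b j) • mderiv a (conn φ b) (F y) := Finset.sum_comm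
    have e5 : ∑ b, ∑ a, (jac F y a j * jac F y b i) • mderiv a (conn φ b) (F y) =
        ∑ a, ∑ b, (jac F y a i * jac F y b j) • mderiv b (conn φ a) (F y) :=
      Finset.sum_congr rfl fun b _ => Finset.sum_congr rfl fun a _ => by rw [mul_comm]
    rw [e1, e2, e3, e4, e5]
    simp only [curv, smul_add, smul_sub, Finset.sum_add_distrib, Finset.sum_sub_distrib]
    abel
  rw [hcurv]
  have k1 := key i j
  have k2 := key j i
  have ji := jac_mul_conn h hφ hy i
  have jj := jac_mul_conn h hφ hy j
  rw [hcomm] at k1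
  -- The differentiated laws supply the derivatives of the connections. The undifferentiated laws,
  -- multiplied by connection matrices on the proper side, supply the commutators.
  simp only [curv]
  linear_combination (norm := noncomm_ring) k1 - k2 + ji * conn (pullF F φ) j y -
    jj * conn (pullF F φ) i y + pullConn F φ i y * jj - pullConn F φ j y * ji

theorem riemann_pullF (h : IsChange F Ω' Ω) (hφ : IsG2On Ω φ) (hy : y ∈ Ω') :
    riemann (pullF F φ) y = pullT (jac F y) (riemann φ (F y)) := by
  ext J
  rw [vec4_eta J, riemann_eq, metric_pullF h hy, Matrix.mul_assoc, jac_mul_curv h hφ hy]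
  generalize J 0 = i
  generalize J 1 = j
  generalize J 2 = k
  generalize J 3 = l
  have e : (jac F y)ᵀ * metric φ (F y) * ((∑ a, ∑ b, (jac F y a i * jac F y b j) •
      curv φ a b (F y)) * jac F y) = ∑ a, ∑ b, (jac F y a i * jac F y b j) •
        ((jac F y)ᵀ * (metric φ (F y) * curv φ a b (F y)) * jac F y) := by
    simp only [Finset.sum_mul, Finset.mul_sum, Matrix.smul_mul, Matrix.mul_smul, Matrix.mul_assoc]
  rw [e, pullT, sum_index4]
  simp only [Matrix.sum_apply, Matrix.smul_apply, smul_eq_mul]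
  refine Finset.sum_congr rfl fun a _ => Finset.sum_congr rfl fun b _ => ?_
  rw [Matrix.mul_apply, Finset.sum_comm, Finset.mul_sum]
  refine Finset.sum_congr rfl fun d _ => ?_
  rw [Matrix.mul_apply, Finset.sum_mul, Finset.mul_sum]
  refine Finset.sum_congr rfl fun c _ => ?_
  rw [riemann_eq, Fin.prod_univ_four]
  simp only [Matrix.transpose_apply, Matrix.cons_val]
  ring

theorem psi_pullF (h : IsChange F Ω' Ω) (hy : y ∈ Ω') :
    psi (pullF F φ) y = pullT (jac F y) (psi φ (F y)) :=
  hodgeStar_pull (h.det_ne_zero y hy) rfl _ rfl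

theorem torsion_pullF (h : IsChange F Ω' Ω) (hφ : IsG2On Ω φ) (hy : y ∈ Ω') :
    torsion (pullF F φ) y = pullT (jac F y) (torsion φ (F y)) := by
  ext J
  rw [vec2_eta J, torsion, covDeriv_pullF h hφ hφ.smooth hy, psi_pullF h hy]
  simp only [Matrix.cons_val_zero, Matrix.cons_val_one, pullT_cons]
  rw [contract_sum_left, Finset.mul_sum]
  refine Finset.sum_congr rfl fun a _ => ?_
  rw [contract_smul_left, contract_sum_right, Finset.mul_sum, Finset.mul_sum, Finset.mul_sum]
  refine Finset.sum_congr rfl fun b _ => ?_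
  rw [contract_smul_right, contract_pull (h.det_ne_zero y hy) rfl, pullT_zero_index, torsion]
  simp only [Matrix.cons_val_zero, Matrix.cons_val_one]
  ring

theorem covDeriv_congr {k : ℕ} {α β : CoordTensor k} (hΩ : IsOpen Ω) (hy : y ∈ Ω)
    (h : ∀ z ∈ Ω, α z = β z) : covDeriv φ α y = covDeriv φ β y := by
  ext J
  simp only [covDeriv]
  rw [pderiv_congr hΩ hy (fun z hz => by rw [h z hz]), h y hy]

theorem IsG2On.smooth_covDeriv (hφ : IsG2On Ω φ) {k : ℕ} {α : CoordTensor k}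
    (hα : SmoothOn Ω α) : SmoothOn Ω (covDeriv φ α) := fun J =>
  (contDiffOn_pderiv hφ.isOpen (hα _)).sub (ContDiffOn.sum fun s _ => ContDiffOn.sum fun m _ =>
    (hφ.smooth_christoffel m (J 0) (Fin.tail J s)).mul (hα _))

theorem IsG2On.smooth_contract (hφ : IsG2On Ω φ) {k : ℕ} {a b : E7 → (Fin k → Fin 7) → ℝ}
    (ha : ∀ J, ContDiffOn ℝ ∞ (fun z => a z J) Ω) (hb : ∀ J, ContDiffOn ℝ ∞ (fun z => b z J) Ω) :
    ContDiffOn ℝ ∞ (fun z => contract φ z (a z) (b z)) Ω :=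
  ContDiffOn.sum fun I _ => ContDiffOn.sum fun J _ =>
    ((ha I).mul (hb J)).mul (contDiffOn_prod fun s _ => hφ.smooth_metricInv (I s) (J s))

theorem IsG2On.smooth_torsion (hφ : IsG2On Ω φ) : SmoothOn Ω (torsion φ) := fun _ =>
  contDiffOn_const.mul (hφ.smooth_contract (fun _ => hφ.smooth_covDeriv hφ.smooth _)
    (fun _ => hφ.smooth_psi _))

theorem covDeriv_torsion_pullF (h : IsChange F Ω' Ω) (hφ : IsG2On Ω φ) (hy : y ∈ Ω') :
    covDeriv (pullF F φ) (torsion (pullF F φ)) y =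
      pullT (jac F y) (covDeriv φ (torsion φ) (F y)) := by
  rw [← covDeriv_pullF h hφ hφ.smooth_torsion hy]
  exact covDeriv_congr h.isOpen_source hy fun z hz => torsion_pullF h hφ hz

theorem coordLambda_pullF (h : IsChange F Ω' Ω) (hφ : IsG2On Ω φ) (hy : y ∈ Ω') :
    coordLambda (pullF F φ) y = coordLambda φ (F y) := by
  rw [coordLambda, covDeriv_torsion_pullF h hφ hy, riemann_pullF h hφ hy,
    contract_pull (h.det_ne_zero y hy) rfl, contract_pull (h.det_ne_zero y hy) rfl, coordLambda]

/-! ### Exterior derivatives -/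

/-- Skew-symmetry of components. -/
def IsAlt {k : ℕ} (a : (Fin k → Fin 7) → ℝ) : Prop :=
  ∀ (J : Fin k → Fin 7) (i j : Fin k), i ≠ j → a (J ∘ Equiv.swap i j) = -a J

/-- The alternating map with given skew-symmetric components. -/
def altMap {k : ℕ} (a : (Fin k → Fin 7) → ℝ) (ha : IsAlt a) :
    (Fin 7 → ℝ) [⋀^Fin k]→ₗ[ℝ] ℝ where
  toMultilinearMap := ∑ I : Fin k → Fin 7, a I •
    (MultilinearMap.mkPiAlgebra ℝ (Fin k) ℝ).compLinearMap (fun s => LinearMap.proj (I s))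
  map_eq_zero_of_eq' := by
    intro v i j hv hij
    simp only [MultilinearMap.toFun_eq_coe, _root_.sum_apply, _root_.smul_apply,
      MultilinearMap.compLinearMap_apply, MultilinearMap.mkPiAlgebra_apply, LinearMap.proj_apply,
      smul_eq_mul]
    have hvs : ∀ s, v (Equiv.swap i j s) = v s := by
      intro s
      rcases eq_or_ne s i with rfl | h1
      · rw [Equiv.swap_apply_left, hv]
      rcases eq_or_ne s j with rfl | h2
      · rw [Equiv.swap_apply_right, hv]
      · rw [Equiv.swap_apply_of_ne_of_ne h1 h2]
    have h1 : ∑ I : Fin k → Fin 7, a I * ∏ s, v s (I s) =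
        ∑ I : Fin k → Fin 7, -(a I * ∏ s, v s (I s)) := by
      rw [← ((Equiv.swap i j).arrowCongr (Equiv.refl (Fin 7))).sum_comp]
      refine Finset.sum_congr rfl fun I _ => ?_
      have : ((Equiv.swap i j).arrowCongr (Equiv.refl (Fin 7))) I = I ∘ Equiv.swap i j := by
        ext s; simp [Equiv.arrowCongr]
      rw [this, ha I i j hij, neg_mul]
      congr 2
      rw [← Equiv.prod_comp (Equiv.swap i j)]
      refine Finset.prod_congr rfl fun s _ => ?_
      rw [hvs]
      simp
    rw [Finset.sum_neg_distrib] at h1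
    linarith

theorem altMap_single {k : ℕ} (a : (Fin k → Fin 7) → ℝ) (ha : IsAlt a) (J : Fin k → Fin 7) :
    altMap a ha (fun s => Pi.single (J s) 1) = a J := by
  change (∑ I : Fin k → Fin 7, a I • (MultilinearMap.mkPiAlgebra ℝ (Fin k) ℝ).compLinearMap
    (fun s => (LinearMap.proj (I s) : (Fin 7 → ℝ) →ₗ[ℝ] ℝ))) _ = _
  simp only [_root_.sum_apply, _root_.smul_apply,
      MultilinearMap.compLinearMap_apply, MultilinearMap.mkPiAlgebra_apply, LinearMap.proj_apply,
      smul_eq_mul]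
  have : ∀ I : Fin k → Fin 7, ∏ s, (Pi.single (J s) 1 : Fin 7 → ℝ) (I s) =
      if I = J then 1 else 0 := by
    intro I
    rw [← prod_one_apply]
    exact Finset.prod_congr rfl fun s _ => by simp [Pi.single_apply, Matrix.one_apply]
  simp [this]

/-- The two lists obtained by removing one of two equal entries differ by a cyclic permutation,
whose sign is the relative sign of the two terms. -/
theorem IsAlt.removeNth {k : ℕ} {a : (Fin k → Fin 7) → ℝ} (ha : IsAlt a)
    (w : Fin (k + 1) → Fin 7) {i j : Fin (k + 1)} (hij : i ≠ j) (hw : w i = w j) :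
    (-1) ^ (i : ℕ) * a (fun r => w (i.succAbove r)) +
      (-1) ^ (j : ℕ) * a (fun r => w (j.succAbove r)) = 0 := by
  have := (altMap a ha).neg_one_pow_smul_map_removeNth_add_eq_zero_of_eq
    (v := fun s => (Pi.single (w s) 1 : Fin 7 → ℝ)) (i := i) (j := j) (by simp [hw]) hij
  have h1 : ∀ i : Fin (k + 1), altMap a ha (i.removeNth fun s => (Pi.single (w s) 1 : Fin 7 → ℝ)) =
      a (fun r => w (i.succAbove r)) := fun i => by
    rw [← altMap_single a ha]
    rfl
  simpa [h1] using this

/-- A symmetric bilinear operation in the lower indices does not contribute to the exterior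
derivative. -/
theorem IsAlt.sum_symm_eq_zero {k : ℕ} {a : (Fin k → Fin 7) → ℝ} (ha : IsAlt a)
    {G : Fin 7 → Fin 7 → Fin 7 → ℝ} (hG : ∀ m i j, G m i j = G m j i) (J : Fin (k + 1) → Fin 7) :
    ∑ s : Fin (k + 1), (-1) ^ (s : ℕ) * ∑ r : Fin k, ∑ m, G m (J s) (J (s.succAbove r)) *
      a (Function.update (fun r => J (s.succAbove r)) r m) = 0 := by
  let f : Fin (k + 1) → Fin (k + 1) → ℝ := fun s t => if t = s then 0 else
    (-1) ^ (s : ℕ) * ∑ m, G m (J s) (J t) * a (fun r => Function.update J t m (s.succAbove r))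
  have h1 : ∀ s : Fin (k + 1), (-1) ^ (s : ℕ) * ∑ r : Fin k, ∑ m, G m (J s) (J (s.succAbove r)) *
      a (Function.update (fun r => J (s.succAbove r)) r m) = ∑ t, f s t := by
    intro s
    rw [Fin.sum_univ_succAbove _ s, Finset.mul_sum]
    simp only [f, if_true, zero_add]
    refine Finset.sum_congr rfl fun r _ => ?_
    rw [if_neg (Fin.succAbove_ne s r)]
    congr 1
    refine Finset.sum_congr rfl fun m _ => ?_
    congr 2
    ext q
    by_cases hq : q = r
    · subst hq; simp
    · rw [Function.update_of_ne hq, Function.update_of_ne]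
      exact fun h => hq (Fin.succAbove_right_injective h)
  have h2 : ∀ s t, f s t + f t s = 0 := by
    intro s t
    by_cases hst : t = s
    · simp [f, hst]
    · simp only [f, if_neg hst, if_neg (Ne.symm hst)]
      simp only [Finset.mul_sum]
      rw [← Finset.sum_add_distrib]
      refine Finset.sum_eq_zero fun m _ => ?_
      let w : Fin (k + 1) → Fin 7 := Function.update (Function.update J t m) s m
      have e1 : (fun r => Function.update J t m (s.succAbove r)) = fun r => w (s.succAbove r) := by
        ext r; simp only [w]; rw [Function.update_of_ne (Fin.succAbove_ne s r)]
      have hw : w = Function.update (Function.update J s m) t m := Function.update_comm hst _ _ _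
      have e2 : (fun r => Function.update J s m (t.succAbove r)) = fun r => w (t.succAbove r) := by
        ext r; rw [hw, Function.update_of_ne (Fin.succAbove_ne t r)]
      have := ha.removeNth w (i := s) (j := t) (Ne.symm hst) (by
        rw [hw, Function.update_self, ← hw]; simp [w])
      rw [e1, e2, hG m (J t) (J s)]
      linear_combination G m (J s) (J t) * this
  simp only [h1]
  have h3 : ∑ s, ∑ t, f s t = ∑ s, ∑ t, f t s := Finset.sum_comm
  have h4 : ∑ s, ∑ t, f s t + ∑ s, ∑ t, f t s = 0 := by
    simp only [← Finset.sum_add_distrib, h2, Finset.sum_const_zero]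
  linarith

/-- The Christoffel terms cancel after antisymmetrization because they are symmetric in the lower
indices. With this, naturality of `d` follows from that of the covariant derivative. -/
theorem IsG2On.extD_eq (hφ : IsG2On Ω φ) {k : ℕ} {α : CoordTensor k} (hy : y ∈ Ω)
    (ha : IsAlt (α y)) (J : Fin (k + 1) → Fin 7) :
    extD α y J = ∑ s : Fin (k + 1), (-1) ^ (s : ℕ) *
      covDeriv φ α y (Matrix.vecCons (J s) fun r => J (s.succAbove r)) := by
  have := ha.sum_symm_eq_zero (G := fun m i j => christoffel φ m i j y)
    (fun m i j => hφ.christoffel_symm hy m i j) J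
  simp only [covDeriv_cons, mul_sub, Finset.sum_sub_distrib]
  rw [this, sub_zero]
  rfl

theorem isAlt_pullT (A : Matrix (Fin 7) (Fin 7) ℝ) {k : ℕ} {a : (Fin k → Fin 7) → ℝ}
    (ha : IsAlt a) : IsAlt (pullT A a) := by
  intro J i j hij
  simp only [pullT]
  rw [← ((Equiv.swap i j).arrowCongr (Equiv.refl (Fin 7))).sum_comp, ← Finset.sum_neg_distrib]
  refine Finset.sum_congr rfl fun I _ => ?_
  have : ((Equiv.swap i j).arrowCongr (Equiv.refl (Fin 7))) I = I ∘ Equiv.swap i j := by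
    ext s; simp [Equiv.arrowCongr]
  rw [this, ha I i j hij, neg_mul]
  congr 2
  exact Equiv.prod_comp (Equiv.swap i j) (fun s => A (I s) (J s))

theorem isAlt_of_swaps3 {a : V3} (h1 : ∀ i j k, a ![j, i, k] = -a ![i, j, k])
    (h2 : ∀ i j k, a ![i, k, j] = -a ![i, j, k]) : IsAlt a := by
  intro J i j hij
  have e : J ∘ Equiv.swap i j = ![J (Equiv.swap i j 0), J (Equiv.swap i j 1),
    J (Equiv.swap i j 2)] := vec3_eta _
  have h3 : ∀ i j k, a ![k, j, i] = -a ![i, j, k] := fun i j k => by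
    rw [h1 j k i, h2 j i k, h1 i j k]; ring
  rw [e, vec3_eta J]
  fin_cases i <;> fin_cases j <;> first | exact absurd rfl hij | skip
  · exact h1 _ _ _
  · exact h3 _ _ _
  · exact h1 _ _ _
  · exact h2 _ _ _
  · exact h3 _ _ _
  · exact h2 _ _ _

theorem isAlt_std : IsAlt std :=
  isAlt_of_swaps3 (fun i j k => by simp [std, phiZ_swap12 i j k])
    (fun i j k => by simp [std, phiZ_swap23 i j k])

theorem IsG2On.isAlt (hφ : IsG2On Ω φ) (hy : y ∈ Ω) : IsAlt (φ y) := by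
  obtain ⟨A, -, hA'⟩ := hφ.pos y hy
  rw [hA']
  exact isAlt_pullT A isAlt_std

theorem leviCivita_swap (f : Fin 7 → Fin 7) {i j : Fin 7} (hij : i ≠ j) :
    leviCivita (f ∘ Equiv.swap i j) = -leviCivita f := by
  have := Matrix.det_permute (Equiv.swap i j) ((1 : Matrix (Fin 7) (Fin 7) ℝ).submatrix f id)
  rw [Equiv.Perm.sign_swap hij] at this
  simpa [leviCivita] using this

theorem isAlt_hodgeStar (φ : CoordTensor 3) {k l : ℕ} (h : k + l = 7) (α : CoordTensor k)
    (y : E7) : IsAlt (hodgeStar φ h α y) := by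
  intro J i j hij
  have e : ∀ I : Fin k → Fin 7, (Fin.append I (J ∘ Equiv.swap i j) ∘ Fin.cast h.symm : Fin 7 → Fin 7)
      = (Fin.append I J ∘ Fin.cast h.symm) ∘
        Equiv.swap (Fin.cast h (Fin.natAdd k i)) (Fin.cast h (Fin.natAdd k j)) := by
    intro I
    ext s
    obtain ⟨s, rfl⟩ : ∃ s', Fin.cast h s' = s := ⟨Fin.cast h.symm s, by simp⟩
    have hsw : Equiv.swap (Fin.cast h (Fin.natAdd k i)) (Fin.cast h (Fin.natAdd k j))
        (Fin.cast h s) = Fin.cast h (Equiv.swap (Fin.natAdd k i) (Fin.natAdd k j) s) := by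
      simp only [Equiv.swap_apply_def, Fin.cast_inj]
      split_ifs <;> rfl
    simp only [Function.comp_apply, hsw, Fin.cast_cast, Fin.cast_eq_self]
    refine Fin.addCases (fun s => ?_) (fun s => ?_) s
    · rw [Fin.append_left, Equiv.swap_apply_of_ne_of_ne, Fin.append_left]
      · simp [Fin.ext_iff]; omega
      · simp [Fin.ext_iff]; omega
    · rw [Fin.append_right]
      rcases eq_or_ne s i with rfl | h1
      · simp
      rcases eq_or_ne s j with rfl | h2
      · simp
      rw [Function.comp_apply, Equiv.swap_apply_of_ne_of_ne h1 h2, Equiv.swap_apply_of_ne_of_ne,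
        Fin.append_right]
      · simpa [Fin.ext_iff] using h1
      · simpa [Fin.ext_iff] using h2
  have hne : Fin.cast h (Fin.natAdd k i) ≠ Fin.cast h (Fin.natAdd k j) := by
    simpa [Fin.ext_iff] using hij
  simp only [hodgeStar, e, leviCivita_swap _ hne]
  have : (fun I : Fin k → Fin 7 => volCoeff φ y * -leviCivita (Fin.append I J ∘ Fin.cast h.symm)) =
    fun I => (-1) * (volCoeff φ y * leviCivita (Fin.append I J ∘ Fin.cast h.symm)) := by
    ext I; ring
  rw [this, contract_smul_right]
  ring

theorem extD_congr {k : ℕ} {α β : CoordTensor k} (hΩ : IsOpen Ω) (hy : y ∈ Ω)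
    (h : ∀ z ∈ Ω, α z = β z) : extD α y = extD β y := by
  ext J
  simp only [extD]
  exact Finset.sum_congr rfl fun s _ => by
    rw [pderiv_congr hΩ hy (fun z hz => by rw [h z hz])]

theorem extD_pullF (h : IsChange F Ω' Ω) (hφ : IsG2On Ω φ) {k : ℕ} {α : CoordTensor k}
    (hα : SmoothOn Ω α) (ha : ∀ z ∈ Ω, IsAlt (α z)) (hy : y ∈ Ω') :
    extD (pullF F α) y = pullT (jac F y) (extD α (F y)) := by
  ext J
  rw [(hφ.pull h).extD_eq hy (isAlt_pullT _ (ha _ (h.maps y hy))), covDeriv_pullF h hφ hα hy]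
  have : extD α (F y) = fun I => ∑ s : Fin (k + 1), (-1) ^ (s : ℕ) *
      covDeriv φ α (F y) (Matrix.vecCons (I s) fun r => I (s.succAbove r)) := by
    ext I; exact hφ.extD_eq (h.maps y hy) (ha _ (h.maps y hy)) I
  rw [this, pullT_sum]
  refine Finset.sum_congr rfl fun s _ => ?_
  rw [pullT_smul]
  congr 1
  rw [pullT_cons]
  simp only [pullT]
  rw [← (Fin.insertNthEquiv (fun _ => Fin 7) s).sum_comp, Fintype.sum_prod_type]
  refine Finset.sum_congr rfl fun b _ => ?_
  rw [Finset.mul_sum]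
  refine Finset.sum_congr rfl fun I _ => ?_
  rw [Fin.prod_univ_succAbove _ s]
  simp
  ring

theorem IsG2On.smooth_hodgeStar (hφ : IsG2On Ω φ) {k l : ℕ} (h : k + l = 7) {α : CoordTensor k}
    (hα : SmoothOn Ω α) : SmoothOn Ω (hodgeStar φ h α) := fun _ =>
  contDiffOn_const.mul (hφ.smooth_contract hα fun _ => ((contDiffOn_volCoeff).comp hφ.contDiff
    fun _ hy => hφ.mem_nondegSet hy).mul contDiffOn_const)

theorem smooth_extD (hΩ : IsOpen Ω) {k : ℕ} {α : CoordTensor k} (hα : SmoothOn Ω α) :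
    SmoothOn Ω (extD α) := fun _ =>
  ContDiffOn.sum fun _ _ => contDiffOn_const.mul (contDiffOn_pderiv hΩ (hα _))

/-- The `2`-form `d* φ`. -/
def tau (φ : CoordTensor 3) : CoordTensor 2 := codiff φ (k := 2) (l := 4) rfl φ

theorem tau_eq (φ : CoordTensor 3) (y : E7) :
    tau φ y = fun J => (-1) * hodgeStar φ (k := 5) (l := 2) rfl (extD (psi φ)) y J := by
  ext J
  simp only [tau, codiff, psi]
  norm_num

theorem IsG2On.smooth_tau (hφ : IsG2On Ω φ) : SmoothOn Ω (tau φ) := fun J => by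
  simp only [tau_eq]
  exact contDiffOn_const.mul (hφ.smooth_hodgeStar rfl (smooth_extD hφ.isOpen hφ.smooth_psi) J)

theorem isAlt_tau (φ : CoordTensor 3) (y : E7) : IsAlt (tau φ y) := by
  intro J i j hij
  rw [tau_eq]
  simp only [isAlt_hodgeStar φ (k := 5) (l := 2) rfl (extD (psi φ)) y J i j hij]
  ring

theorem tau_pullF (h : IsChange F Ω' Ω) (hφ : IsG2On Ω φ) (hy : y ∈ Ω') :
    tau (pullF F φ) y = pullT (jac F y) (tau φ (F y)) := by
  rw [tau_eq, tau_eq, pullT_smul]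
  have : extD (psi (pullF F φ)) y = pullT (jac F y) (extD (psi φ) (F y)) := by
    rw [← extD_pullF h hφ hφ.smooth_psi (fun z _ => isAlt_hodgeStar φ _ φ z) hy]
    exact extD_congr h.isOpen_source hy fun z hz => psi_pullF h hz
  rw [hodgeStar_pull (φ := φ) (φ' := pullF F φ) (h.det_ne_zero y hy) rfl rfl this]

theorem extD_tau_pullF (h : IsChange F Ω' Ω) (hφ : IsG2On Ω φ) (hy : y ∈ Ω') :
    extD (tau (pullF F φ)) y = pullT (jac F y) (extD (tau φ) (F y)) := by
  rw [← extD_pullF h hφ hφ.smooth_tau (fun z _ => isAlt_tau φ z) hy]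
  exact extD_congr h.isOpen_source hy fun z hz => tau_pullF h hφ hz

end

section

/-! ### Closed `G₂` structures and the flow on open subsets of `ℝ⁷` -/

/-- A closed `G₂` structure on an open set. -/
structure IsClosedG2On (Ω : Set E7) (φ : CoordTensor 3) : Prop extends IsG2On Ω φ where
  closed : ∀ y ∈ Ω, ∀ J, extD φ y J = 0

/-- A solution of the Laplacian flow on an open set, in the form `∂φ/∂t = d d* φ`, `dφ = 0`. -/
structure IsG2Flow (I : Set ℝ) (Ω : Set E7) (φ : ℝ → CoordTensor 3) : Prop where
  isOpen_time : IsOpen I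
  smooth : ∀ J, ContDiffOn ℝ ∞ (fun p : ℝ × E7 => φ p.1 p.2 J) (I ×ˢ Ω)
  structureAt : ∀ t ∈ I, IsClosedG2On Ω (φ t)
  evolution : ∀ t ∈ I, ∀ y ∈ Ω, ∀ J,
    HasDerivAt (fun s => φ s y J) (extD (tau (φ t)) y J) t

variable {Ω Ω' : Set E7} {φ : CoordTensor 3} {F : E7 → E7} {y : E7}

theorem IsClosedG2On.pull (h : IsChange F Ω' Ω) (hφ : IsClosedG2On Ω φ) :
    IsClosedG2On Ω' (pullF F φ) where
  toIsG2On := hφ.toIsG2On.pull h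
  closed := fun y hy J => by
    rw [extD_pullF h hφ.toIsG2On hφ.smooth (fun z hz => hφ.isAlt hz) hy]
    simp [pullT, hφ.closed _ (h.maps y hy)]

theorem IsG2Flow.pull {I : Set ℝ} {φ : ℝ → CoordTensor 3} (h : IsChange F Ω' Ω)
    (hφ : IsG2Flow I Ω φ) : IsG2Flow I Ω' (fun t => pullF F (φ t)) where
  isOpen_time := hφ.isOpen_time
  smooth := fun J => by
    change ContDiffOn ℝ ∞ (fun p : ℝ × E7 => ∑ K : Fin 3 → Fin 7, φ p.1 (F p.2) K *
      ∏ s, jac F p.2 (K s) (J s)) (I ×ˢ Ω')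
    refine ContDiffOn.sum fun K _ => ContDiffOn.mul ?_
      (contDiffOn_prod (f := fun s (p : ℝ × E7) => jac F p.2 (K s) (J s)) fun s _ => ?_)
    · refine (hφ.smooth K).comp (g := fun p : ℝ × E7 => φ p.1 p.2 K)
        (f := fun p : ℝ × E7 => (p.1, F p.2)) ?_ ?_
      · exact contDiff_fst.contDiffOn.prodMk (h.smooth.comp contDiff_snd.contDiffOn fun p hp => hp.2)
      · exact fun p hp => ⟨hp.1, h.maps _ hp.2⟩
    · exact (h.smooth_jac (K s) (J s)).comp contDiff_snd.contDiffOn fun p hp => hp.2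
  structureAt := fun t ht => (hφ.structureAt t ht).pull h
  evolution := fun t ht y hy J => by
    rw [extD_tau_pullF h (hφ.structureAt t ht).toIsG2On hy]
    simp only [pullF, pullT]
    exact HasDerivAt.fun_sum fun K _ => (hφ.evolution t ht _ (h.maps y hy) K).mul_const _

/-! ### Derivatives of time-dependent functions -/

theorem contDiffOn_pderiv_time {s : Set ℝ} (hs : UniqueDiffOn ℝ s) (hΩ : IsOpen Ω)
    {f : ℝ → E7 → ℝ} (hf : ContDiffOn ℝ ∞ (fun p : ℝ × E7 => f p.1 p.2) (s ×ˢ Ω)) (i : Fin 7) :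
    ContDiffOn ℝ ∞ (fun p : ℝ × E7 => pderiv i (f p.1) p.2) (s ×ˢ Ω) := by
  have hu : UniqueDiffOn ℝ (s ×ˢ Ω) := hs.prod hΩ.uniqueDiffOn
  have h1 := (hf.fderivWithin hu (m := ∞) (by simp)).clm_apply
    (contDiffOn_const (c := ((0 : ℝ), (EuclideanSpace.single i 1 : E7))))
  refine h1.congr fun p hp => ?_
  have hd : HasFDerivWithinAt (fun p : ℝ × E7 => f p.1 p.2)
      (fderivWithin ℝ (fun p : ℝ × E7 => f p.1 p.2) (s ×ˢ Ω) p) (s ×ˢ Ω) p :=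
    ((hf.differentiableOn (by simp)) p hp).hasFDerivWithinAt
  have hg : HasFDerivWithinAt (fun z : E7 => (p.1, z)) (ContinuousLinearMap.inr ℝ ℝ E7) Ω p.2 :=
    (hasFDerivAt_prodMk_right p.1 p.2).hasFDerivWithinAt
  have hc : HasFDerivWithinAt (fun z => f p.1 z) _ Ω p.2 :=
    HasFDerivWithinAt.comp (g := fun p : ℝ × E7 => f p.1 p.2) (f := fun z : E7 => (p.1, z))
      (t := s ×ˢ Ω) p.2 hd hg fun z hz => ⟨hp.1, hz⟩
  have := (hc.hasFDerivAt (hΩ.mem_nhds hp.2)).fderiv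
  rw [pderiv, this]
  rfl

/-- Time and space derivatives commute: both mixed derivatives are values of the second derivative
of one function on `ℝ × ℝ⁷`, which is symmetric. -/
theorem hasDerivAt_pderiv {I : Set ℝ} (hI : IsOpen I) (hΩ : IsOpen Ω) {f f' : ℝ → E7 → ℝ}
    (hf : ContDiffOn ℝ ∞ (fun p : ℝ × E7 => f p.1 p.2) (I ×ˢ Ω))
    (hf' : ∀ t ∈ I, ∀ y ∈ Ω, HasDerivAt (fun s => f s y) (f' t y) t) (i : Fin 7) :
    ∀ t ∈ I, ∀ y ∈ Ω, HasDerivAt (fun s => pderiv i (f s) y) (pderiv i (f' t) y) t := by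
  intro t ht y hy
  set G : ℝ × E7 → ℝ := fun p => f p.1 p.2 with hG
  have hO : IsOpen (I ×ˢ Ω) := hI.prod hΩ
  have hGat : ∀ p ∈ I ×ˢ Ω, ContDiffAt ℝ ∞ G p := fun p hp => hf.contDiffAt (hO.mem_nhds hp)
  have hGd : ∀ p ∈ I ×ˢ Ω, HasFDerivAt G (fderiv ℝ G p) p := fun p hp =>
    ((hGat p hp).differentiableAt (by simp)).hasFDerivAt
  have hp : (t, y) ∈ I ×ˢ Ω := ⟨ht, hy⟩
  have hG2 : HasFDerivAt (fderiv ℝ G) (fderiv ℝ (fderiv ℝ G) (t, y)) (t, y) :=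
    (((hGat _ hp).fderiv_right (m := ∞) (by simp)).differentiableAt (by simp)).hasFDerivAt
  have hsym : IsSymmSndFDerivAt ℝ G (t, y) := (hGat _ hp).isSymmSndFDerivAt (by
    simp only [minSmoothness_of_isRCLikeNormedField]; exact ENat.LEInfty.out)
  have h1 : ∀ p ∈ I ×ˢ Ω, f' p.1 p.2 = fderiv ℝ G p ((1 : ℝ), (0 : E7)) := by
    intro p hp
    have hc := (hGd p hp).comp_hasDerivAt p.1
      ((hasDerivAt_id p.1).prodMk (hasDerivAt_const p.1 p.2))
    exact (hf' p.1 hp.1 p.2 hp.2).unique hc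
  have h2 : ∀ p ∈ I ×ˢ Ω, pderiv i (f p.1) p.2 =
      fderiv ℝ G p ((0 : ℝ), (EuclideanSpace.single i 1 : E7)) := by
    intro p hp
    have hc := HasFDerivAt.comp (g := G) (f := fun z : E7 => (p.1, z)) p.2 (hGd (p.1, p.2) hp)
      (hasFDerivAt_prodMk_right (𝕜 := ℝ) p.1 p.2)
    have : HasFDerivAt (f p.1) ((fderiv ℝ G p).comp (ContinuousLinearMap.inr ℝ ℝ E7)) p.2 := hc
    rw [pderiv, this.fderiv]
    rfl
  have h3 : pderiv i (f' t) y = fderiv ℝ (fderiv ℝ G) (t, y)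
      ((0 : ℝ), (EuclideanSpace.single i 1 : E7)) ((1 : ℝ), (0 : E7)) := by
    rw [pderiv_congr hΩ hy (fun z hz => h1 (t, z) ⟨ht, hz⟩)]
    have hc := (hG2.clm_apply (hasFDerivAt_const ((1 : ℝ), (0 : E7)) (t, y))).comp y
      (hasFDerivAt_prodMk_right t y)
    have : HasFDerivAt (fun z => fderiv ℝ G (t, z) ((1 : ℝ), (0 : E7))) _ y := hc
    rw [pderiv, this.fderiv]
    simp
  have h4 : HasDerivAt (fun s => fderiv ℝ G (s, y) ((0 : ℝ), (EuclideanSpace.single i 1 : E7)))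
      (fderiv ℝ (fderiv ℝ G) (t, y) ((1 : ℝ), (0 : E7))
        ((0 : ℝ), (EuclideanSpace.single i 1 : E7))) t := by
    have hc := (hG2.clm_apply (hasFDerivAt_const ((0 : ℝ), (EuclideanSpace.single i 1 : E7))
      (t, y))).comp_hasDerivAt t ((hasDerivAt_id t).prodMk (hasDerivAt_const t y))
    refine hc.congr_deriv ?_
    simp
  rw [h3, hsym]
  refine h4.congr_of_eventuallyEq ?_
  filter_upwards [hI.mem_nhds ht] with s hs
  exact h2 (s, y) ⟨hs, hy⟩

/-! ### Differential polynomials in a `G₂` structure -/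

/-- Iterated partial derivatives. -/
def pd : List (Fin 7) → (E7 → ℝ) → E7 → ℝ
  | [], f => f
  | i :: L, f => pderiv i (pd L f)

theorem contDiffOn_pd (hΩ : IsOpen Ω) (L : List (Fin 7)) {f : E7 → ℝ}
    (hf : ContDiffOn ℝ ∞ f Ω) : ContDiffOn ℝ ∞ (pd L f) Ω := by
  induction L with
  | nil => exact hf
  | cons i L ih => exact contDiffOn_pderiv hΩ ih

theorem contDiffOn_pd_time {s : Set ℝ} (hs : UniqueDiffOn ℝ s) (hΩ : IsOpen Ω)
    {f : ℝ → E7 → ℝ} (hf : ContDiffOn ℝ ∞ (fun p : ℝ × E7 => f p.1 p.2) (s ×ˢ Ω))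
    (L : List (Fin 7)) : ContDiffOn ℝ ∞ (fun p : ℝ × E7 => pd L (f p.1) p.2) (s ×ˢ Ω) := by
  induction L with
  | nil => exact hf
  | cons i L ih => exact contDiffOn_pderiv_time (f := fun t => pd L (f t)) hs hΩ ih i

/-- The skew part of a `3`-tensor. -/
def altV (v : V3) : V3 := fun J =>
  (1 / 6) * ∑ σ : Equiv.Perm (Fin 3), ((Equiv.Perm.sign σ : ℤ) : ℝ) * v (J ∘ σ)

theorem IsAlt.comp_perm {k : ℕ} {a : (Fin k → Fin 7) → ℝ} (ha : IsAlt a) (σ : Equiv.Perm (Fin k)) :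
    ∀ J, a (J ∘ σ) = ((Equiv.Perm.sign σ : ℤ) : ℝ) * a J := by
  induction σ using Equiv.Perm.swap_induction_on with
  | one => simp
  | swap_mul f i j hij ih =>
    intro J
    have : J ∘ (Equiv.swap i j * f : Equiv.Perm (Fin k)) = (J ∘ Equiv.swap i j) ∘ f := rfl
    rw [this, ih, ha J i j hij, Equiv.Perm.sign_mul, Equiv.Perm.sign_swap hij]
    simp

theorem altV_of_isAlt {v : V3} (hv : IsAlt v) : altV v = v := by
  ext J
  have : ∀ σ : Equiv.Perm (Fin 3), ((Equiv.Perm.sign σ : ℤ) : ℝ) * v (J ∘ σ) = v J := by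
    intro σ
    rw [hv.comp_perm σ, ← mul_assoc]
    rcases Int.units_eq_one_or (Equiv.Perm.sign σ) with h | h <;> rw [h] <;> simp
  simp only [altV, this, Finset.sum_const, Finset.card_univ, Fintype.card_perm, Fintype.card_fin]
  simp [Nat.factorial]

theorem contDiff_altV : ContDiff ℝ ∞ altV := by
  unfold altV
  fun_prop

/-- The domain of the coefficient functions. -/
def coefSet : Set V3 := altV ⁻¹' nondegSet

theorem isOpen_coefSet : IsOpen coefSet := isOpen_nondegSet.preimage contDiff_altV.continuous

theorem IsG2On.mem_coefSet (hφ : IsG2On Ω φ) (hy : y ∈ Ω) : φ y ∈ coefSet := by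
  change altV (φ y) ∈ nondegSet
  rw [altV_of_isAlt (hφ.isAlt hy)]
  exact hφ.mem_nondegSet hy

theorem std_mem_coefSet : std ∈ coefSet := by
  change altV std ∈ nondegSet
  rw [altV_of_isAlt isAlt_std]
  change (bForm (fun _ => std) 0).det ≠ 0
  simp [bForm_std]

theorem fderiv_pi_eq {f : E7 → V3} (hf : ∀ J, DifferentiableAt ℝ (fun z => f z J) y) (i : Fin 7) :
    fderiv ℝ f y (EuclideanSpace.single i 1) = fun J => pderiv i (fun z => f z J) y := by
  rw [fderiv_pi hf]
  rfl

theorem clm_apply_eq_sum (l : V3 →L[ℝ] ℝ) (v : V3) : l v = ∑ J, l (Pi.single J 1) * v J := by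
  have := LinearMap.pi_apply_eq_sum_univ l.toLinearMap v
  simp only [ContinuousLinearMap.coe_coe, smul_eq_mul] at this
  rw [this]
  refine Finset.sum_congr rfl fun J _ => ?_
  rw [mul_comm]
  congr 2
  ext K
  simp [Pi.single_apply, eq_comm]

/-- A partial derivative of a coefficient function. -/
def coefD (c : V3 → ℝ) (J : Fin 3 → Fin 7) (v : V3) : ℝ := fderiv ℝ c v (Pi.single J 1)

theorem contDiffOn_coefD {c : V3 → ℝ} (hc : ContDiffOn ℝ ∞ c coefSet) (J : Fin 3 → Fin 7) :
    ContDiffOn ℝ ∞ (coefD c J) coefSet :=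
  (hc.fderiv_of_isOpen isOpen_coefSet (m := ∞) (by simp)).clm_apply contDiffOn_const

theorem pderiv_coef {c : V3 → ℝ} (hc : ContDiffOn ℝ ∞ c coefSet) (hφ : IsG2On Ω φ) (hy : y ∈ Ω)
    (i : Fin 7) : pderiv i (fun z => c (φ z)) y =
      fderiv ℝ c (φ y) fun J => pderiv i (fun z => φ z J) y := by
  have hd : ∀ J, DifferentiableAt ℝ (fun z => φ z J) y := fun J =>
    differentiableAt_of_contDiffOn hφ.isOpen (hφ.smooth J) hy
  have h1 : DifferentiableAt ℝ c (φ y) :=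
    (hc.contDiffAt (isOpen_coefSet.mem_nhds (hφ.mem_coefSet hy))).differentiableAt (by simp)
  have h2 : fderiv ℝ (fun z => c (φ z)) y = _ := fderiv_comp y h1 (differentiableAt_pi.2 hd)
  rw [pderiv, h2, ← fderiv_pi_eq hd]
  rfl

/-- Functionals of a `G₂` structure. -/
abbrev Fnl := CoordTensor 3 → E7 → ℝ

/-- Differential polynomials of order at most `k` that are homogeneous of weight `w`, where a
derivative of order `m` has weight `m` and the coefficients are smooth functions of the
`3`-form. -/
inductive DPoly : ℕ → ℕ → Fnl → Prop
  | coef (k : ℕ) (c : V3 → ℝ) (hc : ContDiffOn ℝ ∞ c coefSet) : DPoly k 0 fun φ y => c (φ y)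
  | jet (k w : ℕ) (L : List (Fin 7)) (J : Fin 3 → Fin 7) (hL : L.length = w) (hk : w ≤ k)
      (h1 : 1 ≤ w) : DPoly k w fun φ y => pd L (fun z => φ z J) y
  | zero (k w : ℕ) : DPoly k w fun _ _ => 0
  | add (k w : ℕ) (Φ Ψ : Fnl) : DPoly k w Φ → DPoly k w Ψ → DPoly k w fun φ y => Φ φ y + Ψ φ y
  | mul (k a b w : ℕ) (Φ Ψ : Fnl) (hw : a + b = w) :
      DPoly k a Φ → DPoly k b Ψ → DPoly k w fun φ y => Φ φ y * Ψ φ y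

/-- Two functionals agree on closed `G₂` structures. -/
def FEq (Φ Ψ : Fnl) : Prop := ∀ (Ω : Set E7) (φ : CoordTensor 3), IsClosedG2On Ω φ →
  ∀ y ∈ Ω, Φ φ y = Ψ φ y

/-- `Φ` agrees with a differential polynomial on closed `G₂` structures. -/
def DP (k w : ℕ) (Φ : Fnl) : Prop := ∃ Ψ, DPoly k w Ψ ∧ FEq Φ Ψ

theorem DPoly.mono {k k' w : ℕ} {Φ : Fnl} (h : DPoly k w Φ) (hk : k ≤ k') : DPoly k' w Φ := by
  induction h with
  | coef c hc => exact .coef _ c hc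
  | jet w L J hL hk1 h1 => exact .jet _ _ L J hL (hk1.trans hk) h1
  | zero w => exact .zero _ _
  | add w Φ Ψ _ _ ih1 ih2 => exact .add _ _ _ _ ih1 ih2
  | mul a b w Φ Ψ hw _ _ ih1 ih2 => exact .mul _ _ _ _ _ _ hw ih1 ih2

theorem DPoly.contDiffOn {k w : ℕ} {Φ : Fnl} (h : DPoly k w Φ) (hφ : IsG2On Ω φ) :
    ContDiffOn ℝ ∞ (Φ φ) Ω := by
  induction h with
  | coef c hc => exact hc.comp hφ.contDiff fun z hz => hφ.mem_coefSet hz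
  | jet w L J hL hk1 h1 => exact contDiffOn_pd hφ.isOpen L (hφ.smooth J)
  | zero w => exact contDiffOn_const
  | add w Φ Ψ _ _ ih1 ih2 => exact ih1.add ih2
  | mul a b w Φ Ψ hw _ _ ih1 ih2 => exact ih1.mul ih2

theorem DPoly.contDiffOn_time {k w : ℕ} {Φ : Fnl} (h : DPoly k w Φ) {s : Set ℝ}
    (hs : UniqueDiffOn ℝ s) (hΩ : IsOpen Ω) {φ : ℝ → CoordTensor 3}
    (hφ : ∀ J, ContDiffOn ℝ ∞ (fun p : ℝ × E7 => φ p.1 p.2 J) (s ×ˢ Ω))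
    (hφ' : ∀ t ∈ s, IsG2On Ω (φ t)) :
    ContDiffOn ℝ ∞ (fun p : ℝ × E7 => Φ (φ p.1) p.2) (s ×ˢ Ω) := by
  induction h with
  | coef c hc =>
    exact hc.comp (contDiffOn_pi.2 hφ) fun p hp => (hφ' p.1 hp.1).mem_coefSet hp.2
  | jet w L J hL hk1 h1 =>
    exact contDiffOn_pd_time hs hΩ (f := fun t z => φ t z J) (hφ J) L
  | zero w => exact contDiffOn_const
  | add w Φ Ψ _ _ ih1 ih2 => exact ih1.add ih2
  | mul a b w Φ Ψ hw _ _ ih1 ih2 => exact ih1.mul ih2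

section DPClosure

variable {k a b w : ℕ} {Φ Ψ : Fnl}

theorem DPoly.dp (h : DPoly k w Φ) : DP k w Φ := ⟨Φ, h, fun _ _ _ _ _ => rfl⟩

theorem DP.congr (h : DP k w Ψ) (he : FEq Φ Ψ) : DP k w Φ := by
  obtain ⟨Ψ', h1, h2⟩ := h
  exact ⟨Ψ', h1, fun Ω φ hφ y hy => (he Ω φ hφ y hy).trans (h2 Ω φ hφ y hy)⟩

theorem DP.mono {k' : ℕ} (h : DP k w Φ) (hk : k ≤ k') : DP k' w Φ := by
  obtain ⟨Ψ', h1, h2⟩ := h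
  exact ⟨Ψ', h1.mono hk, h2⟩

theorem DP.zero : DP k w fun _ _ => 0 := (DPoly.zero k w).dp

theorem DP.coef {c : V3 → ℝ} (hc : ContDiffOn ℝ ∞ c coefSet) : DP k 0 fun φ y => c (φ y) :=
  (DPoly.coef k c hc).dp

theorem DP.const (c : ℝ) : DP k 0 fun _ _ => c := DP.coef (c := fun _ => c) contDiffOn_const

theorem DP.add (h1 : DP k w Φ) (h2 : DP k w Ψ) : DP k w fun φ y => Φ φ y + Ψ φ y := by
  obtain ⟨Φ', h1, e1⟩ := h1
  obtain ⟨Ψ', h2, e2⟩ := h2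
  exact ⟨_, .add _ _ _ _ h1 h2, fun Ω φ hφ y hy => by
    dsimp only; rw [e1 Ω φ hφ y hy, e2 Ω φ hφ y hy]⟩

theorem DP.mul' (hw : a + b = w) (h1 : DP k a Φ) (h2 : DP k b Ψ) :
    DP k w fun φ y => Φ φ y * Ψ φ y := by
  obtain ⟨Φ', h1, e1⟩ := h1
  obtain ⟨Ψ', h2, e2⟩ := h2
  exact ⟨_, .mul _ _ _ _ _ _ hw h1 h2, fun Ω φ hφ y hy => by
    dsimp only; rw [e1 Ω φ hφ y hy, e2 Ω φ hφ y hy]⟩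

theorem DP.mul (h1 : DP k a Φ) (h2 : DP k b Ψ) : DP k (a + b) fun φ y => Φ φ y * Ψ φ y :=
  DP.mul' rfl h1 h2

theorem DP.coef_mul (h1 : DP k 0 Φ) (h2 : DP k w Ψ) : DP k w fun φ y => Φ φ y * Ψ φ y :=
  DP.mul' (by simp) h1 h2

theorem DP.const_mul (c : ℝ) (h : DP k w Φ) : DP k w fun φ y => c * Φ φ y :=
  (DP.const c).coef_mul h

theorem DP.neg (h : DP k w Φ) : DP k w fun φ y => -Φ φ y :=
  (h.const_mul (-1)).congr fun _ _ _ _ _ => by ring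

theorem DP.sub (h1 : DP k w Φ) (h2 : DP k w Ψ) : DP k w fun φ y => Φ φ y - Ψ φ y :=
  (h1.add h2.neg).congr fun _ _ _ _ _ => by ring

theorem DP.sum {ι : Type*} (S : Finset ι) {Φ : ι → Fnl} (h : ∀ i ∈ S, DP k w (Φ i)) :
    DP k w fun φ y => ∑ i ∈ S, Φ i φ y := by
  classical
  induction S using Finset.induction_on with
  | empty => simpa using DP.zero
  | insert i S hi ih =>
    simp only [Finset.sum_insert hi]
    exact (h i (by simp)).add (ih fun j hj => h j (by simp [hj]))

theorem DP.prod {ι : Type*} (S : Finset ι) {Φ : ι → Fnl} (h : ∀ i ∈ S, DP k 0 (Φ i)) :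
    DP k 0 fun φ y => ∏ i ∈ S, Φ i φ y := by
  classical
  induction S using Finset.induction_on with
  | empty => simpa using DP.const 1
  | insert i S hi ih =>
    simp only [Finset.prod_insert hi]
    exact (h i (by simp)).coef_mul (ih fun j hj => h j (by simp [hj]))

theorem DP.jet (L : List (Fin 7)) (J : Fin 3 → Fin 7) (hL : L.length = w) (hk : w ≤ k)
    (h1 : 1 ≤ w) : DP k w fun φ y => pd L (fun z => φ z J) y := (DPoly.jet k w L J hL hk h1).dp

theorem DP.contDiffOn (h : DP k w Φ) (hφ : IsClosedG2On Ω φ) : ContDiffOn ℝ ∞ (Φ φ) Ω := by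
  obtain ⟨Ψ, h1, h2⟩ := h
  exact (h1.contDiffOn hφ.toIsG2On).congr fun y hy => h2 Ω φ hφ y hy

theorem FEq.pderiv (h : FEq Φ Ψ) (i : Fin 7) :
    FEq (fun φ y => pderiv i (Φ φ) y) fun φ y => pderiv i (Ψ φ) y := fun Ω φ hφ _ hy =>
  pderiv_congr hφ.isOpen hy fun z hz => h Ω φ hφ z hz

/-- By the chain rule, a derivative of a coefficient is a sum of coefficients times first
derivatives of `φ`, so order and weight both rise by exactly one. -/
theorem DPoly.pderiv (h : DPoly k w Φ) (i : Fin 7) :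
    DP (k + 1) (w + 1) fun φ y => pderiv i (Φ φ) y := by
  induction h with
  | coef c hc =>
    have h1 : DP (k + 1) (0 + 1) fun φ y => ∑ J, coefD c J (φ y) * pd [i] (fun z => φ z J) y :=
      DP.sum _ fun J _ => (DP.coef (contDiffOn_coefD hc J)).coef_mul
        (DP.jet [i] J rfl (by omega) le_rfl)
    refine h1.congr fun Ω φ hφ y hy => ?_
    dsimp only
    rw [pderiv_coef hc hφ.toIsG2On hy, clm_apply_eq_sum]
    rfl
  | jet w L J hL hk1 h1 => exact DP.jet (i :: L) J (by simp [hL]) (by omega) (by omega)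
  | zero w => exact DP.zero.congr fun Ω φ hφ y hy => pderiv_const 0
  | add w Φ Ψ h1 h2 ih1 ih2 =>
    exact (ih1.add ih2).congr fun Ω φ hφ y hy =>
      pderiv_add (differentiableAt_of_contDiffOn hφ.isOpen (h1.contDiffOn hφ.toIsG2On) hy)
        (differentiableAt_of_contDiffOn hφ.isOpen (h2.contDiffOn hφ.toIsG2On) hy)
  | mul a b w Φ Ψ hw h1 h2 ih1 ih2 =>
    refine ((DP.mul' (w := w + 1) (by omega) ih1 (h2.dp.mono (Nat.le_succ k))).add
      (DP.mul' (w := w + 1) (by omega) (h1.dp.mono (Nat.le_succ k)) ih2)).congr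
      fun Ω φ hφ y hy => ?_
    exact pderiv_mul (differentiableAt_of_contDiffOn hφ.isOpen (h1.contDiffOn hφ.toIsG2On) hy)
        (differentiableAt_of_contDiffOn hφ.isOpen (h2.contDiffOn hφ.toIsG2On) hy)

theorem DP.pderiv (h : DP k w Φ) (i : Fin 7) :
    DP (k + 1) (w + 1) fun φ y => G2.pderiv i (Φ φ) y := by
  obtain ⟨Ψ, h1, h2⟩ := h
  exact (h1.pderiv i).congr (h2.pderiv i)

theorem DP.pd (h : DP k w Φ) (L : List (Fin 7)) :
    DP (k + L.length) (w + L.length) fun φ y => pd L (Φ φ) y := by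
  induction L with
  | nil => exact h
  | cons i L ih => exact ih.pderiv i

/-- A bound for the derivatives of order between `1` and `k` of the `3`-form at a point. -/
def JetBound (k : ℕ) (φ : CoordTensor 3) (y : E7) (ρ : ℝ) : Prop :=
  ∀ L : List (Fin 7), 1 ≤ L.length → L.length ≤ k → ∀ J,
    |G2.pd L (fun z => φ z J) y| ≤ ρ ^ L.length

/-- At a point where `φ` is standard every coefficient is a fixed number, and homogeneity gives the
power of `ρ`. This is why undifferentiated components enter only through coefficients and jets have
order at least `1`. -/
theorem DPoly.bound (h : DPoly k w Φ) : ∃ C : ℝ, 0 ≤ C ∧ ∀ (φ : CoordTensor 3) (y : E7) (ρ : ℝ),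
    0 ≤ ρ → φ y = std → JetBound k φ y ρ → |Φ φ y| ≤ C * ρ ^ w := by
  induction h with
  | coef c hc =>
    exact ⟨|c std|, abs_nonneg _, fun φ y ρ hρ h0 _ => by dsimp only; rw [h0]; simp⟩
  | jet w L J hL hk1 h1 =>
    refine ⟨1, zero_le_one, fun φ y ρ hρ h0 hb => ?_⟩
    have := hb L (by omega) (by omega) J
    rw [hL] at this
    simpa using this
  | zero w => exact ⟨0, le_rfl, fun φ y ρ hρ h0 hb => by simp⟩
  | add w Φ Ψ _ _ ih1 ih2 =>
    obtain ⟨C1, hC1, h1⟩ := ih1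
    obtain ⟨C2, hC2, h2⟩ := ih2
    refine ⟨C1 + C2, by positivity, fun φ y ρ hρ h0 hb => ?_⟩
    calc _ ≤ |Φ φ y| + |Ψ φ y| := abs_add_le _ _
      _ ≤ C1 * ρ ^ w + C2 * ρ ^ w := add_le_add (h1 φ y ρ hρ h0 hb) (h2 φ y ρ hρ h0 hb)
      _ = _ := by ring
  | mul a b w Φ Ψ hw _ _ ih1 ih2 =>
    obtain ⟨C1, hC1, h1⟩ := ih1
    obtain ⟨C2, hC2, h2⟩ := ih2
    refine ⟨C1 * C2, by positivity, fun φ y ρ hρ h0 hb => ?_⟩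
    dsimp only
    rw [abs_mul]
    calc |Φ φ y| * |Ψ φ y| ≤ (C1 * ρ ^ a) * (C2 * ρ ^ b) :=
          mul_le_mul (h1 φ y ρ hρ h0 hb) (h2 φ y ρ hρ h0 hb) (abs_nonneg _) (by positivity)
      _ = _ := by rw [← hw, pow_add]; ring

theorem DP.bound (h : DP k w Φ) : ∃ C : ℝ, 0 ≤ C ∧ ∀ (Ω : Set E7) (φ : CoordTensor 3) (y : E7)
    (ρ : ℝ), IsClosedG2On Ω φ → y ∈ Ω → 0 ≤ ρ → φ y = std → JetBound k φ y ρ →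
      |Φ φ y| ≤ C * ρ ^ w := by
  obtain ⟨Ψ, h1, h2⟩ := h
  obtain ⟨C, hC, hb⟩ := h1.bound
  exact ⟨C, hC, fun Ω φ y ρ hφ hy hρ h0 hj => by
    rw [h2 Ω φ hφ y hy]; exact hb φ y ρ hρ h0 hj⟩

end DPClosure

/-! ### Lower order terms -/

/-- Differential polynomials of weight `w` without derivatives of order `w`, except with
coefficients that vanish at the standard form. -/
inductive Low : ℕ → Fnl → Prop
  | dp (w : ℕ) (Φ : Fnl) : DP w (w + 1) Φ → Low (w + 1) Φ
  | coef (w : ℕ) (c : V3 → ℝ) (hc : ContDiffOn ℝ ∞ c coefSet) (h0 : c std = 0) (hw : 1 ≤ w)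
      (Φ : Fnl) : DP w w Φ → Low w fun φ y => c (φ y) * Φ φ y
  | add (w : ℕ) (Φ Ψ : Fnl) : Low w Φ → Low w Ψ → Low w fun φ y => Φ φ y + Ψ φ y
  | congr (w : ℕ) (Φ Ψ : Fnl) : FEq Φ Ψ → Low w Ψ → Low w Φ

section LowClosure

variable {k a b w : ℕ} {Φ Ψ : Fnl}

theorem Low.one_le (h : Low w Φ) : 1 ≤ w := by
  induction h with
  | dp w Φ h => omega
  | coef w c hc h0 hw Φ h => exact hw
  | add w Φ Ψ _ _ ih _ => exact ih
  | congr w Φ Ψ _ _ ih => exact ih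

theorem Low.dp_self (h : Low w Φ) : DP w w Φ := by
  induction h with
  | dp w Φ h => exact h.mono (Nat.le_succ w)
  | coef w c hc h0 hw Φ h => exact (DP.coef hc).coef_mul h
  | add w Φ Ψ _ _ ih1 ih2 => exact ih1.add ih2
  | congr w Φ Ψ he _ ih => exact ih.congr he

theorem DP.low (h : DP k w Φ) (hk : k + 1 ≤ w) : Low w Φ := by
  obtain ⟨w, rfl⟩ : ∃ w', w = w' + 1 := ⟨w - 1, by omega⟩
  exact .dp w Φ (h.mono (by omega))

theorem Low.coef_mul {c : Fnl} (hc : DP 0 0 c) (h : Low w Φ) :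
    Low w fun φ y => c φ y * Φ φ y := by
  induction h with
  | dp w Φ h => exact .dp _ _ ((hc.mono (Nat.zero_le _)).coef_mul h)
  | coef w d hd h0 hw Φ h =>
    exact .congr _ _ _ (fun Ω φ hφ y hy => by ring)
      (Low.coef w d hd h0 hw _ ((hc.mono (Nat.zero_le _)).coef_mul h))
  | add w Φ Ψ _ _ ih1 ih2 =>
    exact .congr _ _ _ (fun Ω φ hφ y hy => by ring) (Low.add _ _ _ ih1 ih2)
  | congr w Φ Ψ he _ ih =>
    exact .congr _ _ _ (fun Ω φ hφ y hy => by rw [he Ω φ hφ y hy]) ih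

theorem Low.const_mul (c : ℝ) (h : Low w Φ) : Low w fun φ y => c * Φ φ y :=
  h.coef_mul (DP.const c)

theorem Low.zero (hw : 1 ≤ w) : Low w fun _ _ => 0 := DP.low (k := 0) DP.zero (by omega)

theorem Low.sum (hw : 1 ≤ w) {ι : Type*} (S : Finset ι) {Φ : ι → Fnl}
    (h : ∀ i ∈ S, Low w (Φ i)) : Low w fun φ y => ∑ i ∈ S, Φ i φ y := by
  classical
  induction S using Finset.induction_on with
  | empty => simpa using Low.zero hw
  | insert i S hi ih =>
    simp only [Finset.sum_insert hi]
    exact Low.add _ _ _ (h i (by simp)) (ih fun j hj => h j (by simp [hj]))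

theorem DP.mul_low (ha : 1 ≤ a) (hb : 1 ≤ b) (h1 : DP a a Φ) (h2 : DP b b Ψ) :
    Low (a + b) fun φ y => Φ φ y * Ψ φ y :=
  DP.low (k := a + b - 1) ((h1.mono (by omega)).mul (h2.mono (by omega))) (by omega)

/-- A coefficient that vanishes at the standard form may lose this property when it is
differentiated. It then multiplies a factor of order at most `w`, which is below the new weight `w +
1`, so the term is still of lower order. -/
theorem Low.pderiv (h : Low w Φ) (i : Fin 7) : Low (w + 1) fun φ y => pderiv i (Φ φ) y := by
  induction h with
  | dp w Φ h => exact .dp _ _ (h.pderiv i)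
  | coef w c hc h0 hw Φ h =>
    have h1 : DP 1 1 fun φ y => G2.pderiv i (fun z => c (φ z)) y := (DP.coef (k := 0) hc).pderiv i
    refine .congr _ _ _ (fun Ω φ hφ y hy => ?_) (Low.add _ _ _
      (Low.coef (w + 1) c hc h0 (by omega) _ (h.pderiv i))
      (DP.low (k := w) (DP.mul' (w := w + 1) (by omega) (h1.mono hw) h) le_rfl))
    dsimp only
    rw [pderiv_mul (differentiableAt_of_contDiffOn hφ.isOpen
        ((DP.coef (k := 0) hc).contDiffOn hφ) hy)
      (differentiableAt_of_contDiffOn hφ.isOpen (h.contDiffOn hφ) hy)]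
    ring
  | add w Φ Ψ h1 h2 ih1 ih2 =>
    refine .congr _ _ _ (fun Ω φ hφ y hy => ?_) (Low.add _ _ _ ih1 ih2)
    exact pderiv_add (differentiableAt_of_contDiffOn hφ.isOpen (h1.dp_self.contDiffOn hφ) hy)
      (differentiableAt_of_contDiffOn hφ.isOpen (h2.dp_self.contDiffOn hφ) hy)
  | congr w Φ Ψ he _ ih => exact .congr _ _ _ (he.pderiv i) ih

/-- The terms containing derivatives of order `w` have coefficient zero where `φ` is standard, so
jets of order at most `w - 1` suffice. -/
theorem Low.bound (h : Low w Φ) : ∃ C : ℝ, 0 ≤ C ∧ ∀ (Ω : Set E7) (φ : CoordTensor 3) (y : E7)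
    (ρ : ℝ), IsClosedG2On Ω φ → y ∈ Ω → 0 ≤ ρ → φ y = std → JetBound (w - 1) φ y ρ →
      |Φ φ y| ≤ C * ρ ^ w := by
  induction h with
  | dp w Φ h => exact h.bound
  | coef w c hc h0 hw Φ h =>
    exact ⟨0, le_rfl, fun Ω φ y ρ _ _ _ hs _ => by dsimp only; rw [hs, h0]; simp⟩
  | add w Φ Ψ _ _ ih1 ih2 =>
    obtain ⟨C1, hC1, h1⟩ := ih1
    obtain ⟨C2, hC2, h2⟩ := ih2
    refine ⟨C1 + C2, by positivity, fun Ω φ y ρ hφ hy hρ h0 hb => ?_⟩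
    calc _ ≤ |Φ φ y| + |Ψ φ y| := abs_add_le _ _
      _ ≤ C1 * ρ ^ w + C2 * ρ ^ w := add_le_add (h1 Ω φ y ρ hφ hy hρ h0 hb) (h2 Ω φ y ρ hφ hy hρ h0 hb)
      _ = _ := by ring
  | congr w Φ Ψ he _ ih =>
    obtain ⟨C, hC, hb⟩ := ih
    exact ⟨C, hC, fun Ω φ y ρ hφ hy hρ h0 hj => by
      rw [he Ω φ hφ y hy]; exact hb Ω φ y ρ hφ hy hρ h0 hj⟩

end LowClosure

end

section

/-! ### Coefficient functionals and equality up to lower order terms -/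

/-- `Φ` is a smooth function of the `3`-form alone, with value `c₀` at the standard form. -/
def Coef (Φ : Fnl) (c₀ : ℝ) : Prop :=
  ∃ c : V3 → ℝ, ContDiffOn ℝ ∞ c coefSet ∧ c std = c₀ ∧ FEq Φ fun φ y => c (φ y)

/-- Equality of two differential polynomials of order and weight `w` up to lower order terms. -/
structure LEq (w : ℕ) (Φ Ψ : Fnl) : Prop where
  left : DP w w Φ
  right : DP w w Ψ
  low : Low w fun φ y => Φ φ y - Ψ φ y

section LEqClosure

variable {k a b w : ℕ} {Φ Ψ Φ' Ψ' Θ : Fnl} {c₀ c₁ : ℝ}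

theorem Coef.const (c : ℝ) : Coef (fun _ _ => c) c :=
  ⟨fun _ => c, contDiffOn_const, rfl, fun _ _ _ _ _ => rfl⟩

/-- Precomposition with `altV` makes `coefSet` the domain and changes no value on a `3`-form. -/
theorem Coef.of_nondeg {c : V3 → ℝ} (hc : ContDiffOn ℝ ∞ c nondegSet) :
    Coef (fun φ y => c (φ y)) (c std) := by
  refine ⟨fun v => c (altV v), hc.comp contDiff_altV.contDiffOn fun v hv => hv, ?_, ?_⟩
  · exact congrArg c (altV_of_isAlt isAlt_std)
  · intro Ω φ hφ y hy
    dsimp only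
    rw [altV_of_isAlt (hφ.isAlt hy)]

theorem Coef.mul (h1 : Coef Φ c₀) (h2 : Coef Ψ c₁) : Coef (fun φ y => Φ φ y * Ψ φ y) (c₀ * c₁) := by
  obtain ⟨c, hc, h0, he⟩ := h1
  obtain ⟨d, hd, h0', he'⟩ := h2
  refine ⟨fun v => c v * d v, hc.mul hd, by simp only [h0, h0'], fun Ω φ hφ y hy => ?_⟩
  dsimp only
  rw [he Ω φ hφ y hy, he' Ω φ hφ y hy]

theorem Coef.prod {ι : Type*} (S : Finset ι) {Φ : ι → Fnl} {c : ι → ℝ}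
    (h : ∀ i ∈ S, Coef (Φ i) (c i)) : Coef (fun φ y => ∏ i ∈ S, Φ i φ y) (∏ i ∈ S, c i) := by
  classical
  induction S using Finset.induction_on with
  | empty => simpa using Coef.const 1
  | insert i S hi ih =>
    simp only [Finset.prod_insert hi]
    exact (h i (by simp)).mul (ih fun j hj => h j (by simp [hj]))

theorem Coef.dp (h : Coef Φ c₀) : DP k 0 Φ := by
  obtain ⟨c, h1, _, h3⟩ := h
  exact (DP.coef h1).congr h3

theorem LEq.one_le (h : LEq w Φ Ψ) : 1 ≤ w := h.low.one_le

theorem LEq.congr (h : LEq w Φ Ψ) (h1 : FEq Φ' Φ) (h2 : FEq Ψ' Ψ) : LEq w Φ' Ψ' where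
  left := h.left.congr h1
  right := h.right.congr h2
  low := .congr _ _ _ (fun Ω φ hφ y hy => by
    rw [h1 Ω φ hφ y hy, h2 Ω φ hφ y hy]) h.low

theorem LEq.congr_left (h : LEq w Φ Ψ) (h1 : FEq Φ' Φ) : LEq w Φ' Ψ :=
  h.congr h1 fun _ _ _ _ _ => rfl

theorem LEq.congr_right (h : LEq w Φ Ψ) (h1 : FEq Ψ' Ψ) : LEq w Φ Ψ' :=
  h.congr (fun _ _ _ _ _ => rfl) h1

theorem LEq.refl (hw : 1 ≤ w) (h : DP w w Φ) : LEq w Φ Φ where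
  left := h
  right := h
  low := .congr _ _ _ (fun _ _ _ _ _ => sub_self _) (Low.zero hw)

theorem LEq.trans (h1 : LEq w Φ Ψ) (h2 : LEq w Ψ Θ) : LEq w Φ Θ where
  left := h1.left
  right := h2.right
  low := .congr _ _ _ (fun Ω φ hφ y hy => by ring) (Low.add _ _ _ h1.low h2.low)

theorem LEq.symm (h1 : LEq w Φ Ψ) : LEq w Ψ Φ where
  left := h1.right
  right := h1.left
  low := .congr _ _ _ (fun Ω φ hφ y hy => by ring) (h1.low.const_mul (-1))

theorem LEq.add (h1 : LEq w Φ Ψ) (h2 : LEq w Φ' Ψ') :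
    LEq w (fun φ y => Φ φ y + Φ' φ y) fun φ y => Ψ φ y + Ψ' φ y where
  left := h1.left.add h2.left
  right := h1.right.add h2.right
  low := .congr _ _ _ (fun Ω φ hφ y hy => by ring) (Low.add _ _ _ h1.low h2.low)

theorem LEq.const_mul (c : ℝ) (h1 : LEq w Φ Ψ) :
    LEq w (fun φ y => c * Φ φ y) fun φ y => c * Ψ φ y where
  left := h1.left.const_mul c
  right := h1.right.const_mul c
  low := .congr _ _ _ (fun Ω φ hφ y hy => by ring) (h1.low.const_mul c)

theorem LEq.sub (h1 : LEq w Φ Ψ) (h2 : LEq w Φ' Ψ') :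
    LEq w (fun φ y => Φ φ y - Φ' φ y) fun φ y => Ψ φ y - Ψ' φ y :=
  (h1.add (h2.const_mul (-1))).congr (fun _ _ _ _ _ => by ring) (fun _ _ _ _ _ => by ring)

theorem LEq.sum (hw : 1 ≤ w) {ι : Type*} (S : Finset ι) {Φ Ψ : ι → Fnl}
    (h : ∀ i ∈ S, LEq w (Φ i) (Ψ i)) :
    LEq w (fun φ y => ∑ i ∈ S, Φ i φ y) fun φ y => ∑ i ∈ S, Ψ i φ y where
  left := DP.sum S fun i hi => (h i hi).left
  right := DP.sum S fun i hi => (h i hi).right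
  low := .congr _ _ _ (fun _ _ _ _ _ => Finset.sum_sub_distrib ..|>.symm)
    (Low.sum hw S fun i hi => (h i hi).low)

/-- Freezing a coefficient at the standard form costs `(c - c₀) Φ`, and the new coefficient vanishes
there. -/
theorem LEq.coef_mul (hc : Coef Θ c₀) (h : LEq w Φ Ψ) :
    LEq w (fun φ y => Θ φ y * Φ φ y) fun φ y => c₀ * Ψ φ y where
  left := hc.dp.coef_mul h.left
  right := h.right.const_mul c₀
  low := by
    obtain ⟨c, h1, h2, h3⟩ := hc
    refine .congr _ _ _ (fun Ω φ hφ y hy => ?_) (Low.add _ _ _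
      (Low.coef w (fun v => c v - c₀) (h1.sub contDiffOn_const) (by rw [h2, sub_self]) h.one_le Φ
        h.left) (h.low.const_mul c₀))
    rw [h3 Ω φ hφ y hy]
    ring

theorem LEq.pderiv (h : LEq w Φ Ψ) (i : Fin 7) :
    LEq (w + 1) (fun φ y => G2.pderiv i (Φ φ) y) fun φ y => G2.pderiv i (Ψ φ) y where
  left := h.left.pderiv i
  right := h.right.pderiv i
  low := .congr _ _ _ (fun _ _ hφ _ hy => (pderiv_sub
      (differentiableAt_of_contDiffOn hφ.isOpen (h.left.contDiffOn hφ) hy)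
      (differentiableAt_of_contDiffOn hφ.isOpen (h.right.contDiffOn hφ) hy)).symm)
    (h.low.pderiv i)

/-- When both factors have positive weight, neither contains derivatives of order `a + b`. Quadratic
terms such as `Γ * Γ` and `Γ * T` are therefore negligible. -/
theorem LEq.mul_zero (ha : 1 ≤ a) (hb : 1 ≤ b) (h1 : DP a a Φ) (h2 : DP b b Ψ) :
    LEq (a + b) (fun φ y => Φ φ y * Ψ φ y) fun _ _ => 0 where
  left := (h1.mono (by omega)).mul (h2.mono (by omega))
  right := DP.zero
  low := .congr _ _ _ (fun _ _ _ _ _ => sub_zero _) (DP.mul_low ha hb h1 h2)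

theorem LEq.pderiv_coef {c : V3 → ℝ} (hc : ContDiffOn ℝ ∞ c coefSet) (i : Fin 7) :
    LEq 1 (fun φ y => G2.pderiv i (fun z => c (φ z)) y)
      fun φ y => ∑ J, coefD c J std * G2.pderiv i (fun z => φ z J) y := by
  have h : LEq 1 (fun φ y => ∑ J, coefD c J (φ y) * G2.pd [i] (fun z => φ z J) y)
      fun φ y => ∑ J, coefD c J std * G2.pd [i] (fun z => φ z J) y :=
    LEq.sum le_rfl _ fun J _ => LEq.coef_mul
      ⟨coefD c J, contDiffOn_coefD hc J, rfl, fun _ _ _ _ _ => rfl⟩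
      (LEq.refl le_rfl (DP.jet [i] J rfl le_rfl le_rfl))
  refine h.congr_left fun Ω φ hφ y hy => ?_
  dsimp only
  rw [G2.pderiv_coef hc hφ.toIsG2On hy, clm_apply_eq_sum]
  rfl

end LEqClosure

/-! ### The coefficients attached to a `G₂` structure -/

theorem coef_metric (i j : Fin 7) :
    Coef (fun φ y => metric φ y i j) ((1 : Matrix (Fin 7) (Fin 7) ℝ) i j) := by
  have := Coef.of_nondeg (contDiffOn_metric i j)
  rwa [metric_std rfl] at this

theorem coef_metricInv (i j : Fin 7) :
    Coef (fun φ y => metricInv φ y i j) ((1 : Matrix (Fin 7) (Fin 7) ℝ) i j) := by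
  have := Coef.of_nondeg (contDiffOn_metricInv i j)
  rwa [metricInv_std rfl] at this

theorem coef_volCoeff : Coef (fun φ y => volCoeff φ y) 1 := by
  have := Coef.of_nondeg contDiffOn_volCoeff
  rwa [volCoeff_std rfl] at this

theorem coef_psi (J : Fin 4 → Fin 7) : Coef (fun φ y => psi φ y J) (stdPsi J) := by
  have := Coef.of_nondeg (contDiffOn_hodgeStar_self rfl J)
  change Coef _ (psi (fun _ => std) 0 J) at this
  rwa [psi_std rfl] at this

theorem coef_self (J : Fin 3 → Fin 7) : Coef (fun φ y => φ y J) (std J) :=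
  Coef.of_nondeg (c := fun v => v J) (contDiff_apply ℝ ℝ J).contDiffOn

theorem dp_christoffel (m i j : Fin 7) : DP 1 1 fun φ y => christoffel φ m i j y := by
  unfold christoffel
  refine DP.const_mul _ (DP.sum _ fun l _ => (coef_metricInv m l).dp.coef_mul ?_)
  exact ((((coef_metric j l).dp (k := 0)).pderiv i).add
    (((coef_metric i l).dp (k := 0)).pderiv j)).sub (((coef_metric i j).dp (k := 0)).pderiv l)

theorem DP.covDeriv {k w : ℕ} {m : ℕ} {α : CoordTensor 3 → CoordTensor m}
    (h : ∀ J, DP k w fun φ y => α φ y J) (J : Fin (m + 1) → Fin 7) :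
    DP (k + 1) (w + 1) fun φ y => covDeriv φ (α φ) y J := by
  unfold G2.covDeriv
  refine DP.sub ((h _).pderiv _) (DP.sum _ fun s _ => DP.sum _ fun n _ => ?_)
  exact DP.mul' (by omega) ((dp_christoffel _ _ _).mono (by omega)) ((h _).mono (by omega))

theorem DP.contract {k a b w m : ℕ} (hw : a + b = w)
    {α β : CoordTensor 3 → CoordTensor m} (hα : ∀ J, DP k a fun φ y => α φ y J)
    (hβ : ∀ J, DP k b fun φ y => β φ y J) :
    DP k w fun φ y => contract φ y (α φ y) (β φ y) := by
  unfold G2.contract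
  refine DP.sum _ fun I _ => DP.sum _ fun J _ => DP.mul' (b := 0) (add_zero w)
    (DP.mul' hw (hα I) (hβ J)) (DP.prod _ fun s _ => (coef_metricInv _ _).dp)

theorem dp_torsion (J : Fin 2 → Fin 7) : DP 1 1 fun φ y => torsion φ y J := by
  unfold torsion
  refine DP.const_mul _ (DP.contract (a := 1) (b := 0) rfl
    (α := fun φ y L => G2.covDeriv φ φ y (Matrix.vecCons (J 0) L))
    (β := fun φ y L => psi φ y (Matrix.vecCons (J 1) L)) (fun L => ?_) fun L => (coef_psi _).dp)
  exact DP.covDeriv (k := 0) (w := 0) (α := fun φ => φ) (fun J => (coef_self J).dp) _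

theorem dp_covDeriv_torsion (J : Fin 3 → Fin 7) :
    DP 2 2 fun φ y => covDeriv φ (torsion φ) y J := DP.covDeriv dp_torsion J

theorem dp_riemann (J : Fin 4 → Fin 7) : DP 2 2 fun φ y => riemann φ y J := by
  unfold riemann
  refine DP.sum _ fun m _ => (coef_metric _ _).dp.coef_mul (DP.add (DP.sub
    ((dp_christoffel _ _ _).pderiv _) ((dp_christoffel _ _ _).pderiv _)) (DP.sum _ fun p _ =>
    DP.sub ?_ ?_)) <;>
  exact ((dp_christoffel _ _ _).mono (Nat.le_succ 1)).mul
    ((dp_christoffel _ _ _).mono (Nat.le_succ 1))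

theorem DP.extD {k w m : ℕ} {α : CoordTensor 3 → CoordTensor m}
    (h : ∀ J, DP k w fun φ y => α φ y J) (J : Fin (m + 1) → Fin 7) :
    DP (k + 1) (w + 1) fun φ y => extD (α φ) y J := by
  unfold G2.extD
  exact DP.sum _ fun s _ => DP.const_mul _ ((h _).pderiv _)

theorem DP.hodgeStar {k w m n : ℕ} (hmn : m + n = 7) {α : CoordTensor 3 → CoordTensor m}
    (h : ∀ J, DP k w fun φ y => α φ y J) (J : Fin n → Fin 7) :
    DP k w fun φ y => hodgeStar φ hmn (α φ) y J := by
  unfold G2.hodgeStar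
  exact DP.const_mul _ (DP.contract (add_zero w) h
    (β := fun φ y I => volCoeff φ y * leviCivita (Fin.append I J ∘ Fin.cast hmn.symm))
    fun I => (coef_volCoeff.mul (Coef.const _)).dp)

theorem dp_tau (J : Fin 2 → Fin 7) : DP 1 1 fun φ y => tau φ y J := by
  simp only [tau_eq]
  exact DP.const_mul _ (DP.hodgeStar _ (DP.extD (k := 0) (w := 0) fun K => (coef_psi K).dp) J)

theorem dp_extD_tau (J : Fin 3 → Fin 7) : DP 2 2 fun φ y => extD (tau φ) y J := DP.extD dp_tau J

/-! ### Time derivatives -/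

/-- `Ψ` is the time derivative of `Φ` along solutions of the flow. -/
def HasTD (Φ Ψ : Fnl) : Prop := ∀ (I : Set ℝ) (Ω : Set E7) (φ : ℝ → CoordTensor 3),
  IsG2Flow I Ω φ → ∀ t ∈ I, ∀ y ∈ Ω, HasDerivAt (fun s => Φ (φ s) y) (Ψ (φ t) y) t

section TimeDerivative

variable {k w : ℕ} {Φ Ψ Φ' Ψ' : Fnl}

theorem HasTD.congr (h : HasTD Φ Ψ) (he : FEq Φ' Φ) : HasTD Φ' Ψ := by
  intro I Ω φ hφ t ht y hy
  refine (h I Ω φ hφ t ht y hy).congr_of_eventuallyEq ?_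
  filter_upwards [hφ.isOpen_time.mem_nhds ht] with s hs
  exact he Ω (φ s) (hφ.structureAt s hs) y hy

theorem HasTD.add (h1 : HasTD Φ Ψ) (h2 : HasTD Φ' Ψ') :
    HasTD (fun φ y => Φ φ y + Φ' φ y) fun φ y => Ψ φ y + Ψ' φ y :=
  fun I Ω φ hφ t ht y hy => (h1 I Ω φ hφ t ht y hy).add (h2 I Ω φ hφ t ht y hy)

theorem HasTD.sub (h1 : HasTD Φ Ψ) (h2 : HasTD Φ' Ψ') :
    HasTD (fun φ y => Φ φ y - Φ' φ y) fun φ y => Ψ φ y - Ψ' φ y :=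
  fun I Ω φ hφ t ht y hy => (h1 I Ω φ hφ t ht y hy).sub (h2 I Ω φ hφ t ht y hy)

theorem HasTD.const_mul (c : ℝ) (h1 : HasTD Φ Ψ) :
    HasTD (fun φ y => c * Φ φ y) fun φ y => c * Ψ φ y :=
  fun I Ω φ hφ t ht y hy => (h1 I Ω φ hφ t ht y hy).const_mul c

theorem HasTD.mul (h1 : HasTD Φ Ψ) (h2 : HasTD Φ' Ψ') :
    HasTD (fun φ y => Φ φ y * Φ' φ y) fun φ y => Ψ φ y * Φ' φ y + Φ φ y * Ψ' φ y :=
  fun I Ω φ hφ t ht y hy => (h1 I Ω φ hφ t ht y hy).mul (h2 I Ω φ hφ t ht y hy)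

theorem HasTD.sum {ι : Type*} (S : Finset ι) {Φ Ψ : ι → Fnl} (h : ∀ i ∈ S, HasTD (Φ i) (Ψ i)) :
    HasTD (fun φ y => ∑ i ∈ S, Φ i φ y) fun φ y => ∑ i ∈ S, Ψ i φ y :=
  fun I Ω φ hφ t ht y hy => HasDerivAt.fun_sum fun i hi => h i hi I Ω φ hφ t ht y hy

theorem hasTD_coef {c : V3 → ℝ} (hc : ContDiffOn ℝ ∞ c coefSet) :
    HasTD (fun φ y => c (φ y)) fun φ y => ∑ J, coefD c J (φ y) * extD (tau φ) y J := by
  intro I Ω φ hφ t ht y hy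
  have h1 : HasFDerivAt c (fderiv ℝ c (φ t y)) (φ t y) :=
    ((hc.contDiffAt (isOpen_coefSet.mem_nhds
      ((hφ.structureAt t ht).mem_coefSet hy))).differentiableAt (by simp)).hasFDerivAt
  have h2 : HasDerivAt (fun s => φ s y) (extD (tau (φ t)) y) t :=
    hasDerivAt_pi.2 fun J => hφ.evolution t ht y hy J
  have h3 := h1.comp_hasDerivAt t h2
  rw [clm_apply_eq_sum] at h3
  exact h3

theorem hasTD_jet (L : List (Fin 7)) (J : Fin 3 → Fin 7) :
    HasTD (fun φ y => pd L (fun z => φ z J) y) fun φ y => pd L (fun z => extD (tau φ) z J) y := by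
  intro I Ω φ hφ t ht y hy
  have hΩ : IsOpen Ω := (hφ.structureAt t ht).isOpen
  induction L generalizing t y with
  | nil => exact hφ.evolution t ht y hy J
  | cons i L ih =>
    exact hasDerivAt_pderiv hφ.isOpen_time hΩ (f := fun s => pd L (fun z => φ s z J))
      (f' := fun s => pd L (fun z => extD (tau (φ s)) z J))
      (contDiffOn_pd_time (f := fun s z => φ s z J) hφ.isOpen_time.uniqueDiffOn hΩ
        (hφ.smooth J) L) ih i t ht y hy

/-- The velocity `d d* φ` has order and weight `2`: the parabolic scaling of the flow. -/
theorem DPoly.exists_hasTD (h : DPoly k w Φ) : ∃ Ψ, DP (k + 2) (w + 2) Ψ ∧ HasTD Φ Ψ := by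
  induction h with
  | coef c hc =>
    exact ⟨_, DP.sum _ fun J _ => (DP.coef (contDiffOn_coefD hc J)).coef_mul
      ((dp_extD_tau J).mono (by omega)), hasTD_coef hc⟩
  | jet w L J hL hk1 h1 =>
    refine ⟨_, ?_, hasTD_jet L J⟩
    have := (dp_extD_tau J).pd L
    rw [hL, add_comm 2 w] at this
    exact this.mono (by omega)
  | zero w => exact ⟨_, DP.zero, fun I Ω φ hφ t ht y hy => hasDerivAt_const t 0⟩
  | add w Φ Ψ _ _ ih1 ih2 =>
    obtain ⟨Φ', h1, t1⟩ := ih1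
    obtain ⟨Ψ', h2, t2⟩ := ih2
    exact ⟨_, h1.add h2, t1.add t2⟩
  | mul a b w Φ Ψ hw d1 d2 ih1 ih2 =>
    obtain ⟨Φ', h1, t1⟩ := ih1
    obtain ⟨Ψ', h2, t2⟩ := ih2
    exact ⟨_, (DP.mul' (by omega) h1 (d2.dp.mono (by omega))).add
      (DP.mul' (by omega) (d1.dp.mono (by omega)) h2), t1.mul t2⟩

theorem DP.exists_hasTD (h : DP k w Φ) : ∃ Ψ, DP (k + 2) (w + 2) Ψ ∧ HasTD Φ Ψ := by
  obtain ⟨Φ', h1, h2⟩ := h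
  obtain ⟨Ψ, h3, h4⟩ := h1.exists_hasTD
  exact ⟨Ψ, h3, h4.congr h2⟩

/-- The delicate case is the time derivative of a coefficient vanishing at the standard form. It has
order `2`, and since `w ≥ 1` its product with the other factor has order at most `w + 1`, below the
weight `w + 2`. -/
theorem Low.exists_hasTD (h : Low w Φ) : ∃ Ψ, Low (w + 2) Ψ ∧ HasTD Φ Ψ := by
  induction h with
  | dp w Φ h =>
    obtain ⟨Ψ, h1, h2⟩ := h.exists_hasTD
    exact ⟨Ψ, .dp _ _ h1, h2⟩
  | coef w c hc h0 hw Φ h =>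
    obtain ⟨Ψ, h1, h2⟩ := h.exists_hasTD
    obtain ⟨d, h3, h4⟩ := (DP.coef (k := 0) hc).exists_hasTD
    exact ⟨_, Low.add _ _ _ (DP.low (k := w + 1) (DP.mul' (w := w + 2) (by omega)
      (h3.mono (by omega)) (h.mono (by omega))) le_rfl) (Low.coef _ c hc h0 (by omega) _ h1),
      h4.mul h2⟩
  | add w Φ Ψ _ _ ih1 ih2 =>
    obtain ⟨Φ', h1, t1⟩ := ih1
    obtain ⟨Ψ', h2, t2⟩ := ih2
    exact ⟨_, Low.add _ _ _ h1 h2, t1.add t2⟩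
  | congr w Φ Ψ he _ ih =>
    obtain ⟨Ψ', h1, h2⟩ := ih
    exact ⟨Ψ', h1, h2.congr he⟩

end TimeDerivative

end

section

/-! ### Linear algebra of the standard form -/

/-- The components of the standard `3`-form, as real numbers. -/
def ph (i j k : Fin 7) : ℝ := phiZ i j k

/-- The components of the dual `4`-form, as real numbers. -/
def ps (i j k l : Fin 7) : ℝ := psiZ i j k l

/-- The Kronecker symbol. -/
def dl (i j : Fin 7) : ℝ := if i = j then 1 else 0

theorem cast_deltaZ (i j : Fin 7) : (deltaZ i j : ℝ) = dl i j := by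
  simp only [deltaZ, dl]; split_ifs <;> simp

theorem dl_comm (i j : Fin 7) : dl i j = dl j i := by simp only [dl, eq_comm]

theorem sum_dl_mul (i : Fin 7) (f : Fin 7 → ℝ) : ∑ j, dl i j * f j = f i := by simp [dl]

theorem sum_dl_mul' (i : Fin 7) (f : Fin 7 → ℝ) : ∑ j, dl j i * f j = f i := by simp [dl]

theorem ph_swap12 (i j k : Fin 7) : ph j i k = -ph i j k := by
  simp only [ph, phiZ_swap12 i j k]; push_cast; rfl

theorem ph_swap23 (i j k : Fin 7) : ph i k j = -ph i j k := by
  simp only [ph, phiZ_swap23 i j k]; push_cast; rfl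

theorem ph_rot (i j k : Fin 7) : ph j k i = ph i j k := by
  rw [ph_swap23 j i k, ph_swap12 i j k, neg_neg]

theorem ps_swap12 (i j k l : Fin 7) : ps j i k l = -ps i j k l := by
  simp only [ps, psiZ_swap12 i j k l]; push_cast; rfl

theorem ps_swap23 (i j k l : Fin 7) : ps i k j l = -ps i j k l := by
  simp only [ps, psiZ_swap23 i j k l]; push_cast; rfl

theorem ps_swap34 (i j k l : Fin 7) : ps i j l k = -ps i j k l := by
  simp only [ps, psiZ_swap34 i j k l]; push_cast; rfl

theorem ps_pair (i j k l : Fin 7) : ps k l i j = ps i j k l := by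
  rw [ps_swap23 k i l j, ps_swap12 i k l j, ps_swap34 i k j l, ps_swap23 i j k l]; ring

theorem ph_ph (i j a b : Fin 7) : ∑ k, ph i j k * ph a b k =
    dl i a * dl j b - dl i b * dl j a + ps i j a b := by
  have := phiZ_phiZ i j a b
  rw [sumZ_eq] at this
  simp only [ph, ps, ← cast_deltaZ]
  exact_mod_cast this

theorem ph_ps (i j a b c : Fin 7) : ∑ k, ph i j k * ps a b c k =
    -(dl i a * ph j b c + dl i b * ph a j c + dl i c * ph a b j
      - dl j a * ph i b c - dl j b * ph a i c - dl j c * ph a b i) := by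
  have := phiZ_psiZ i j a b c
  rw [sumZ_eq] at this
  simp only [ph, ps, ← cast_deltaZ]
  exact_mod_cast this

theorem ph_ps_two (i a b : Fin 7) : ∑ c, ∑ d, ph i c d * ps a b c d = 4 * ph i a b := by
  simp only [ph, ps]
  exact_mod_cast phiZ_psiZ_two i a b

/-- One factor `ψ` is rewritten by `ph_ph` as a contraction of two `φ` minus Kronecker symbols. The
product then reduces to `ph_ps_two` and `ph_ph`. -/
theorem ps_ps_two (m i n j : Fin 7) : ∑ k, ∑ l, ps m i k l * ps n j k l =
    4 * (dl m n * dl i j) - 4 * (dl m j * dl i n) + 2 * ps m i n j := by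
  have h1 : ∀ k l, ps m i k l * ps n j k l = (∑ p, ph n j p * (ph p k l * ps m i k l))
      - dl n k * (dl j l * ps m i k l) + dl n l * (dl j k * ps m i k l) := by
    intro k l
    have := ph_ph n j k l
    have e : ∑ p, ph n j p * (ph p k l * ps m i k l) = (∑ p, ph n j p * ph k l p) * ps m i k l := by
      rw [Finset.sum_mul]
      exact Finset.sum_congr rfl fun p _ => by rw [ph_rot p k l]; ring
    rw [e, this]; ring
  simp only [h1, Finset.sum_add_distrib, Finset.sum_sub_distrib]
  have h2 : ∑ k, ∑ l, ∑ p, ph n j p * (ph p k l * ps m i k l) = ∑ p, ph n j p * (4 * ph m i p) := by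
    calc _ = ∑ k, ∑ p, ∑ l, ph n j p * (ph p k l * ps m i k l) :=
          Finset.sum_congr rfl fun k _ => Finset.sum_comm
      _ = ∑ p, ∑ k, ∑ l, ph n j p * (ph p k l * ps m i k l) := Finset.sum_comm
      _ = _ := by
        refine Finset.sum_congr rfl fun p _ => ?_
        simp only [← Finset.mul_sum]
        rw [ph_ps_two, ← ph_rot p m i]
  have h3 : ∑ k, ∑ l, dl n k * (dl j l * ps m i k l) = ps m i n j := by
    simp only [← Finset.mul_sum, sum_dl_mul]
  have h4 : ∑ k, ∑ l, dl n l * (dl j k * ps m i k l) = ps m i j n := by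
    simp only [sum_dl_mul]
  have h5 : ∑ p, ph n j p * (4 * ph m i p) = 4 * ∑ p, ph n j p * ph m i p := by
    rw [Finset.mul_sum]; exact Finset.sum_congr rfl fun p _ => by ring
  rw [h2, h3, h4, h5, ph_ph, ps_pair m i n j, ps_swap34 m i n j, dl_comm n m, dl_comm j i,
    dl_comm n i, dl_comm j m]
  ring

theorem wedge_sorted : ∀ p l : Fin 7, p < l → ∀ x y : Fin 7, x < y → ∀ z, y < z → ∀ w, z < w →
    (phiZ x p l * phiZ y z w - phiZ y p l * phiZ x z w + phiZ z p l * phiZ x y w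
      - phiZ w p l * phiZ x y z) -
    (deltaZ l x * psiZ p y z w + deltaZ l y * psiZ x p z w + deltaZ l z * psiZ x y p w
      + deltaZ l w * psiZ x y z p - deltaZ p x * psiZ l y z w - deltaZ p y * psiZ x l z w
      - deltaZ p z * psiZ x y l w - deltaZ p w * psiZ x y z l) = 0 := by decide +kernel

/-- An elementary skew matrix in the plane of `p` and `l` acts on `ψ`, up to sign, as the wedge of
the covector of `e_p × e_l` with `φ`. Summed against a general skew matrix it gives
`act_stdPsi_of_skew`. -/
theorem phiZ_wedge_phiZ (p l x y z w : Fin 7) :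
    (phiZ x p l * phiZ y z w - phiZ y p l * phiZ x z w + phiZ z p l * phiZ x y w
      - phiZ w p l * phiZ x y z) -
    (deltaZ l x * psiZ p y z w + deltaZ l y * psiZ x p z w + deltaZ l z * psiZ x y p w
      + deltaZ l w * psiZ x y z p - deltaZ p x * psiZ l y z w - deltaZ p y * psiZ x l z w
      - deltaZ p z * psiZ x y l w - deltaZ p w * psiZ x y z l) = 0 := by
  have key : ∀ p l, p < l → ∀ x y z w,
      (phiZ x p l * phiZ y z w - phiZ y p l * phiZ x z w + phiZ z p l * phiZ x y w
      - phiZ w p l * phiZ x y z) -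
    (deltaZ l x * psiZ p y z w + deltaZ l y * psiZ x p z w + deltaZ l z * psiZ x y p w
      + deltaZ l w * psiZ x y z p - deltaZ p x * psiZ l y z w - deltaZ p y * psiZ x l z w
      - deltaZ p z * psiZ x y l w - deltaZ p w * psiZ x y z l) = 0 := by
    intro p l hpl
    refine eq_zero_of_skew4 (fun x y z w => ?_) (fun x y z w => ?_) (fun x y z w => ?_)
      (fun x y hx z hy w hz => wedge_sorted p l hpl x y hx z hy w hz)
    · rw [phiZ_swap12 x y w, phiZ_swap12 x y z, psiZ_swap12 x p z w, psiZ_swap12 y p z w,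
        psiZ_swap12 x y p w, psiZ_swap12 x y z p, psiZ_swap12 x l z w, psiZ_swap12 y l z w,
        psiZ_swap12 x y l w, psiZ_swap12 x y z l]
      ring
    · rw [phiZ_swap12 y z w, phiZ_swap23 x y z, psiZ_swap23 p y z w, psiZ_swap23 l y z w,
        psiZ_swap23 x z p w, psiZ_swap23 x p y w, psiZ_swap23 x y z p, psiZ_swap23 x z l w,
        psiZ_swap23 x l y w, psiZ_swap23 x y z l]
      ring
    · rw [phiZ_swap23 y z w, phiZ_swap23 x z w, psiZ_swap34 p y z w, psiZ_swap34 l y z w,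
        psiZ_swap34 x p z w, psiZ_swap34 x l z w, psiZ_swap34 x y w p, psiZ_swap34 x y p z,
        psiZ_swap34 x y w l, psiZ_swap34 x y l z]
      ring
  rcases lt_trichotomy p l with h | rfl | h
  · exact key p l h x y z w
  · have e : ∀ a, phiZ a p p = 0 := fun a => by have := phiZ_swap23 a p p; omega
    simp only [e]; ring
  · have := key l p h x y z w
    rw [phiZ_swap23 x p l, phiZ_swap23 y p l, phiZ_swap23 z p l, phiZ_swap23 w p l] at this
    linarith

/-! ### The action of `𝔤𝔩₇` on tensors -/

/-- The infinitesimal pullback of a covariant tensor along a matrix. -/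
def act (A : Matrix (Fin 7) (Fin 7) ℝ) {k : ℕ} (a : (Fin k → Fin 7) → ℝ) (J : Fin k → Fin 7) : ℝ :=
  ∑ r, ∑ m, A m (J r) * a (Function.update J r m)

theorem sum_update {k : ℕ} (J : Fin k → Fin 7) (r : Fin k) (A : Matrix (Fin 7) (Fin 7) ℝ)
    (a : (Fin k → Fin 7) → ℝ) :
    ∑ K, a K * (A (K r) (J r) * ∏ s ∈ Finset.univ.erase r, (1 : Matrix (Fin 7) (Fin 7) ℝ) (K s) (J s))
      = ∑ m, A m (J r) * a (Function.update J r m) := by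
  symm
  refine Fintype.sum_of_injective (fun m => Function.update J r m)
    (Function.update_injective J r) _ _ (fun K hK => ?_) fun m => ?_
  · have : ∃ s, s ≠ r ∧ K s ≠ J s := by
      by_contra! hc
      refine hK ⟨K r, ?_⟩
      ext s
      by_cases hs : s = r
      · subst hs; simp
      · simp [Function.update_of_ne hs, hc s hs]
    obtain ⟨s, hs, hne⟩ := this
    have : ∏ s ∈ Finset.univ.erase r, (1 : Matrix (Fin 7) (Fin 7) ℝ) (K s) (J s) = 0 :=
      Finset.prod_eq_zero (i := s) (by simp [hs]) (Matrix.one_apply_ne hne)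
    rw [this]
    simp
  · have : ∏ s ∈ Finset.univ.erase r, (1 : Matrix (Fin 7) (Fin 7) ℝ)
        (Function.update J r m s) (J s) = 1 := by
      refine Finset.prod_eq_one fun s hs => ?_
      rw [Function.update_of_ne (Finset.ne_of_mem_erase hs), Matrix.one_apply_eq]
    rw [this]
    simp
    ring

/-- It allows an equivariant function to be differentiated along the curves `(1 + s A)^* φ₀`. -/
theorem hasDerivAt_pullT (A : Matrix (Fin 7) (Fin 7) ℝ) {k : ℕ} (a : (Fin k → Fin 7) → ℝ)
    (J : Fin k → Fin 7) :
    HasDerivAt (fun s : ℝ => pullT (1 + s • A) a J) (act A a J) 0 := by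
  have h1 : ∀ K : Fin k → Fin 7, HasDerivAt (fun s : ℝ => ∏ r, (1 + s • A) (K r) (J r))
      (∑ r, (∏ q ∈ Finset.univ.erase r, (1 : Matrix (Fin 7) (Fin 7) ℝ) (K q) (J q)) *
        A (K r) (J r)) 0 := by
    intro K
    have := HasDerivAt.fun_finsetProd (u := Finset.univ) (x := (0 : ℝ))
      (f := fun r (s : ℝ) => (1 + s • A) (K r) (J r)) (f' := fun r => A (K r) (J r)) fun r _ => by
        simp only [Matrix.add_apply, Matrix.smul_apply, smul_eq_mul]
        simpa using ((hasDerivAt_id (0 : ℝ)).mul_const (A (K r) (J r))).const_add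
          ((1 : Matrix (Fin 7) (Fin 7) ℝ) (K r) (J r))
    simpa using this
  have h2 : HasDerivAt (fun s : ℝ => pullT (1 + s • A) a J) _ 0 :=
    HasDerivAt.fun_sum fun K _ => (h1 K).const_mul (a K)
  refine h2.congr_deriv ?_
  simp only [act, Finset.mul_sum]
  rw [Finset.sum_comm]
  refine Finset.sum_congr rfl fun r _ => ?_
  rw [← sum_update]
  exact Finset.sum_congr rfl fun K _ => by ring

theorem act_three (A : Matrix (Fin 7) (Fin 7) ℝ) (a : V3) (i j k : Fin 7) : act A a ![i, j, k] =
    ∑ p, (A p i * a ![p, j, k] + A p j * a ![i, p, k] + A p k * a ![i, j, p]) := by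
  have e0 : ∀ m, Function.update ![i, j, k] 0 m = ![m, j, k] := fun m => by
    ext s; fin_cases s <;> rfl
  have e1 : ∀ m, Function.update ![i, j, k] 1 m = ![i, m, k] := fun m => by
    ext s; fin_cases s <;> rfl
  have e2 : ∀ m, Function.update ![i, j, k] 2 m = ![i, j, m] := fun m => by
    ext s; fin_cases s <;> rfl
  simp only [act, Fin.sum_univ_three, e0, e1, e2, Finset.sum_add_distrib]
  rfl

theorem act_four (A : Matrix (Fin 7) (Fin 7) ℝ) (a : (Fin 4 → Fin 7) → ℝ) (i j k l : Fin 7) :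
    act A a ![i, j, k, l] = ∑ p, (A p i * a ![p, j, k, l] + A p j * a ![i, p, k, l]
      + A p k * a ![i, j, p, l] + A p l * a ![i, j, k, p]) := by
  have e0 : ∀ m, Function.update ![i, j, k, l] 0 m = ![m, j, k, l] := fun m => by
    ext s; fin_cases s <;> rfl
  have e1 : ∀ m, Function.update ![i, j, k, l] 1 m = ![i, m, k, l] := fun m => by
    ext s; fin_cases s <;> rfl
  have e2 : ∀ m, Function.update ![i, j, k, l] 2 m = ![i, j, m, l] := fun m => by
    ext s; fin_cases s <;> rfl
  have e3 : ∀ m, Function.update ![i, j, k, l] 3 m = ![i, j, k, m] := fun m => by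
    ext s; fin_cases s <;> rfl
  simp only [act, Fin.sum_univ_four, e0, e1, e2, e3, Finset.sum_add_distrib]
  rfl

/-- The contraction `χ_{imn} φ_{jmn}` with the standard form. -/
def contrPhi (χ : V3) (i j : Fin 7) : ℝ := ∑ m, ∑ n, χ ![i, m, n] * ph j m n

/-- A section of the infinitesimal action of `𝔤𝔩₇` on the standard form. -/
def sec (χ : V3) : Matrix (Fin 7) (Fin 7) ℝ := Matrix.of fun p l =>
  -- Multiplied by `36` the weights are `3`, `6` and `1`. In `sectionKer` the last one becomes `3`,
  -- since each of the three slots of the standard form contributes the same trace term.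
  (1 / 12) * contrPhi χ p l + (1 / 6) * contrPhi χ l p - (1 / 36) * (∑ q, contrPhi χ q q) * dl p l

theorem contrPhi_mul_left (χ : V3) (l m n : Fin 7) : ∑ p, contrPhi χ p l * ph p m n =
    ∑ a, ∑ b, ∑ c, χ ![a, b, c] * (ph l b c * ph a m n) := by
  simp only [contrPhi, Finset.sum_mul, mul_assoc]

theorem contrPhi_mul_right (χ : V3) (l m n : Fin 7) : ∑ p, contrPhi χ l p * ph p m n =
    ∑ a, ∑ b, ∑ c, χ ![a, b, c] * (dl l a * (dl b m * dl c n - dl b n * dl c m + ps b c m n)) := by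
  have h1 : ∀ a, ∑ b, ∑ c, χ ![a, b, c] *
      (dl l a * (dl b m * dl c n - dl b n * dl c m + ps b c m n)) = dl l a *
      ∑ b, ∑ c, χ ![a, b, c] * (dl b m * dl c n - dl b n * dl c m + ps b c m n) := by
    intro a
    simp only [Finset.mul_sum]
    exact Finset.sum_congr rfl fun b _ => Finset.sum_congr rfl fun c _ => by ring
  simp only [h1, sum_dl_mul]
  simp only [contrPhi, Finset.sum_mul, mul_assoc]
  rw [Finset.sum_comm]
  refine Finset.sum_congr rfl fun b _ => ?_
  rw [Finset.sum_comm]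
  refine Finset.sum_congr rfl fun c _ => ?_
  rw [← ph_ph, Finset.mul_sum]
  exact Finset.sum_congr rfl fun p _ => by rw [ph_rot p b c, ph_rot p m n]

/-- Infinitesimally, the `GL₇`-orbit of the standard form is all of `Λ³`. Hence the first-order
behaviour of metric and dual form in any direction can be read off from their equivariance. -/
theorem act_sec {χ : V3} (hχ : IsAlt χ) : act (sec χ) std = χ := by
  have s1 : ∀ i j k, χ ![j, i, k] = -χ ![i, j, k] := fun i j k => by
    have := hχ ![i, j, k] 0 1 (by decide)
    rw [← this]; congr 1; ext s; fin_cases s <;> rfl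
  have s2 : ∀ i j k, χ ![i, k, j] = -χ ![i, j, k] := fun i j k => by
    have := hχ ![i, j, k] 1 2 (by decide)
    rw [← this]; congr 1; ext s; fin_cases s <;> rfl
  have rot : ∀ i j k, χ ![j, k, i] = χ ![i, j, k] := fun i j k => by rw [s2 j i k, s1 i j k, neg_neg]
  ext J
  rw [vec3_eta J]
  generalize J 0 = l, J 1 = m, J 2 = n
  rw [act_three]
  have hstd : ∀ a b c : Fin 7, std ![a, b, c] = ph a b c := fun a b c => rfl
  have hr1 : ∀ p, ph l p n = ph p n l := fun p => by rw [← ph_rot l p n]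
  have hr2 : ∀ p, ph l m p = ph p l m := fun p => by rw [ph_rot p l m]
  have key : ∀ i j k : Fin 7, ∑ p, sec χ p i * ph p j k =
      (1 / 12) * (∑ a, ∑ b, ∑ c, χ ![a, b, c] * (ph i b c * ph a j k)) +
      (1 / 6) * (∑ a, ∑ b, ∑ c, χ ![a, b, c] *
        (dl i a * (dl b j * dl c k - dl b k * dl c j + ps b c j k))) -
      (1 / 36) * (∑ a, ∑ b, ∑ c, χ ![a, b, c] * ph a b c) * ph i j k := by
    intro i j k
    rw [← contrPhi_mul_left, ← contrPhi_mul_right]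
    have : ∀ p, sec χ p i * ph p j k = (1 / 12) * (contrPhi χ p i * ph p j k) +
      (1 / 6) * (contrPhi χ i p * ph p j k)
      - dl p i * ((1 / 36) * (∑ q, contrPhi χ q q) * ph p j k) := fun p => by
        simp only [sec, Matrix.of_apply]; ring
    simp only [this, Finset.sum_add_distrib, Finset.sum_sub_distrib, ← Finset.mul_sum, sum_dl_mul']
    rfl
  simp only [hstd, Finset.sum_add_distrib, hr1, hr2, key]
  set K : Fin 7 → Fin 7 → Fin 7 → ℝ := fun a b c => (sectionKer l m n a b c : ℝ) with hK
  -- Since `χ` is invariant under cyclic rotation of its indices, the kernel may be replaced by the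
  -- average of its rotations; `sectionKer_cyclic` gives `3 · (sum) = 18 · 6 χ`.
  have hsum : ∑ a, ∑ b, ∑ c, χ ![a, b, c] * K a b c = 36 * χ ![l, m, n] := by
    have r1 : ∑ a, ∑ b, ∑ c, χ ![a, b, c] * K a b c = ∑ a, ∑ b, ∑ c, χ ![a, b, c] * K b c a := by
      calc _ = ∑ b, ∑ c, ∑ a, χ ![b, c, a] * K b c a := rfl
        _ = ∑ b, ∑ a, ∑ c, χ ![b, c, a] * K b c a :=
          Finset.sum_congr rfl fun b _ => Finset.sum_comm
        _ = ∑ a, ∑ b, ∑ c, χ ![b, c, a] * K b c a := Finset.sum_comm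
        _ = _ := by simp only [rot]
    have r2 : ∑ a, ∑ b, ∑ c, χ ![a, b, c] * K a b c = ∑ a, ∑ b, ∑ c, χ ![a, b, c] * K c a b := by
      calc _ = ∑ c, ∑ a, ∑ b, χ ![c, a, b] * K c a b := rfl
        _ = ∑ a, ∑ c, ∑ b, χ ![c, a, b] * K c a b := Finset.sum_comm
        _ = ∑ a, ∑ b, ∑ c, χ ![c, a, b] * K c a b :=
          Finset.sum_congr rfl fun b _ => Finset.sum_comm
        _ = _ := by
          refine Finset.sum_congr rfl fun a _ => Finset.sum_congr rfl fun b _ =>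
            Finset.sum_congr rfl fun c _ => ?_
          rw [rot c a b]
    have r3 : ∑ a, ∑ b, ∑ c, χ ![a, b, c] * K a b c + ∑ a, ∑ b, ∑ c, χ ![a, b, c] * K b c a +
        ∑ a, ∑ b, ∑ c, χ ![a, b, c] * K c a b = 18 * ∑ a, ∑ b, ∑ c, χ ![a, b, c] *
          (dl l a * (dl m b * dl n c - dl m c * dl n b)
            - dl l b * (dl m a * dl n c - dl m c * dl n a)
            + dl l c * (dl m a * dl n b - dl m b * dl n a)) := by
      simp only [← Finset.sum_add_distrib, Finset.mul_sum]
      refine Finset.sum_congr rfl fun a _ => Finset.sum_congr rfl fun b _ =>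
        Finset.sum_congr rfl fun c _ => ?_
      have : K a b c + K b c a + K c a b = 18 * (dl l a * (dl m b * dl n c - dl m c * dl n b)
            - dl l b * (dl m a * dl n c - dl m c * dl n a)
            + dl l c * (dl m a * dl n b - dl m b * dl n a)) := by
        have h := sectionKer_cyclic l m n a b c
        simp only [det3Z] at h
        simp only [hK, ← cast_deltaZ]
        exact_mod_cast h
      linear_combination χ ![a, b, c] * this
    have r4 : ∑ a, ∑ b, ∑ c, χ ![a, b, c] *
          (dl l a * (dl m b * dl n c - dl m c * dl n b)
            - dl l b * (dl m a * dl n c - dl m c * dl n a)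
            + dl l c * (dl m a * dl n b - dl m b * dl n a)) = 6 * χ ![l, m, n] := by
      have e : ∀ a b c, χ ![a, b, c] * (dl l a * (dl m b * dl n c - dl m c * dl n b)
            - dl l b * (dl m a * dl n c - dl m c * dl n a)
            + dl l c * (dl m a * dl n b - dl m b * dl n a)) =
          dl l a * (dl m b * (dl n c * χ ![a, b, c])) - dl l a * (dl n b * (dl m c * χ ![a, b, c]))
          - dl m a * (dl l b * (dl n c * χ ![a, b, c])) + dl n a * (dl l b * (dl m c * χ ![a, b, c]))
          + dl m a * (dl n b * (dl l c * χ ![a, b, c]))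
          - dl n a * (dl m b * (dl l c * χ ![a, b, c])) := fun a b c => by ring
      simp only [e, Finset.sum_add_distrib, Finset.sum_sub_distrib, ← Finset.mul_sum, sum_dl_mul]
      rw [s2 l m n, s1 l m n, rot l m n, s2 n l m, ← rot n l m]
      ring
    linarith
  have hexp : ∑ a, ∑ b, ∑ c, χ ![a, b, c] * K a b c =
      3 * (∑ a, ∑ b, ∑ c, χ ![a, b, c] * (ph l b c * ph a m n)) +
      3 * (∑ a, ∑ b, ∑ c, χ ![a, b, c] * (ph m b c * ph a n l)) +
      3 * (∑ a, ∑ b, ∑ c, χ ![a, b, c] * (ph n b c * ph a l m)) +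
      6 * (∑ a, ∑ b, ∑ c, χ ![a, b, c] *
        (dl l a * (dl b m * dl c n - dl b n * dl c m + ps b c m n))) +
      6 * (∑ a, ∑ b, ∑ c, χ ![a, b, c] *
        (dl m a * (dl b n * dl c l - dl b l * dl c n + ps b c n l))) +
      6 * (∑ a, ∑ b, ∑ c, χ ![a, b, c] *
        (dl n a * (dl b l * dl c m - dl b m * dl c l + ps b c l m))) -
      3 * (∑ a, ∑ b, ∑ c, χ ![a, b, c] * ph a b c) * ph l m n := by
    simp only [Finset.mul_sum, Finset.sum_mul, ← Finset.sum_add_distrib, ← Finset.sum_sub_distrib]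
    refine Finset.sum_congr rfl fun a _ => Finset.sum_congr rfl fun b _ =>
        Finset.sum_congr rfl fun c _ => ?_
    simp only [hK, sectionKer, gZ]
    push_cast
    simp only [cast_deltaZ]
    have e1 : (phiZ l a n : ℝ) = ph a n l := (hr1 a)
    have e2 : (phiZ l m a : ℝ) = ph a l m := (hr2 a)
    rw [e1, e2]
    simp only [ph, ps]
    ring
  have f1 : ph m n l = ph l m n := ph_rot l m n
  have f2 : ph n l m = ph l m n := (ph_rot n l m).symm
  rw [f1, f2]
  linear_combination (1 / 36) * hsum - (1 / 36) * hexp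


/-- The vector attached to a skew matrix by the standard form. -/
def skewVec (B : Matrix (Fin 7) (Fin 7) ℝ) (m : Fin 7) : ℝ := -(1 / 2) * ∑ p, ∑ q, ph m p q * B p q

theorem ph_ps_first (p q j k l : Fin 7) : ∑ m, ph m p q * ps m j k l =
    dl p j * ph q k l + dl p k * ph j q l + dl p l * ph j k q
      - dl q j * ph p k l - dl q k * ph j p l - dl q l * ph j k p := by
  have : ∀ m, ph m p q * ps m j k l = -(ph p q m * ps j k l m) := fun m => by
    rw [ph_rot m p q, ps_swap12 j m k l, ps_swap23 j k m l, ps_swap34 j k l m]; ring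
  simp only [this, Finset.sum_neg_distrib, ph_ps]
  ring

/-- Only the `7`-dimensional part of a skew matrix moves the standard form; the stabilizer `𝔤₂` acts
trivially. What remains is a vector contracted with `ψ`. -/
theorem act_std_of_skew {B : Matrix (Fin 7) (Fin 7) ℝ} (hB : ∀ p q, B q p = -B p q)
    (j k l : Fin 7) : act B std ![j, k, l] = ∑ m, skewVec B m * ps m j k l := by
  have h1 : ∑ m, skewVec B m * ps m j k l =
      -(1 / 2) * ∑ p, ∑ q, B p q * ∑ m, ph m p q * ps m j k l := by
    simp only [skewVec, Finset.mul_sum, Finset.sum_mul]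
    rw [Finset.sum_comm]
    refine Finset.sum_congr rfl fun p _ => ?_
    rw [Finset.sum_comm]
    exact Finset.sum_congr rfl fun q _ => Finset.sum_congr rfl fun m _ => by ring
  have h2 : ∀ p q, B p q * ∑ m, ph m p q * ps m j k l =
      dl p j * (B p q * ph q k l) + dl p k * (B p q * ph j q l) + dl p l * (B p q * ph j k q)
      - dl q j * (B p q * ph p k l) - dl q k * (B p q * ph j p l) - dl q l * (B p q * ph j k p) := by
    intro p q; rw [ph_ps_first]; ring
  rw [h1, act_three]
  simp only [h2, Finset.sum_add_distrib, Finset.sum_sub_distrib, ← Finset.mul_sum, sum_dl_mul']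
  have h3 : ∀ (a : Fin 7) (f : Fin 7 → ℝ), ∑ q, B a q * f q = -∑ p, B p a * f p := by
    intro a f
    rw [← Finset.sum_neg_distrib]
    exact Finset.sum_congr rfl fun q _ => by rw [hB q a]; ring
  rw [h3 j (fun q => ph q k l), h3 k (fun q => ph j q l), h3 l (fun q => ph j k q)]
  have hs : ∀ a b c : Fin 7, std ![a, b, c] = ph a b c := fun _ _ _ => rfl
  simp only [hs]
  ring

/-- The counterpart for the dual form: only the vector of the skew matrix survives, and its action
on `ψ` is minus its wedge with `φ`. -/
theorem act_stdPsi_of_skew {B : Matrix (Fin 7) (Fin 7) ℝ} (hB : ∀ p q, B q p = -B p q)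
    (x y z w : Fin 7) : act B stdPsi ![x, y, z, w] = -(skewVec B x * ph y z w -
      skewVec B y * ph x z w + skewVec B z * ph x y w - skewVec B w * ph x y z) := by
  have h1 : skewVec B x * ph y z w - skewVec B y * ph x z w + skewVec B z * ph x y w
      - skewVec B w * ph x y z = -(1 / 2) * ∑ p, ∑ q, B p q * (ph x p q * ph y z w
        - ph y p q * ph x z w + ph z p q * ph x y w - ph w p q * ph x y z) := by
    simp only [skewVec, mul_assoc, Finset.sum_mul, ← mul_sub, ← mul_add, ← Finset.sum_sub_distrib,
      ← Finset.sum_add_distrib]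
    congr 1
    exact Finset.sum_congr rfl fun p _ => Finset.sum_congr rfl fun q _ => by ring
  have h2 : ∀ p q, B p q * (ph x p q * ph y z w
        - ph y p q * ph x z w + ph z p q * ph x y w - ph w p q * ph x y z) =
      dl q x * (B p q * ps p y z w) + dl q y * (B p q * ps x p z w) + dl q z * (B p q * ps x y p w)
      + dl q w * (B p q * ps x y z p) - dl p x * (B p q * ps q y z w)
      - dl p y * (B p q * ps x q z w) - dl p z * (B p q * ps x y q w)
      - dl p w * (B p q * ps x y z q) := by
    intro p q
    have h := phiZ_wedge_phiZ p q x y z w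
    have h' : (ph x p q * ph y z w - ph y p q * ph x z w + ph z p q * ph x y w
        - ph w p q * ph x y z) - (dl q x * ps p y z w + dl q y * ps x p z w + dl q z * ps x y p w
        + dl q w * ps x y z p - dl p x * ps q y z w - dl p y * ps x q z w
        - dl p z * ps x y q w - dl p w * ps x y z q) = 0 := by
      simp only [ph, ps, ← cast_deltaZ]
      exact_mod_cast h
    linear_combination B p q * h'
  rw [h1, act_four]
  simp only [h2, Finset.sum_add_distrib, Finset.sum_sub_distrib, ← Finset.mul_sum, sum_dl_mul']
  have h3 : ∀ (a : Fin 7) (f : Fin 7 → ℝ), ∑ q, B a q * f q = -∑ p, B p a * f p := by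
    intro a f
    rw [← Finset.sum_neg_distrib]
    exact Finset.sum_congr rfl fun q _ => by rw [hB q a]; ring
  rw [h3 x (fun q => ps q y z w), h3 y (fun q => ps x q z w), h3 z (fun q => ps x y q w),
    h3 w (fun q => ps x y z q)]
  have hs : ∀ a b c d : Fin 7, stdPsi ![a, b, c, d] = ps a b c d := fun _ _ _ _ => rfl
  simp only [hs]
  ring

/-! ### Contractions of the dual form and the torsion of a closed structure -/

theorem sum3_front (f : Fin 7 → Fin 7 → Fin 7 → ℝ) :
    ∑ k, ∑ l, ∑ m, f k l m = ∑ m, ∑ k, ∑ l, f k l m := by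
  calc _ = ∑ k, ∑ m, ∑ l, f k l m := Finset.sum_congr rfl fun k _ => Finset.sum_comm
    _ = _ := Finset.sum_comm

theorem sum4_front (f : Fin 7 → Fin 7 → Fin 7 → Fin 7 → ℝ) :
    ∑ j, ∑ k, ∑ l, ∑ m, f j k l m = ∑ m, ∑ j, ∑ k, ∑ l, f j k l m := by
  calc _ = ∑ j, ∑ m, ∑ k, ∑ l, f j k l m := Finset.sum_congr rfl fun k _ => sum3_front _
    _ = _ := Finset.sum_comm

theorem ps_ps_three (m n : Fin 7) : ∑ j, ∑ k, ∑ l, ps m j k l * ps n j k l = 24 * dl m n := by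
  have h : ∀ j, ps m j n j = 0 := fun j => by
    have h1 := ps_swap23 m n j j
    have h2 := ps_swap34 m n j j
    linarith
  have h2 : ∀ j, 4 * (dl m n * dl j j) - 4 * (dl m j * dl j n) = 4 * dl m n - dl m j * (4 * dl j n) :=
    fun j => by simp only [dl, if_true]; ring
  simp only [ps_ps_two, h, mul_zero, add_zero, h2, Finset.sum_sub_distrib, sum_dl_mul]
  simp
  ring

/-- The algebraic content of the closedness of a `G₂` structure: the torsion is skew, and it lies
in the `14`-dimensional part of the space of `2`-forms. -/
theorem torsion_algebra {T : Fin 7 → Fin 7 → ℝ} (hT : ∀ i j k l, ∑ m, T i m * ps m j k l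
      - ∑ m, T j m * ps m i k l + ∑ m, T k m * ps m i j l - ∑ m, T l m * ps m i j k = 0) :
    (∀ i j, T j i = -T i j) ∧ (∀ i j, ∑ m, ∑ n, T m n * ps i j m n = -2 * T i j) ∧
      ∀ k, ∑ i, ∑ j, ph k i j * T i j = 0 := by
  set Q : Fin 7 → Fin 7 → ℝ := fun i n => ∑ j, ∑ m, T j m * ps m i n j with hQ
  have hQs : ∀ i n, Q n i = -Q i n := fun i n => by
    simp only [hQ, ← Finset.sum_neg_distrib]
    exact Finset.sum_congr rfl fun j _ => Finset.sum_congr rfl fun m _ => by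
      rw [ps_swap23 m i n j]; ring
  -- The closedness identity is contracted with `ψ_{njkl}`. Its first term gives `24 T`, the other
  -- three give `-X` each, and `ps_ps_two` expands `X` into `T`, its trace and `Q`.
  have main : ∀ i n, 12 * T i n + 12 * (∑ j, T j j) * dl i n - 6 * Q i n = 0 := by
    intro i n
    set X : ℝ := ∑ j, ∑ m, T j m * ∑ k, ∑ l, ps m i k l * ps n j k l with hX
    have e1 : ∑ j, ∑ k, ∑ l, ps n j k l * ∑ m, T i m * ps m j k l = 24 * T i n := by
      have : ∀ m, T i m * ∑ j, ∑ k, ∑ l, ps m j k l * ps n j k l = dl m n * (24 * T i m) :=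
        fun m => by rw [ps_ps_three]; ring
      rw [← sum_dl_mul' n (fun m => 24 * T i m)]
      simp only [← this, Finset.mul_sum]
      rw [sum4_front]
      exact Finset.sum_congr rfl fun m _ => Finset.sum_congr rfl fun j _ =>
        Finset.sum_congr rfl fun k _ => Finset.sum_congr rfl fun l _ => by ring
    have e2 : ∑ j, ∑ k, ∑ l, ps n j k l * ∑ m, T j m * ps m i k l = X := by
      refine Finset.sum_congr rfl fun j _ => ?_
      simp only [Finset.mul_sum]
      rw [sum3_front]
      exact Finset.sum_congr rfl fun m _ => Finset.sum_congr rfl fun k _ =>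
        Finset.sum_congr rfl fun l _ => by ring
    have e3 : ∑ j, ∑ k, ∑ l, ps n j k l * ∑ m, T k m * ps m i j l = -X := by
      rw [← e2, Finset.sum_comm]
      simp only [← Finset.sum_neg_distrib]
      refine Finset.sum_congr rfl fun j _ => Finset.sum_congr rfl fun k _ =>
        Finset.sum_congr rfl fun l _ => ?_
      rw [ps_swap23 n j k l]; ring
    have e4 : ∑ j, ∑ k, ∑ l, ps n j k l * ∑ m, T l m * ps m i j k = X := by
      rw [← e2, sum3_front]
      refine Finset.sum_congr rfl fun j _ => Finset.sum_congr rfl fun k _ =>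
        Finset.sum_congr rfl fun l _ => ?_
      rw [ps_swap34 n k j l, ps_swap23 n j k l]; ring
    have e5 : X = 4 * T i n - 4 * (∑ j, T j j) * dl i n + 2 * Q i n := by
      have h : ∀ j m, T j m * ∑ k, ∑ l, ps m i k l * ps n j k l =
          dl m n * (dl i j * (4 * T j m)) - dl m j * (4 * T j m * dl i n)
            + 2 * (T j m * ps m i n j) := fun j m => by rw [ps_ps_two]; ring
      simp only [hX, h, Finset.sum_add_distrib, Finset.sum_sub_distrib, sum_dl_mul', sum_dl_mul]
      simp only [hQ, Finset.mul_sum, Finset.sum_mul]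
    have e0 : ∑ j, ∑ k, ∑ l, ps n j k l * (∑ m, T i m * ps m j k l
      - ∑ m, T j m * ps m i k l + ∑ m, T k m * ps m i j l - ∑ m, T l m * ps m i j k) = 0 := by
      simp [hT]
    simp only [mul_add, mul_sub, Finset.sum_add_distrib, Finset.sum_sub_distrib] at e0
    rw [e1, e2, e3, e4, e5] at e0
    linarith
  have hQ0 : ∀ i, Q i i = 0 := fun i => by linarith [hQs i i]
  -- On the diagonal the skew `Q` drops out, so every `T i i` equals minus the trace; summing over
  -- seven indices forces the trace to vanish.
  have htr : ∑ j, T j j = 0 := by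
    have : ∀ i, T i i = -(∑ j, T j j) := fun i => by
      have := main i i
      rw [hQ0] at this
      simp only [dl, if_true] at this
      linarith
    have h2 : ∑ i, T i i = ∑ i : Fin 7, -(∑ j, T j j) := Finset.sum_congr rfl fun i _ => this i
    simp only [Finset.sum_const, Finset.card_univ, Fintype.card_fin, nsmul_eq_mul] at h2
    push_cast at h2
    linarith
  have hQT : ∀ i n, Q i n = 2 * T i n := fun i n => by
    have := main i n
    rw [htr] at this
    linarith
  have h2 : ∀ i j, ∑ m, ∑ n, T m n * ps i j m n = -2 * T i j := by
    intro i j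
    have := hQT i j
    have e : ∑ m, ∑ n, T m n * ps i j m n = -Q i j := by
      simp only [hQ, ← Finset.sum_neg_distrib]
      refine Finset.sum_congr rfl fun m _ => Finset.sum_congr rfl fun n _ => ?_
      rw [ps_swap12 i n j m, ps_swap23 i j n m, ps_swap34 i j m n]; ring
    rw [e, this]; ring
  refine ⟨fun i j => by linarith [hQT i j, hQT j i, hQs i j], h2, fun k => ?_⟩
  -- Contracting the eigenvalue equation with `φ` and using `φ ψ = 4 φ` shows that `-2` and `4`
  -- times the same vector agree, so the vector is zero.
  have e1 : ∑ i, ∑ j, ph k i j * (-2 * T i j) = ∑ m, ∑ n, T m n * (4 * ph k m n) := by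
    have h : ∀ m n, T m n * (4 * ph k m n) = ∑ i, ∑ j, ph k i j * (T m n * ps i j m n) := by
      intro m n
      rw [← ph_ps_two, Finset.mul_sum]
      refine Finset.sum_congr rfl fun i _ => ?_
      rw [Finset.mul_sum]
      exact Finset.sum_congr rfl fun j _ => by rw [ps_pair i j m n]; ring
    simp only [h, ← h2, Finset.mul_sum]
    calc _ = ∑ i, ∑ m, ∑ n, ∑ j, ph k i j * (T m n * ps i j m n) :=
          Finset.sum_congr rfl fun i _ => (sum3_front _).symm
      _ = ∑ m, ∑ i, ∑ n, ∑ j, ph k i j * (T m n * ps i j m n) := Finset.sum_comm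
      _ = _ := Finset.sum_congr rfl fun m _ => Finset.sum_comm
  have e2 : ∑ i, ∑ j, ph k i j * (-2 * T i j) = -2 * ∑ i, ∑ j, ph k i j * T i j := by
    simp only [Finset.mul_sum]
    exact Finset.sum_congr rfl fun i _ => Finset.sum_congr rfl fun j _ => by ring
  have e3 : ∑ m, ∑ n, T m n * (4 * ph k m n) = 4 * ∑ i, ∑ j, ph k i j * T i j := by
    simp only [Finset.mul_sum]
    exact Finset.sum_congr rfl fun i _ => Finset.sum_congr rfl fun j _ => by ring
  linarith

end

section

/-! ### Linearization at the standard form -/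

theorem contrPhi_add (χ χ' : V3) (i j : Fin 7) :
    contrPhi (χ + χ') i j = contrPhi χ i j + contrPhi χ' i j := by
  simp only [contrPhi, Pi.add_apply, add_mul, Finset.sum_add_distrib]

theorem contrPhi_smul (c : ℝ) (χ : V3) (i j : Fin 7) :
    contrPhi (c • χ) i j = c * contrPhi χ i j := by
  simp only [contrPhi, Pi.smul_apply, smul_eq_mul, Finset.mul_sum, mul_assoc]

/-- The components of the section `sec`, as continuous linear forms. -/
def secL (p l : Fin 7) : V3 →L[ℝ] ℝ := LinearMap.toContinuousLinearMap
  { toFun := fun χ => sec χ p l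
    map_add' := fun χ χ' => by
      simp only [sec, Matrix.of_apply, contrPhi_add, Finset.sum_add_distrib]; ring
    map_smul' := fun c χ => by
      simp only [sec, Matrix.of_apply, contrPhi_smul, ← Finset.mul_sum, RingHom.id_apply,
        smul_eq_mul]
      ring }

theorem secL_apply (p l : Fin 7) (χ : V3) : secL p l χ = sec χ p l := rfl

variable {Ω : Set E7} {φ : CoordTensor 3} {y : E7}

/-- The partial derivative of a tensor field, componentwise. -/
def dcomp {k : ℕ} (i : Fin 7) (α : CoordTensor k) (y : E7) (J : Fin k → Fin 7) : ℝ :=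
  pderiv i (fun z => α z J) y

theorem IsG2On.pderiv_sec (hφ : IsG2On Ω φ) (hy : y ∈ Ω) (i p l : Fin 7) :
    pderiv i (fun z => sec (φ z) p l) y = sec (dcomp i φ y) p l := by
  have := pderiv_coef (c := secL p l) (secL p l).contDiff.contDiffOn hφ hy i
  rw [(secL p l).fderiv] at this
  exact this

theorem IsG2On.isAlt_dcomp (hφ : IsG2On Ω φ) (hy : y ∈ Ω) (i : Fin 7) : IsAlt (dcomp i φ y) := by
  intro J a b hab
  rw [dcomp, pderiv_congr hφ.isOpen hy (fun z hz => hφ.isAlt hz J a b hab), pderiv_neg]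
  rfl

/-- The derivative is taken along the curve of pullbacks `(1 + s A)^* φ₀`, where equivariant
quantities are explicit. The ninth root defining the volume is never differentiated by hand. -/
theorem fderiv_altV_of_pull {c : V3 → ℝ} (hc : ContDiffOn ℝ ∞ c nondegSet)
    {A : Matrix (Fin 7) (Fin 7) ℝ} {d : ℝ}
    (hd : HasDerivAt (fun s : ℝ => c (pullT (1 + s • A) std)) d 0) :
    fderiv ℝ (fun v => c (altV v)) std (act A std) = d := by
  have hc' : ContDiffOn ℝ ∞ (fun v => c (altV v)) coefSet :=
    hc.comp contDiff_altV.contDiffOn fun v hv => hv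
  have h1 : HasFDerivAt (fun v => c (altV v)) (fderiv ℝ (fun v => c (altV v)) std) std :=
    ((hc'.contDiffAt (isOpen_coefSet.mem_nhds std_mem_coefSet)).differentiableAt
      (by simp)).hasFDerivAt
  have h2 : HasDerivAt (fun s : ℝ => pullT (1 + s • A) std) (act A std) 0 :=
    hasDerivAt_pi.2 fun J => hasDerivAt_pullT A std J
  have h0 : pullT (1 + (0 : ℝ) • A) std = std := by rw [zero_smul, add_zero, pullT_one]
  rw [← h0] at h1
  have h3 := h1.comp_hasDerivAt (0 : ℝ) h2
  have h4 : ((fun v => c (altV v)) ∘ fun s : ℝ => pullT (1 + s • A) std) =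
      fun s : ℝ => c (pullT (1 + s • A) std) := by
    ext s
    simp only [Function.comp]
    rw [altV_of_isAlt (isAlt_pullT _ isAlt_std)]
  rw [h4, h0] at h3
  exact h3.unique hd

theorem eventually_det_ne_zero (A : Matrix (Fin 7) (Fin 7) ℝ) :
    ∀ᶠ s : ℝ in nhds 0, (1 + s • A).det ≠ 0 := by
  have h : Continuous fun s : ℝ => (1 + s • A).det := by
    refine Continuous.matrix_det ?_
    fun_prop
  exact h.continuousAt.eventually_ne (by simp)

theorem fderiv_metric_act (A : Matrix (Fin 7) (Fin 7) ℝ) (i j : Fin 7) :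
    fderiv ℝ (fun v => metric (fun _ => altV v) 0 i j) std (act A std) = A i j + A j i := by
  refine fderiv_altV_of_pull (contDiffOn_metric i j) ?_
  have h1 : HasDerivAt (fun s : ℝ => ∑ p, (1 + s • A) p i * (1 + s • A) p j) (A i j + A j i) 0 := by
    have h : ∀ p q, HasDerivAt (fun s : ℝ => (1 + s • A) p q) (A p q) 0 := fun p q => by
      simp only [Matrix.add_apply, Matrix.smul_apply, smul_eq_mul]
      simpa using ((hasDerivAt_id (0 : ℝ)).mul_const (A p q)).const_add
          ((1 : Matrix (Fin 7) (Fin 7) ℝ) p q)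
    have h2 : HasDerivAt (fun s : ℝ => ∑ p, (1 + s • A) p i * (1 + s • A) p j) _ 0 :=
      HasDerivAt.fun_sum fun p _ => (h p i).mul (h p j)
    refine h2.congr_deriv ?_
    simp [Matrix.one_apply, Finset.sum_add_distrib]
    ring
  refine h1.congr_of_eventuallyEq ?_
  filter_upwards [eventually_det_ne_zero A] with s hs
  rw [metric_pull hs (φ := fun _ => std) (y := (0 : E7)) rfl, metric_std rfl, Matrix.mul_one,
    Matrix.mul_apply]
  rfl

theorem fderiv_metric_std {χ : V3} (hχ : IsAlt χ) (i j : Fin 7) :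
    fderiv ℝ (fun v => metric (fun _ => altV v) 0 i j) std χ = sec χ i j + sec χ j i := by
  rw [← fderiv_metric_act (sec χ) i j, act_sec hχ]

theorem isAlt_act (A : Matrix (Fin 7) (Fin 7) ℝ) {k : ℕ} {a : (Fin k → Fin 7) → ℝ}
    (ha : IsAlt a) : IsAlt (act A a) := by
  intro J i j hij
  have h1 := hasDerivAt_pullT A a (J ∘ Equiv.swap i j)
  have h2 := (hasDerivAt_pullT A a J).neg
  refine h1.unique (h2.congr_of_eventuallyEq (Filter.Eventually.of_forall fun s => ?_))
  exact isAlt_pullT _ ha J i j hij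

/-- The linearized metric of an infinitesimal change of frame. -/
theorem sec_act_symm (A : Matrix (Fin 7) (Fin 7) ℝ) (i j : Fin 7) :
    sec (act A std) i j + sec (act A std) j i = A i j + A j i := by
  rw [← fderiv_metric_std (isAlt_act A isAlt_std), fderiv_metric_act]

theorem fderiv_psi_std {χ : V3} (hχ : IsAlt χ) (J : Fin 4 → Fin 7) :
    fderiv ℝ (fun v => psi (fun _ => altV v) 0 J) std χ = act (sec χ) stdPsi J := by
  rw [← act_sec hχ, ← congrArg sec (act_sec hχ).symm]
  refine fderiv_altV_of_pull (contDiffOn_hodgeStar_self rfl J) ?_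
  refine (hasDerivAt_pullT (sec χ) stdPsi J).congr_of_eventuallyEq ?_
  filter_upwards [eventually_det_ne_zero (sec χ)] with s hs
  have := hodgeStar_pull hs (φ := fun _ => std) (y := (0 : E7)) (φ' := fun _ =>
    pullT (1 + s • sec χ) std) (y' := (0 : E7)) rfl (rfl : 3 + 4 = 7)
    (α := fun _ => std) (α' := fun _ => pullT (1 + s • sec χ) std) rfl
  rw [this]
  change pullT _ (psi (fun _ => std) 0) J = _
  rw [psi_std rfl]

/-- The linearized metric. -/
def lmet (φ : CoordTensor 3) (p l : Fin 7) (y : E7) : ℝ := sec (φ y) p l + sec (φ y) l p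

/-- The linearized Christoffel symbols. -/
def lchr (φ : CoordTensor 3) (m i j : Fin 7) (y : E7) : ℝ :=
  (1 / 2) * (pderiv i (lmet φ j m) y + pderiv j (lmet φ i m) y - pderiv m (lmet φ i j) y)

/-- The linearized Christoffel symbols, as matrices. -/
def lconn (φ : CoordTensor 3) (i : Fin 7) (y : E7) : Matrix (Fin 7) (Fin 7) ℝ :=
  Matrix.of fun m j => lchr φ m i j y

/-- The deviation of a partial derivative from the linearized covariant derivative. -/
def ldev (φ : CoordTensor 3) (i : Fin 7) (y : E7) : Matrix (Fin 7) (Fin 7) ℝ :=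
  Matrix.of fun p l => pderiv i (fun z => sec (φ z) p l) y - lchr φ p i l y

/-- The linearized torsion. -/
def ltor (φ : CoordTensor 3) (i j : Fin 7) (y : E7) : ℝ := skewVec (ldev φ i y) j

/-- The linearized curvature. -/
def lcur (φ : CoordTensor 3) (i j k l : Fin 7) (y : E7) : ℝ :=
  pderiv i (lchr φ k j l) y - pderiv j (lchr φ k i l) y

theorem IsG2On.smooth_sec (hφ : IsG2On Ω φ) (p l : Fin 7) :
    ContDiffOn ℝ ∞ (fun z => sec (φ z) p l) Ω :=
  (secL p l).contDiff.comp_contDiffOn hφ.contDiff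

theorem IsG2On.smooth_lmet (hφ : IsG2On Ω φ) (p l : Fin 7) : ContDiffOn ℝ ∞ (lmet φ p l) Ω :=
  (hφ.smooth_sec p l).add (hφ.smooth_sec l p)

theorem lmet_comm (φ : CoordTensor 3) (p l : Fin 7) : lmet φ p l = lmet φ l p := by
  ext y; simp only [lmet, add_comm]

theorem lchr_symm (φ : CoordTensor 3) (m i j : Fin 7) : lchr φ m i j = lchr φ m j i := by
  ext y; simp only [lchr, lmet_comm φ i j]; ring

theorem IsG2On.smooth_lchr (hφ : IsG2On Ω φ) (m i j : Fin 7) : ContDiffOn ℝ ∞ (lchr φ m i j) Ω :=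
  contDiffOn_const.mul (((contDiffOn_pderiv hφ.isOpen (hφ.smooth_lmet j m)).add
    (contDiffOn_pderiv hφ.isOpen (hφ.smooth_lmet i m))).sub
    (contDiffOn_pderiv hφ.isOpen (hφ.smooth_lmet i j)))

theorem IsG2On.pderiv_lmet (hφ : IsG2On Ω φ) (hy : y ∈ Ω) (i p l : Fin 7) :
    pderiv i (lmet φ p l) y = sec (dcomp i φ y) p l + sec (dcomp i φ y) l p := by
  rw [← hφ.pderiv_sec hy, ← hφ.pderiv_sec hy]
  exact pderiv_add (differentiableAt_of_contDiffOn hφ.isOpen (hφ.smooth_sec p l) hy)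
    (differentiableAt_of_contDiffOn hφ.isOpen (hφ.smooth_sec l p) hy)

/-- Linearized metric compatibility: the symmetric parts of `sec (∂_i φ)` and of the Christoffel
matrix are both half of `∂_i` of the linearized metric. The difference is therefore skew, and only
its vector, the torsion, matters. -/
theorem IsG2On.ldev_skew (hφ : IsG2On Ω φ) (hy : y ∈ Ω) (i p l : Fin 7) :
    ldev φ i y l p = -ldev φ i y p l := by
  simp only [ldev, Matrix.of_apply, lchr, lmet_comm φ p l]
  rw [hφ.pderiv_sec hy, hφ.pderiv_sec hy, hφ.pderiv_lmet hy i l p]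
  ring

theorem act_add (A B : Matrix (Fin 7) (Fin 7) ℝ) {k : ℕ} (a : (Fin k → Fin 7) → ℝ)
    (J : Fin k → Fin 7) : act (A + B) a J = act A a J + act B a J := by
  simp only [act, Matrix.add_apply, add_mul, Finset.sum_add_distrib]

theorem IsG2On.sec_dcomp (hφ : IsG2On Ω φ) (hy : y ∈ Ω) (i : Fin 7) :
    sec (dcomp i φ y) = lconn φ i y + ldev φ i y := by
  ext p l
  simp only [lconn, ldev, Matrix.add_apply, Matrix.of_apply, hφ.pderiv_sec hy]
  ring

/-- The first derivatives of a `G₂` structure in terms of the linearized torsion. -/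
theorem IsG2On.pderiv_eq (hφ : IsG2On Ω φ) (hy : y ∈ Ω) (i j k l : Fin 7) :
    pderiv i (fun z => φ z ![j, k, l]) y =
      act (lconn φ i y) std ![j, k, l] + ∑ m, ltor φ i m y * ps m j k l := by
  have h := congrFun (act_sec (hφ.isAlt_dcomp hy i)) ![j, k, l]
  rw [hφ.sec_dcomp hy, act_add, act_std_of_skew (hφ.ldev_skew hy i)] at h
  exact h.symm

/-! The geometric quantities agree with their linearizations up to lower order terms. -/

theorem leq_metric (k i j : Fin 7) : LEq 1 (fun φ y => pderiv k (fun z => metric φ z i j) y)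
    fun φ y => pderiv k (lmet φ i j) y := by
  have hc : ContDiffOn ℝ ∞ (fun v => metric (fun _ => altV v) 0 i j) coefSet :=
    (contDiffOn_metric i j).comp contDiff_altV.contDiffOn fun v hv => hv
  refine (LEq.pderiv_coef hc k).congr (fun Ω φ hφ y hy => ?_) fun Ω φ hφ y hy => ?_
  · refine pderiv_congr hφ.isOpen hy fun z hz => ?_
    rw [altV_of_isAlt (hφ.isAlt hz)]
    rfl
  · rw [hφ.pderiv_lmet hy, ← fderiv_metric_std (hφ.isAlt_dcomp hy k), clm_apply_eq_sum]
    rfl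

theorem leq_psi (k : Fin 7) (J : Fin 4 → Fin 7) : LEq 1 (fun φ y => pderiv k (fun z => psi φ z J) y)
    fun φ y => act (sec (dcomp k φ y)) stdPsi J := by
  have hc : ContDiffOn ℝ ∞ (fun v => psi (fun _ => altV v) 0 J) coefSet :=
    (contDiffOn_hodgeStar_self rfl J).comp contDiff_altV.contDiffOn fun v hv => hv
  refine (LEq.pderiv_coef hc k).congr (fun Ω φ hφ y hy => ?_) fun Ω φ hφ y hy => ?_
  · refine pderiv_congr hφ.isOpen hy fun z hz => ?_
    rw [altV_of_isAlt (hφ.isAlt hz)]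
    rfl
  · rw [← fderiv_psi_std (hφ.isAlt_dcomp hy k), clm_apply_eq_sum]
    rfl

theorem leq_christoffel (m i j : Fin 7) : LEq 1 (fun φ y => christoffel φ m i j y)
    fun φ y => lchr φ m i j y := by
  have h : LEq 1 _ _ := LEq.const_mul (1 / 2) (LEq.sum le_rfl Finset.univ fun l _ =>
    LEq.coef_mul (coef_metricInv m l)
      (((leq_metric i j l).add (leq_metric j i l)).sub (leq_metric l i j)))
  refine h.congr (fun Ω φ hφ y hy => rfl) fun Ω φ hφ y hy => ?_
  simp [lchr, Matrix.one_apply]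

theorem LEq.contract {w m : ℕ} {α β α' : CoordTensor 3 → CoordTensor m}
    {b : (Fin m → Fin 7) → ℝ} (hw : 1 ≤ w)
    (hα : ∀ J, LEq w (fun φ y => α φ y J) fun φ y => α' φ y J)
    (hβ : ∀ J, Coef (fun φ y => β φ y J) (b J)) :
    LEq w (fun φ y => contract φ y (α φ y) (β φ y)) fun φ y => ∑ I, α' φ y I * b I := by
  have h : LEq w _ _ := LEq.sum hw Finset.univ fun I _ => LEq.sum hw Finset.univ fun J _ =>
    LEq.coef_mul ((hβ J).mul (Coef.prod Finset.univ fun s _ => coef_metricInv (I s) (J s))) (hα I)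
  refine h.congr (fun Ω φ hφ y hy => ?_) fun Ω φ hφ y hy => ?_
  · simp only [G2.contract]
    exact Finset.sum_congr rfl fun I _ => Finset.sum_congr rfl fun J _ => by ring
  · simp only [prod_one_apply]
    simp [mul_comm]

/-- With frozen coefficients the Christoffel terms are the action of the matrix `lconn` on the
standard form, and `∂_i φ` is the action of `sec (∂_i φ)` by `act_sec`. Their difference is the
action of `ldev`. -/
theorem leq_covDeriv_self (i : Fin 7) (L : Fin 3 → Fin 7) :
    LEq 1 (fun φ y => covDeriv φ φ y (Matrix.vecCons i L))
      fun φ y => act (ldev φ i y) std L := by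
  have h : LEq 1 _ _ := LEq.sub (LEq.refl le_rfl (DP.jet [i] L rfl le_rfl le_rfl))
    (LEq.sum le_rfl Finset.univ fun s _ => LEq.sum le_rfl Finset.univ fun m _ =>
      LEq.coef_mul (coef_self (Function.update L s m)) (leq_christoffel m i (L s)))
  refine h.congr (fun Ω φ hφ y hy => ?_) fun Ω φ hφ y hy => ?_
  · rw [covDeriv_cons]
    simp only [mul_comm (christoffel _ _ _ _ _)]
    rfl
  · have h1 := congrFun (act_sec (hφ.isAlt_dcomp hy i)) L
    rw [hφ.sec_dcomp hy, act_add] at h1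
    have h2 : act (lconn φ i y) std L =
        ∑ s, ∑ m, std (Function.update L s m) * lchr φ m i (L s) y := by
      simp only [act, lconn, Matrix.of_apply, mul_comm]
    dsimp only
    rw [← h2]
    have h3 : pd [i] (fun z => φ z L) y = dcomp i φ y L := rfl
    rw [h3]
    linarith

/-- The covariant derivative of `φ` is to leading order the vector `ltor` contracted with `ψ`, and
`ps_ps_three` recovers the vector. Its constant `24` explains the normalization of `T`. -/
theorem leq_torsion (i j : Fin 7) : LEq 1 (fun φ y => torsion φ y ![i, j])
    fun φ y => ltor φ i j y := by
  have h := LEq.const_mul (1 / 24) (LEq.contract (w := 1) le_rfl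
    (α := fun φ y L => covDeriv φ φ y (Matrix.vecCons i L))
    (α' := fun φ y L => act (ldev φ i y) std L)
    (β := fun φ y L => psi φ y (Matrix.vecCons j L)) (fun L => leq_covDeriv_self i L)
    (fun L => coef_psi (Matrix.vecCons j L)))
  refine h.congr (fun Ω φ hφ y hy => rfl) fun Ω φ hφ y hy => ?_
  dsimp only
  rw [sum_index3]
  have hs : ∀ a b c d : Fin 7, stdPsi ![a, b, c, d] = ps a b c d := fun _ _ _ _ => rfl
  simp only [act_std_of_skew (hφ.ldev_skew hy i), hs, Finset.sum_mul]
  rw [sum4_front]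
  have h2 : ∀ m, ∑ a, ∑ b, ∑ c, skewVec (ldev φ i y) m * ps m a b c * ps j a b c =
      dl m j * (24 * ltor φ i m y) := by
    intro m
    simp only [mul_assoc, ← Finset.mul_sum, ps_ps_three, ltor]
    ring
  simp only [h2, sum_dl_mul']
  ring

theorem leq_covDeriv_torsion (i j k : Fin 7) :
    LEq 2 (fun φ y => covDeriv φ (torsion φ) y ![i, j, k]) fun φ y => pderiv i (ltor φ j k) y := by
  have h : LEq 2 _ _ := LEq.sub ((leq_torsion j k).pderiv i)
    (LEq.sum (by norm_num) Finset.univ fun s _ => LEq.sum (by norm_num) Finset.univ fun m _ =>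
      LEq.mul_zero le_rfl le_rfl (dp_christoffel m i (![j, k] s))
        (dp_torsion (Function.update ![j, k] s m)))
  refine h.congr (fun Ω φ hφ y hy => rfl) fun Ω φ hφ y hy => ?_
  simp

theorem leq_riemann (i j k l : Fin 7) :
    LEq 2 (fun φ y => riemann φ y ![i, j, k, l]) fun φ y => lcur φ i j k l y := by
  have h : LEq 2 _ _ := LEq.sum (by norm_num) Finset.univ fun m _ =>
    LEq.coef_mul (coef_metric k m) (LEq.add (LEq.sub ((leq_christoffel m j l).pderiv i)
      ((leq_christoffel m i l).pderiv j)) (LEq.sum (by norm_num) Finset.univ fun p _ => LEq.sub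
      (LEq.mul_zero le_rfl le_rfl (dp_christoffel m i p) (dp_christoffel p j l))
      (LEq.mul_zero le_rfl le_rfl (dp_christoffel m j p) (dp_christoffel p i l))))
  refine h.congr (fun Ω φ hφ y hy => rfl) fun Ω φ hφ y hy => ?_
  simp [lcur, Matrix.one_apply]


/-! ### The linearizations of `d* φ` and of the closedness condition -/

theorem isAlt_stdPsi : IsAlt stdPsi := by
  rw [← psi_std (φ := fun _ => std) (y := 0) rfl]
  exact isAlt_hodgeStar _ _ _ _

theorem sum_act_lconn {k : ℕ} {a : (Fin k → Fin 7) → ℝ} (ha : IsAlt a) (φ : CoordTensor 3) (y : E7)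
    (J : Fin (k + 1) → Fin 7) : ∑ s : Fin (k + 1), (-1) ^ (s : ℕ) *
      act (lconn φ (J s) y) a (fun r => J (s.succAbove r)) = 0 :=
  ha.sum_symm_eq_zero (G := fun m i j => lchr φ m i j y)
    (fun m i j => congrFun (lchr_symm φ m i j) y) J

/-- The Christoffel part of `∂ψ` is symmetric in its lower indices and disappears from the exterior
derivative, so `dψ` depends only on the torsion at leading order. -/
theorem leq_extD_psi (J : Fin 5 → Fin 7) : LEq 1 (fun φ y => extD (psi φ) y J) fun φ y =>
    ∑ s : Fin 5, (-1) ^ (s : ℕ) * act (ldev φ (J s) y) stdPsi (fun r => J (s.succAbove r)) := by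
  have h : LEq 1 _ _ := LEq.sum le_rfl Finset.univ fun (s : Fin 5) _ => LEq.const_mul ((-1) ^ (s : ℕ))
    (leq_psi (J s) (fun r => J (s.succAbove r)))
  refine h.congr (fun Ω φ hφ y hy => rfl) fun Ω φ hφ y hy => ?_
  simp only [hφ.sec_dcomp hy, act_add, mul_add, Finset.sum_add_distrib]
  rw [sum_act_lconn isAlt_stdPsi, zero_add]

theorem sum_index5 (f : (Fin 5 → Fin 7) → ℝ) :
    ∑ I, f I = ∑ a, ∑ b, ∑ c, ∑ d, ∑ e, f ![a, b, c, d, e] := by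
  simp only [sum_cons, Finset.univ_unique, Finset.sum_singleton]
  rfl

theorem epsZ_move (i x y z w a b : Fin 7) : epsZ i x y z w a b = epsZ y z w i x a b := by
  simp only [epsZ, ltSign_swap i y, ltSign_swap i z, ltSign_swap i w, ltSign_swap x y,
    ltSign_swap x z, ltSign_swap x w]
  ring

theorem sum_alt4 {e : Fin 7 → Fin 7 → Fin 7 → Fin 7 → ℝ} (h12 : ∀ x y z w, e y x z w = -e x y z w)
    (h23 : ∀ x y z w, e x z y w = -e x y z w) (h34 : ∀ x y z w, e x y w z = -e x y z w)
    (g : Fin 7 → Fin 7 → Fin 7 → Fin 7 → ℝ) :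
    ∑ x, ∑ y, ∑ z, ∑ w, (g x y z w - g y x z w + g z x y w - g w x y z) * e x y z w =
      4 * ∑ x, ∑ y, ∑ z, ∑ w, g x y z w * e x y z w := by
  have e2 : ∑ x, ∑ y, ∑ z, ∑ w, g y x z w * e x y z w = -∑ x, ∑ y, ∑ z, ∑ w, g x y z w * e x y z w := by
    rw [Finset.sum_comm]
    simp only [← Finset.sum_neg_distrib]
    exact Finset.sum_congr rfl fun x _ => Finset.sum_congr rfl fun y _ =>
      Finset.sum_congr rfl fun z _ => Finset.sum_congr rfl fun w _ => by rw [h12 x y z w]; ring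
  have e3 : ∑ x, ∑ y, ∑ z, ∑ w, g z x y w * e x y z w = ∑ x, ∑ y, ∑ z, ∑ w, g x y z w * e x y z w := by
    rw [sum3_front fun x y z => ∑ w, g z x y w * e x y z w]
    exact Finset.sum_congr rfl fun x _ => Finset.sum_congr rfl fun y _ =>
      Finset.sum_congr rfl fun z _ => Finset.sum_congr rfl fun w _ => by
        rw [h23 y x z w, h12 x y z w]; ring
  have e4 : ∑ x, ∑ y, ∑ z, ∑ w, g w x y z * e x y z w = -∑ x, ∑ y, ∑ z, ∑ w, g x y z w * e x y z w := by
    rw [sum4_front]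
    simp only [← Finset.sum_neg_distrib]
    exact Finset.sum_congr rfl fun x _ => Finset.sum_congr rfl fun y _ =>
      Finset.sum_congr rfl fun z _ => Finset.sum_congr rfl fun w _ => by
        rw [h34 y z x w, h23 y x z w, h12 x y z w]; ring
  simp only [add_mul, sub_mul, Finset.sum_add_distrib, Finset.sum_sub_distrib]
  rw [e2, e3, e4]
  ring

/-- Moving the separated index to the front costs exactly the sign with which its term occurs, so
the five terms contribute equally. -/
theorem sum_alt5 {e : Fin 7 → Fin 7 → Fin 7 → Fin 7 → Fin 7 → ℝ}
    (h12 : ∀ i x y z w, e x i y z w = -e i x y z w) (h23 : ∀ i x y z w, e i y x z w = -e i x y z w)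
    (h34 : ∀ i x y z w, e i x z y w = -e i x y z w) (h45 : ∀ i x y z w, e i x y w z = -e i x y z w)
    (g : Fin 7 → Fin 7 → Fin 7 → Fin 7 → Fin 7 → ℝ) :
    ∑ i, ∑ x, ∑ y, ∑ z, ∑ w, (g i x y z w - g x i y z w + g y i x z w - g z i x y w + g w i x y z) *
      e i x y z w = 5 * ∑ i, ∑ x, ∑ y, ∑ z, ∑ w, g i x y z w * e i x y z w := by
  have e5 : ∑ i, ∑ x, ∑ y, ∑ z, ∑ w, g w i x y z * e i x y z w =
      ∑ i, ∑ x, ∑ y, ∑ z, ∑ w, g i x y z w * e i x y z w := by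
    calc _ = ∑ i, ∑ w, ∑ x, ∑ y, ∑ z, g w i x y z * e i x y z w :=
          Finset.sum_congr rfl fun i _ => sum4_front _
      _ = ∑ w, ∑ i, ∑ x, ∑ y, ∑ z, g w i x y z * e i x y z w := Finset.sum_comm
      _ = _ := Finset.sum_congr rfl fun i _ => Finset.sum_congr rfl fun x _ =>
        Finset.sum_congr rfl fun y _ => Finset.sum_congr rfl fun z _ =>
        Finset.sum_congr rfl fun w _ => by
          rw [h45 x y z i w, h34 x y i z w, h23 x i y z w, h12 i x y z w]; ring
  have e2 : ∑ i, ∑ x, ∑ y, ∑ z, ∑ w, g x i y z w * e i x y z w =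
      -∑ i, ∑ x, ∑ y, ∑ z, ∑ w, g i x y z w * e i x y z w := by
    rw [Finset.sum_comm]
    simp only [← Finset.sum_neg_distrib]
    exact Finset.sum_congr rfl fun i _ => Finset.sum_congr rfl fun x _ =>
      Finset.sum_congr rfl fun y _ => Finset.sum_congr rfl fun z _ =>
      Finset.sum_congr rfl fun w _ => by rw [h12 i x y z w]; ring
  have e3 : ∑ i, ∑ x, ∑ y, ∑ z, ∑ w, g y i x z w * e i x y z w =
      ∑ i, ∑ x, ∑ y, ∑ z, ∑ w, g i x y z w * e i x y z w := by
    rw [sum3_front fun i x y => ∑ z, ∑ w, g y i x z w * e i x y z w]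
    exact Finset.sum_congr rfl fun i _ => Finset.sum_congr rfl fun x _ =>
      Finset.sum_congr rfl fun y _ => Finset.sum_congr rfl fun z _ =>
      Finset.sum_congr rfl fun w _ => by rw [h23 x i y z w, h12 i x y z w]; ring
  have e4 : ∑ i, ∑ x, ∑ y, ∑ z, ∑ w, g z i x y w * e i x y z w =
      -∑ i, ∑ x, ∑ y, ∑ z, ∑ w, g i x y z w * e i x y z w := by
    rw [sum4_front fun i x y z => ∑ w, g z i x y w * e i x y z w]
    simp only [← Finset.sum_neg_distrib]
    exact Finset.sum_congr rfl fun i _ => Finset.sum_congr rfl fun x _ =>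
      Finset.sum_congr rfl fun y _ => Finset.sum_congr rfl fun z _ =>
      Finset.sum_congr rfl fun w _ => by
        rw [h34 x y i z w, h23 x i y z w, h12 i x y z w]; ring
  simp only [add_mul, sub_mul, Finset.sum_add_distrib, Finset.sum_sub_distrib]
  rw [e2, e3, e4, e5]
  ring

theorem append_five_two (i x y z w a b : Fin 7) :
    (Fin.append ![i, x, y, z, w] ![a, b] ∘ Fin.cast rfl : Fin 7 → Fin 7) =
      ![i, x, y, z, w, a, b] := by
  ext s; fin_cases s <;> rfl

/-- By `act_stdPsi_of_skew`, `dψ` is a combination of wedges of torsion vectors with `φ`.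
Antisymmetrization yields the factors `5` and `4`, the contraction of `φ` with the volume form
yields `6 ψ`, and `5 · 4 · 6` cancels the `5!` of the Hodge star. The sign of `d*` cancels that of
the action. -/
theorem leq_tau (a b : Fin 7) : LEq 1 (fun φ y => tau φ y ![a, b]) fun φ y =>
    ∑ i, ∑ x, ltor φ i x y * ps i x a b := by
  have h := LEq.const_mul (-1) (LEq.const_mul (1 / (Nat.factorial 5 : ℝ)) (LEq.contract (w := 1)
    le_rfl (α := fun φ y I => extD (psi φ) y I)
    (α' := fun φ y I => ∑ s : Fin 5, (-1) ^ (s : ℕ) *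
      act (ldev φ (I s) y) stdPsi (fun r => I (s.succAbove r)))
    (β := fun φ y I => volCoeff φ y * leviCivita (Fin.append I ![a, b] ∘ Fin.cast rfl))
    (fun I => leq_extD_psi I) (fun I => coef_volCoeff.mul (Coef.const _))))
  refine h.congr (fun Ω φ hφ y hy => ?_) fun Ω φ hφ y hy => ?_
  · rw [tau_eq]
    rfl
  dsimp only
  rw [sum_index5]
  set G : Fin 7 → Fin 7 → Fin 7 → Fin 7 → Fin 7 → ℝ := fun i x y' z w =>
    act (ldev φ i y) stdPsi ![x, y', z, w] with hG
  set e : Fin 7 → Fin 7 → Fin 7 → Fin 7 → Fin 7 → ℝ := fun i x y' z w =>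
    (epsZ i x y' z w a b : ℝ) with he
  have h1 : ∀ i x y' z w : Fin 7, ∑ s : Fin 5, (-1) ^ (s : ℕ) *
      act (ldev φ (![i, x, y', z, w] s) y) stdPsi (fun r => ![i, x, y', z, w] (s.succAbove r)) =
      G i x y' z w - G x i y' z w + G y' i x z w - G z i x y' w + G w i x y' z := by
    intro i x y' z w
    have c0 : (fun r => ![i, x, y', z, w] (Fin.succAbove 0 r)) = ![x, y', z, w] := by
      ext r; fin_cases r <;> rfl
    have c1 : (fun r => ![i, x, y', z, w] (Fin.succAbove 1 r)) = ![i, y', z, w] := by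
      ext r; fin_cases r <;> rfl
    have c2 : (fun r => ![i, x, y', z, w] (Fin.succAbove 2 r)) = ![i, x, z, w] := by
      ext r; fin_cases r <;> rfl
    have c3 : (fun r => ![i, x, y', z, w] (Fin.succAbove 3 r)) = ![i, x, y', w] := by
      ext r; fin_cases r <;> rfl
    have c4 : (fun r => ![i, x, y', z, w] (Fin.succAbove 4 r)) = ![i, x, y', z] := by
      ext r; fin_cases r <;> rfl
    rw [Fin.sum_univ_five, c0, c1, c2, c3, c4]
    simp [hG]
    ring
  simp only [h1, append_five_two, leviCivita_eq, one_mul]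
  have e12 : ∀ i x y' z w, e x i y' z w = -e i x y' z w := fun i x y' z w => by
    simp only [he, epsZ, ltSign_swap i x]; push_cast; ring
  have e23 : ∀ i x y' z w, e i y' x z w = -e i x y' z w := fun i x y' z w => by
    simp only [he, epsZ, ltSign_swap x y']; push_cast; ring
  have e34 : ∀ i x y' z w, e i x z y' w = -e i x y' z w := fun i x y' z w => by
    simp only [he, epsZ, ltSign_swap y' z]; push_cast; ring
  have e45 : ∀ i x y' z w, e i x y' w z = -e i x y' z w := fun i x y' z w => by
    simp only [he, epsZ, ltSign_swap z w]; push_cast; ring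
  have h2 : ∑ i, ∑ x, ∑ y', ∑ z, ∑ w, (G i x y' z w - G x i y' z w + G y' i x z w - G z i x y' w
      + G w i x y' z) * (epsZ i x y' z w a b : ℝ) =
      5 * ∑ i, ∑ x, ∑ y', ∑ z, ∑ w, G i x y' z w * e i x y' z w := sum_alt5 e12 e23 e34 e45 G
  have h3 : ∀ i, ∑ x, ∑ y', ∑ z, ∑ w, G i x y' z w * e i x y' z w =
      -(4 * ∑ x, ∑ y', ∑ z, ∑ w, ltor φ i x y * ph y' z w * e i x y' z w) := by
    intro i
    rw [← sum_alt4 (e := e i) (e23 i) (e34 i) (e45 i)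
      (g := fun x y' z w => ltor φ i x y * ph y' z w)]
    simp only [← Finset.sum_neg_distrib]
    refine Finset.sum_congr rfl fun x _ => Finset.sum_congr rfl fun y' _ =>
      Finset.sum_congr rfl fun z _ => Finset.sum_congr rfl fun w _ => ?_
    simp only [hG, act_stdPsi_of_skew (hφ.ldev_skew hy i), ltor]
    ring
  have h4 : ∀ i x, ∑ y', ∑ z, ∑ w, ltor φ i x y * ph y' z w * e i x y' z w =
      6 * (ltor φ i x y * ps i x a b) := by
    intro i x
    have h5 : ∑ y', ∑ z, ∑ w, ph y' z w * e i x y' z w = 6 * ps i x a b := by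
      simp only [ph, ps, he, epsZ_move i x]
      exact_mod_cast phiZ_epsZ i x a b
    simp only [mul_assoc, ← Finset.mul_sum]
    rw [h5]; ring
  rw [h2]
  simp only [h3, h4, Finset.sum_neg_distrib, ← Finset.mul_sum]
  simp [Nat.factorial]
  ring

/-- By `pderiv_eq` the derivatives of `φ` split into a Christoffel and a torsion part. The former
drops out of `dφ` by symmetry, so closedness is a purely algebraic condition on the torsion. -/
theorem IsClosedG2On.sum_ltor_eq_zero (hφ : IsClosedG2On Ω φ) (hy : y ∈ Ω) (i j k l : Fin 7) :
    ∑ m, ltor φ i m y * ps m j k l - ∑ m, ltor φ j m y * ps m i k l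
      + ∑ m, ltor φ k m y * ps m i j l - ∑ m, ltor φ l m y * ps m i j k = 0 := by
  have h1 := hφ.closed y hy ![i, j, k, l]
  have h2 := sum_act_lconn isAlt_std φ y ![i, j, k, l]
  have c0 : (fun r => ![i, j, k, l] (Fin.succAbove 0 r)) = ![j, k, l] := by
    ext r; fin_cases r <;> rfl
  have c1 : (fun r => ![i, j, k, l] (Fin.succAbove 1 r)) = ![i, k, l] := by
    ext r; fin_cases r <;> rfl
  have c2 : (fun r => ![i, j, k, l] (Fin.succAbove 2 r)) = ![i, j, l] := by
    ext r; fin_cases r <;> rfl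
  have c3 : (fun r => ![i, j, k, l] (Fin.succAbove 3 r)) = ![i, j, k] := by
    ext r; fin_cases r <;> rfl
  rw [extD, Fin.sum_univ_four, c0, c1, c2, c3] at h1
  rw [Fin.sum_univ_four, c0, c1, c2, c3] at h2
  have q : ∀ i j k l : Fin 7, pderiv i (fun z => φ z ![j, k, l]) y =
      act (lconn φ i y) std ![j, k, l] + ∑ m, ltor φ i m y * ps m j k l := hφ.pderiv_eq hy
  simp at h1 h2
  rw [q, q, q, q] at h1
  linarith

theorem IsClosedG2On.ltor_algebra (hφ : IsClosedG2On Ω φ) (hy : y ∈ Ω) :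
    (∀ i j, ltor φ j i y = -ltor φ i j y) ∧
    (∀ i j, ∑ m, ∑ n, ltor φ m n y * ps i j m n = -2 * ltor φ i j y) ∧
      ∀ k, ∑ i, ∑ j, ph k i j * ltor φ i j y = 0 :=
  torsion_algebra (hφ.sum_ltor_eq_zero hy)

/-- The contraction with `ψ` in `leq_tau` has eigenvalue `-2` on the torsion of a closed structure.
-/
theorem leq_tau_torsion (a b : Fin 7) : LEq 1 (fun φ y => tau φ y ![a, b]) fun φ y =>
    -2 * ltor φ a b y :=
  (leq_tau a b).congr_right fun Ω φ hφ y hy => by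
    rw [← (hφ.ltor_algebra hy).2.1 a b]
    exact Finset.sum_congr rfl fun i _ => Finset.sum_congr rfl fun j _ => by rw [ps_pair a b i j]

end

section

/-! ### Identities for the linearized torsion and curvature -/

variable {Ω : Set E7} {φ α : CoordTensor 3} {y : E7}

/-- The vector part of a `3`-form. -/
def lvec (α : CoordTensor 3) (j : Fin 7) (y : E7) : ℝ := skewVec (sec (α y)) j

/-- The linearized Ricci curvature. -/
def lric (α : CoordTensor 3) (j l : Fin 7) (y : E7) : ℝ := ∑ k, lcur α k j k l y

/-- The second derivatives of the linearized metric. -/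
def lmet2 (α : CoordTensor 3) (a b p q : Fin 7) (y : E7) : ℝ := pderiv a (pderiv b (lmet α p q)) y

/-- The Laplacian of the coordinate metric. -/
def lap (f : E7 → ℝ) (y : E7) : ℝ := ∑ a, pderiv a (pderiv a f) y

theorem pderiv_half_comb {f g h k : E7 → ℝ} (hf : DifferentiableAt ℝ f y)
    (hg : DifferentiableAt ℝ g y) (hh : DifferentiableAt ℝ h y) (hk : DifferentiableAt ℝ k y)
    (i : Fin 7) : pderiv i (fun z => (1 / 2) * (f z - g z - h z + k z)) y =
      (1 / 2) * (pderiv i f y - pderiv i g y - pderiv i h y + pderiv i k y) := by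
  rw [pderiv_const_mul _ (((hf.fun_sub hg).fun_sub hh).fun_add hk),
    pderiv_add ((hf.fun_sub hg).fun_sub hh) hk, pderiv_sub (hf.fun_sub hg) hh, pderiv_sub hf hg]

theorem SmoothOn.sec (hα : SmoothOn Ω α) (p l : Fin 7) :
    ContDiffOn ℝ ∞ (fun z => sec (α z) p l) Ω :=
  (secL p l).contDiff.comp_contDiffOn (contDiffOn_pi.2 hα)

theorem SmoothOn.lmet (hα : SmoothOn Ω α) (p l : Fin 7) : ContDiffOn ℝ ∞ (lmet α p l) Ω :=
  (hα.sec p l).add (hα.sec l p)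

theorem SmoothOn.lvec (hα : SmoothOn Ω α) (j : Fin 7) : ContDiffOn ℝ ∞ (lvec α j) Ω :=
  contDiffOn_const.mul (ContDiffOn.sum fun p _ => ContDiffOn.sum fun q _ =>
    contDiffOn_const.mul (hα.sec p q))

theorem SmoothOn.lmet2 (hα : SmoothOn Ω α) (hΩ : IsOpen Ω) (a b p q : Fin 7) :
    ContDiffOn ℝ ∞ (lmet2 α a b p q) Ω :=
  contDiffOn_pderiv hΩ (contDiffOn_pderiv hΩ (hα.lmet p q))

theorem SmoothOn.lchr (hα : SmoothOn Ω α) (hΩ : IsOpen Ω) (m i j : Fin 7) :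
    ContDiffOn ℝ ∞ (lchr α m i j) Ω :=
  contDiffOn_const.mul (((contDiffOn_pderiv hΩ (hα.lmet j m)).add
    (contDiffOn_pderiv hΩ (hα.lmet i m))).sub (contDiffOn_pderiv hΩ (hα.lmet i j)))

theorem SmoothOn.ltor (hα : SmoothOn Ω α) (hΩ : IsOpen Ω) (i j : Fin 7) :
    ContDiffOn ℝ ∞ (ltor α i j) Ω :=
  contDiffOn_const.mul (ContDiffOn.sum fun p _ => ContDiffOn.sum fun q _ =>
    contDiffOn_const.mul ((contDiffOn_pderiv hΩ (hα.sec p q)).sub (hα.lchr hΩ p i q)))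

theorem SmoothOn.lcur (hα : SmoothOn Ω α) (hΩ : IsOpen Ω) (i j k l : Fin 7) :
    ContDiffOn ℝ ∞ (lcur α i j k l) Ω :=
  (contDiffOn_pderiv hΩ (hα.lchr hΩ k j l)).sub (contDiffOn_pderiv hΩ (hα.lchr hΩ k i l))

theorem SmoothOn.lric (hα : SmoothOn Ω α) (hΩ : IsOpen Ω) (j l : Fin 7) :
    ContDiffOn ℝ ∞ (lric α j l) Ω := ContDiffOn.sum fun k _ => hα.lcur hΩ k j k l

theorem SmoothOn.lmet2_comm (hα : SmoothOn Ω α) (hΩ : IsOpen Ω) (hy : y ∈ Ω) (a b p q : Fin 7) :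
    G2.lmet2 α a b p q y = G2.lmet2 α b a p q y := pderiv_comm hΩ (hα.lmet p q) hy

theorem lmet2_symm (a b p q : Fin 7) : lmet2 α a b p q = lmet2 α a b q p := by
  ext z; simp only [lmet2, lmet_comm α p q]

theorem SmoothOn.lcur_eq (hα : SmoothOn Ω α) (hΩ : IsOpen Ω) (hy : y ∈ Ω) (i j k l : Fin 7) :
    G2.lcur α i j k l y = (1 / 2) * (G2.lmet2 α i l j k y - G2.lmet2 α i k j l y
      - G2.lmet2 α j l i k y + G2.lmet2 α j k i l y) := by
  have h : ∀ a m i j, pderiv a (G2.lchr α m i j) y =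
      (1 / 2) * (G2.lmet2 α a i j m y + G2.lmet2 α a j i m y - G2.lmet2 α a m i j y) := by
    intro a m i j
    have d : ∀ b p q, DifferentiableAt ℝ (pderiv b (G2.lmet α p q)) y := fun b p q =>
      differentiableAt_of_contDiffOn hΩ (contDiffOn_pderiv hΩ (hα.lmet p q)) hy
    have e : pderiv a (G2.lchr α m i j) y = (1 / 2) * pderiv a (fun z =>
        pderiv i (G2.lmet α j m) z + pderiv j (G2.lmet α i m) z - pderiv m (G2.lmet α i j) z) y :=
      pderiv_const_mul _ (((d i j m).add (d j i m)).sub (d m i j))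
    rw [e, pderiv_sub ((d i j m).fun_add (d j i m)) (d m i j), pderiv_add (d i j m) (d j i m)]
    rfl
  rw [G2.lcur, h, h, hα.lmet2_comm hΩ hy j i l k]
  ring

theorem SmoothOn.pderiv_lcur (hα : SmoothOn Ω α) (hΩ : IsOpen Ω) (hy : y ∈ Ω) (a i j k l : Fin 7) :
    pderiv a (G2.lcur α i j k l) y = (1 / 2) * (pderiv a (G2.lmet2 α i l j k) y
      - pderiv a (G2.lmet2 α i k j l) y - pderiv a (G2.lmet2 α j l i k) y
      + pderiv a (G2.lmet2 α j k i l) y) := by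
  have d : ∀ a b p q, DifferentiableAt ℝ (G2.lmet2 α a b p q) y := fun a b p q =>
    differentiableAt_of_contDiffOn hΩ (hα.lmet2 hΩ a b p q) hy
  rw [pderiv_congr hΩ hy (fun z hz => hα.lcur_eq hΩ hz i j k l),
    pderiv_half_comb (d _ _ _ _) (d _ _ _ _) (d _ _ _ _) (d _ _ _ _)]

theorem SmoothOn.pderiv_pderiv_lcur (hα : SmoothOn Ω α) (hΩ : IsOpen Ω) (hy : y ∈ Ω)
    (a b i j k l : Fin 7) :
    pderiv b (pderiv a (G2.lcur α i j k l)) y = (1 / 2) * (pderiv b (pderiv a (G2.lmet2 α i l j k)) y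
      - pderiv b (pderiv a (G2.lmet2 α i k j l)) y - pderiv b (pderiv a (G2.lmet2 α j l i k)) y
      + pderiv b (pderiv a (G2.lmet2 α j k i l)) y) := by
  have d : ∀ b c p q, DifferentiableAt ℝ (pderiv a (G2.lmet2 α b c p q)) y := fun b c p q =>
    differentiableAt_of_contDiffOn hΩ (contDiffOn_pderiv hΩ (hα.lmet2 hΩ b c p q)) hy
  rw [pderiv_congr hΩ hy (fun z hz => hα.pderiv_lcur hΩ hz a i j k l),
    pderiv_half_comb (d _ _ _ _) (d _ _ _ _) (d _ _ _ _) (d _ _ _ _)]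

theorem sum_ph_swap (j : Fin 7) (f : Fin 7 → Fin 7 → ℝ) :
    ∑ p, ∑ q, ph j p q * f q p = -∑ p, ∑ q, ph j p q * f p q := by
  rw [Finset.sum_comm]
  simp only [← Finset.sum_neg_distrib]
  exact Finset.sum_congr rfl fun p _ => Finset.sum_congr rfl fun q _ => by
    rw [ph_swap23 j p q]; ring

theorem sum_ph_symm (j : Fin 7) {f : Fin 7 → Fin 7 → ℝ} (hf : ∀ p q, f p q = f q p) :
    ∑ p, ∑ q, ph j p q * f p q = 0 := by
  have h := sum_ph_swap j f
  have h2 : ∑ p, ∑ q, ph j p q * f q p = ∑ p, ∑ q, ph j p q * f p q :=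
    Finset.sum_congr rfl fun p _ => Finset.sum_congr rfl fun q _ => by rw [hf p q]
  linarith

/-- The linearized torsion is the gradient of the vector part plus half a curl of the linearized
metric. The term of the Christoffel symbol that is symmetric in `p, q` is killed by the skew `φ`. In
this form identities for the torsion reduce to symmetry of second derivatives. -/
theorem SmoothOn.ltor_eq (hα : SmoothOn Ω α) (hΩ : IsOpen Ω) (hy : y ∈ Ω) (i j : Fin 7) :
    G2.ltor α i j y = pderiv i (G2.lvec α j) y
      + (1 / 2) * ∑ p, ∑ q, ph j p q * pderiv q (G2.lmet α i p) y := by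
  have d : ∀ p q, DifferentiableAt ℝ (fun z => G2.sec (α z) p q) y := fun p q =>
    differentiableAt_of_contDiffOn hΩ (hα.sec p q) hy
  have h1 : pderiv i (G2.lvec α j) y =
      -(1 / 2) * ∑ p, ∑ q, ph j p q * pderiv i (fun z => G2.sec (α z) p q) y := by
    have e : pderiv i (G2.lvec α j) y = -(1 / 2) * pderiv i (fun z =>
        ∑ p, ∑ q, ph j p q * G2.sec (α z) p q) y :=
      pderiv_const_mul _ (DifferentiableAt.fun_sum fun p _ => DifferentiableAt.fun_sum fun q _ =>
        (d p q).const_mul _)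
    rw [e, pderiv_sum _ fun p _ => DifferentiableAt.fun_sum fun q _ => (d p q).const_mul _]
    congr 1
    refine Finset.sum_congr rfl fun p _ => ?_
    rw [pderiv_sum _ fun q _ => (d p q).const_mul _]
    exact Finset.sum_congr rfl fun q _ => pderiv_const_mul _ (d p q)
  have h2 : G2.ltor α i j y = -(1 / 2) * (∑ p, ∑ q, ph j p q * pderiv i (fun z => G2.sec (α z) p q) y
      - ∑ p, ∑ q, ph j p q * G2.lchr α p i q y) := by
    simp only [G2.ltor, skewVec, ldev, Matrix.of_apply, ← Finset.sum_sub_distrib, mul_sub]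
  have h3 : ∑ p, ∑ q, ph j p q * G2.lchr α p i q y =
      (1 / 2) * (∑ p, ∑ q, ph j p q * pderiv i (G2.lmet α q p) y
        + ∑ p, ∑ q, ph j p q * pderiv q (G2.lmet α i p) y
        - ∑ p, ∑ q, ph j p q * pderiv p (G2.lmet α i q) y) := by
    simp only [← Finset.sum_sub_distrib, ← Finset.sum_add_distrib, Finset.mul_sum, G2.lchr]
    exact Finset.sum_congr rfl fun p _ => Finset.sum_congr rfl fun q _ => by ring
  have h4 : ∑ p, ∑ q, ph j p q * pderiv i (G2.lmet α q p) y = 0 :=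
    sum_ph_symm j fun p q => by rw [lmet_comm]
  have h5 := sum_ph_swap j fun p q => pderiv q (G2.lmet α i p) y
  rw [h2, h1, h3, h4, h5]
  ring

theorem SmoothOn.pderiv_ltor (hα : SmoothOn Ω α) (hΩ : IsOpen Ω) (hy : y ∈ Ω) (a i j : Fin 7) :
    pderiv a (G2.ltor α i j) y = pderiv a (pderiv i (G2.lvec α j)) y
      + (1 / 2) * ∑ p, ∑ q, ph j p q * G2.lmet2 α a q i p y := by
  have d : ∀ q p, DifferentiableAt ℝ (pderiv q (G2.lmet α i p)) y := fun q p =>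
    differentiableAt_of_contDiffOn hΩ (contDiffOn_pderiv hΩ (hα.lmet i p)) hy
  have d2 : DifferentiableAt ℝ (fun z => ∑ p, ∑ q, ph j p q * pderiv q (G2.lmet α i p) z) y :=
    DifferentiableAt.fun_sum fun p _ => DifferentiableAt.fun_sum fun q _ => (d q p).const_mul _
  have d1 : DifferentiableAt ℝ (pderiv i (G2.lvec α j)) y :=
    differentiableAt_of_contDiffOn hΩ (contDiffOn_pderiv hΩ (hα.lvec j)) hy
  rw [pderiv_congr hΩ hy (fun z hz => hα.ltor_eq hΩ hz i j), pderiv_add d1 (d2.const_mul _),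
    pderiv_const_mul _ d2,
    pderiv_sum _ fun p _ => DifferentiableAt.fun_sum fun q _ => (d q p).const_mul _]
  congr 2
  refine Finset.sum_congr rfl fun p _ => ?_
  rw [pderiv_sum _ fun q _ => (d q p).const_mul _]
  exact Finset.sum_congr rfl fun q _ => pderiv_const_mul _ (d q p)

/-- The curl of the linearized torsion is a contraction of the linearized curvature. -/
theorem SmoothOn.curl_ltor (hα : SmoothOn Ω α) (hΩ : IsOpen Ω) (hy : y ∈ Ω) (i j m : Fin 7) :
    pderiv i (G2.ltor α j m) y - pderiv j (G2.ltor α i m) y =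
      (1 / 2) * ∑ l, ∑ p, ph m l p * G2.lcur α i j l p y := by
  rw [hα.pderiv_ltor hΩ hy, hα.pderiv_ltor hΩ hy, pderiv_comm hΩ (hα.lvec m) hy]
  have h1 : ∑ l, ∑ p, ph m l p * G2.lcur α i j l p y = (1 / 2) * (
      ∑ l, ∑ p, ph m l p * G2.lmet2 α i p j l y - ∑ l, ∑ p, ph m l p * G2.lmet2 α i l j p y
      - ∑ l, ∑ p, ph m l p * G2.lmet2 α j p i l y + ∑ l, ∑ p, ph m l p * G2.lmet2 α j l i p y) := by
    simp only [← Finset.sum_sub_distrib, ← Finset.sum_add_distrib, Finset.mul_sum,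
      hα.lcur_eq hΩ hy]
    exact Finset.sum_congr rfl fun p _ => Finset.sum_congr rfl fun q _ => by ring
  have h2 := sum_ph_swap m fun l p => G2.lmet2 α i p j l y
  have h3 := sum_ph_swap m fun l p => G2.lmet2 α j p i l y
  rw [h1, h2, h3]
  ring

theorem SmoothOn.lric_eq (hα : SmoothOn Ω α) (hΩ : IsOpen Ω) (hy : y ∈ Ω) (j l : Fin 7) :
    G2.lric α j l y = ∑ k, (1 / 2) * (G2.lmet2 α k l j k y - G2.lmet2 α k k j l y
      - G2.lmet2 α j l k k y + G2.lmet2 α j k k l y) :=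
  Finset.sum_congr rfl fun k _ => hα.lcur_eq hΩ hy k j k l

theorem SmoothOn.lric_symm (hα : SmoothOn Ω α) (hΩ : IsOpen Ω) (hy : y ∈ Ω) (j l : Fin 7) :
    G2.lric α j l y = G2.lric α l j y := by
  rw [hα.lric_eq hΩ hy, hα.lric_eq hΩ hy]
  refine Finset.sum_congr rfl fun k _ => ?_
  rw [hα.lmet2_comm hΩ hy k l, lmet2_symm l k j k, hα.lmet2_comm hΩ hy j k, lmet2_symm k j k l,
    lmet2_symm k k j l, hα.lmet2_comm hΩ hy j l]
  ring

theorem IsClosedG2On.pderiv_ltor_skew (hφ : IsClosedG2On Ω φ) (hy : y ∈ Ω) (a i j : Fin 7) :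
    pderiv a (ltor φ j i) y = -pderiv a (ltor φ i j) y := by
  rw [← pderiv_neg]
  exact pderiv_congr hφ.isOpen hy fun z hz => (hφ.ltor_algebra hz).1 i j

theorem IsClosedG2On.sum_ph_pderiv_ltor (hφ : IsClosedG2On Ω φ) (hy : y ∈ Ω) (a k : Fin 7) :
    ∑ i, ∑ j, ph k i j * pderiv a (ltor φ i j) y = 0 := by
  have d : ∀ i j, DifferentiableAt ℝ (ltor φ i j) y := fun i j =>
    differentiableAt_of_contDiffOn hφ.isOpen (hφ.smooth.ltor hφ.isOpen i j) hy
  have h := pderiv_congr (i := a) hφ.isOpen hy fun z hz => (hφ.ltor_algebra hz).2.2 k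
  rw [pderiv_const, pderiv_sum _ fun p _ => DifferentiableAt.fun_sum fun q _ =>
    (d p q).const_mul _] at h
  rw [← h]
  refine Finset.sum_congr rfl fun p _ => ?_
  rw [pderiv_sum _ fun q _ => (d p q).const_mul _]
  exact Finset.sum_congr rfl fun q _ => (pderiv_const_mul _ (d p q)).symm

/-- The linearized Ricci curvature in terms of the linearized torsion. -/
theorem IsClosedG2On.sum_ph_pderiv_ltor_eq (hφ : IsClosedG2On Ω φ) (hy : y ∈ Ω) (i j : Fin 7) :
    ∑ m, ∑ n, ph j m n * pderiv m (ltor φ i n) y = -lric φ i j y := by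
  have hs := hφ.smooth
  have hΩ := hφ.isOpen
  -- `curl_ltor` exchanges the derivative index with the first torsion index. The exchanged term
  -- vanishes because the torsion has no `7`-dimensional part, so only a contraction of curvature
  -- with two factors `φ` is left.
  have h1 : ∀ m n, ph j m n * pderiv m (ltor φ i n) y = ph j m n * pderiv i (ltor φ m n) y +
      (1 / 2) * ∑ l, ∑ p, (ph j m n * ph l p n) * lcur φ m i l p y := by
    intro m n
    have h := hs.curl_ltor hΩ hy m i n
    have e : ∑ l, ∑ p, (ph j m n * ph l p n) * lcur φ m i l p y =
        ph j m n * ∑ l, ∑ p, ph n l p * lcur φ m i l p y := by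
      simp only [Finset.mul_sum]
      exact Finset.sum_congr rfl fun l _ => Finset.sum_congr rfl fun p _ => by
        rw [ph_rot n l p]; ring
    rw [e]
    linear_combination ph j m n * h
  simp only [h1, Finset.sum_add_distrib, hφ.sum_ph_pderiv_ltor hy, zero_add, ← Finset.mul_sum]
  have h2 : ∀ m, ∑ n, ∑ l, ∑ p, (ph j m n * ph l p n) * lcur φ m i l p y = ∑ l, ∑ p,
      (dl j l * (dl m p * lcur φ m i l p y) - dl m l * (dl j p * lcur φ m i l p y)
        + ps j m l p * lcur φ m i l p y) := by
    intro m
    rw [← sum3_front fun l p n => (ph j m n * ph l p n) * lcur φ m i l p y]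
    refine Finset.sum_congr rfl fun l _ => Finset.sum_congr rfl fun p _ => ?_
    rw [← Finset.sum_mul, ph_ph]
    ring
  simp only [h2, Finset.sum_add_distrib, Finset.sum_sub_distrib, ← Finset.mul_sum, sum_dl_mul]
  -- The first Bianchi identity: each of the four second derivatives in the curvature is symmetric
  -- in two of the indices `m, l, p`, in which `ψ` is skew.
  have h3 : ∑ m, ∑ l, ∑ p, ps j m l p * lcur φ m i l p y = 0 := by
    have s1 : ∀ f : Fin 7 → Fin 7 → Fin 7 → ℝ, (∀ m l p, f m l p = f p l m) →
        ∑ m, ∑ l, ∑ p, ps j m l p * f m l p = 0 := by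
      intro f hf
      have : ∑ m, ∑ l, ∑ p, ps j m l p * f m l p = -∑ m, ∑ l, ∑ p, ps j m l p * f m l p := by
        conv_lhs => rw [sum3_front fun m l p => ps j m l p * f m l p]
        simp only [← Finset.sum_neg_distrib]
        refine Finset.sum_congr rfl fun m _ => ?_
        rw [Finset.sum_comm]
        refine Finset.sum_congr rfl fun l _ => Finset.sum_congr rfl fun p _ => ?_
        rw [hf p l m, ps_swap23 j l p m, ps_swap34 j l m p, ps_swap23 j m l p]
        ring
      linarith
    have s2 : ∀ f : Fin 7 → Fin 7 → Fin 7 → ℝ, (∀ m l p, f m l p = f l m p) →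
        ∑ m, ∑ l, ∑ p, ps j m l p * f m l p = 0 := by
      intro f hf
      have : ∑ m, ∑ l, ∑ p, ps j m l p * f m l p = -∑ m, ∑ l, ∑ p, ps j m l p * f m l p := by
        conv_lhs => rw [Finset.sum_comm]
        simp only [← Finset.sum_neg_distrib]
        refine Finset.sum_congr rfl fun m _ => Finset.sum_congr rfl fun l _ =>
          Finset.sum_congr rfl fun p _ => ?_
        rw [hf l m p, ps_swap23 j m l p]
        ring
      linarith
    have e : ∑ m, ∑ l, ∑ p, ps j m l p * lcur φ m i l p y = (1 / 2) * (
        ∑ m, ∑ l, ∑ p, ps j m l p * lmet2 φ m p i l y - ∑ m, ∑ l, ∑ p, ps j m l p * lmet2 φ m l i p y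
        - ∑ m, ∑ l, ∑ p, ps j m l p * lmet2 φ i p m l y
        + ∑ m, ∑ l, ∑ p, ps j m l p * lmet2 φ i l m p y) := by
      simp only [← Finset.sum_sub_distrib, ← Finset.sum_add_distrib, Finset.mul_sum,
        hs.lcur_eq hΩ hy]
      exact Finset.sum_congr rfl fun m _ => Finset.sum_congr rfl fun p _ =>
        Finset.sum_congr rfl fun q _ => by ring
    rw [e, s1 (fun m l p => lmet2 φ m p i l y) fun m l p => hs.lmet2_comm hΩ hy m p i l,
      s2 (fun m l p => lmet2 φ m l i p y) fun m l p => hs.lmet2_comm hΩ hy m l i p,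
      s2 (fun m l p => lmet2 φ i p m l y) fun m l p => by rw [lmet2_symm],
      s1 (fun m l p => lmet2 φ i l m p y) fun m l p => by rw [lmet2_symm]]
    ring
  have h4 : ∑ m, lcur φ m i j m y = -lric φ i j y := by
    rw [lric, ← Finset.sum_neg_distrib]
    refine Finset.sum_congr rfl fun m _ => ?_
    rw [hs.lcur_eq hΩ hy, hs.lcur_eq hΩ hy]
    ring
  rw [h3, h4]
  simp only [lric]
  ring


/-- The trace of `ltor_eq` shows that the vector part is divergence free. By skewness the divergence
may be taken over the second index of the torsion; there the gradient term is a derivative of that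
zero divergence, and the curl term vanishes because second derivatives commute. -/
theorem IsClosedG2On.sum_pderiv_ltor (hφ : IsClosedG2On Ω φ) (hy : y ∈ Ω) (j : Fin 7) :
    ∑ i, pderiv i (ltor φ i j) y = 0 := by
  have hs := hφ.smooth
  have hΩ := hφ.isOpen
  have hdiv : ∀ z ∈ Ω, ∑ i, pderiv i (lvec φ i) z = 0 := by
    intro z hz
    have h1 : ∑ i, ltor φ i i z = 0 := by
      refine Finset.sum_eq_zero fun i _ => ?_
      linarith [(hφ.ltor_algebra hz).1 i i]
    have h2 : ∑ i, ∑ p, ∑ q, ph i p q * pderiv q (lmet φ i p) z = 0 := by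
      rw [sum3_front]
      refine Finset.sum_eq_zero fun q _ => ?_
      rw [← sum_ph_symm q (f := fun i p => pderiv q (lmet φ i p) z)
        fun i p => by rw [lmet_comm]]
      exact Finset.sum_congr rfl fun i _ => Finset.sum_congr rfl fun p _ => by rw [← ph_rot q i p]
    simp only [hs.ltor_eq hΩ hz, Finset.sum_add_distrib, ← Finset.mul_sum, h2] at h1
    linarith
  have h1 : ∑ i, pderiv i (ltor φ i j) y = -∑ i, pderiv i (ltor φ j i) y := by
    rw [← Finset.sum_neg_distrib]
    exact Finset.sum_congr rfl fun i _ => hφ.pderiv_ltor_skew hy i j i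
  have h2 : ∑ i, ∑ p, ∑ q, ph i p q * lmet2 φ i q j p y = 0 := by
    have : ∑ i, ∑ p, ∑ q, ph i p q * lmet2 φ i q j p y =
        ∑ p, -∑ i, ∑ q, ph p i q * lmet2 φ i q j p y := by
      rw [Finset.sum_comm]
      refine Finset.sum_congr rfl fun p _ => ?_
      simp only [← Finset.sum_neg_distrib]
      exact Finset.sum_congr rfl fun i _ => Finset.sum_congr rfl fun q _ => by
        rw [ph_swap12 p i q]; ring
    rw [this]
    refine Finset.sum_eq_zero fun p _ => ?_
    rw [sum_ph_symm p (f := fun i q => lmet2 φ i q j p y)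
      fun i q => hs.lmet2_comm hΩ hy i q j p, neg_zero]
  have h3 : ∑ i, pderiv i (pderiv j (lvec φ i)) y = 0 := by
    have e : ∀ i, pderiv i (pderiv j (lvec φ i)) y = pderiv j (pderiv i (lvec φ i)) y :=
      fun i => pderiv_comm hΩ (hs.lvec i) hy
    simp only [e]
    rw [← pderiv_sum _ fun i _ => differentiableAt_of_contDiffOn hΩ
      (contDiffOn_pderiv hΩ (hs.lvec i)) hy, pderiv_congr hΩ hy hdiv, pderiv_const]
  rw [h1]
  simp only [hs.pderiv_ltor hΩ hy, Finset.sum_add_distrib, ← Finset.mul_sum, h2, h3]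
  ring

/-- The linearization of `d* φ`. -/
def ltau (φ : CoordTensor 3) : CoordTensor 2 := fun y J => -2 * ltor φ (J 0) (J 1) y

/-- The linearization of the velocity `d d* φ` of the flow. -/
def lflow (φ : CoordTensor 3) : CoordTensor 3 := extD (ltau φ)

theorem IsClosedG2On.smooth_lflow (hφ : IsClosedG2On Ω φ) : SmoothOn Ω (lflow φ) :=
  smooth_extD hφ.isOpen fun J => contDiffOn_const.mul (hφ.smooth.ltor hφ.isOpen (J 0) (J 1))

theorem IsClosedG2On.lflow_eq (hφ : IsClosedG2On Ω φ) (hy : y ∈ Ω) (i m n : Fin 7) :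
    lflow φ y ![i, m, n] = -2 * (pderiv i (ltor φ m n) y - pderiv m (ltor φ i n) y
      + pderiv n (ltor φ i m) y) := by
  have d : ∀ i j, DifferentiableAt ℝ (ltor φ i j) y := fun i j =>
    differentiableAt_of_contDiffOn hφ.isOpen (hφ.smooth.ltor hφ.isOpen i j) hy
  have h : ∀ a i j, pderiv a (fun z => ltau φ z ![i, j]) y = -2 * pderiv a (ltor φ i j) y :=
    fun a i j => pderiv_const_mul _ (d i j)
  have c0 : (fun r => ![i, m, n] (Fin.succAbove 0 r)) = ![m, n] := by
    ext r; fin_cases r <;> rfl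
  have c1 : (fun r => ![i, m, n] (Fin.succAbove 1 r)) = ![i, n] := by
    ext r; fin_cases r <;> rfl
  have c2 : (fun r => ![i, m, n] (Fin.succAbove 2 r)) = ![i, m] := by
    ext r; fin_cases r <;> rfl
  rw [lflow, extD, Fin.sum_univ_three, c0, c1, c2]
  simp
  rw [h, h, h]
  ring

/-- Of the three terms of `d`, the one differentiating in the direction `i` is the `7`-part of the
torsion and vanishes. The other two agree up to relabelling, and each is a curl of torsion, hence a
Ricci term. -/
theorem IsClosedG2On.contrPhi_lflow (hφ : IsClosedG2On Ω φ) (hy : y ∈ Ω) (i j : Fin 7) :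
    contrPhi (lflow φ y) i j = -4 * lric φ i j y := by
  have h1 : contrPhi (lflow φ y) i j = -2 * (∑ m, ∑ n, ph j m n * pderiv i (ltor φ m n) y
      - ∑ m, ∑ n, ph j m n * pderiv m (ltor φ i n) y
      + ∑ m, ∑ n, ph j m n * pderiv n (ltor φ i m) y) := by
    simp only [contrPhi, hφ.lflow_eq hy, ← Finset.sum_sub_distrib, ← Finset.sum_add_distrib,
      Finset.mul_sum]
    exact Finset.sum_congr rfl fun m _ => Finset.sum_congr rfl fun n _ => by ring
  rw [h1, hφ.sum_ph_pderiv_ltor hy, sum_ph_swap j (fun m n => pderiv m (ltor φ i n) y),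
    hφ.sum_ph_pderiv_ltor_eq hy]
  ring

/-- The linearized scalar curvature is a doubly contracted curl of the torsion, which vanishes again
because the torsion has no `7`-part. The trace term in `sec` therefore does not contribute to the
flow. -/
theorem IsClosedG2On.sum_lric_self (hφ : IsClosedG2On Ω φ) (hy : y ∈ Ω) :
    ∑ i, lric φ i i y = 0 := by
  have h1 : ∑ i, lric φ i i y = -∑ i, ∑ m, ∑ n, ph i m n * pderiv m (ltor φ i n) y := by
    rw [← Finset.sum_neg_distrib]
    exact Finset.sum_congr rfl fun i _ => by rw [hφ.sum_ph_pderiv_ltor_eq hy]; ring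
  have h2 : ∑ i, ∑ m, ∑ n, ph i m n * pderiv m (ltor φ i n) y = 0 := by
    rw [Finset.sum_comm]
    refine Finset.sum_eq_zero fun m _ => ?_
    rw [← neg_zero, ← hφ.sum_ph_pderiv_ltor hy m m]
    simp only [← Finset.sum_neg_distrib]
    exact Finset.sum_congr rfl fun i _ => Finset.sum_congr rfl fun n _ => by
      rw [ph_swap12 m i n]; ring
  rw [h1, h2, neg_zero]

theorem IsClosedG2On.sec_lflow (hφ : IsClosedG2On Ω φ) (hy : y ∈ Ω) (i j : Fin 7) :
    sec (lflow φ y) i j = -lric φ i j y := by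
  simp only [sec, Matrix.of_apply, hφ.contrPhi_lflow hy, ← Finset.mul_sum, hφ.sum_lric_self hy]
  rw [hφ.smooth.lric_symm hφ.isOpen hy j i]
  ring

/-- At the linear level the metric evolves by Ricci flow. This is the reason for the heat equations
of torsion and curvature below. -/
theorem IsClosedG2On.lmet_lflow (hφ : IsClosedG2On Ω φ) (hy : y ∈ Ω) (i j : Fin 7) :
    lmet (lflow φ) i j y = -2 * lric φ i j y := by
  rw [lmet, hφ.sec_lflow hy, hφ.sec_lflow hy, hφ.smooth.lric_symm hφ.isOpen hy j i]
  ring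

/-- The matrix of the velocity is minus the Ricci curvature, hence symmetric; the flow has no
component that would rotate the form within a fixed metric. -/
theorem IsClosedG2On.lvec_lflow (hφ : IsClosedG2On Ω φ) (hy : y ∈ Ω) (j : Fin 7) :
    lvec (lflow φ) j y = 0 := by
  simp only [lvec, skewVec, hφ.sec_lflow hy]
  rw [sum_ph_symm j (f := fun p q => -lric φ p q y) fun p q => by
    rw [hφ.smooth.lric_symm hφ.isOpen hy p q]]
  ring

/-- The evolution of the linearized torsion. -/
theorem IsClosedG2On.ltor_lflow (hφ : IsClosedG2On Ω φ) (hy : y ∈ Ω) (j m : Fin 7) :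
    ltor (lflow φ) j m y = lap (ltor φ j m) y := by
  have hs := hφ.smooth
  have hΩ := hφ.isOpen
  have dm : ∀ a b p q, DifferentiableAt ℝ (lmet2 φ a b p q) y := fun a b p q =>
    differentiableAt_of_contDiffOn hΩ (hs.lmet2 hΩ a b p q) hy
  have dt : ∀ a i j, DifferentiableAt ℝ (pderiv a (ltor φ i j)) y := fun a i j =>
    differentiableAt_of_contDiffOn hΩ (contDiffOn_pderiv hΩ (hs.ltor hΩ i j)) hy
  have dc : ∀ i j k l, DifferentiableAt ℝ (lcur φ i j k l) y := fun i j k l =>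
    differentiableAt_of_contDiffOn hΩ (hs.lcur hΩ i j k l) hy
  have dr : ∀ i j, DifferentiableAt ℝ (lric φ i j) y := fun i j =>
    differentiableAt_of_contDiffOn hΩ (hs.lric hΩ i j) hy
  have m3 : ∀ c a b p q, pderiv c (lmet2 φ a b p q) y = pderiv c (lmet2 φ b a p q) y :=
    fun c a b p q => pderiv_congr hΩ hy fun z hz => hs.lmet2_comm hΩ hz a b p q
  have m4 : ∀ c a b p q, pderiv c (lmet2 φ a b p q) y = pderiv a (lmet2 φ c b p q) y :=
    fun c a b p q => pderiv_comm hΩ (contDiffOn_pderiv hΩ (hs.lmet p q)) hy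
  have m5 : ∀ c a b p q, pderiv c (lmet2 φ a b p q) y = pderiv c (lmet2 φ a b q p) y :=
    fun c a b p q => by rw [lmet2_symm]
  have hL : ltor (lflow φ) j m y = -∑ p, ∑ q, ph m p q * pderiv q (lric φ j p) y := by
    rw [hφ.smooth_lflow.ltor_eq hΩ hy, pderiv_congr hΩ hy (fun z hz => hφ.lvec_lflow hz m),
      pderiv_const, zero_add, Finset.mul_sum, ← Finset.sum_neg_distrib]
    refine Finset.sum_congr rfl fun p _ => ?_
    rw [Finset.mul_sum, ← Finset.sum_neg_distrib]
    refine Finset.sum_congr rfl fun q _ => ?_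
    rw [pderiv_congr hΩ hy (fun z hz => hφ.lmet_lflow hz j p), pderiv_const_mul _ (dr j p)]
    ring
  have hric : ∀ p q, pderiv q (lric φ j p) y = ∑ k, (1 / 2) * (pderiv q (lmet2 φ k p j k) y
      - pderiv q (lmet2 φ k k j p) y - pderiv q (lmet2 φ j p k k) y
      + pderiv q (lmet2 φ j k k p) y) := by
    intro p q
    have : pderiv q (lric φ j p) y = ∑ k, pderiv q (lcur φ k j k p) y :=
      pderiv_sum _ fun k _ => dc k j k p
    rw [this]
    exact Finset.sum_congr rfl fun k _ => hs.pderiv_lcur hΩ hy q k j k p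
  -- The curl identity turns `∂_i ∂_i T_{jm}` into `∂_j ∂_i T_{im}` plus a divergence of curvature.
  -- The first term vanishes since the torsion is divergence free.
  have hR : lap (ltor φ j m) y = (1 / 2) * ∑ i, ∑ l, ∑ p, ph m l p * pderiv i (lcur φ i j l p) y := by
    have h1 : ∀ i, pderiv i (pderiv i (ltor φ j m)) y = pderiv j (pderiv i (ltor φ i m)) y +
        (1 / 2) * ∑ l, ∑ p, ph m l p * pderiv i (lcur φ i j l p) y := by
      intro i
      have e : pderiv i (pderiv i (ltor φ j m)) y = pderiv i (fun z => pderiv j (ltor φ i m) z +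
          (1 / 2) * ∑ l, ∑ p, ph m l p * lcur φ i j l p z) y :=
        pderiv_congr hΩ hy fun z hz => by linarith [hs.curl_ltor hΩ hz i j m]
      have d2 : DifferentiableAt ℝ (fun z => ∑ l, ∑ p, ph m l p * lcur φ i j l p z) y :=
        DifferentiableAt.fun_sum fun l _ => DifferentiableAt.fun_sum fun p _ =>
          (dc i j l p).const_mul _
      rw [e, pderiv_add (dt j i m) (d2.const_mul _), pderiv_const_mul _ d2,
        pderiv_comm hΩ (hs.ltor hΩ i m) hy, pderiv_sum _ fun l _ =>
          DifferentiableAt.fun_sum fun p _ => (dc i j l p).const_mul _]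
      congr 2
      refine Finset.sum_congr rfl fun l _ => ?_
      rw [pderiv_sum _ fun p _ => (dc i j l p).const_mul _]
      exact Finset.sum_congr rfl fun p _ => pderiv_const_mul _ (dc i j l p)
    have h2 : ∑ i, pderiv j (pderiv i (ltor φ i m)) y = 0 := by
      rw [← pderiv_sum _ fun i _ => dt i i m,
        pderiv_congr hΩ hy (fun z hz => hφ.sum_pderiv_ltor hz m), pderiv_const]
    simp only [lap, h1, Finset.sum_add_distrib, h2, zero_add, ← Finset.mul_sum]
  have sw : ∀ f : Fin 7 → Fin 7 → ℝ, ∑ p, ∑ q, ph m p q * f q p = -∑ p, ∑ q, ph m p q * f p q :=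
    sum_ph_swap m
  -- Two of the four third-derivative terms of the Ricci curvature are symmetric in `p, q` and
  -- vanish against `φ`. The other two match the divergence computed in `l2`.
  have l1 : ∑ p, ∑ q, ph m p q * pderiv q (lric φ j p) y = (1 / 2) * ∑ k,
      (∑ p, ∑ q, ph m p q * pderiv q (lmet2 φ j k k p) y
        - ∑ p, ∑ q, ph m p q * pderiv q (lmet2 φ k k j p) y) := by
    have z1 : ∀ k, ∑ p, ∑ q, ph m p q * pderiv q (lmet2 φ k p j k) y = 0 := fun k =>
      sum_ph_symm m fun p q => by rw [m3 q k p, m4 q p k, m3 p k q]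
    have z2 : ∀ k, ∑ p, ∑ q, ph m p q * pderiv q (lmet2 φ j p k k) y = 0 := fun k =>
      sum_ph_symm m fun p q => by rw [m3 q j p, m4 q p j, m3 p j q]
    have e : ∑ p, ∑ q, ph m p q * pderiv q (lric φ j p) y = (1 / 2) * ∑ k,
        (∑ p, ∑ q, ph m p q * pderiv q (lmet2 φ k p j k) y
        - ∑ p, ∑ q, ph m p q * pderiv q (lmet2 φ k k j p) y
        - ∑ p, ∑ q, ph m p q * pderiv q (lmet2 φ j p k k) y
        + ∑ p, ∑ q, ph m p q * pderiv q (lmet2 φ j k k p) y) := by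
      simp only [hric, Finset.mul_sum, ← Finset.sum_sub_distrib, ← Finset.sum_add_distrib]
      rw [sum3_front]
      exact Finset.sum_congr rfl fun k _ => Finset.sum_congr rfl fun p _ =>
        Finset.sum_congr rfl fun q _ => by ring
    rw [e]
    congr 1
    exact Finset.sum_congr rfl fun k _ => by rw [z1, z2]; ring
  have l2 : ∑ i, ∑ l, ∑ p, ph m l p * pderiv i (lcur φ i j l p) y = ∑ k,
      (∑ p, ∑ q, ph m p q * pderiv q (lmet2 φ k k j p) y
        - ∑ p, ∑ q, ph m p q * pderiv q (lmet2 φ j k k p) y) := by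
    refine Finset.sum_congr rfl fun k _ => ?_
    have e : ∑ l, ∑ p, ph m l p * pderiv k (lcur φ k j l p) y = (1 / 2) *
        (∑ p, ∑ q, ph m p q * pderiv q (lmet2 φ k k j p) y
        - ∑ p, ∑ q, ph m p q * pderiv p (lmet2 φ k k j q) y
        - ∑ p, ∑ q, ph m p q * pderiv q (lmet2 φ j k k p) y
        + ∑ p, ∑ q, ph m p q * pderiv p (lmet2 φ j k k q) y) := by
      simp only [hs.pderiv_lcur hΩ hy, Finset.mul_sum, ← Finset.sum_sub_distrib,
        ← Finset.sum_add_distrib]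
      refine Finset.sum_congr rfl fun l _ => Finset.sum_congr rfl fun p _ => ?_
      rw [m3 k k p, m4 k p k, m3 k k l, m4 k l k, m3 k j p, m4 k p j, m3 k j l, m4 k l j,
        m3 p k j, m3 l k j]
      ring
    rw [e, sw fun p q => pderiv q (lmet2 φ k k j p) y, sw fun p q => pderiv q (lmet2 φ j k k p) y]
    ring
  rw [hL, hR, l1, l2, Finset.mul_sum, Finset.mul_sum, ← Finset.sum_neg_distrib]
  exact Finset.sum_congr rfl fun k _ => by ring

/-- The evolution of the linearized curvature. -/
theorem IsClosedG2On.lcur_lflow (hφ : IsClosedG2On Ω φ) (hy : y ∈ Ω) (i j k l : Fin 7) :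
    lcur (lflow φ) i j k l y = lap (lcur φ i j k l) y := by
  have hs := hφ.smooth
  have hΩ := hφ.isOpen
  set D : Fin 7 → Fin 7 → Fin 7 → Fin 7 → Fin 7 → Fin 7 → ℝ := fun a b c d p q =>
    pderiv a (pderiv b (lmet2 φ c d p q)) y with hD
  have D1 : ∀ a b c d p q, D b a c d p q = D a b c d p q := fun a b c d p q =>
    pderiv_comm hΩ (hs.lmet2 hΩ c d p q) hy
  have D2 : ∀ a b c d p q, D a c b d p q = D a b c d p q := fun a b c d p q =>
    pderiv_congr hΩ hy fun z hz => pderiv_comm hΩ (contDiffOn_pderiv hΩ (hs.lmet p q)) hz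
  have D3 : ∀ a b c d p q, D a b d c p q = D a b c d p q := fun a b c d p q =>
    pderiv_congr hΩ hy fun z hz => pderiv_congr hΩ hz fun w hw => hs.lmet2_comm hΩ hw d c p q
  have D4 : ∀ a b c d p q, D a b c d q p = D a b c d p q := fun a b c d p q => by
    simp only [hD, lmet2_symm c d q p]
  have dr : ∀ a i j, DifferentiableAt ℝ (pderiv a (lric φ i j)) y := fun a i j =>
    differentiableAt_of_contDiffOn hΩ (contDiffOn_pderiv hΩ (hs.lric hΩ i j)) hy
  have hM : ∀ a b p q, lmet2 (lflow φ) a b p q y = -∑ e, (D a b e q p e - D a b e e p q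
      - D a b p q e e + D a b p e e q) := by
    intro a b p q
    have h1 : ∀ z ∈ Ω, pderiv b (lmet (lflow φ) p q) z = -2 * pderiv b (lric φ p q) z := by
      intro z hz
      rw [pderiv_congr hΩ hz (fun w hw => hφ.lmet_lflow hw p q),
        pderiv_const_mul _ (differentiableAt_of_contDiffOn hΩ (hs.lric hΩ p q) hz)]
    have h2 : ∀ z ∈ Ω, pderiv b (lric φ p q) z = ∑ e, pderiv b (lcur φ e p e q) z := fun z hz =>
      pderiv_sum _ fun e _ => differentiableAt_of_contDiffOn hΩ (hs.lcur hΩ e p e q) hz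
    have h3 : pderiv a (pderiv b (lric φ p q)) y = ∑ e, pderiv a (pderiv b (lcur φ e p e q)) y := by
      rw [pderiv_congr hΩ hy h2]
      exact pderiv_sum _ fun e _ => differentiableAt_of_contDiffOn hΩ
        (contDiffOn_pderiv hΩ (hs.lcur hΩ e p e q)) hy
    rw [lmet2, pderiv_congr hΩ hy h1, pderiv_const_mul _ (dr b p q), h3, Finset.mul_sum,
      ← Finset.sum_neg_distrib]
    refine Finset.sum_congr rfl fun e _ => ?_
    rw [hs.pderiv_pderiv_lcur hΩ hy]
    ring
  rw [hφ.smooth_lflow.lcur_eq hΩ hy, hM, hM, hM, hM, lap, ← Finset.sum_neg_distrib,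
    ← Finset.sum_neg_distrib, ← Finset.sum_neg_distrib, ← Finset.sum_neg_distrib,
    ← Finset.sum_sub_distrib, ← Finset.sum_sub_distrib, ← Finset.sum_add_distrib, Finset.mul_sum]
  refine Finset.sum_congr rfl fun e _ => ?_
  rw [hs.pderiv_pderiv_lcur hΩ hy]
  change _ = (1 / 2) * (D e e i l j k - D e e i k j l - D e e j l i k + D e e j k i l)
  -- The fourth derivatives containing `e e` as derivative indices assemble to the Laplacian. The
  -- other twelve cancel in six pairs, identified in `f2` to `f7`; this is the diffeomorphism
  -- invariance of the linearized curvature.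
  have f1 : ∀ a b p q, D a b e e p q = D e e a b p q := fun a b p q => by
    rw [D2 a e b e, D1 e a, D3 e a e b, D2 e e a b]
  have f2 : D i l e k j e = D i k e l j e := by rw [D3 i l k e, D2 i k l e, D3 i k e l]
  have f3 : D i l j k e e = D i k j l e e := by
    rw [D3 i l k j, D2 i k l j, D3 i k j l]
  have f4 : D j l e k i e = D j k e l i e := by rw [D3 j l k e, D2 j k l e, D3 j k e l]
  have f5 : D j l i k e e = D j k i l e e := by
    rw [D3 j l k i, D2 j k l i, D3 j k i l]
  have f6 : D i l j e e k = D j l i e e k := by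
    rw [D2 i j l e, D1 j i, D2 j l i e]
  have f7 : D i k j e e l = D j k i e e l := by
    rw [D2 i j k e, D1 j i, D2 j k i e]
  rw [f1, f1, f1, f1, f2, f3, f4, f5, f6, f7]
  ring

end

section

/-! ### The evolution of torsion and curvature up to lower order terms -/

variable {k w : ℕ} {Φ Ψ : Fnl}

theorem DP.contDiffOn_time (h : DP k w Φ) {s : Set ℝ} (hs : UniqueDiffOn ℝ s) {Ω : Set E7}
    (hΩ : IsOpen Ω) {φ : ℝ → CoordTensor 3}
    (hφ : ∀ J, ContDiffOn ℝ ∞ (fun p : ℝ × E7 => φ p.1 p.2 J) (s ×ˢ Ω))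
    (hφ' : ∀ t ∈ s, IsClosedG2On Ω (φ t)) :
    ContDiffOn ℝ ∞ (fun p : ℝ × E7 => Φ (φ p.1) p.2) (s ×ˢ Ω) := by
  obtain ⟨Ψ, h1, h2⟩ := h
  exact (h1.contDiffOn_time hs hΩ hφ fun t ht => (hφ' t ht).toIsG2On).congr fun p hp =>
    h2 Ω (φ p.1) (hφ' p.1 hp.1) p.2 hp.2

theorem HasTD.pderiv (hΦ : DP k w Φ) (h : HasTD Φ Ψ) (i : Fin 7) :
    HasTD (fun φ y => G2.pderiv i (Φ φ) y) fun φ y => G2.pderiv i (Ψ φ) y := by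
  intro I Ω φ hφ t ht y hy
  have hΩ : IsOpen Ω := (hφ.structureAt t ht).isOpen
  exact hasDerivAt_pderiv hφ.isOpen_time hΩ (f := fun s => Φ (φ s)) (f' := fun s => Ψ (φ s))
    (hΦ.contDiffOn_time hφ.isOpen_time.uniqueDiffOn hΩ hφ.smooth hφ.structureAt)
    (fun s hs z hz => h I Ω φ hφ s hs z hz) i t ht y hy

theorem hasTD_sec (p l : Fin 7) :
    HasTD (fun φ y => sec (φ y) p l) fun φ y => sec (extD (tau φ) y) p l := by
  intro I Ω φ hφ t ht y hy
  have h2 : HasDerivAt (fun s => φ s y) (extD (tau (φ t)) y) t :=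
    hasDerivAt_pi.2 fun J => hφ.evolution t ht y hy J
  exact (secL p l).hasFDerivAt.comp_hasDerivAt t h2

theorem dp_sec (p l : Fin 7) : DP k 0 fun φ y => sec (φ y) p l :=
  DP.coef (c := secL p l) (secL p l).contDiff.contDiffOn

theorem dp_lmet (p l : Fin 7) : DP k 0 fun φ y => lmet φ p l y := (dp_sec p l).add (dp_sec l p)

theorem dp_lchr (m i j : Fin 7) : DP 1 1 fun φ y => lchr φ m i j y := (leq_christoffel m i j).right

theorem hasTD_lmet (p l : Fin 7) :
    HasTD (fun φ y => lmet φ p l y) fun φ y => lmet (extD (tau φ)) p l y :=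
  (hasTD_sec p l).add (hasTD_sec l p)

theorem hasTD_lchr (m i j : Fin 7) :
    HasTD (fun φ y => lchr φ m i j y) fun φ y => lchr (extD (tau φ)) m i j y :=
  ((((hasTD_lmet j m).pderiv (dp_lmet (k := 0) j m) i).add
    ((hasTD_lmet i m).pderiv (dp_lmet (k := 0) i m) j)).sub
    ((hasTD_lmet i j).pderiv (dp_lmet (k := 0) i j) m)).const_mul _

theorem hasTD_lcur (i j k l : Fin 7) :
    HasTD (fun φ y => lcur φ i j k l y) fun φ y => lcur (extD (tau φ)) i j k l y :=
  ((hasTD_lchr k j l).pderiv (dp_lchr k j l) i).sub ((hasTD_lchr k i l).pderiv (dp_lchr k i l) j)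

theorem hasTD_ltor (i j : Fin 7) :
    HasTD (fun φ y => ltor φ i j y) fun φ y => ltor (extD (tau φ)) i j y :=
  HasTD.const_mul _ (HasTD.sum _ fun p _ => HasTD.sum _ fun q _ => HasTD.const_mul _
    (((hasTD_sec p q).pderiv (dp_sec (k := 0) p q) i).sub (hasTD_lchr p i q)))

theorem leq_extD_tau (J : Fin 3 → Fin 7) :
    LEq 2 (fun φ y => extD (tau φ) y J) fun φ y => lflow φ y J := by
  have h : ∀ K : Fin 2 → Fin 7, LEq 1 (fun φ y => tau φ y K) fun φ y => ltau φ y K := fun K => by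
    have := leq_tau_torsion (K 0) (K 1)
    rwa [← vec2_eta K] at this
  exact LEq.sum (by norm_num) Finset.univ fun s _ => LEq.const_mul _ ((h _).pderiv (J s))

theorem leq_sec (p l : Fin 7) :
    LEq 2 (fun φ y => sec (extD (tau φ) y) p l) fun φ y => sec (lflow φ y) p l := by
  have h : LEq 2 _ _ := LEq.sum (by norm_num) Finset.univ fun J _ =>
    LEq.const_mul (secL p l (Pi.single J 1)) (leq_extD_tau J)
  refine h.congr (fun Ω φ hφ y hy => ?_) fun Ω φ hφ y hy => ?_
  · rw [← secL_apply, clm_apply_eq_sum]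
  · rw [← secL_apply, clm_apply_eq_sum]

theorem leq_lmet (p l : Fin 7) :
    LEq 2 (fun φ y => lmet (extD (tau φ)) p l y) fun φ y => lmet (lflow φ) p l y :=
  (leq_sec p l).add (leq_sec l p)

theorem leq_lchr (m i j : Fin 7) :
    LEq 3 (fun φ y => lchr (extD (tau φ)) m i j y) fun φ y => lchr (lflow φ) m i j y :=
  ((((leq_lmet j m).pderiv i).add ((leq_lmet i m).pderiv j)).sub ((leq_lmet i j).pderiv m)).const_mul _

theorem leq_lcur (i j k l : Fin 7) :
    LEq 4 (fun φ y => lcur (extD (tau φ)) i j k l y) fun φ y => lcur (lflow φ) i j k l y :=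
  ((leq_lchr k j l).pderiv i).sub ((leq_lchr k i l).pderiv j)

theorem leq_ltor (i j : Fin 7) :
    LEq 3 (fun φ y => ltor (extD (tau φ)) i j y) fun φ y => ltor (lflow φ) i j y :=
  LEq.const_mul _ (LEq.sum (by norm_num) _ fun p _ => LEq.sum (by norm_num) _ fun q _ =>
    LEq.const_mul _ (((leq_sec p q).pderiv i).sub (leq_lchr p i q)))

theorem LEq.lap (h : LEq w Φ Ψ) :
    LEq (w + 2) (fun φ y => G2.lap (Φ φ) y) fun φ y => G2.lap (Ψ φ) y :=
  LEq.sum (by omega) Finset.univ fun a _ => (h.pderiv a).pderiv a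

theorem LEq.of_low (h : Low w Φ) : LEq w Φ fun _ _ => 0 where
  left := h.dp_self
  right := DP.zero
  low := .congr _ _ _ (fun _ _ _ _ _ => sub_zero _) h

theorem lap_pderiv {Ω : Set E7} (hΩ : IsOpen Ω) {f : E7 → ℝ} (hf : ContDiffOn ℝ ∞ f Ω) {y : E7}
    (hy : y ∈ Ω) (i : Fin 7) : lap (pderiv i f) y = pderiv i (lap f) y := by
  have : pderiv i (lap f) y = ∑ a, pderiv i (pderiv a (pderiv a f)) y :=
    pderiv_sum _ fun a _ => differentiableAt_of_contDiffOn hΩ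
      (contDiffOn_pderiv hΩ (contDiffOn_pderiv hΩ hf)) hy
  rw [this]
  refine Finset.sum_congr rfl fun a _ => ?_
  rw [pderiv_congr hΩ hy (fun z hz => pderiv_comm (i := a) (j := i) hΩ hf hz),
    pderiv_comm hΩ (contDiffOn_pderiv hΩ hf) hy]

/-- The heat equation up to lower order terms. -/
def HeatType (Φ : Fnl) : Prop := DP 2 2 Φ ∧ ∃ Ψ, HasTD Φ Ψ ∧ LEq 4 Ψ fun φ y => lap (Φ φ) y

/-- The difference between a quantity and its linearization stays of lower order under a time
derivative and under the Laplacian. An exact heat equation for the linearization thus passes to the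
quantity itself, modulo lower order terms. -/
theorem HeatType.of_leq {Λ Λ' Λ'' : Fnl} (h : LEq 2 Φ Λ) (h1 : HasTD Λ Λ') (h2 : LEq 4 Λ' Λ'')
    (h3 : FEq Λ'' fun φ y => lap (Λ φ) y) : HeatType Φ := by
  refine ⟨h.left, ?_⟩
  obtain ⟨Ψ, h4, h5⟩ := h.low.exists_hasTD
  refine ⟨_, (h5.add h1).congr fun Ω φ hφ y hy => by ring, ?_⟩
  have h6 := ((LEq.of_low h4).add h2).congr_right (Ψ' := fun φ y => lap (Λ φ) y)
    fun Ω φ hφ y hy => by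
      dsimp only; rw [zero_add]; exact (h3 Ω φ hφ y hy).symm
  exact h6.trans h.lap.symm

theorem heatType_riemann (J : Fin 4 → Fin 7) : HeatType fun φ y => riemann φ y J := by
  rw [vec4_eta J]
  exact .of_leq (leq_riemann _ _ _ _) (hasTD_lcur _ _ _ _) (leq_lcur _ _ _ _)
    fun Ω φ hφ y hy => hφ.lcur_lflow hy _ _ _ _

theorem heatType_covDeriv_torsion (J : Fin 3 → Fin 7) :
    HeatType fun φ y => covDeriv φ (torsion φ) y J := by
  rw [vec3_eta J]
  refine .of_leq (leq_covDeriv_torsion _ _ _)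
    ((hasTD_ltor (J 1) (J 2)).pderiv (leq_torsion (J 1) (J 2)).right _)
    ((leq_ltor (J 1) (J 2)).pderiv (J 0)) fun Ω φ hφ y hy => ?_
  have h := lap_pderiv hφ.isOpen (hφ.smooth.ltor hφ.isOpen (J 1) (J 2)) hy (J 0)
  rw [pderiv_congr hφ.isOpen hy (fun z hz => hφ.ltor_lflow hz (J 1) (J 2))]
  exact h.symm

/-! ### Products of heat type quantities at a point with standard form -/

theorem JetBound.mono {k l : ℕ} {φ : CoordTensor 3} {y : E7} {ρ : ℝ} (h : JetBound l φ y ρ)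
    (hkl : k ≤ l) : JetBound k φ y ρ := fun L h1 h2 J => h L h1 (h2.trans hkl) J

theorem lap_mul {Ω : Set E7} (hΩ : IsOpen Ω) {f g : E7 → ℝ} (hf : ContDiffOn ℝ ∞ f Ω)
    (hg : ContDiffOn ℝ ∞ g Ω) {y : E7} (hy : y ∈ Ω) : lap (fun z => f z * g z) y =
      lap f y * g y + f y * lap g y + 2 * ∑ a, pderiv a f y * pderiv a g y := by
  have d : ∀ {f : E7 → ℝ}, ContDiffOn ℝ ∞ f Ω → ∀ z ∈ Ω, DifferentiableAt ℝ f z :=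
    fun h z hz => differentiableAt_of_contDiffOn hΩ h hz
  simp only [lap, Finset.sum_mul, Finset.mul_sum, ← Finset.sum_add_distrib]
  refine Finset.sum_congr rfl fun a _ => ?_
  have hf' := contDiffOn_pderiv (i := a) hΩ hf
  have hg' := contDiffOn_pderiv (i := a) hΩ hg
  rw [pderiv_congr hΩ hy (fun z hz => pderiv_mul (i := a) (d hf z hz) (d hg z hz)),
    pderiv_add ((d hf' y hy).fun_mul (d hg y hy)) ((d hf y hy).fun_mul (d hg' y hy)),
    pderiv_mul (d hf' y hy) (d hg y hy), pderiv_mul (d hf y hy) (d hg' y hy)]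
  ring

theorem Coef.eq_of_std {c : ℝ} (h : Coef Φ c) {Ω : Set E7} {φ : CoordTensor 3} {y : E7}
    (hφ : IsClosedG2On Ω φ) (hy : y ∈ Ω) (h0 : φ y = std) : Φ φ y = c := by
  obtain ⟨d, _, h2, h3⟩ := h
  exact (h3 Ω φ hφ y hy).trans (by dsimp only; rw [h0, h2])

/-- `Ψ` is bounded by `C ρ ^ n` at points where the `3`-form is standard and its derivatives are
bounded in terms of `ρ`. -/
def Bdd (n : ℕ) (C : ℝ) (Φ : Fnl) : Prop := ∀ (Ω : Set E7) (φ : CoordTensor 3) (y : E7)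
    (ρ : ℝ), IsClosedG2On Ω φ → y ∈ Ω → 0 ≤ ρ → φ y = std → JetBound 3 φ y ρ → |Φ φ y| ≤ C * ρ ^ n

theorem DP.exists_bdd (h : DP k w Φ) (hk : k ≤ 3) : ∃ C, 0 ≤ C ∧ Bdd w C Φ := by
  obtain ⟨C, hC, h1⟩ := h.bound
  exact ⟨C, hC, fun Ω φ y ρ hφ hy hρ h0 hj => h1 Ω φ y ρ hφ hy hρ h0 (hj.mono hk)⟩

theorem Low.exists_bdd (h : Low w Φ) (hw : w ≤ 4) : ∃ C, 0 ≤ C ∧ Bdd w C Φ := by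
  obtain ⟨C, hC, h1⟩ := h.bound
  exact ⟨C, hC, fun Ω φ y ρ hφ hy hρ h0 hj => h1 Ω φ y ρ hφ hy hρ h0 (hj.mono (by omega))⟩

/-- The evolution of a product of two quantities of heat type with a coefficient. -/
theorem HeatType.mul_coef {A B N : Fnl} {n : ℝ} (hA : HeatType A) (hB : HeatType B)
    (hN : Coef N n) : ∃ Ψ, HasTD (fun φ y => A φ y * B φ y * N φ y) Ψ ∧ ∃ C : ℝ, 0 ≤ C ∧
      ∀ (Ω : Set E7) (φ : CoordTensor 3) (y : E7) (ρ : ℝ), IsClosedG2On Ω φ → y ∈ Ω → 0 ≤ ρ →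
        φ y = std → JetBound 3 φ y ρ →
        |Ψ φ y - lap (fun z => A φ z * B φ z * N φ z) y
          + 2 * n * ∑ a, pderiv a (A φ) y * pderiv a (B φ) y| ≤
          C * ρ ^ 4 * (|A φ y| + |B φ y|) := by
  obtain ⟨dA, A', tA, lA⟩ := hA
  obtain ⟨dB, B', tB, lB⟩ := hB
  obtain ⟨N', dN', tN⟩ := (hN.dp (k := 0)).exists_hasTD
  refine ⟨_, (tA.mul tB).mul tN, ?_⟩
  have dlN : DP 2 2 fun φ y => lap (N φ) y :=
    DP.sum _ fun a _ => ((hN.dp (k := 0)).pderiv a).pderiv a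
  obtain ⟨C1, hC1, b1⟩ := lA.low.exists_bdd le_rfl
  obtain ⟨C2, hC2, b2⟩ := lB.low.exists_bdd le_rfl
  obtain ⟨C3, hC3, b3⟩ := (DP.sub dN' dlN).exists_bdd (by norm_num)
  obtain ⟨C4, hC4, b4⟩ := dA.exists_bdd (by norm_num)
  obtain ⟨C5, hC5, b5⟩ := (DP.sum (k := 3) (w := 4) Finset.univ fun a _ => ((dA.pderiv a).mul
    ((((hN.dp (k := 0)).pderiv a).mono (by norm_num : 0 + 1 ≤ 3))))).exists_bdd le_rfl
  obtain ⟨C6, hC6, b6⟩ := (DP.sum (k := 3) (w := 4) Finset.univ fun a _ => ((dB.pderiv a).mul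
    ((((hN.dp (k := 0)).pderiv a).mono (by norm_num : 0 + 1 ≤ 3))))).exists_bdd le_rfl
  refine ⟨|n| * (C1 + C2) + C4 * C3 + 2 * (C5 + C6), by positivity,
    fun Ω φ y ρ hφ hy hρ h0 hj => ?_⟩
  have sA := dA.contDiffOn hφ
  have sB := dB.contDiffOn hφ
  have sN := (hN.dp (k := 0)).contDiffOn hφ
  have hn := hN.eq_of_std hφ hy h0
  have d : ∀ {f : E7 → ℝ}, ContDiffOn ℝ ∞ f Ω → DifferentiableAt ℝ f y :=
    fun h => differentiableAt_of_contDiffOn hφ.isOpen h hy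
  have e1 := b1 Ω φ y ρ hφ hy hρ h0 hj
  have e2 := b2 Ω φ y ρ hφ hy hρ h0 hj
  have e3 := b3 Ω φ y ρ hφ hy hρ h0 hj
  have e4 := b4 Ω φ y ρ hφ hy hρ h0 hj
  have e5 := b5 Ω φ y ρ hφ hy hρ h0 hj
  have e6 := b6 Ω φ y ρ hφ hy hρ h0 hj
  dsimp only at e1 e2 e3 e4 e5 e6
  have hl := lap_mul hφ.isOpen (sA.mul sB) sN hy
  have hl2 := lap_mul hφ.isOpen sA sB hy
  have hc : ∑ a, pderiv a (fun z => A φ z * B φ z) y * pderiv a (N φ) y =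
      (∑ a, pderiv a (A φ) y * pderiv a (N φ) y) * B φ y
        + (∑ a, pderiv a (B φ) y * pderiv a (N φ) y) * A φ y := by
    rw [Finset.sum_mul, Finset.sum_mul, ← Finset.sum_add_distrib]
    exact Finset.sum_congr rfl fun a _ => by rw [pderiv_mul (d sA) (d sB)]; ring
  set P := ∑ a, pderiv a (A φ) y * pderiv a (N φ) y
  set Q := ∑ a, pderiv a (B φ) y * pderiv a (N φ) y
  set R := ∑ a, pderiv a (A φ) y * pderiv a (B φ) y
  -- The product rule, with the gradient product `R` as the good term. Every error has a factor `A`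
  -- or `B`: heat equation errors and gradient products with `N` have weight `4`, and the evolution
  -- error of `N` has weight `2` and multiplies both `A` and `B`, one of which is bounded by `ρ ^
  -- 2`.
  have key : ((A' φ y * B φ y + A φ y * B' φ y) * N φ y + A φ y * B φ y * N' φ y)
      - lap (fun z => A φ z * B φ z * N φ z) y + 2 * n * R =
      n * (A' φ y - lap (A φ) y) * B φ y + n * (B' φ y - lap (B φ) y) * A φ y
        + A φ y * (N' φ y - lap (N φ) y) * B φ y - 2 * P * B φ y - 2 * Q * A φ y := by
    have hl' : lap (fun z => A φ z * B φ z * N φ z) y = _ := hl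
    rw [hl', hl2]
    have hc2 : ∑ a, pderiv a (A φ * B φ) y * pderiv a (N φ) y = P * B φ y + Q * A φ y := hc
    rw [hn]
    linear_combination (-2) * hc2
  rw [key]
  have r4 : 0 ≤ ρ ^ 4 := by positivity
  have a3 : |A φ y| * |N' φ y - lap (N φ) y| ≤ C4 * C3 * ρ ^ 4 := by
    calc _ ≤ (C4 * ρ ^ 2) * (C3 * ρ ^ 2) := mul_le_mul e4 e3 (abs_nonneg _) (by positivity)
      _ = _ := by ring
  have t1 : |n * (A' φ y - lap (A φ) y) * B φ y| ≤ |n| * (C1 * ρ ^ 4) * |B φ y| := by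
    rw [abs_mul, abs_mul]; gcongr
  have t2 : |n * (B' φ y - lap (B φ) y) * A φ y| ≤ |n| * (C2 * ρ ^ 4) * |A φ y| := by
    rw [abs_mul, abs_mul]; gcongr
  have t3 : |A φ y * (N' φ y - lap (N φ) y) * B φ y| ≤ C4 * C3 * ρ ^ 4 * |B φ y| := by
    rw [abs_mul, abs_mul]; gcongr
  have t4 : |2 * P * B φ y| ≤ 2 * (C5 * ρ ^ 4) * |B φ y| := by
    rw [abs_mul, abs_mul, abs_two]; gcongr
  have t5 : |2 * Q * A φ y| ≤ 2 * (C6 * ρ ^ 4) * |A φ y| := by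
    rw [abs_mul, abs_mul, abs_two]; gcongr
  have tri := abs_sub (n * (A' φ y - lap (A φ) y) * B φ y + n * (B' φ y - lap (B φ) y) * A φ y
        + A φ y * (N' φ y - lap (N φ) y) * B φ y - 2 * P * B φ y) (2 * Q * A φ y)
  have tri2 := abs_sub (n * (A' φ y - lap (A φ) y) * B φ y + n * (B' φ y - lap (B φ) y) * A φ y
        + A φ y * (N' φ y - lap (N φ) y) * B φ y) (2 * P * B φ y)
  have tri3 := abs_add_three (n * (A' φ y - lap (A φ) y) * B φ y)
    (n * (B' φ y - lap (B φ) y) * A φ y) (A φ y * (N' φ y - lap (N φ) y) * B φ y)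
  have p1 : 0 ≤ |n| * C1 * ρ ^ 4 * |A φ y| := by positivity
  have p2 : 0 ≤ |n| * C2 * ρ ^ 4 * |B φ y| := by positivity
  have p3 : 0 ≤ C4 * C3 * ρ ^ 4 * |A φ y| := by positivity
  have p4 : 0 ≤ C5 * ρ ^ 4 * |A φ y| := by positivity
  have p5 : 0 ≤ C6 * ρ ^ 4 * |B φ y| := by positivity
  nlinarith

end

section

/-! ### The evolution of the norm of torsion and curvature -/

/-- Applied to every pair of components with the product of inverse metrics as coefficient. At a
standard form this coefficient is the Kronecker symbol of the two multi-indices, so the gradient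
terms add up to a sum of squares. -/
theorem HeatType.contract {m : ℕ} {α : CoordTensor 3 → CoordTensor m}
    (h : ∀ J, HeatType fun φ y => α φ y J) :
    ∃ Ψ, HasTD (fun φ y => contract φ y (α φ y) (α φ y)) Ψ ∧ ∃ C : ℝ, 0 ≤ C ∧
      ∀ (Ω : Set E7) (φ : CoordTensor 3) (y : E7) (ρ : ℝ), IsClosedG2On Ω φ → y ∈ Ω → 0 ≤ ρ →
        φ y = std → JetBound 3 φ y ρ →
        |Ψ φ y - lap (fun z => contract φ z (α φ z) (α φ z)) y
          + 2 * ∑ J, ∑ a, pderiv a (fun z => α φ z J) y ^ 2| ≤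
          C * ρ ^ 4 * ∑ J, |α φ y J| := by
  have hN : ∀ I J : Fin m → Fin 7, Coef (fun φ y => ∏ s, metricInv φ y (I s) (J s))
      (if I = J then 1 else 0) := fun I J => by
    have := Coef.prod Finset.univ fun s _ => coef_metricInv (I s) (J s)
    rwa [prod_one_apply] at this
  choose Ψ hΨ C hC hb using fun I J => (h I).mul_coef (h J) (hN I J)
  refine ⟨_, HasTD.sum Finset.univ fun I _ => HasTD.sum Finset.univ fun J _ => hΨ I J,
    ∑ I, ∑ J, C I J * 2, Finset.sum_nonneg fun I _ => Finset.sum_nonneg fun J _ =>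
      mul_nonneg (hC I J) zero_le_two, fun Ω φ y ρ hφ hy hρ h0 hj => ?_⟩
  set A : ℝ := ∑ J, |α φ y J| with hA
  have hle : ∀ J, |α φ y J| ≤ A := fun J =>
    Finset.single_le_sum (f := fun J => |α φ y J|) (fun _ _ => abs_nonneg _) (Finset.mem_univ J)
  have sP : ∀ I J, ContDiffOn ℝ ∞ (fun z => α φ z I * α φ z J *
      ∏ s, metricInv φ z (I s) (J s)) Ω := fun I J =>
    (((h I).1.contDiffOn hφ).mul ((h J).1.contDiffOn hφ)).mul (((hN I J).dp (k := 0)).contDiffOn hφ)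
  have hlap : lap (fun z => G2.contract φ z (α φ z) (α φ z)) y = ∑ I, ∑ J,
      lap (fun z => α φ z I * α φ z J * ∏ s, metricInv φ z (I s) (J s)) y := by
    have h1 : ∀ a, ∀ z ∈ Ω, pderiv a (fun z => G2.contract φ z (α φ z) (α φ z)) z = ∑ I, ∑ J,
        pderiv a (fun z => α φ z I * α φ z J * ∏ s, metricInv φ z (I s) (J s)) z := by
      intro a z hz
      have d : ∀ I J, DifferentiableAt ℝ (fun z => α φ z I * α φ z J *
        ∏ s, metricInv φ z (I s) (J s)) z := fun I J =>
          differentiableAt_of_contDiffOn hφ.isOpen (sP I J) hz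
      simp only [G2.contract]
      rw [pderiv_sum _ fun I _ => DifferentiableAt.fun_sum fun J _ => d I J]
      exact Finset.sum_congr rfl fun I _ => pderiv_sum _ fun J _ => d I J
    have d : ∀ a I J, DifferentiableAt ℝ (pderiv a fun z => α φ z I * α φ z J *
        ∏ s, metricInv φ z (I s) (J s)) y := fun a I J =>
          differentiableAt_of_contDiffOn hφ.isOpen (contDiffOn_pderiv hφ.isOpen (sP I J)) hy
    have h2 : ∀ a, pderiv a (pderiv a (fun z => G2.contract φ z (α φ z) (α φ z))) y = ∑ I, ∑ J,
        pderiv a (pderiv a fun z => α φ z I * α φ z J * ∏ s, metricInv φ z (I s) (J s)) y := by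
      intro a
      rw [pderiv_congr hφ.isOpen hy (h1 a),
        pderiv_sum _ fun I _ => DifferentiableAt.fun_sum fun J _ => d a I J]
      exact Finset.sum_congr rfl fun I _ => pderiv_sum _ fun J _ => d a I J
    simp only [lap, h2]
    rw [Finset.sum_comm]
    exact Finset.sum_congr rfl fun I _ => Finset.sum_comm
  have hG : ∑ J, ∑ a, pderiv a (fun z => α φ z J) y ^ 2 = ∑ I, ∑ J, (if I = J then (1 : ℝ) else 0) *
      ∑ a, pderiv a (fun z => α φ z I) y * pderiv a (fun z => α φ z J) y := by
    simp [pow_two]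
  rw [hlap, hG, Finset.mul_sum, Finset.sum_mul, Finset.sum_mul, ← Finset.sum_sub_distrib,
    ← Finset.sum_add_distrib]
  refine (Finset.abs_sum_le_sum_abs _ _).trans (Finset.sum_le_sum fun I _ => ?_)
  rw [Finset.mul_sum, Finset.sum_mul, Finset.sum_mul, ← Finset.sum_sub_distrib,
    ← Finset.sum_add_distrib]
  refine (Finset.abs_sum_le_sum_abs _ _).trans (Finset.sum_le_sum fun J _ => ?_)
  have := hb I J Ω φ y ρ hφ hy hρ h0 hj
  rw [← mul_assoc]
  refine this.trans ?_
  have r4 : 0 ≤ C I J * ρ ^ 4 := mul_nonneg (hC I J) (by positivity)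
  calc C I J * ρ ^ 4 * (|α φ y I| + |α φ y J|) ≤ C I J * ρ ^ 4 * (A + A) := by
        gcongr
        · exact hle I
        · exact hle J
    _ = _ := by ring

/-- The square of `coordLambda`. -/
def lambdaSq (φ : CoordTensor 3) (y : E7) : ℝ :=
  contract φ y (covDeriv φ (torsion φ) y) (covDeriv φ (torsion φ) y)
    + contract φ y (riemann φ y) (riemann φ y)

theorem dp_lambdaSq : DP 2 4 lambdaSq :=
  (DP.contract rfl dp_covDeriv_torsion dp_covDeriv_torsion).add
    (DP.contract rfl dp_riemann dp_riemann)

/-- Pulled back from the standard form, the contraction becomes a sum of squares of components. -/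
theorem contract_self_nonneg {Ω : Set E7} {φ : CoordTensor 3} {y : E7} (hφ : IsG2On Ω φ)
    (hy : y ∈ Ω) {k : ℕ} (a : (Fin k → Fin 7) → ℝ) : 0 ≤ contract φ y a a := by
  obtain ⟨A, hA, h⟩ := hφ.pos y hy
  have h1 := contract_pull (φ := fun _ => std) (φ' := φ) (y := (0 : E7)) (y' := y) hA h
    (pullT A⁻¹ a) (pullT A⁻¹ a)
  have h2 : pullT A (pullT A⁻¹ a) = a := by
    rw [← pullT_mul, Matrix.nonsing_inv_mul _ (isUnit_iff_ne_zero.2 hA), pullT_one]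
  rw [h2, contract_std (φ := fun _ => std) (y := (0 : E7)) rfl] at h1
  rw [h1]
  exact Finset.sum_nonneg fun I _ => mul_self_nonneg _

theorem lambdaSq_nonneg {Ω : Set E7} {φ : CoordTensor 3} {y : E7} (hφ : IsG2On Ω φ)
    (hy : y ∈ Ω) : 0 ≤ lambdaSq φ y :=
  add_nonneg (contract_self_nonneg hφ hy _) (contract_self_nonneg hφ hy _)

theorem coordLambda_sq {Ω : Set E7} {φ : CoordTensor 3} {y : E7} (hφ : IsG2On Ω φ)
    (hy : y ∈ Ω) : coordLambda φ y ^ 2 = lambdaSq φ y := Real.sq_sqrt (lambdaSq_nonneg hφ hy)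

theorem lambdaSq_std {φ : CoordTensor 3} {y : E7} (h0 : φ y = std) : lambdaSq φ y =
    ∑ J, covDeriv φ (torsion φ) y J ^ 2 + ∑ J, riemann φ y J ^ 2 := by
  simp only [lambdaSq, contract_std h0, pow_two]

theorem abs_le_coordLambda {Ω : Set E7} {φ : CoordTensor 3} {y : E7} (hφ : IsG2On Ω φ)
    (hy : y ∈ Ω) (h0 : φ y = std) :
    (∀ J, |covDeriv φ (torsion φ) y J| ≤ coordLambda φ y) ∧
    ∀ J, |riemann φ y J| ≤ coordLambda φ y := by
  have hL : 0 ≤ coordLambda φ y := Real.sqrt_nonneg _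
  have hsq := coordLambda_sq hφ hy
  rw [lambdaSq_std h0] at hsq
  have n1 : 0 ≤ ∑ J, covDeriv φ (torsion φ) y J ^ 2 := Finset.sum_nonneg fun _ _ => sq_nonneg _
  have n2 : 0 ≤ ∑ J, riemann φ y J ^ 2 := Finset.sum_nonneg fun _ _ => sq_nonneg _
  refine ⟨fun J => abs_le_of_sq_le_sq ?_ hL, fun J => abs_le_of_sq_le_sq ?_ hL⟩
  · have := Finset.single_le_sum (f := fun J => covDeriv φ (torsion φ) y J ^ 2)
      (fun _ _ => sq_nonneg _) (Finset.mem_univ J)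
    linarith
  · have := Finset.single_le_sum (f := fun J => riemann φ y J ^ 2)
      (fun _ _ => sq_nonneg _) (Finset.mem_univ J)
    linarith

/-- The squared norm of the derivatives of torsion and curvature. -/
def gradSq (φ : CoordTensor 3) (y : E7) : ℝ :=
  ∑ J, ∑ a, pderiv a (fun z => covDeriv φ (torsion φ) z J) y ^ 2
    + ∑ J, ∑ a, pderiv a (fun z => riemann φ z J) y ^ 2

/-- The evolution inequality of `coordLambda ^ 2` at a point where the `3`-form is standard. -/
theorem exists_hasTD_lambdaSq : ∃ Ψ, HasTD lambdaSq Ψ ∧ ∃ C : ℝ, 0 ≤ C ∧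
    ∀ (Ω : Set E7) (φ : CoordTensor 3) (y : E7) (ρ : ℝ), IsClosedG2On Ω φ → y ∈ Ω → 0 ≤ ρ →
      φ y = std → JetBound 3 φ y ρ →
      Ψ φ y ≤ lap (lambdaSq φ) y - 2 * gradSq φ y + C * ρ ^ 4 * coordLambda φ y := by
  obtain ⟨Ψ₁, t₁, C₁, hC₁, b₁⟩ := HeatType.contract heatType_covDeriv_torsion
  obtain ⟨Ψ₂, t₂, C₂, hC₂, b₂⟩ := HeatType.contract heatType_riemann
  -- `343 = 7 ^ 3` and `2401 = 7 ^ 4` count the components of `∇T` and `Rm`, each of which is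
  -- bounded by `Λ`.
  refine ⟨_, t₁.add t₂, C₁ * 343 + C₂ * 2401, by positivity, fun Ω φ y ρ hφ hy hρ h0 hj => ?_⟩
  have e₁ := b₁ Ω φ y ρ hφ hy hρ h0 hj
  have e₂ := b₂ Ω φ y ρ hφ hy hρ h0 hj
  have hL : 0 ≤ coordLambda φ y := Real.sqrt_nonneg _
  obtain ⟨m1, m2⟩ := abs_le_coordLambda hφ.toIsG2On hy h0
  have s1 : ∑ J, |covDeriv φ (torsion φ) y J| ≤ 343 * coordLambda φ y := by
    refine (Finset.sum_le_card_nsmul _ _ _ fun J _ => m1 J).trans_eq ?_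
    simp
  have s2 : ∑ J, |riemann φ y J| ≤ 2401 * coordLambda φ y := by
    refine (Finset.sum_le_card_nsmul _ _ _ fun J _ => m2 J).trans_eq ?_
    simp
  have hlap : lap (lambdaSq φ) y =
      lap (fun z => contract φ z (covDeriv φ (torsion φ) z) (covDeriv φ (torsion φ) z)) y
      + lap (fun z => contract φ z (riemann φ z) (riemann φ z)) y := by
    have c1 := (DP.contract rfl dp_covDeriv_torsion dp_covDeriv_torsion).contDiffOn hφ
    have c2 := (DP.contract rfl dp_riemann dp_riemann).contDiffOn hφ
    simp only [lap, ← Finset.sum_add_distrib]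
    refine Finset.sum_congr rfl fun a _ => ?_
    rw [← pderiv_add (differentiableAt_of_contDiffOn hφ.isOpen (contDiffOn_pderiv hφ.isOpen c1) hy)
      (differentiableAt_of_contDiffOn hφ.isOpen (contDiffOn_pderiv hφ.isOpen c2) hy)]
    refine pderiv_congr hφ.isOpen hy fun z hz => ?_
    exact pderiv_add (differentiableAt_of_contDiffOn hφ.isOpen c1 hz)
      (differentiableAt_of_contDiffOn hφ.isOpen c2 hz)
  rw [hlap, gradSq]
  have f₁ := (abs_le.1 e₁).2
  have f₂ := (abs_le.1 e₂).2
  have r4 : 0 ≤ ρ ^ 4 := by positivity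
  have g1 : C₁ * ρ ^ 4 * ∑ J, |covDeriv φ (torsion φ) y J| ≤
      C₁ * ρ ^ 4 * (343 * coordLambda φ y) := by gcongr
  have g2 : C₂ * ρ ^ 4 * ∑ J, |riemann φ y J| ≤ C₂ * ρ ^ 4 * (2401 * coordLambda φ y) := by gcongr
  linarith

end

section

/-! ### Vanishing to finite order at the origin -/

/-- The partial derivatives of `f` of order less than `m` vanish at the origin. -/
def Van : ℕ → (E7 → ℝ) → Prop
  | 0, _ => True
  | m + 1, f => f 0 = 0 ∧ ∀ i, Van m (pderiv i f)

section Van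

variable {Ω : Set E7} {f g : E7 → ℝ} {m n : ℕ}

theorem Van.congr (hΩ : IsOpen Ω) (h0 : (0 : E7) ∈ Ω) (h : Van m f) (hfg : ∀ z ∈ Ω, g z = f z) :
    Van m g := by
  induction m generalizing f g with
  | zero => trivial
  | succ m ih =>
    exact ⟨(hfg 0 h0).trans h.1, fun i => ih (h.2 i) fun z hz => pderiv_congr hΩ hz hfg⟩

theorem Van.zero : Van m fun _ => 0 := by
  induction m with
  | zero => trivial
  | succ m ih =>
    refine ⟨rfl, fun i => ?_⟩
    have : pderiv i (fun _ : E7 => (0 : ℝ)) = fun _ => 0 := funext fun y => pderiv_const 0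
    rwa [this]

theorem Van.add (hΩ : IsOpen Ω) (h0 : (0 : E7) ∈ Ω) (sf : ContDiffOn ℝ ∞ f Ω)
    (sg : ContDiffOn ℝ ∞ g Ω) (hf : Van m f) (hg : Van m g) : Van m fun z => f z + g z := by
  induction m generalizing f g with
  | zero => trivial
  | succ m ih =>
    refine ⟨by simp [hf.1, hg.1], fun i => ?_⟩
    refine (ih (contDiffOn_pderiv hΩ sf) (contDiffOn_pderiv hΩ sg) (hf.2 i) (hg.2 i)).congr hΩ h0
      fun z hz => ?_
    exact pderiv_add (differentiableAt_of_contDiffOn hΩ sf hz)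
      (differentiableAt_of_contDiffOn hΩ sg hz)

theorem Van.sum (hΩ : IsOpen Ω) (h0 : (0 : E7) ∈ Ω) {ι : Type*} (S : Finset ι)
    {f : ι → E7 → ℝ} (sf : ∀ a, ContDiffOn ℝ ∞ (f a) Ω) (hf : ∀ a, Van m (f a)) :
    Van m fun z => ∑ a ∈ S, f a z := by
  classical
  induction S using Finset.induction_on with
  | empty => simpa using Van.zero
  | insert a S ha ih =>
    simp only [Finset.sum_insert ha]
    exact Van.add hΩ h0 (sf a) (ContDiffOn.sum fun b _ => sf b) (hf a) ih

/-- Orders of vanishing add, by the product rule. A factor of order `0` carries no information,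
which is why that case is treated separately. -/
theorem Van.mul (hΩ : IsOpen Ω) (h0 : (0 : E7) ∈ Ω) (sf : ContDiffOn ℝ ∞ f Ω)
    (sg : ContDiffOn ℝ ∞ g Ω) {a b : ℕ} (hf : Van a f) (hg : Van b g) (hm : m ≤ a + b) :
    Van m fun z => f z * g z := by
  induction m generalizing f g a b with
  | zero => trivial
  | succ m ih =>
    refine ⟨?_, fun i => ?_⟩
    · rcases a with _ | a
      · obtain ⟨b, rfl⟩ : ∃ k, b = k + 1 := ⟨b - 1, by omega⟩
        simp [hg.1]
      · simp [hf.1]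
    have sf' := contDiffOn_pderiv (i := i) hΩ sf
    have sg' := contDiffOn_pderiv (i := i) hΩ sg
    refine (Van.add hΩ h0 (sf'.mul sg) (sf.mul sg') ?_ ?_).congr hΩ h0 fun z hz =>
      pderiv_mul (differentiableAt_of_contDiffOn hΩ sf hz) (differentiableAt_of_contDiffOn hΩ sg hz)
    · rcases a with _ | a
      · exact ih sf' sg (a := 0) trivial hg (by omega)
      · exact ih sf' sg (hf.2 i) hg (by omega)
    · rcases b with _ | b
      · exact ih sf sg' (b := 0) hf trivial (by omega)
      · exact ih sf sg' hf (hg.2 i) (by omega)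

theorem Van.const_mul (hΩ : IsOpen Ω) (h0 : (0 : E7) ∈ Ω) (sf : ContDiffOn ℝ ∞ f Ω) (c : ℝ)
    (hf : Van m f) : Van m fun z => c * f z :=
  Van.mul hΩ h0 contDiffOn_const sf (a := 0) trivial hf (by omega)

theorem Van.sub (hΩ : IsOpen Ω) (h0 : (0 : E7) ∈ Ω) (sf : ContDiffOn ℝ ∞ f Ω)
    (sg : ContDiffOn ℝ ∞ g Ω) (hf : Van m f) (hg : Van m g) : Van m fun z => f z - g z :=
  (Van.add hΩ h0 sf (contDiffOn_const.mul sg) hf (hg.const_mul hΩ h0 sg (-1))).congr hΩ h0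
    fun z _ => by ring

end Van

/-! ### Changes of coordinates tangent to the identity -/

/-- The map `y ↦ y + q(y)`. -/
def shift (q : Fin 7 → E7 → ℝ) (y : E7) : E7 := WithLp.toLp 2 fun a => y a + q a y

section Shift

variable {Ω : Set E7} {φ : CoordTensor 3} {q : Fin 7 → E7 → ℝ} {k : ℕ}

theorem shift_apply (q : Fin 7 → E7 → ℝ) (y : E7) (a : Fin 7) : shift q y a = y a + q a y := rfl

theorem contDiff_shift (hq : ∀ a, ContDiff ℝ ∞ (q a)) : ContDiff ℝ ∞ (shift q) := by
  rw [contDiff_euclidean]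
  intro a
  exact (EuclideanSpace.proj a : E7 →L[ℝ] ℝ).contDiff.add (hq a)

theorem pderiv_coord (i a : Fin 7) (y : E7) :
    pderiv i (fun z : E7 => z a) y = (1 : Matrix (Fin 7) (Fin 7) ℝ) a i := by
  have : fderiv ℝ (fun z : E7 => z a) y = (EuclideanSpace.proj a : E7 →L[ℝ] ℝ) :=
    (EuclideanSpace.proj a : E7 →L[ℝ] ℝ).fderiv
  rw [pderiv, this]
  simp [Matrix.one_apply]

theorem contDiff_differentiableAt {f : E7 → ℝ} (hf : ContDiff ℝ ∞ f) (y : E7) :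
    DifferentiableAt ℝ f y := (hf.differentiable (by simp)) y

theorem jac_shift (hq : ∀ a, ContDiff ℝ ∞ (q a)) (y : E7) (a i : Fin 7) :
    jac (shift q) y a i = (1 : Matrix (Fin 7) (Fin 7) ℝ) a i + pderiv i (q a) y := by
  simp only [jac, Matrix.of_apply, shift_apply]
  have h : DifferentiableAt ℝ (fun z : E7 => z a) y :=
    (EuclideanSpace.proj a : E7 →L[ℝ] ℝ).differentiableAt
  rw [pderiv_add h (contDiff_differentiableAt (hq a) y), pderiv_coord]

theorem shift_zero (hv : ∀ a, Van (k + 1) (q a)) : shift q 0 = 0 := by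
  ext a
  rw [shift_apply, (hv a).1]
  simp

/-- The domain on which `shift q` is a change of coordinates into `Ω`. -/
def shiftDomain (q : Fin 7 → E7 → ℝ) (Ω : Set E7) : Set E7 :=
  Ω ∩ ({y | shift q y ∈ Ω} ∩ {y | (jac (shift q) y).det ≠ 0})

theorem isChange_shift (hΩ : IsOpen Ω) (hq : ∀ a, ContDiff ℝ ∞ (q a)) :
    IsChange (shift q) (shiftDomain q Ω) Ω where
  isOpen_source := by
    refine hΩ.inter ((hΩ.preimage (contDiff_shift hq).continuous).inter ?_)
    have h : ∀ a i, Continuous fun y => jac (shift q) y a i := fun a i => by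
      have := contDiffOn_pderiv (i := i) isOpen_univ
        (contDiffOn_coord (contDiff_shift hq).contDiffOn a)
      exact (contDiffOn_univ.1 this).continuous
    exact isOpen_ne.preimage (Continuous.matrix_det (continuous_matrix h))
  isOpen_target := hΩ
  smooth := (contDiff_shift hq).contDiffOn
  maps := fun _ hy => hy.2.1
  det_ne_zero := fun _ hy => hy.2.2

theorem jac_shift_zero (hq : ∀ a, ContDiff ℝ ∞ (q a)) (hv : ∀ a, Van (k + 2) (q a)) :
    jac (shift q) 0 = 1 := by
  ext a i
  rw [jac_shift hq, ((hv a).2 i).1, add_zero]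

theorem zero_mem_shiftDomain (h0 : (0 : E7) ∈ Ω) (hq : ∀ a, ContDiff ℝ ∞ (q a))
    (hv : ∀ a, Van (k + 2) (q a)) : (0 : E7) ∈ shiftDomain q Ω := by
  refine ⟨h0, ?_, ?_⟩
  · change shift q 0 ∈ Ω
    rwa [shift_zero hv]
  · change (jac (shift q) 0).det ≠ 0
    rw [jac_shift_zero hq hv]; simp

theorem pullF_shift_zero (hq : ∀ a, ContDiff ℝ ∞ (q a)) (hv : ∀ a, Van (k + 2) (q a)) {l : ℕ}
    (α : CoordTensor l) : pullF (shift q) α 0 = α 0 := by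
  rw [pullF, jac_shift_zero hq hv, shift_zero hv, pullT_one]

variable {Ω' : Set E7}

/-- By the chain rule the derivative of the difference is the same difference for `∂g` plus a
product of `∂g` and `∂q`. The latter vanishes to one order less than `q`, which is what the
induction needs. -/
theorem van_comp_shift (h0' : (0 : E7) ∈ Ω') (hc : IsChange (shift q) Ω' Ω)
    (hsub : Ω' ⊆ Ω) (hq : ∀ a, ContDiff ℝ ∞ (q a)) (hv : ∀ a, Van (k + 1) (q a)) {n : ℕ}
    (hn : n ≤ k + 1) {g : E7 → ℝ} (hg : ContDiffOn ℝ ∞ g Ω) :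
    Van n fun z => g (shift q z) - g z := by
  have hΩ' := hc.isOpen_source
  have hΩ := hc.isOpen_target
  induction n generalizing g with
  | zero => trivial
  | succ n ih =>
    refine ⟨by simp [shift_zero hv], fun i => ?_⟩
    have sg : ∀ a, ContDiffOn ℝ ∞ (pderiv a g) Ω := fun a => contDiffOn_pderiv hΩ hg
    have sq : ∀ a, ContDiffOn ℝ ∞ (pderiv i (q a)) Ω' := fun a =>
      contDiffOn_pderiv hΩ' (hq a).contDiffOn
    refine (Van.add hΩ' h0' ((hc.smooth_comp (sg i)).sub ((sg i).mono hsub))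
      (ContDiffOn.sum fun a _ => (hc.smooth_comp (sg a)).mul (sq a)) (ih (by omega) (sg i))
      (Van.sum hΩ' h0' Finset.univ (fun a => (hc.smooth_comp (sg a)).mul (sq a)) fun a =>
        Van.mul hΩ' h0' (hc.smooth_comp (sg a)) (sq a) (a := 0) trivial ((hv a).2 i)
          (by omega))).congr hΩ' h0' fun z hz => ?_
    rw [pderiv_sub (differentiableAt_of_contDiffOn hΩ' (hc.smooth_comp hg) hz)
      (differentiableAt_of_contDiffOn hΩ hg (hsub hz)),
      pderiv_comp (differentiableAt_of_contDiffOn hΩ hg (hc.maps z hz)) (hc.diffAt hz)]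
    have : ∀ a, pderiv i (fun z => shift q z a) z =
        (1 : Matrix (Fin 7) (Fin 7) ℝ) a i + pderiv i (q a) z := fun a => jac_shift hq z a i
    simp only [this, mul_add, Finset.sum_add_distrib]
    simp [Matrix.one_apply]
    ring

theorem act_eq_sum_three (A : Matrix (Fin 7) (Fin 7) ℝ) (a : V3) (J : Fin 3 → Fin 7) :
    act A a J = ∑ I : Fin 3 → Fin 7, a I *
      (A (I 0) (J 0) * (1 : Matrix (Fin 7) (Fin 7) ℝ) (I 1) (J 1) *
          (1 : Matrix (Fin 7) (Fin 7) ℝ) (I 2) (J 2)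
        + (1 : Matrix (Fin 7) (Fin 7) ℝ) (I 0) (J 0) * A (I 1) (J 1) *
          (1 : Matrix (Fin 7) (Fin 7) ℝ) (I 2) (J 2)
        + (1 : Matrix (Fin 7) (Fin 7) ℝ) (I 0) (J 0) * (1 : Matrix (Fin 7) (Fin 7) ℝ) (I 1) (J 1) *
          A (I 2) (J 2)) := by
  have e0 : (Finset.univ.erase (0 : Fin 3)) = {1, 2} := by decide
  have e1 : (Finset.univ.erase (1 : Fin 3)) = {0, 2} := by decide
  have e2 : (Finset.univ.erase (2 : Fin 3)) = {0, 1} := by decide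
  simp only [act, ← sum_update, Fin.sum_univ_three, e0, e1, e2, ← Finset.sum_add_distrib]
  refine Finset.sum_congr rfl fun I _ => ?_
  rw [Finset.prod_pair (by decide), Finset.prod_pair (by decide), Finset.prod_pair (by decide)]
  ring

/-- The differential of `q`, as a matrix. -/
def dmat (q : Fin 7 → E7 → ℝ) (y : E7) : Matrix (Fin 7) (Fin 7) ℝ :=
  Matrix.of fun m i => pderiv i (q m) y

/-- The change of a `3`-form under a shift, to first order. -/
theorem van_pullF_shift (h0 : (0 : E7) ∈ Ω') (hc : IsChange (shift q) Ω' Ω)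
    (hsub : Ω' ⊆ Ω) (hq : ∀ a, ContDiff ℝ ∞ (q a)) (hv : ∀ a, Van (k + 2) (q a))
    (hφ : SmoothOn Ω φ) (hs : φ 0 = std) (J : Fin 3 → Fin 7) :
    Van (k + 2) fun z => pullF (shift q) φ z J - φ z J - act (dmat q z) std J := by
  have hΩ' := hc.isOpen_source
  have sA : ∀ m i, ContDiffOn ℝ ∞ (fun z => dmat q z m i) Ω' := fun m i =>
    contDiffOn_pderiv hΩ' (hq m).contDiffOn
  have vA : ∀ m i, Van (k + 1) fun z => dmat q z m i := fun m i => (hv m).2 i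
  have sφ : ∀ I, ContDiffOn ℝ ∞ (fun z => φ z I) Ω' := fun I => (hφ I).mono hsub
  have sF : ∀ I, ContDiffOn ℝ ∞ (fun z => φ (shift q z) I) Ω' := fun I => hc.smooth_comp (hφ I)
  have key : ∀ I : Fin 3 → Fin 7, ∃ r : E7 → ℝ, ContDiffOn ℝ ∞ r Ω' ∧ Van (k + 2) r ∧
      ∀ z, φ (shift q z) I * ∏ s, jac (shift q) z (I s) (J s) = r z
        + φ z I * ∏ s, (1 : Matrix (Fin 7) (Fin 7) ℝ) (I s) (J s)
        + std I * (dmat q z (I 0) (J 0) * (1 : Matrix (Fin 7) (Fin 7) ℝ) (I 1) (J 1) *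
          (1 : Matrix (Fin 7) (Fin 7) ℝ) (I 2) (J 2)
        + (1 : Matrix (Fin 7) (Fin 7) ℝ) (I 0) (J 0) * dmat q z (I 1) (J 1) *
          (1 : Matrix (Fin 7) (Fin 7) ℝ) (I 2) (J 2)
        + (1 : Matrix (Fin 7) (Fin 7) ℝ) (I 0) (J 0) * (1 : Matrix (Fin 7) (Fin 7) ℝ) (I 1) (J 1) *
          dmat q z (I 2) (J 2)) := by
    intro I
    set d0 := (1 : Matrix (Fin 7) (Fin 7) ℝ) (I 0) (J 0)
    set d1 := (1 : Matrix (Fin 7) (Fin 7) ℝ) (I 1) (J 1)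
    set d2 := (1 : Matrix (Fin 7) (Fin 7) ℝ) (I 2) (J 2)
    set A0 : E7 → ℝ := fun z => dmat q z (I 0) (J 0)
    set A1 : E7 → ℝ := fun z => dmat q z (I 1) (J 1)
    set A2 : E7 → ℝ := fun z => dmat q z (I 2) (J 2)
    have s0 : ContDiffOn ℝ ∞ A0 Ω' := sA _ _
    have s1 : ContDiffOn ℝ ∞ A1 Ω' := sA _ _
    have s2 : ContDiffOn ℝ ∞ A2 Ω' := sA _ _
    have v0 : Van (k + 1) A0 := vA _ _
    have v1 : Van (k + 1) A1 := vA _ _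
    have v2 : Van (k + 1) A2 := vA _ _
    have c : ∀ r : ℝ, ContDiffOn ℝ ∞ (fun _ : E7 => r) Ω' := fun r => contDiffOn_const
    -- The remainder has three parts: `t1` from moving the base point, `u` from terms at least
    -- quadratic in `∂q`, and `φ - std` times the linear part `p`. As `∂q` vanishes to order `k +
    -- 1`, all three vanish to order `k + 2`; the last uses that `φ` is standard at the origin.
    set t1 : E7 → ℝ := fun z => (φ (shift q z) I - φ z I) * ((d0 + A0 z) * (d1 + A1 z) * (d2 + A2 z))
    set u : E7 → ℝ := fun z => A0 z * A1 z * (d2 + A2 z) + (A0 z * A2 z * d1 + A1 z * A2 z * d0)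
    set p : E7 → ℝ := fun z => A0 z * (d1 * d2) + (A1 z * (d0 * d2) + A2 z * (d0 * d1))
    have s3 : ContDiffOn ℝ ∞ (fun z => d2 + A2 z) Ω' := (c d2).add s2
    have st1a : ContDiffOn ℝ ∞ (fun z => φ (shift q z) I - φ z I) Ω' := (sF I).sub (sφ I)
    have st1b : ContDiffOn ℝ ∞ (fun z => (d0 + A0 z) * (d1 + A1 z) * (d2 + A2 z)) Ω' :=
      (((c d0).add s0).mul ((c d1).add s1)).mul s3
    have su : ContDiffOn ℝ ∞ u Ω' := ((s0.mul s1).mul s3).add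
      (((s0.mul s2).mul (c d1)).add ((s1.mul s2).mul (c d0)))
    have sp : ContDiffOn ℝ ∞ p Ω' := (s0.mul (c _)).add ((s1.mul (c _)).add (s2.mul (c _)))
    have sw : ContDiffOn ℝ ∞ (fun z => φ z I - std I) Ω' := (sφ I).sub (c _)
    have vt1 : Van (k + 2) t1 := Van.mul hΩ' h0 st1a st1b (b := 0)
      (van_comp_shift h0 hc hsub hq hv le_rfl (hφ I)) trivial (by omega)
    have vu : Van (k + 2) u := by
      have w : ∀ {f g h : E7 → ℝ}, ContDiffOn ℝ ∞ f Ω' → ContDiffOn ℝ ∞ g Ω' →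
          ContDiffOn ℝ ∞ h Ω' → Van (k + 1) f → Van (k + 1) g →
          Van (k + 2) fun z => f z * g z * h z := fun sf sg sh vf vg =>
        Van.mul hΩ' h0 (sf.mul sg) sh (a := k + 2) (b := 0)
          (Van.mul hΩ' h0 sf sg vf vg (by omega)) trivial (by omega)
      exact Van.add hΩ' h0 ((s0.mul s1).mul s3) (((s0.mul s2).mul (c d1)).add
        ((s1.mul s2).mul (c d0))) (w s0 s1 s3 v0 v1)
        (Van.add hΩ' h0 ((s0.mul s2).mul (c d1)) ((s1.mul s2).mul (c d0))
          (w s0 s2 (c _) v0 v2) (w s1 s2 (c _) v1 v2))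
    have vp : Van (k + 1) p := by
      have w : ∀ {f : E7 → ℝ} (r : ℝ), ContDiffOn ℝ ∞ f Ω' → Van (k + 1) f →
          Van (k + 1) fun z => f z * r := fun r sf vf =>
        Van.mul hΩ' h0 sf (c r) (b := 0) vf trivial (by omega)
      exact Van.add hΩ' h0 (s0.mul (c _)) ((s1.mul (c _)).add (s2.mul (c _))) (w _ s0 v0)
        (Van.add hΩ' h0 (s1.mul (c _)) (s2.mul (c _)) (w _ s1 v1) (w _ s2 v2))
    have vw : Van 1 fun z => φ z I - std I := ⟨by simp [hs], fun _ => trivial⟩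
    refine ⟨fun z => t1 z + (φ z I * u z + (φ z I - std I) * p z), (st1a.mul st1b).add
      (((sφ I).mul su).add (sw.mul sp)), Van.add hΩ' h0 (st1a.mul st1b)
      (((sφ I).mul su).add (sw.mul sp)) vt1 (Van.add hΩ' h0 ((sφ I).mul su) (sw.mul sp)
      (Van.mul hΩ' h0 (sφ I) su (a := 0) trivial vu (by omega))
      (Van.mul hΩ' h0 sw sp vw vp (by omega))), fun z => ?_⟩
    rw [Fin.prod_univ_three, Fin.prod_univ_three, jac_shift hq, jac_shift hq, jac_shift hq]
    change φ (shift q z) I * ((d0 + A0 z) * (d1 + A1 z) * (d2 + A2 z)) =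
      t1 z + (φ z I * u z + (φ z I - std I) * p z) + φ z I * (d0 * d1 * d2) +
      std I * (A0 z * d1 * d2 + d0 * A1 z * d2 + d0 * d1 * A2 z)
    simp only [t1, u, p]
    ring
  choose r sr vr hr using key
  refine (Van.sum hΩ' h0 Finset.univ sr vr).congr hΩ' h0 fun z _ => ?_
  have e1 : pullF (shift q) φ z J = ∑ I, φ (shift q z) I * ∏ s, jac (shift q) z (I s) (J s) := rfl
  have e2 : φ z J = ∑ I, φ z I * ∏ s, (1 : Matrix (Fin 7) (Fin 7) ℝ) (I s) (J s) := by
    conv_lhs => rw [← pullT_one (φ z)]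
    rfl
  rw [e1, e2, act_eq_sum_three, ← Finset.sum_sub_distrib, ← Finset.sum_sub_distrib]
  refine Finset.sum_congr rfl fun I _ => ?_
  rw [hr I z]
  ring

/-- The first-order change of `φ` is the action of the differential of `q`, whose linearized metric
is twice its symmetric part by `sec_act_symm`. -/
theorem van_lmet_shift (h0 : (0 : E7) ∈ Ω') (hc : IsChange (shift q) Ω' Ω)
    (hsub : Ω' ⊆ Ω) (hq : ∀ a, ContDiff ℝ ∞ (q a)) (hv : ∀ a, Van (k + 2) (q a))
    (hφ : SmoothOn Ω φ) (hs : φ 0 = std) (p l : Fin 7) :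
    Van (k + 2) fun z => lmet (pullF (shift q) φ) p l z - lmet φ p l z
      - (pderiv l (q p) z + pderiv p (q l) z) := by
  have hΩ' := hc.isOpen_source
  have sA : ∀ J, ContDiffOn ℝ ∞ (fun z => act (dmat q z) std J) Ω' := fun J =>
    ContDiffOn.sum fun r _ => ContDiffOn.sum fun m _ =>
      (contDiffOn_pderiv hΩ' (hq m).contDiffOn).mul contDiffOn_const
  have sD : ∀ J, ContDiffOn ℝ ∞
      (fun z => pullF (shift q) φ z J - φ z J - act (dmat q z) std J) Ω' := fun J =>
    ((hc.smooth_pullF hφ J).sub ((hφ J).mono hsub)).sub (sA J)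
  refine (Van.sum hΩ' h0 Finset.univ (f := fun J z => (secL p l + secL l p) (Pi.single J 1) *
    (pullF (shift q) φ z J - φ z J - act (dmat q z) std J))
    (fun J => contDiffOn_const.mul (sD J)) fun J => Van.const_mul hΩ' h0 (sD J) _
      (van_pullF_shift h0 hc hsub hq hv hφ hs J)).congr hΩ' h0 fun z _ => ?_
  have e := clm_apply_eq_sum (secL p l + secL l p)
    (pullF (shift q) φ z - φ z - act (dmat q z) std)
  simp only [Pi.sub_apply] at e
  rw [← e, map_sub, map_sub]
  simp only [add_apply, secL_apply, sec_act_symm, lmet]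
  rfl

/-- The change of the linearized Christoffel symbols under a shift. -/
theorem van_lchr_shift (h0 : (0 : E7) ∈ Ω') (hc : IsChange (shift q) Ω' Ω)
    (hsub : Ω' ⊆ Ω) (hq : ∀ a, ContDiff ℝ ∞ (q a)) (hv : ∀ a, Van (k + 2) (q a))
    (hφ : SmoothOn Ω φ) (hs : φ 0 = std) (m i j : Fin 7) :
    Van (k + 1) fun z => lchr (pullF (shift q) φ) m i j z - lchr φ m i j z
      - pderiv i (pderiv j (q m)) z := by
  have hΩ' := hc.isOpen_source
  have sq : ∀ a b, ContDiffOn ℝ ∞ (pderiv a (q b)) Ω' := fun a b =>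
    contDiffOn_pderiv hΩ' (hq b).contDiffOn
  have sl : ∀ p l, ContDiffOn ℝ ∞ (lmet φ p l) Ω' := fun p l => (hφ.lmet p l).mono hsub
  have sl' : ∀ p l, ContDiffOn ℝ ∞ (lmet (pullF (shift q) φ) p l) Ω' := fun p l =>
    (hc.smooth_pullF hφ).lmet p l
  have sD : ∀ p l, ContDiffOn ℝ ∞ (fun z => lmet (pullF (shift q) φ) p l z - lmet φ p l z
      - (pderiv l (q p) z + pderiv p (q l) z)) Ω' := fun p l =>
    ((sl' p l).sub (sl p l)).sub ((sq l p).add (sq p l))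
  have v : ∀ a p l, Van (k + 1) (pderiv a fun z => lmet (pullF (shift q) φ) p l z - lmet φ p l z
      - (pderiv l (q p) z + pderiv p (q l) z)) := fun a p l =>
    (van_lmet_shift h0 hc hsub hq hv hφ hs p l).2 a
  have s := fun a p l => contDiffOn_pderiv (i := a) hΩ' (sD p l)
  refine (Van.const_mul hΩ' h0 (((s i j m).add (s j i m)).sub (s m i j)) (1 / 2)
    (Van.sub hΩ' h0 ((s i j m).add (s j i m)) (s m i j)
      (Van.add hΩ' h0 (s i j m) (s j i m) (v i j m) (v j i m)) (v m i j))).congr hΩ' h0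
    fun z hz => ?_
  have d : ∀ {f : E7 → ℝ}, ContDiffOn ℝ ∞ f Ω' → DifferentiableAt ℝ f z := fun hf =>
    differentiableAt_of_contDiffOn hΩ' hf hz
  have e : ∀ a p l, pderiv a (fun z => lmet (pullF (shift q) φ) p l z - lmet φ p l z
      - (pderiv l (q p) z + pderiv p (q l) z)) z =
      pderiv a (lmet (pullF (shift q) φ) p l) z - pderiv a (lmet φ p l) z
      - (pderiv a (pderiv l (q p)) z + pderiv a (pderiv p (q l)) z) := fun a p l => by
    rw [pderiv_sub (d ((sl' p l).sub (sl p l))) (d ((sq l p).add (sq p l))),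
      pderiv_sub (d (sl' p l)) (d (sl p l)), pderiv_add (d (sq l p)) (d (sq p l))]
  have sy : ∀ a b c, pderiv a (pderiv b (q c)) z = pderiv b (pderiv a (q c)) z := fun a b c =>
    pderiv_comm hΩ' (hq c).contDiffOn hz
  simp only [e, lchr]
  rw [sy m i j, sy m j i, sy j i m]
  ring

end Shift

end

section

/-! ### Homogeneous polynomials -/

/-- A smooth function which is homogeneous of degree `r`, by Euler's identity. -/
def Hom (r : ℕ) (f : E7 → ℝ) : Prop :=
  ContDiff ℝ ∞ f ∧ ∀ y : E7, ∑ i, y i * pderiv i f y = r * f y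

/-- The primitive of a closed `1`-form with homogeneous components. -/
def prim (r : ℕ) (q : Fin 7 → E7 → ℝ) (y : E7) : ℝ := (1 / (r + 1 : ℝ)) * ∑ i, y i * q i y

theorem hom_const (c : ℝ) : Hom 0 fun _ => c :=
  ⟨contDiff_const, fun y => by simp [pderiv_const]⟩

theorem contDiff_apply_coord (a : Fin 7) : ContDiff ℝ ∞ fun z : E7 => z a :=
  (EuclideanSpace.proj a : E7 →L[ℝ] ℝ).contDiff

section Prim

variable {r : ℕ} {q : Fin 7 → E7 → ℝ}

/-- The Poincaré lemma without integration: closedness turns `∑ yᵢ ∂ⱼ qᵢ` into `∑ yᵢ ∂ᵢ qⱼ`, which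
Euler's identity evaluates as `r qⱼ`. The factor `1 / (r + 1)` is therefore right. -/
theorem pderiv_prim (hq : ∀ i, Hom r (q i)) (hc : ∀ i j, pderiv j (q i) = pderiv i (q j))
    (j : Fin 7) : pderiv j (prim r q) = q j := by
  ext y
  have d : ∀ i, DifferentiableAt ℝ (q i) y := fun i => contDiff_differentiableAt (hq i).1 y
  have d' : ∀ i, DifferentiableAt ℝ (fun z : E7 => z i) y := fun i =>
    contDiff_differentiableAt (contDiff_apply_coord i) y
  have e : pderiv j (prim r q) y = (1 / (r + 1 : ℝ)) * ∑ i, pderiv j (fun z => z i * q i z) y := by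
    rw [← pderiv_sum Finset.univ fun i _ => (d' i).fun_mul (d i),
      ← pderiv_const_mul _ (DifferentiableAt.fun_sum fun i _ => (d' i).fun_mul (d i))]
    rfl
  have e2 : ∀ i, pderiv j (fun z : E7 => z i * q i z) y =
      (1 : Matrix (Fin 7) (Fin 7) ℝ) i j * q i y + y i * pderiv i (q j) y := fun i => by
    rw [pderiv_mul (d' i) (d i), pderiv_coord, hc i j]
  rw [e]
  simp only [e2, Finset.sum_add_distrib, (hq j).2 y]
  have : (r : ℝ) + 1 ≠ 0 := by positivity
  simp [Matrix.one_apply]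
  field_simp
  ring

theorem hom_prim (hq : ∀ i, Hom r (q i)) (hc : ∀ i j, pderiv j (q i) = pderiv i (q j)) :
    Hom (r + 1) (prim r q) := by
  refine ⟨contDiff_const.mul (ContDiff.sum fun i _ => (contDiff_apply_coord i).mul (hq i).1),
    fun y => ?_⟩
  simp only [pderiv_prim hq hc]
  have : (r : ℝ) + 1 ≠ 0 := by positivity
  rw [prim]
  push_cast
  field_simp

theorem van_prim (hq : ∀ i, Hom r (q i)) (hc : ∀ i j, pderiv j (q i) = pderiv i (q j)) {m : ℕ}
    (hv : ∀ i, Van m (q i)) : Van (m + 1) (prim r q) :=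
  ⟨by simp [prim], fun i => by rw [pderiv_prim hq hc]; exact hv i⟩

end Prim

/-- The linear form with coefficients `b`. -/
def poly1 (b : Fin 7 → ℝ) : E7 → ℝ := prim 0 fun i _ => b i
/-- The quadratic form with second derivatives `b`. -/
def poly2 (b : Fin 7 → Fin 7 → ℝ) : E7 → ℝ := prim 1 fun i => poly1 (b i)
/-- The cubic form with third derivatives `b`. -/
def poly3 (b : Fin 7 → Fin 7 → Fin 7 → ℝ) : E7 → ℝ := prim 2 fun i => poly2 (b i)
/-- The quartic form with fourth derivatives `b`. -/
def poly4 (b : Fin 7 → Fin 7 → Fin 7 → Fin 7 → ℝ) : E7 → ℝ := prim 3 fun i => poly3 (b i)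

theorem curl_const (b : Fin 7 → ℝ) (i j : Fin 7) :
    pderiv j (fun _ : E7 => b i) = pderiv i fun _ : E7 => b j := by
  ext y; rw [pderiv_const, pderiv_const]

theorem poly1_spec (b : Fin 7 → ℝ) : Hom 1 (poly1 b) ∧ Van 1 (poly1 b) ∧
    ∀ i, pderiv i (poly1 b) = fun _ => b i :=
  have h : ∀ i, Hom 0 (fun _ : E7 => b i) := fun i => hom_const (b i)
  ⟨hom_prim h (curl_const b), van_prim (m := 0) h (curl_const b) fun _ => trivial,
    fun i => pderiv_prim h (curl_const b) i⟩

theorem poly2_spec {b : Fin 7 → Fin 7 → ℝ} (hb : ∀ i j, b i j = b j i) :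
    Hom 2 (poly2 b) ∧ Van 2 (poly2 b) ∧ ∀ i, pderiv i (poly2 b) = poly1 (b i) :=
  have h := fun i => (poly1_spec (b i)).1
  have hc : ∀ i j, pderiv j (poly1 (b i)) = pderiv i (poly1 (b j)) := fun i j => by
    rw [(poly1_spec (b i)).2.2, (poly1_spec (b j)).2.2, hb]
  ⟨hom_prim h hc, van_prim h hc fun i => (poly1_spec (b i)).2.1, fun i => pderiv_prim h hc i⟩

theorem poly3_spec {b : Fin 7 → Fin 7 → Fin 7 → ℝ} (hb : ∀ i j, b i j = b j i)
    (hb' : ∀ i j k, b i j k = b i k j) :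
    Hom 3 (poly3 b) ∧ Van 3 (poly3 b) ∧ ∀ i, pderiv i (poly3 b) = poly2 (b i) :=
  have s := fun i => poly2_spec (hb' i)
  have h := fun i => (s i).1
  have hc : ∀ i j, pderiv j (poly2 (b i)) = pderiv i (poly2 (b j)) := fun i j => by
    rw [(s i).2.2, (s j).2.2, hb]
  ⟨hom_prim h hc, van_prim h hc fun i => (s i).2.1, fun i => pderiv_prim h hc i⟩

theorem poly4_spec {b : Fin 7 → Fin 7 → Fin 7 → Fin 7 → ℝ} (hb : ∀ i j, b i j = b j i)
    (hb' : ∀ i j k, b i j k = b i k j) (hb'' : ∀ i j k l, b i j k l = b i j l k) :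
    Hom 4 (poly4 b) ∧ Van 4 (poly4 b) ∧ ∀ i, pderiv i (poly4 b) = poly3 (b i) :=
  have s := fun i => poly3_spec (hb' i) (hb'' i)
  have h := fun i => (s i).1
  have hc : ∀ i j, pderiv j (poly3 (b i)) = pderiv i (poly3 (b j)) := fun i j => by
    rw [(s i).2.2, (s j).2.2, hb]
  ⟨hom_prim h hc, van_prim h hc fun i => (s i).2.1, fun i => pderiv_prim h hc i⟩

/-! ### The gauge -/

/-- The first derivatives of the linearized Christoffel symbols, summed cyclically. -/
def cyc (φ : CoordTensor 3) (m i j p : Fin 7) : ℝ :=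
  pderiv p (lchr φ m i j) 0 + pderiv i (lchr φ m j p) 0 + pderiv j (lchr φ m p i) 0

/-- The second derivatives of the linearized Christoffel symbols, symmetrized. -/
def cyc2 (φ : CoordTensor 3) (m i j p q : Fin 7) : ℝ :=
  pderiv p (pderiv q (lchr φ m i j)) 0 + pderiv j (pderiv q (lchr φ m i p)) 0
    + pderiv j (pderiv p (lchr φ m i q)) 0 + pderiv i (pderiv q (lchr φ m j p)) 0
    + pderiv i (pderiv p (lchr φ m j q)) 0 + pderiv i (pderiv j (lchr φ m p q)) 0

/-- The coordinates are normal to order `k` at the origin. -/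
structure GaugeAt (k : ℕ) (φ : CoordTensor 3) : Prop where
  std : φ 0 = G2.std
  one : 1 ≤ k → ∀ m i j, lchr φ m i j 0 = 0
  two : 2 ≤ k → ∀ m i j p, cyc φ m i j p = 0
  three : 3 ≤ k → ∀ m i j p q, cyc2 φ m i j p q = 0

section Gauge

variable {Ω Ω' Ω'' : Set E7} {φ φ' : CoordTensor 3} {F G : E7 → E7} {k : ℕ}

theorem lchr_congr (hΩ : IsOpen Ω) (h : ∀ z ∈ Ω, φ' z = φ z) (m i j : Fin 7) :
    ∀ z ∈ Ω, lchr φ' m i j z = lchr φ m i j z := fun z hz => by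
  have e : ∀ a p l, pderiv a (lmet φ' p l) z = pderiv a (lmet φ p l) z := fun a p l =>
    pderiv_congr hΩ hz fun w hw => by rw [lmet, lmet, h w hw]
  rw [lchr, lchr, e, e, e]

theorem GaugeAt.congr (hΩ : IsOpen Ω) (h0 : (0 : E7) ∈ Ω) (h : ∀ z ∈ Ω, φ' z = φ z)
    (hg : GaugeAt k φ) : GaugeAt k φ' := by
  have e := lchr_congr hΩ h
  have e1 : ∀ p m i j, ∀ z ∈ Ω, pderiv p (lchr φ' m i j) z = pderiv p (lchr φ m i j) z :=
    fun p m i j z hz => pderiv_congr hΩ hz (e m i j)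
  have e2 : ∀ p q m i j, pderiv p (pderiv q (lchr φ' m i j)) 0 =
      pderiv p (pderiv q (lchr φ m i j)) 0 :=
    fun p q m i j => pderiv_congr hΩ h0 (e1 q m i j)
  refine ⟨(h 0 h0).trans hg.std, fun hk m i j => ?_, fun hk m i j p => ?_,
    fun hk m i j p q => ?_⟩
  · rw [e m i j 0 h0]; exact hg.one hk m i j
  · rw [cyc, e1 _ _ _ _ 0 h0, e1 _ _ _ _ 0 h0, e1 _ _ _ _ 0 h0]; exact hg.two hk m i j p
  · rw [cyc2, e2, e2, e2, e2, e2, e2]; exact hg.three hk m i j p q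

/-! ### Composition of coordinate changes and the construction of the gauge -/

theorem jac_comp (hF : IsChange F Ω' Ω) (hG : IsChange G Ω'' Ω') {y : E7} (hy : y ∈ Ω'') :
    jac (F ∘ G) y = jac F (G y) * jac G y := by
  ext a i
  rw [Matrix.mul_apply]
  exact pderiv_comp (f := fun z => F z a) (differentiableAt_of_contDiffOn hF.isOpen_source
    (contDiffOn_coord hF.smooth a) (hG.maps y hy)) (hG.diffAt hy)

theorem IsChange.comp (hF : IsChange F Ω' Ω) (hG : IsChange G Ω'' Ω') :
    IsChange (F ∘ G) Ω'' Ω where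
  isOpen_source := hG.isOpen_source
  isOpen_target := hF.isOpen_target
  smooth := hF.smooth.comp hG.smooth hG.maps
  maps := fun y hy => hF.maps _ (hG.maps y hy)
  det_ne_zero := fun y hy => by
    rw [jac_comp hF hG hy, Matrix.det_mul]
    exact mul_ne_zero (hF.det_ne_zero _ (hG.maps y hy)) (hG.det_ne_zero y hy)

theorem pullF_comp (hF : IsChange F Ω' Ω) (hG : IsChange G Ω'' Ω') {y : E7} (hy : y ∈ Ω'') {l : ℕ}
    (α : CoordTensor l) : pullF (F ∘ G) α y = pullF G (pullF F α) y := by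
  rw [pullF, jac_comp hF hG hy, pullT_mul]
  rfl

/-- The affine map `y ↦ y₀ + B y`. -/
def affineMap (y₀ : E7) (B : Matrix (Fin 7) (Fin 7) ℝ) (y : E7) : E7 :=
  WithLp.toLp 2 fun a => y₀ a + ∑ b, B a b * y b

theorem contDiff_affineMap (y₀ : E7) (B : Matrix (Fin 7) (Fin 7) ℝ) :
    ContDiff ℝ ∞ (affineMap y₀ B) := by
  rw [contDiff_euclidean]
  exact fun a => contDiff_const.add (ContDiff.sum fun b _ =>
    contDiff_const.mul (contDiff_apply_coord b))

theorem jac_affineMap (y₀ : E7) (B : Matrix (Fin 7) (Fin 7) ℝ) (y : E7) :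
    jac (affineMap y₀ B) y = B := by
  ext a i
  have d' : ∀ i, DifferentiableAt ℝ (fun z : E7 => z i) y := fun i =>
    contDiff_differentiableAt (contDiff_apply_coord i) y
  change pderiv i (fun z : E7 => y₀ a + ∑ b, B a b * z b) y = B a i
  rw [pderiv_add (differentiableAt_const _)
    (DifferentiableAt.fun_sum fun b _ => (d' b).const_mul _), pderiv_const,
    pderiv_sum Finset.univ fun b _ => (d' b).const_mul _]
  simp [pderiv_const_mul _ (d' _), pderiv_coord, Matrix.one_apply]

theorem affineMap_zero (y₀ : E7) (B : Matrix (Fin 7) (Fin 7) ℝ) : affineMap y₀ B 0 = y₀ := by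
  ext a; simp [affineMap]

/-- If `φ` is the pullback of the standard form by `A` at `y₀`, the affine map with linear part
`A⁻¹` makes it standard at the origin. -/
theorem IsG2On.exists_frame (hφ : IsG2On Ω φ) {y₀ : E7} (hy : y₀ ∈ Ω) : ∃ F Ω',
    IsChange F Ω' Ω ∧ (0 : E7) ∈ Ω' ∧ F 0 = y₀ ∧ pullF F φ 0 = std := by
  obtain ⟨A, hA, h⟩ := hφ.pos y₀ hy
  refine ⟨affineMap y₀ A⁻¹, affineMap y₀ A⁻¹ ⁻¹' Ω, ⟨hφ.isOpen.preimage
    (contDiff_affineMap _ _).continuous, hφ.isOpen, (contDiff_affineMap _ _).contDiffOn,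
    fun y hy => hy, fun y _ => ?_⟩, ?_, affineMap_zero _ _, ?_⟩
  · rw [jac_affineMap]
    exact (Matrix.isUnit_nonsing_inv_det A (isUnit_iff_ne_zero.2 hA)).ne_zero
  · change affineMap y₀ A⁻¹ 0 ∈ Ω
    rwa [affineMap_zero]
  · rw [pullF, jac_affineMap, affineMap_zero, h, ← pullT_mul,
      Matrix.mul_nonsing_inv _ (isUnit_iff_ne_zero.2 hA), pullT_one]

theorem Van.pderiv_eq {f f' g : E7 → ℝ} (hΩ : IsOpen Ω) (h0 : (0 : E7) ∈ Ω)
    (sf : ContDiffOn ℝ ∞ f Ω) (sf' : ContDiffOn ℝ ∞ f' Ω) (sg : ContDiffOn ℝ ∞ g Ω) {n : ℕ}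
    (h : Van (n + 1) fun z => f' z - f z - g z) (i : Fin 7) :
    Van n fun z => pderiv i f' z - pderiv i f z - pderiv i g z :=
  (h.2 i).congr hΩ h0 fun z hz => by
    have d : ∀ {f : E7 → ℝ}, ContDiffOn ℝ ∞ f Ω → DifferentiableAt ℝ f z := fun hf =>
      differentiableAt_of_contDiffOn hΩ hf hz
    rw [pderiv_sub (d (sf'.sub sf)) (d sg), pderiv_sub (d sf') (d sf)]

theorem Van.eq_add {f f' g : E7 → ℝ} {n : ℕ} (h : Van (n + 1) fun z => f' z - f z - g z) :
    f' 0 = f 0 + g 0 := by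
  have := h.1
  linarith

/-- The gauge is improved by one order by a shift. -/
theorem IsG2On.gauge_step {q : Fin 7 → E7 → ℝ} (hφ : IsG2On Ω φ) (h0 : (0 : E7) ∈ Ω)
    (hs : φ 0 = std) (hq : ∀ a, ContDiff ℝ ∞ (q a)) (hv : ∀ a, Van (k + 2) (q a)) :
    ∃ Ω', IsChange (shift q) Ω' Ω ∧ (0 : E7) ∈ Ω' ∧ shift q 0 = 0 ∧ pullF (shift q) φ 0 = std ∧
      (∀ m i j, lchr (pullF (shift q) φ) m i j 0 =
        lchr φ m i j 0 + pderiv i (pderiv j (q m)) 0) ∧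
      (1 ≤ k → ∀ p m i j, pderiv p (lchr (pullF (shift q) φ) m i j) 0 =
        pderiv p (lchr φ m i j) 0 + pderiv p (pderiv i (pderiv j (q m))) 0) ∧
      (2 ≤ k → ∀ r p m i j, pderiv r (pderiv p (lchr (pullF (shift q) φ) m i j)) 0 =
        pderiv r (pderiv p (lchr φ m i j)) 0
          + pderiv r (pderiv p (pderiv i (pderiv j (q m)))) 0) := by
  have hc := isChange_shift hφ.isOpen hq
  have h0' := zero_mem_shiftDomain h0 hq hv
  have hsub : shiftDomain q Ω ⊆ Ω := Set.inter_subset_left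
  have hΩ' := hc.isOpen_source
  have v := van_lchr_shift h0' hc hsub hq hv hφ.smooth hs
  have s := fun m i j => (hφ.smooth.lchr hφ.isOpen m i j).mono hsub
  have s' := fun m i j => (hc.smooth_pullF hφ.smooth).lchr hΩ' m i j
  have sq : ∀ m i j, ContDiffOn ℝ ∞ (pderiv i (pderiv j (q m))) (shiftDomain q Ω) := fun m i j =>
    contDiffOn_pderiv hΩ' (contDiffOn_pderiv hΩ' (hq m).contDiffOn)
  refine ⟨_, hc, h0', shift_zero hv, (pullF_shift_zero hq hv φ).trans hs,
    fun m i j => (v m i j).eq_add, fun hk p m i j => ?_, fun hk r p m i j => ?_⟩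
  · obtain ⟨k, rfl⟩ : ∃ n, k = n + 1 := ⟨k - 1, by omega⟩
    exact ((v m i j).pderiv_eq hΩ' h0' (s m i j) (s' m i j) (sq m i j) p).eq_add
  · obtain ⟨k, rfl⟩ : ∃ n, k = n + 2 := ⟨k - 2, by omega⟩
    exact (((v m i j).pderiv_eq hΩ' h0' (s m i j) (s' m i j) (sq m i j) p).pderiv_eq hΩ' h0'
      (contDiffOn_pderiv hΩ' (s m i j)) (contDiffOn_pderiv hΩ' (s' m i j))
      (contDiffOn_pderiv hΩ' (sq m i j)) r).eq_add

/-- A shift changes the linearized Christoffel symbols by the second derivatives of `q`, so the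
quadratic form with second derivatives `-Γ` removes them. The prescription is consistent since the
symbols are symmetric. -/
theorem IsG2On.gauge_one (hφ : IsG2On Ω φ) (h0 : (0 : E7) ∈ Ω) (hs : φ 0 = G2.std) :
    ∃ G Ω', IsChange G Ω' Ω ∧ (0 : E7) ∈ Ω' ∧ G 0 = 0 ∧ GaugeAt 1 (pullF G φ) := by
  set b : Fin 7 → Fin 7 → Fin 7 → ℝ := fun m i j => -lchr φ m i j 0 with hb
  have sp := fun m => poly2_spec (b := b m) fun i j => by simp only [hb]; rw [lchr_symm]
  obtain ⟨Ω', hc, h0', z, st, e, -⟩ := hφ.gauge_step (k := 0) h0 hs (fun m => (sp m).1.1)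
    fun m => (sp m).2.1
  refine ⟨_, Ω', hc, h0', z, st, fun _ m i j => ?_, fun h => by omega, fun h => by omega⟩
  rw [e, (sp m).2.2, (poly1_spec _).2.2]
  simp only [hb]
  rw [lchr_symm]
  ring

/-- Third derivatives of the cubic `q` are totally symmetric and contribute three equal terms to the
cyclic sum, hence the factor `-1 / 3`. The cubic does not disturb the first-order gauge. -/
theorem IsG2On.gauge_two (hφ : IsG2On Ω φ) (h0 : (0 : E7) ∈ Ω) (hg : GaugeAt 1 φ) :
    ∃ G Ω', IsChange G Ω' Ω ∧ (0 : E7) ∈ Ω' ∧ G 0 = 0 ∧ GaugeAt 2 (pullF G φ) := by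
  set b : Fin 7 → Fin 7 → Fin 7 → Fin 7 → ℝ := fun m i j p => -(1 / 3) * cyc φ m i j p with hb
  have b1 : ∀ m i j, b m i j = b m j i := fun m i j => by
    ext p
    simp only [hb, cyc, lchr_symm φ m j i, lchr_symm φ m p j, lchr_symm φ m i p]; ring
  have b2 : ∀ m i j p, b m i j p = b m i p j := fun m i j p => by
    simp only [hb, cyc, lchr_symm φ m i p, lchr_symm φ m p j, lchr_symm φ m j i]; ring
  have sp := fun m => poly3_spec (b1 m) (b2 m)
  have e2 : ∀ m i j, pderiv i (pderiv j (poly3 (b m))) = poly1 (b m j i) := fun m i j => by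
    rw [(sp m).2.2, (poly2_spec (b2 m j)).2.2]
  obtain ⟨Ω', hc, h0', z, st, e, e', -⟩ := hφ.gauge_step (k := 1) h0 hg.std (fun m => (sp m).1.1)
    fun m => (sp m).2.1
  refine ⟨_, Ω', hc, h0', z, st, fun _ m i j => ?_, fun _ m i j p => ?_, fun h => by omega⟩
  · rw [e, e2, hg.one le_rfl, (poly1_spec _).2.1.1, add_zero]
  · rw [cyc, e' le_rfl, e' le_rfl, e' le_rfl]
    simp only [e2, (poly1_spec _).2.2]
    rw [b1 m j i, b1 m p j, b2 m j p i, b1 m j i, b2 m i p j]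
    simp only [hb, cyc]
    ring

/-- The sum `cyc2` runs over the six choices of two derivative indices among four. The symmetric
fourth derivatives of the quartic `q` enter six times, hence the factor `-1 / 6`, and they do not
affect the lower orders. -/
theorem IsG2On.gauge_three (hφ : IsG2On Ω φ) (h0 : (0 : E7) ∈ Ω) (hg : GaugeAt 2 φ) :
    ∃ G Ω', IsChange G Ω' Ω ∧ (0 : E7) ∈ Ω' ∧ G 0 = 0 ∧ GaugeAt 3 (pullF G φ) := by
  set b : Fin 7 → Fin 7 → Fin 7 → Fin 7 → Fin 7 → ℝ := fun m i j p q => -(1 / 6) * cyc2 φ m i j p q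
    with hb
  have cm : ∀ m i j p q, pderiv p (pderiv q (lchr φ m i j)) 0 =
      pderiv q (pderiv p (lchr φ m i j)) 0 := fun m i j p q =>
    pderiv_comm hφ.isOpen (hφ.smooth_lchr m i j) h0
  have b1 : ∀ m i j, b m i j = b m j i := fun m i j => by
    ext p q
    simp only [hb, cyc2, lchr_symm φ m j i, cm m p q j i]; ring
  have b2 : ∀ m i j p, b m i j p = b m i p j := fun m i j p => by
    ext q
    simp only [hb, cyc2, lchr_symm φ m p j, cm m i q p j]; ring
  have b3 : ∀ m i j p q, b m i j p q = b m i j q p := fun m i j p q => by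
    simp only [hb, cyc2, lchr_symm φ m q p, cm m i j q p]; ring
  have sp := fun m => poly4_spec (b1 m) (b2 m) (b3 m)
  have e2 : ∀ m i j, pderiv i (pderiv j (poly4 (b m))) = poly2 (b m j i) := fun m i j => by
    rw [(sp m).2.2, (poly3_spec (b2 m j) (b3 m j)).2.2]
  have e3 : ∀ m i j p, pderiv p (pderiv i (pderiv j (poly4 (b m)))) = poly1 (b m j i p) :=
    fun m i j p => by rw [e2, (poly2_spec (b3 m j i)).2.2]
  obtain ⟨Ω', hc, h0', z, st, e, e', e''⟩ := hφ.gauge_step (k := 2) h0 hg.std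
    (fun m => (sp m).1.1) fun m => (sp m).2.1
  refine ⟨_, Ω', hc, h0', z, st, fun _ m i j => ?_, fun _ m i j p => ?_, fun _ m i j p q => ?_⟩
  · rw [e, e2, hg.one (by norm_num), (poly2_spec (b3 m j i)).2.1.1, add_zero]
  · rw [cyc, e' (by norm_num), e' (by norm_num), e' (by norm_num)]
    simp only [e3, (poly1_spec _).2.1.1, add_zero]
    exact hg.two le_rfl m i j p
  · rw [cyc2, e'' le_rfl, e'' le_rfl, e'' le_rfl, e'' le_rfl, e'' le_rfl, e'' le_rfl]
    simp only [e3, (poly1_spec _).2.2]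
    have t : ∀ i j p q, b m i j p q = b m j i p q := fun i j p q => by rw [b1 m i j]
    -- Together with its neighbours this sorts the indices of the six correction terms, so that they
    -- become copies of a single value `b m i j p q`.
    have u : ∀ i j p q, b m i j p q = b m i p j q := fun i j p q => by rw [b2 m i j p]
    have v : ∀ i j p q, b m i j p q = b m i j q p := b3 m
    rw [t j i q p, v i j q p, t p i q j, v i p q j, u i p j q, t q i p j, u i q p j, v i p q j,
      u i p j q, v p j q i, u p j i q, t p i j q, u i p j q, t q j p i, v j q p i, u j q i p,
      t j i q p, v i j q p, v q p j i, u q p i j, t q i p j, u i q p j, v i p q j, u i p j q]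
    simp only [hb, cyc2]
    ring

theorem gauge_comp {y₀ : E7} {F : E7 → E7} (hF : IsChange F Ω' Ω)
    (hF0 : F 0 = y₀) (h : ∃ G Ω'', IsChange G Ω'' Ω' ∧ (0 : E7) ∈ Ω'' ∧ G 0 = 0 ∧
      GaugeAt k (pullF G (pullF F φ))) :
    ∃ F Ω', IsChange F Ω' Ω ∧ (0 : E7) ∈ Ω' ∧ F 0 = y₀ ∧ GaugeAt k (pullF F φ) := by
  obtain ⟨G, Ω'', hG, h0, hG0, hg⟩ := h
  exact ⟨F ∘ G, Ω'', hF.comp hG, h0, by simp [hG0, hF0],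
    hg.congr hG.isOpen_source h0 fun z hz => pullF_comp hF hG hz φ⟩

/-- Around every point there are coordinates which are normal to third order. -/
theorem IsG2On.exists_gauge (hφ : IsG2On Ω φ) {y₀ : E7} (hy : y₀ ∈ Ω) :
    ∃ F Ω', IsChange F Ω' Ω ∧ (0 : E7) ∈ Ω' ∧ F 0 = y₀ ∧ GaugeAt 3 (pullF F φ) := by
  obtain ⟨F, Ω', hF, h0, hF0, hs⟩ := hφ.exists_frame hy
  obtain ⟨F, Ω', hF, h0, hF0, hs⟩ := gauge_comp hF hF0 ((hφ.pull hF).gauge_one h0 hs)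
  obtain ⟨F, Ω', hF, h0, hF0, hs⟩ := gauge_comp hF hF0 ((hφ.pull hF).gauge_two h0 hs)
  exact gauge_comp hF hF0 ((hφ.pull hF).gauge_three h0 hs)

end Gauge

end

section

/-! ### Jets in normal coordinates -/

section

variable {Ω Ω' : Set E7} {φ : CoordTensor 3} {y : E7}

/-- In weight one, no jet is needed for the lower order bound. It can be used with `ρ = 0`, and
equality up to lower order becomes equality. -/
theorem LEq.eq_of_std {Φ Ψ : Fnl} (h : LEq 1 Φ Ψ) (hφ : IsClosedG2On Ω φ) (hy : y ∈ Ω)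
    (h0 : φ y = std) : Φ φ y = Ψ φ y := by
  obtain ⟨C, -, hb⟩ := h.low.bound
  have := hb Ω φ y 0 hφ hy le_rfl h0 fun L h1 h2 => by
    have : L.length ≤ 0 := h2
    omega
  simp only [pow_one, MulZeroClass.mul_zero] at this
  exact sub_eq_zero.1 (abs_nonpos_iff.1 this)

/-- The torsion of a closed `G₂` structure is orthogonal to the `3`-form. -/
theorem IsClosedG2On.contract_torsion (hφ : IsClosedG2On Ω φ) (hy : y ∈ Ω) (k : Fin 7) :
    contract φ y (torsion φ y) (fun L => φ y (Matrix.vecCons k L)) = 0 := by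
  obtain ⟨F, Ω', hF, h0, rfl, hs⟩ := hφ.exists_frame hy
  have hφ' := hφ.pull hF
  have hA := hF.det_ne_zero 0 h0
  set A := jac F 0 with hAdef
  set X : Fin 7 → ℝ := fun k => contract φ (F 0) (torsion φ (F 0))
    (fun L => φ (F 0) (Matrix.vecCons k L)) with hX
  -- In a frame where `φ` is standard the torsion equals its linearization, for which `ltor_algebra`
  -- gives the vanishing. Equivariance brings the result back multiplied by the invertible Jacobian.
  have key : X ᵥ* A = 0 := by
    ext m
    have e1 : contract (pullF F φ) 0 (torsion (pullF F φ) 0)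
        (fun L => pullF F φ 0 (Matrix.vecCons m L)) = ∑ b, A b m * X b := by
      have : (fun L : Fin 2 → Fin 7 => pullF F φ 0 (Matrix.vecCons m L)) = fun L =>
          ∑ b, A b m * pullT A (fun I => φ (F 0) (Matrix.vecCons b I)) L := by
        ext L
        exact pullT_cons _ _ _ _
      rw [this, contract_sum_right]
      refine Finset.sum_congr rfl fun b _ => ?_
      rw [contract_smul_right, torsion_pullF hF hφ.toIsG2On h0,
        contract_pull (φ := φ) (y := F 0) hA rfl]
    have e2 : contract (pullF F φ) 0 (torsion (pullF F φ) 0)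
        (fun L => pullF F φ 0 (Matrix.vecCons m L)) = 0 := by
      rw [contract_std hs, sum_index2, ← (hφ'.ltor_algebra h0).2.2 m]
      refine Finset.sum_congr rfl fun i _ => Finset.sum_congr rfl fun j _ => ?_
      rw [(leq_torsion i j).eq_of_std hφ' h0 hs, hs, mul_comm]
      rfl
    simp only [Matrix.vecMul, dotProduct, Pi.zero_apply]
    rw [← e2, e1]
    exact Finset.sum_congr rfl fun b _ => mul_comm _ _
  exact congrFun (Matrix.eq_zero_of_vecMul_eq_zero hA key) k

variable {k : ℕ}

/-- The derivative of the metric is a sum of two Christoffel symbols, both zero in the gauge. -/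
theorem GaugeAt.pderiv_lmet (hg : GaugeAt k φ) (hk : 1 ≤ k) (a i j : Fin 7) :
    pderiv a (lmet φ i j) 0 = 0 := by
  have h1 := hg.one hk j a i
  have h2 := hg.one hk i a j
  simp only [lchr, lmet_comm φ j i] at h1 h2
  linarith

theorem GaugeAt.pderiv_metricInv (hg : GaugeAt k φ) (hk : 1 ≤ k) (hφ : IsClosedG2On Ω φ)
    (h0 : (0 : E7) ∈ Ω) (a i j : Fin 7) : pderiv a (fun z => metricInv φ z i j) 0 = 0 := by
  have hm : ∀ i j, pderiv a (fun z => metric φ z i j) 0 = 0 := fun i j =>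
    ((leq_metric a i j).eq_of_std hφ h0 hg.std).trans (hg.pderiv_lmet hk a i j)
  have d : ∀ i j, DifferentiableAt ℝ (fun z => metric φ z i j) 0 := fun i j =>
    differentiableAt_of_contDiffOn hφ.isOpen (hφ.smooth_metric i j) h0
  have d' : ∀ i j, DifferentiableAt ℝ (fun z => metricInv φ z i j) 0 := fun i j =>
    differentiableAt_of_contDiffOn hφ.isOpen (hφ.smooth_metricInv i j) h0
  have h1 : pderiv a (fun z => ∑ m, metric φ z i m * metricInv φ z m j) 0 = 0 := by
    rw [← pderiv_const (i := a) (y := 0) ((1 : Matrix (Fin 7) (Fin 7) ℝ) i j)]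
    refine pderiv_congr hφ.isOpen h0 fun z hz => ?_
    rw [← Matrix.mul_apply, hφ.metric_mul_inv hz]
  rw [pderiv_sum _ fun m _ => (d i m).fun_mul (d' m j)] at h1
  simp only [pderiv_mul (d _ _) (d' _ _), hm, metric_std hg.std, zero_mul, zero_add] at h1
  simpa [Matrix.one_apply] using h1

theorem GaugeAt.covDeriv_torsion (hg : GaugeAt k φ) (hk : 1 ≤ k) (hφ : IsClosedG2On Ω φ)
    (h0 : (0 : E7) ∈ Ω) (a : Fin 7) (L : Fin 2 → Fin 7) :
    covDeriv φ (torsion φ) 0 (Matrix.vecCons a L) = pderiv a (fun z => torsion φ z L) 0 := by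
  have h : ∀ m i j, christoffel φ m i j 0 = 0 := fun m i j =>
    ((leq_christoffel m i j).eq_of_std hφ h0 hg.std).trans (hg.one hk m i j)
  rw [covDeriv_cons]
  simp [h]

theorem GaugeAt.pderiv_self (hg : GaugeAt k φ) (hk : 1 ≤ k) (hφ : IsClosedG2On Ω φ)
    (h0 : (0 : E7) ∈ Ω) (a i j l : Fin 7) : pderiv a (fun z => φ z ![i, j, l]) 0 =
      ∑ m, ltor φ a m 0 * ps m i j l := by
  rw [hφ.pderiv_eq h0, act_three]
  simp [lconn, hg.one hk]

/-- The norm of the torsion is controlled by its derivative. -/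
theorem GaugeAt.sum_torsion_sq (hg : GaugeAt k φ) (hk : 1 ≤ k) (hφ : IsClosedG2On Ω φ)
    (h0 : (0 : E7) ∈ Ω) : ∑ a, ∑ m, ltor φ a m 0 ^ 2 =
      -(1 / 2) * ∑ a, ∑ i, ∑ j, covDeriv φ (torsion φ) 0 ![a, i, j] * ph a i j := by
  have hΩ := hφ.isOpen
  have dT : ∀ I, DifferentiableAt ℝ (fun z => torsion φ z I) 0 := fun I =>
    differentiableAt_of_contDiffOn hΩ (hφ.smooth_torsion I) h0
  have dφ : ∀ I, DifferentiableAt ℝ (fun z => φ z I) 0 := fun I =>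
    differentiableAt_of_contDiffOn hΩ (hφ.smooth I) h0
  have dg : ∀ i j, DifferentiableAt ℝ (fun z => metricInv φ z i j) 0 := fun i j =>
    differentiableAt_of_contDiffOn hΩ (hφ.smooth_metricInv i j) h0
  have dP : ∀ I J : Fin 2 → Fin 7, DifferentiableAt ℝ (fun z => ∏ s, metricInv φ z (I s) (J s)) 0 :=
    fun I J => differentiableAt_of_contDiffOn hΩ
      (contDiffOn_prod fun s _ => hφ.smooth_metricInv _ _) h0
  -- The identity `T_{ij} φ_{aij} = 0` is differentiated in the direction `a`. Derivatives of the
  -- inverse metric vanish in the gauge, the derivative of `φ` is the torsion contracted with `ψ`,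
  -- and the eigenvalue `-2` turns the resulting `T ψ T` term into `2 |T|²`.
  have key : ∀ a, ∑ i, ∑ j, covDeriv φ (torsion φ) 0 ![a, i, j] * ph a i j
      + 2 * ∑ m, ltor φ a m 0 ^ 2 = 0 := by
    intro a
    have h1 : pderiv a (fun z => contract φ z (torsion φ z)
        (fun L => φ z (Matrix.vecCons a L))) 0 = 0 := by
      rw [← pderiv_const (i := a) (y := 0) 0]
      exact pderiv_congr hΩ h0 fun z hz => hφ.contract_torsion hz a
    simp only [contract] at h1
    rw [pderiv_sum _ fun I _ => DifferentiableAt.fun_sum fun J _ =>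
      ((dT I).fun_mul (dφ _)).fun_mul (dP I J)] at h1
    have h2 : ∀ I J : Fin 2 → Fin 7, pderiv a (fun z => torsion φ z I * φ z (Matrix.vecCons a J) *
        ∏ s, metricInv φ z (I s) (J s)) 0 =
        (covDeriv φ (torsion φ) 0 (Matrix.vecCons a I) * G2.std (Matrix.vecCons a J) +
          torsion φ 0 I * pderiv a (fun z => φ z (Matrix.vecCons a J)) 0) *
          if I = J then 1 else 0 := by
      intro I J
      have h3 : pderiv a (fun z => ∏ s, metricInv φ z (I s) (J s)) 0 = 0 := by
        rw [pderiv_prod _ fun s _ => dg _ _]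
        simp [hg.pderiv_metricInv hk hφ h0]
      rw [pderiv_mul ((dT I).fun_mul (dφ _)) (dP I J), pderiv_mul (dT I) (dφ _), h3,
        hg.covDeriv_torsion hk hφ h0]
      simp only [metricInv_std hg.std, prod_one_apply, hg.std]
      ring
    have h4 : ∀ I, pderiv a (fun z => ∑ J, torsion φ z I * φ z (Matrix.vecCons a J) *
        ∏ s, metricInv φ z (I s) (J s)) 0 =
        covDeriv φ (torsion φ) 0 (Matrix.vecCons a I) * G2.std (Matrix.vecCons a I) +
          torsion φ 0 I * pderiv a (fun z => φ z (Matrix.vecCons a I)) 0 := by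
      intro I
      rw [pderiv_sum _ fun J _ => ((dT I).fun_mul (dφ _)).fun_mul (dP I J)]
      simp only [h2]
      simp
    simp only [h4, Finset.sum_add_distrib] at h1
    rw [sum_index2, sum_index2] at h1
    have h5 : ∑ i, ∑ j, torsion φ 0 ![i, j] *
        pderiv a (fun z => φ z (Matrix.vecCons a ![i, j])) 0 = 2 * ∑ m, ltor φ a m 0 ^ 2 := by
      have e : ∀ i j, torsion φ 0 ![i, j] * pderiv a (fun z => φ z (Matrix.vecCons a ![i, j])) 0 =
          ∑ m, ltor φ a m 0 * (ltor φ i j 0 * ps m a i j) := fun i j => by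
        rw [hg.pderiv_self hk hφ h0, (leq_torsion i j).eq_of_std hφ h0 hg.std, Finset.mul_sum]
        exact Finset.sum_congr rfl fun m _ => by ring
      simp only [e]
      rw [sum3_front fun i j m => ltor φ a m 0 * (ltor φ i j 0 * ps m a i j)]
      simp only [← Finset.mul_sum, (hφ.ltor_algebra h0).2.1]
      rw [Finset.mul_sum]
      refine Finset.sum_congr rfl fun m _ => ?_
      rw [(hφ.ltor_algebra h0).1 a m]
      ring
    rw [h5] at h1
    exact h1
  have := Finset.sum_eq_zero fun a (_ : a ∈ Finset.univ) => key a
  rw [Finset.sum_add_distrib, ← Finset.mul_sum] at this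
  linarith

/-- Exchanging the derivative index with a lower index of `∂Γ` costs a curvature component. Since
the cyclic sum of `∂Γ` is zero, two exchanges express `3 ∂Γ` by curvature. -/
theorem GaugeAt.pderiv_lchr (hg : GaugeAt k φ) (hk : 2 ≤ k) (p m i j : Fin 7) :
    pderiv p (lchr φ m i j) 0 = (1 / 3) * (lcur φ p i m j 0 + lcur φ p j m i 0) := by
  have h := hg.two hk m i j p
  simp only [cyc] at h
  simp only [lcur, lchr_symm φ m j i, lchr_symm φ m p j]
  linarith

/-- As for first derivatives: four of the other terms in the symmetrized sum are reached by one
exchange of indices and the last by two. This accounts for the six derivatives of curvature and the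
factor `1 / 6`. -/
theorem GaugeAt.pderiv_pderiv_lchr (hg : GaugeAt k φ) (hk : 3 ≤ k) (hφ : IsClosedG2On Ω φ)
    (h0 : (0 : E7) ∈ Ω) (p q m i j : Fin 7) : pderiv p (pderiv q (lchr φ m i j)) 0 =
      (1 / 6) * (2 * pderiv q (lcur φ p j m i) 0 + pderiv p (lcur φ q j m i) 0
        + pderiv q (lcur φ p i m j) 0 + pderiv p (lcur φ q i m j) 0
        + pderiv j (lcur φ q i m p) 0) := by
  have hΩ := hφ.isOpen
  have d : ∀ a m i j, DifferentiableAt ℝ (pderiv a (lchr φ m i j)) 0 := fun a m i j =>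
    differentiableAt_of_contDiffOn hΩ (contDiffOn_pderiv hΩ (hφ.smooth_lchr m i j)) h0
  have e : ∀ a i j k l, pderiv a (lcur φ i j k l) 0 =
      pderiv a (pderiv i (lchr φ k j l)) 0 - pderiv a (pderiv j (lchr φ k i l)) 0 :=
    fun a i j k l => pderiv_sub (d i k j l) (d j k i l)
  have cm : ∀ i j p q, pderiv p (pderiv q (lchr φ m i j)) 0 =
      pderiv q (pderiv p (lchr φ m i j)) 0 := fun i j p q =>
    pderiv_comm hΩ (hφ.smooth_lchr m i j) h0
  have h := hg.three hk m i j p q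
  simp only [cyc2] at h
  simp only [e, lchr_symm φ m j i, lchr_symm φ m p i, lchr_symm φ m q i, lchr_symm φ m p j,
    lchr_symm φ m q j, lchr_symm φ m q p] at h ⊢
  rw [cm i j q p, cm i p q j, cm i q p j, cm j p q i, cm j q p i, cm p q j i]
  linarith

end

end

/-! ### Bounds for the jets of order at most three in normal coordinates -/

section

section

variable {Ω : Set E7} {φ : CoordTensor 3} {y : E7}

/-- Adding the constants makes one bound serve all components of a tensor. -/
theorem Low.exists_bound {ι : Type*} [Fintype ι] {w : ℕ} {Φ : ι → Fnl} (h : ∀ a, Low w (Φ a)) :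
    ∃ C : ℝ, 0 ≤ C ∧ ∀ a (Ω : Set E7) (φ : CoordTensor 3) (y : E7) (ρ : ℝ), IsClosedG2On Ω φ →
      y ∈ Ω → 0 ≤ ρ → φ y = std → JetBound (w - 1) φ y ρ → |Φ a φ y| ≤ C * ρ ^ w := by
  choose C hC hb using fun a => (h a).bound
  refine ⟨∑ a, C a, Finset.sum_nonneg fun a _ => hC a, fun a Ω φ y ρ hφ hy hρ h0 hj => ?_⟩
  refine (hb a Ω φ y ρ hφ hy hρ h0 hj).trans ?_
  gcongr
  exact Finset.single_le_sum (fun a _ => hC a) (Finset.mem_univ a)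

theorem pd_congr (hΩ : IsOpen Ω) {f g : E7 → ℝ} (h : ∀ z ∈ Ω, f z = g z) (L : List (Fin 7)) :
    ∀ z ∈ Ω, pd L f z = pd L g z := by
  induction L with
  | nil => exact h
  | cons i L ih => exact fun z hz => pderiv_congr hΩ hz ih

theorem pd_sum_mul_const (hΩ : IsOpen Ω) {ι : Type*} (S : Finset ι) {f : ι → E7 → ℝ}
    (hf : ∀ a, ContDiffOn ℝ ∞ (f a) Ω) (c : ι → ℝ) (L : List (Fin 7)) :
    ∀ z ∈ Ω, pd L (fun z => ∑ a ∈ S, c a * f a z) z = ∑ a ∈ S, c a * pd L (f a) z := by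
  induction L with
  | nil => exact fun _ _ => rfl
  | cons i L ih =>
    intro z hz
    have d : ∀ a, DifferentiableAt ℝ (pd L (f a)) z := fun a =>
      differentiableAt_of_contDiffOn hΩ (contDiffOn_pd hΩ L (hf a)) hz
    change pderiv i (pd L fun z => ∑ a ∈ S, c a * f a z) z = ∑ a ∈ S, c a * pderiv i (pd L (f a)) z
    rw [pderiv_congr hΩ hz ih, pderiv_sum S fun a _ => (d a).const_mul _]
    exact Finset.sum_congr rfl fun a _ => pderiv_const_mul _ (d a)

theorem pd_append (L : List (Fin 7)) (i : Fin 7) (f : E7 → ℝ) :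
    pd (L ++ [i]) f = pd L (pderiv i f) := by
  induction L with
  | nil => rfl
  | cons j L ih => exact congrArg (pderiv j) ih

/-- A common bound of the components of the standard forms. -/
def stdBound : ℝ := 1 + ∑ J, |std J| + ∑ J, |stdPsi J|

theorem one_le_stdBound : 1 ≤ stdBound := by
  have h1 : 0 ≤ ∑ J, |std J| := Finset.sum_nonneg fun _ _ => abs_nonneg _
  have h2 : 0 ≤ ∑ J, |stdPsi J| := Finset.sum_nonneg fun _ _ => abs_nonneg _
  simp only [stdBound]; linarith

theorem abs_std_le (J : Fin 3 → Fin 7) : |std J| ≤ stdBound := by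
  have h1 := Finset.single_le_sum (f := fun J => |std J|) (fun _ _ => abs_nonneg _)
    (Finset.mem_univ J)
  have h2 : 0 ≤ ∑ J, |stdPsi J| := Finset.sum_nonneg fun _ _ => abs_nonneg _
  simp only [stdBound]; linarith

theorem abs_ps_le (i j k l : Fin 7) : |ps i j k l| ≤ stdBound := by
  have h1 := Finset.single_le_sum (f := fun J => |stdPsi J|) (fun _ _ => abs_nonneg _)
    (Finset.mem_univ ![i, j, k, l])
  have h2 : 0 ≤ ∑ J, |std J| := Finset.sum_nonneg fun _ _ => abs_nonneg _
  have h3 : stdPsi ![i, j, k, l] = ps i j k l := rfl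
  rw [h3] at h1
  simp only [stdBound]; linarith

/-- The jets of a `G₂` structure are controlled by those of the linearized Christoffel symbols and
of the linearized torsion. -/
theorem IsG2On.abs_pd_le (hφ : IsG2On Ω φ) (hy : y ∈ Ω) (L : List (Fin 7)) {B : ℝ}
    (h1 : ∀ m i j, |pd L (lchr φ m i j) y| ≤ B) (h2 : ∀ i j, |pd L (ltor φ i j) y| ≤ B)
    (i : Fin 7) (J : Fin 3 → Fin 7) :
    |pd (L ++ [i]) (fun z => φ z J) y| ≤ 28 * stdBound * B := by
  have hΩ := hφ.isOpen
  rw [vec3_eta J]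
  set j := J 0
  set k := J 1
  set l := J 2
  -- By `pderiv_eq`, `∂φ` is a sum of four families of seven terms, three with Christoffel symbols
  -- and one with torsion, with constant coefficients. Hence the factor `28`.
  set f : Fin 4 × Fin 7 → E7 → ℝ := fun a => ![lchr φ a.2 i j, lchr φ a.2 i k, lchr φ a.2 i l,
    ltor φ i a.2] a.1 with hf
  set c : Fin 4 × Fin 7 → ℝ := fun a => ![std ![a.2, k, l], std ![j, a.2, l], std ![j, k, a.2],
    ps a.2 j k l] a.1 with hc
  have sf : ∀ a, ContDiffOn ℝ ∞ (f a) Ω := by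
    rintro ⟨a, p⟩
    fin_cases a
    · exact hφ.smooth_lchr _ _ _
    · exact hφ.smooth_lchr _ _ _
    · exact hφ.smooth_lchr _ _ _
    · exact hφ.smooth.ltor hΩ _ _
  have bf : ∀ a, |pd L (f a) y| ≤ B := by
    rintro ⟨a, p⟩
    fin_cases a
    · exact h1 _ _ _
    · exact h1 _ _ _
    · exact h1 _ _ _
    · exact h2 _ _
  have bc : ∀ a, |c a| ≤ stdBound := by
    rintro ⟨a, p⟩
    fin_cases a
    · exact abs_std_le _
    · exact abs_std_le _
    · exact abs_std_le _
    · exact abs_ps_le _ _ _ _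
  have e : ∀ z ∈ Ω, pderiv i (fun z => φ z ![j, k, l]) z = ∑ a, c a * f a z := by
    intro z hz
    rw [hφ.pderiv_eq hz, act_three, Fintype.sum_prod_type, Fin.sum_univ_four,
      ← Finset.sum_add_distrib, ← Finset.sum_add_distrib, ← Finset.sum_add_distrib,
      ← Finset.sum_add_distrib]
    refine Finset.sum_congr rfl fun p _ => ?_
    simp only [hf, hc, lconn, Matrix.of_apply, Matrix.cons_val]
    ring
  rw [pd_append, pd_congr hΩ e L y hy, pd_sum_mul_const hΩ _ sf c L y hy]
  refine (Finset.abs_sum_le_sum_abs _ _).trans ?_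
  have hB : 0 ≤ B := (abs_nonneg _).trans (h2 0 0)
  refine (Finset.sum_le_card_nsmul _ _ (stdBound * B) fun a _ => ?_).trans_eq ?_
  · rw [abs_mul]
    exact mul_le_mul (bc a) (bf a) (abs_nonneg _) (by linarith [one_le_stdBound])
  · simp
    ring

/-- Replacing `σ` by `(1 + B) σ` keeps the old bounds and absorbs the constant `B` of the new order,
because `B ≤ (1 + B) ^ (k + 1)`. -/
theorem JetBound.of_step {k : ℕ} {σ B : ℝ} (hσ : 0 ≤ σ) (hB : 0 ≤ B) (hj : JetBound k φ y σ)
    (hs : ∀ (L : List (Fin 7)) i J, L.length = k →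
      |pd (L ++ [i]) (fun z => φ z J) y| ≤ B * σ ^ (k + 1)) :
    JetBound (k + 1) φ y ((1 + B) * σ) := by
  intro L hL1 hLk J
  rcases Nat.lt_or_ge k L.length with h | h
  · obtain ⟨L, i, rfl⟩ : ∃ L' i, L = L' ++ [i] :=
      ⟨L.dropLast, L.getLast (by rintro rfl; simp at hL1), (List.dropLast_append_getLast _).symm⟩
    simp only [List.length_append, List.length_singleton] at h hLk ⊢
    have hk : L.length = k := by omega
    refine (hs L i J hk).trans ?_
    rw [hk, mul_pow]
    gcongr
    calc B ≤ 1 + B := by linarith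
      _ ≤ (1 + B) ^ (k + 1) := le_self_pow₀ (by linarith) (by omega)
  · refine (hj L hL1 h J).trans ?_
    gcongr
    nlinarith

theorem sum_mul_ph (f : (Fin 3 → Fin 7) → ℝ) :
    ∑ a, ∑ i, ∑ j, f ![a, i, j] * ph a i j = ∑ J, f J * std J := by
  rw [sum_index3]
  rfl

/-- The torsion is controlled by the square root of its derivative. -/
theorem GaugeAt.abs_ltor_le {k : ℕ} (hg : GaugeAt k φ) (hk : 1 ≤ k) (hφ : IsClosedG2On Ω φ)
    (h0 : (0 : E7) ∈ Ω) {ρ : ℝ} (hρ : 0 ≤ ρ) (hT : ∀ J, |covDeriv φ (torsion φ) 0 J| ≤ ρ ^ 2)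
    (i j : Fin 7) : |ltor φ i j 0| ≤ 343 * stdBound * ρ := by
  have M1 := one_le_stdBound
  have h1 := hg.sum_torsion_sq hk hφ h0
  rw [sum_mul_ph] at h1
  have h2 : |∑ J, covDeriv φ (torsion φ) 0 J * G2.std J| ≤ 343 * (ρ ^ 2 * stdBound) := by
    refine (Finset.abs_sum_le_sum_abs _ _).trans ?_
    refine (Finset.sum_le_card_nsmul _ _ (ρ ^ 2 * stdBound) fun J _ => ?_).trans_eq (by simp)
    rw [abs_mul]
    exact mul_le_mul (hT J) (abs_std_le J) (abs_nonneg _) (by positivity)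
  have h3 : ltor φ i j 0 ^ 2 ≤ ∑ a, ∑ m, ltor φ a m 0 ^ 2 :=
    (Finset.single_le_sum (f := fun m => ltor φ i m 0 ^ 2) (fun _ _ => sq_nonneg _)
      (Finset.mem_univ j)).trans
      (Finset.single_le_sum (f := fun a => ∑ m, ltor φ a m 0 ^ 2)
        (fun _ _ => Finset.sum_nonneg fun _ _ => sq_nonneg _) (Finset.mem_univ i))
  refine abs_le_of_sq_le_sq ?_ (by positivity)
  have h4 := neg_le_of_abs_le h2
  have h5 : stdBound ≤ stdBound ^ 2 := le_self_pow₀ M1 (by norm_num)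
  have h6 : ρ ^ 2 * stdBound ≤ ρ ^ 2 * stdBound ^ 2 := by gcongr
  have h7 : 0 ≤ ρ ^ 2 * stdBound := by positivity
  calc ltor φ i j 0 ^ 2 ≤ 343 * (ρ ^ 2 * stdBound) := by linarith
    _ ≤ 343 * (ρ ^ 2 * stdBound ^ 2) := by linarith
    _ ≤ (343 * stdBound * ρ) ^ 2 := by nlinarith [mul_nonneg (sq_nonneg ρ) (sq_nonneg stdBound)]

/-- The first jet consists of Christoffel symbols, zero in the gauge, and of torsion, which is
bounded by the square root of its derivative. -/
theorem GaugeAt.jetBound_one {k : ℕ} (hg : GaugeAt k φ) (hk : 1 ≤ k) (hφ : IsClosedG2On Ω φ)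
    (h0 : (0 : E7) ∈ Ω) {ρ : ℝ} (hρ : 0 ≤ ρ) (hT : ∀ J, |covDeriv φ (torsion φ) 0 J| ≤ ρ ^ 2) :
    JetBound 1 φ 0 ((1 + 28 * stdBound * (343 * stdBound)) * ρ) := by
  have M1 := one_le_stdBound
  refine JetBound.of_step (k := 0) hρ (by positivity) (fun L h1 h2 => by omega)
    fun L i J hL => ?_
  obtain rfl := List.length_eq_zero_iff.1 hL
  refine (hφ.abs_pd_le h0 [] (B := 343 * stdBound * ρ) (fun m i j => ?_)
    (hg.abs_ltor_le hk hφ h0 hρ hT) i J).trans_eq (by ring)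
  change |lchr φ m i j 0| ≤ _
  rw [hg.one hk, abs_zero]
  positivity

theorem abs_le_of_abs_sub_le {a b c d : ℝ} (h1 : |b - a| ≤ c) (h2 : |b| ≤ d) : |a| ≤ d + c := by
  have h := abs_sub_abs_le_abs_sub a b
  rw [abs_sub_comm] at h
  linarith

/-- Both `∇T` and `Rm` agree with `∂ ltor` and `lcur` up to lower order terms, which involve only
the first jet and are already bounded. In the gauge `lcur` determines `∂Γ`, so the whole second jet
is bounded. -/
theorem exists_jetBound_two : ∃ K : ℝ, 1 ≤ K ∧ ∀ (Ω : Set E7) (φ : CoordTensor 3) (σ : ℝ),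
    IsClosedG2On Ω φ → (0 : E7) ∈ Ω → GaugeAt 3 φ → 0 ≤ σ → JetBound 1 φ 0 σ →
    (∀ J, |covDeriv φ (torsion φ) 0 J| ≤ σ ^ 2) → (∀ J, |riemann φ 0 J| ≤ σ ^ 2) →
    JetBound 2 φ 0 (K * σ) := by
  have M1 := one_le_stdBound
  obtain ⟨C1, hC1, c1⟩ := Low.exists_bound (ι := Fin 7 × Fin 7 × Fin 7)
    fun a => (leq_covDeriv_torsion a.1 a.2.1 a.2.2).low
  obtain ⟨C2, hC2, c2⟩ := Low.exists_bound (ι := Fin 7 × Fin 7 × Fin 7 × Fin 7)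
    fun a => (leq_riemann a.1 a.2.1 a.2.2.1 a.2.2.2).low
  have hB : 0 ≤ 28 * stdBound * (1 + C1 + C2) := by positivity
  refine ⟨1 + 28 * stdBound * (1 + C1 + C2), by linarith, fun Ω φ σ hφ h0 hg hσ j1 hT hR => ?_⟩
  have n1 : 0 ≤ C1 * σ ^ 2 := by positivity
  have n2 : 0 ≤ C2 * σ ^ 2 := by positivity
  have a1 : ∀ p i j, |pderiv p (ltor φ i j) 0| ≤ (1 + C1 + C2) * σ ^ 2 := by
    intro p i j
    refine (abs_le_of_abs_sub_le (c1 (p, i, j) Ω φ 0 σ hφ h0 hσ hg.std j1)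
      (hT ![p, i, j])).trans ?_
    linarith
  have a2 : ∀ i j k l, |lcur φ i j k l 0| ≤ (1 + C1 + C2) * σ ^ 2 := by
    intro i j k l
    refine (abs_le_of_abs_sub_le (c2 (i, j, k, l) Ω φ 0 σ hφ h0 hσ hg.std j1)
      (hR ![i, j, k, l])).trans ?_
    linarith
  have a3 : ∀ p m i j, |pderiv p (lchr φ m i j) 0| ≤ (1 + C1 + C2) * σ ^ 2 := by
    intro p m i j
    rw [hg.pderiv_lchr (by norm_num)]
    have h1 := abs_le.1 (a2 p i m j)
    have h2 := abs_le.1 (a2 p j m i)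
    rw [abs_le]
    constructor <;> linarith
  refine JetBound.of_step hσ hB j1 fun L i J hL => ?_
  obtain ⟨p, rfl⟩ := List.length_eq_one_iff.1 hL
  exact (hφ.abs_pd_le h0 [p] (fun m i j => a3 p m i j) (fun i j => a1 p i j) i J).trans_eq (by ring)

/-- The same argument one order higher: the lower order errors now involve the second jet, and the
gauge recovers second derivatives of the Christoffel symbols from first derivatives of the
curvature. -/
theorem exists_jetBound_three : ∃ K : ℝ, 1 ≤ K ∧ ∀ (Ω : Set E7) (φ : CoordTensor 3) (σ : ℝ),
    IsClosedG2On Ω φ → (0 : E7) ∈ Ω → GaugeAt 3 φ → 0 ≤ σ → JetBound 2 φ 0 σ →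
    (∀ a J, |pderiv a (fun z => covDeriv φ (torsion φ) z J) 0| ≤ σ ^ 3) →
    (∀ a J, |pderiv a (fun z => riemann φ z J) 0| ≤ σ ^ 3) → JetBound 3 φ 0 (K * σ) := by
  have M1 := one_le_stdBound
  obtain ⟨C1, hC1, c1⟩ := Low.exists_bound (ι := Fin 7 × Fin 7 × Fin 7 × Fin 7)
    fun a => ((leq_covDeriv_torsion a.1 a.2.1 a.2.2.1).pderiv a.2.2.2).low
  obtain ⟨C2, hC2, c2⟩ := Low.exists_bound (ι := Fin 7 × Fin 7 × Fin 7 × Fin 7 × Fin 7)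
    fun a => ((leq_riemann a.1 a.2.1 a.2.2.1 a.2.2.2.1).pderiv a.2.2.2.2).low
  have hB : 0 ≤ 28 * stdBound * (1 + C1 + C2) := by positivity
  refine ⟨1 + 28 * stdBound * (1 + C1 + C2), by linarith, fun Ω φ σ hφ h0 hg hσ j2 hT hR => ?_⟩
  have n1 : 0 ≤ C1 * σ ^ 3 := by positivity
  have n2 : 0 ≤ C2 * σ ^ 3 := by positivity
  have b1 : ∀ q p i j, |pderiv q (pderiv p (ltor φ i j)) 0| ≤ (1 + C1 + C2) * σ ^ 3 := by
    intro q p i j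
    refine (abs_le_of_abs_sub_le (c1 (p, i, j, q) Ω φ 0 σ hφ h0 hσ hg.std j2)
      (hT q ![p, i, j])).trans ?_
    norm_num only
    linarith
  have b2 : ∀ q i j k l, |pderiv q (lcur φ i j k l) 0| ≤ (1 + C1 + C2) * σ ^ 3 := by
    intro q i j k l
    refine (abs_le_of_abs_sub_le (c2 (i, j, k, l, q) Ω φ 0 σ hφ h0 hσ hg.std j2)
      (hR q ![i, j, k, l])).trans ?_
    norm_num only
    linarith
  have b3 : ∀ q p m i j, |pderiv q (pderiv p (lchr φ m i j)) 0| ≤ (1 + C1 + C2) * σ ^ 3 := by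
    intro q p m i j
    rw [hg.pderiv_pderiv_lchr le_rfl hφ h0]
    have h1 := abs_le.1 (b2 p q j m i)
    have h2 := abs_le.1 (b2 q p j m i)
    have h3 := abs_le.1 (b2 p q i m j)
    have h4 := abs_le.1 (b2 q p i m j)
    have h5 := abs_le.1 (b2 j p i m q)
    rw [abs_le]
    constructor <;> linarith
  refine JetBound.of_step hσ hB j2 fun L i J hL => ?_
  obtain ⟨q, p, rfl⟩ := List.length_eq_two.1 hL
  exact (hφ.abs_pd_le h0 [q, p] (fun m i j => b3 q p m i j) (fun i j => b1 q p i j) i J).trans_eq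
    (by ring)

/-- In normal coordinates the jets of order at most three are controlled by torsion, curvature and
their derivatives. -/
theorem exists_jetBound : ∃ K : ℝ, 0 ≤ K ∧ ∀ (Ω : Set E7) (φ : CoordTensor 3) (ρ : ℝ),
    IsClosedG2On Ω φ → (0 : E7) ∈ Ω → GaugeAt 3 φ → 0 ≤ ρ →
    (∀ J, |covDeriv φ (torsion φ) 0 J| ≤ ρ ^ 2) → (∀ J, |riemann φ 0 J| ≤ ρ ^ 2) →
    (∀ a J, |pderiv a (fun z => covDeriv φ (torsion φ) z J) 0| ≤ ρ ^ 3) →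
    (∀ a J, |pderiv a (fun z => riemann φ z J) 0| ≤ ρ ^ 3) → JetBound 3 φ 0 (K * ρ) := by
  have M1 := one_le_stdBound
  obtain ⟨K2, hK2, h2⟩ := exists_jetBound_two
  obtain ⟨K3, hK3, h3⟩ := exists_jetBound_three
  have hB : 0 ≤ 28 * stdBound * (343 * stdBound) := by positivity
  set K1 := 1 + 28 * stdBound * (343 * stdBound)
  have hK1 : 1 ≤ K1 := by simp only [K1]; linarith
  refine ⟨K3 * (K2 * K1), by positivity, fun Ω φ ρ hφ h0 hg hρ hT hR hdT hdR => ?_⟩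
  have e1 : ρ ≤ K1 * ρ := le_mul_of_one_le_left hρ hK1
  have e2 : ρ ≤ K2 * (K1 * ρ) := e1.trans (le_mul_of_one_le_left (by positivity) hK2)
  have j1 := hg.jetBound_one (by norm_num) hφ h0 hρ hT
  have j2 := h2 Ω φ (K1 * ρ) hφ h0 hg (by positivity) j1
    (fun J => (hT J).trans (by gcongr)) fun J => (hR J).trans (by gcongr)
  have j3 := h3 Ω φ (K2 * (K1 * ρ)) hφ h0 hg (by positivity) j2
    (fun a J => (hdT a J).trans (by gcongr)) fun a J => (hdR a J).trans (by gcongr)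
  have e3 : K3 * (K2 * K1) * ρ = K3 * (K2 * (K1 * ρ)) := by ring
  rwa [e3]

end

end

section

/-! ### The evolution inequality at a spatial maximum -/

/-- If the second derivative were positive, the restriction to a coordinate line would also have a
local minimum. It would then be locally constant, with second derivative zero. -/
theorem pderiv_pderiv_nonpos {Ω : Set E7} {f : E7 → ℝ} {y : E7} (hΩ : IsOpen Ω) (hy : y ∈ Ω)
    (hf : ContDiffOn ℝ ∞ f Ω) (hmax : IsLocalMax f y) (a : Fin 7) :
    pderiv a (pderiv a f) y ≤ 0 := by
  by_contra! hpos
  set v : E7 := EuclideanSpace.single a 1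
  set l : ℝ → E7 := fun s => y + s • v with hl
  have hl0 : l 0 = y := by simp [hl]
  have hld : ∀ s, HasDerivAt l v s := fun s => by
    have := ((hasDerivAt_id s).smul_const v).const_add y
    rwa [one_smul] at this
  have hlc : Continuous l := by fun_prop
  have hev : ∀ᶠ s in nhds (0 : ℝ), l s ∈ Ω :=
    hlc.continuousAt.eventually_mem (by rw [hl0]; exact hΩ.mem_nhds hy)
  have hd : ∀ {g : E7 → ℝ} {s : ℝ}, ContDiffOn ℝ ∞ g Ω → l s ∈ Ω →
      HasDerivAt (fun s => g (l s)) (pderiv a g (l s)) s := fun {g s} hg hs =>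
    ((differentiableAt_of_contDiffOn hΩ hg hs).hasFDerivAt).comp_hasDerivAt s (hld s)
  have h0 : l 0 ∈ Ω := by rwa [hl0]
  have e1 : deriv (fun s => f (l s)) =ᶠ[nhds 0] fun s => pderiv a f (l s) :=
    hev.mono fun s hs => (hd hf hs).deriv
  have e2 : deriv (deriv fun s => f (l s)) 0 = pderiv a (pderiv a f) y := by
    rw [e1.deriv_eq, (hd (contDiffOn_pderiv hΩ hf) h0).deriv, hl0]
  have hmax' : IsLocalMax (fun s => f (l s)) 0 := by
    have : Filter.Tendsto l (nhds 0) (nhds y) := by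
      have := hlc.tendsto 0
      rwa [hl0] at this
    have h := this.eventually hmax
    refine h.mono fun s hs => ?_
    change f (l s) ≤ f (l 0)
    rwa [hl0]
  have hmin := isLocalMin_of_deriv_deriv_pos (f := fun s => f (l s)) (x₀ := 0)
    (by rw [e2]; exact hpos) hmax'.deriv_eq_zero (hd hf h0).continuousAt
  have hconst : (fun s => f (l s)) =ᶠ[nhds 0] fun _ => f (l 0) := by
    filter_upwards [hmax', hmin] with s h1 h2 using le_antisymm h1 h2
  have e3 : deriv (fun s => f (l s)) =ᶠ[nhds 0] fun _ => 0 := by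
    filter_upwards [hconst.eventuallyEq_nhds] with s hs
    rw [hs.deriv_eq, deriv_const]
  rw [e3.deriv_eq, deriv_const] at e2
  linarith

theorem sq_le_gradSq (φ : CoordTensor 3) (y : E7) :
    (∀ a J, pderiv a (fun z => covDeriv φ (torsion φ) z J) y ^ 2 ≤ gradSq φ y) ∧
    ∀ a J, pderiv a (fun z => riemann φ z J) y ^ 2 ≤ gradSq φ y := by
  have n1 : ∀ J, 0 ≤ ∑ a, pderiv a (fun z => covDeriv φ (torsion φ) z J) y ^ 2 := fun J =>
    Finset.sum_nonneg fun _ _ => sq_nonneg _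
  have n2 : ∀ J, 0 ≤ ∑ a, pderiv a (fun z => riemann φ z J) y ^ 2 := fun J =>
    Finset.sum_nonneg fun _ _ => sq_nonneg _
  have m1 : 0 ≤ ∑ J, ∑ a, pderiv a (fun z => covDeriv φ (torsion φ) z J) y ^ 2 :=
    Finset.sum_nonneg fun J _ => n1 J
  have m2 : 0 ≤ ∑ J, ∑ a, pderiv a (fun z => riemann φ z J) y ^ 2 :=
    Finset.sum_nonneg fun J _ => n2 J
  constructor
  · intro a J
    have h1 := Finset.single_le_sum (f := fun a => pderiv a (fun z =>
      covDeriv φ (torsion φ) z J) y ^ 2) (fun _ _ => sq_nonneg _) (Finset.mem_univ a)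
    have h2 := Finset.single_le_sum (fun J _ => n1 J) (Finset.mem_univ J)
    rw [gradSq]
    linarith
  · intro a J
    have h1 := Finset.single_le_sum (f := fun a => pderiv a (fun z => riemann φ z J) y ^ 2)
      (fun _ _ => sq_nonneg _) (Finset.mem_univ a)
    have h2 := Finset.single_le_sum (fun J _ => n2 J) (Finset.mem_univ J)
    rw [gradSq]
    linarith

/-- A form of Young's inequality: either `D Λ ≤ g`, and the mixed term is at most `g³`, or `g ≤ D
Λ`, and it is at most `(D Λ)³`. Here `g³` stands for the squared gradient. -/
theorem absorb_gradient {D Λ g : ℝ} (hD : 0 ≤ D) (hΛ : 0 ≤ Λ) (hg : 0 ≤ g) :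
    D * (Λ ^ 2 + g ^ 2) * Λ - 2 * g ^ 3 ≤ (D + D ^ 3) * Λ ^ 3 := by
  have h : D * Λ * g ^ 2 ≤ 2 * g ^ 3 + D ^ 3 * Λ ^ 3 := by
    rcases le_total (D * Λ) g with h | h
    · have h1 : D * Λ * g ^ 2 ≤ g * g ^ 2 := by gcongr
      have h2 : 0 ≤ D ^ 3 * Λ ^ 3 := by positivity
      have h3 : 0 ≤ g ^ 3 := by positivity
      nlinarith
    · have h1 : D * Λ * g ^ 2 ≤ D * Λ * (D * Λ) ^ 2 := by gcongr
      have h3 : 0 ≤ g ^ 3 := by positivity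
      nlinarith
  nlinarith

/-- At a spatial maximum of `Λ`, the time derivative of `Λ²` is bounded by a multiple of `Λ³`. -/
theorem exists_reaction_bound : ∃ C : ℝ, 0 ≤ C ∧
    ∀ (I : Set ℝ) (Ω : Set E7) (φ : ℝ → CoordTensor 3) (t : ℝ) (y : E7), IsG2Flow I Ω φ → t ∈ I →
      y ∈ Ω → IsLocalMax (coordLambda (φ t)) y →
      ∃ d, HasDerivAt (fun s => coordLambda (φ s) y ^ 2) d t ∧ d ≤ C * coordLambda (φ t) y ^ 3 := by
  obtain ⟨Ψ, hTD, C, hC, hb⟩ := exists_hasTD_lambdaSq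
  obtain ⟨K, hK, hj⟩ := exists_jetBound
  set D : ℝ := 8 * C * K ^ 4 with hD
  have hD0 : 0 ≤ D := by positivity
  refine ⟨D + D ^ 3, by positivity, fun I Ω φ t y hφ ht hy hmax => ?_⟩
  -- The gauge is adapted to the single time `t`, but the coordinate change does not depend on time,
  -- so the pulled-back family still solves the flow.
  obtain ⟨F, Ω', hF, h0, hF0, hg⟩ := (hφ.structureAt t ht).exists_gauge hy
  have hφ' := hφ.pull hF
  have hc' := hφ'.structureAt t ht
  have hΛe : ∀ s ∈ I, ∀ z ∈ Ω', coordLambda (pullF F (φ s)) z = coordLambda (φ s) (F z) :=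
    fun s hs z hz => coordLambda_pullF hF (hφ.structureAt s hs).toIsG2On hz
  have hsq : ∀ s ∈ I, ∀ z ∈ Ω', lambdaSq (pullF F (φ s)) z = coordLambda (φ s) (F z) ^ 2 :=
    fun s hs z hz => by rw [← hΛe s hs z hz, coordLambda_sq (hφ'.structureAt s hs).toIsG2On hz]
  have hder := hTD I Ω' _ hφ' t ht 0 h0
  refine ⟨Ψ (pullF F (φ t)) 0, hder.congr_of_eventuallyEq ?_, ?_⟩
  · filter_upwards [hφ.isOpen_time.mem_nhds ht] with s hs
    rw [hsq s hs 0 h0, hF0]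
  set α := pullF F (φ t) with hα
  set Λ := coordLambda (φ t) y with hΛ
  have hΛ0 : 0 ≤ Λ := Real.sqrt_nonneg _
  have hαΛ : coordLambda α 0 = Λ := by rw [hα, hΛe t ht 0 h0, hF0]
  have hG0 : 0 ≤ gradSq α 0 := (sq_nonneg _).trans ((sq_le_gradSq α 0).2 0 0)
  -- The sixth root gives `r³` the size of the first derivatives of `∇T` and `Rm`. With `s² = Λ`,
  -- the scale `ρ = s + r` satisfies both `Λ ≤ ρ²` and the cubic bound required by
  -- `exists_jetBound`.
  set r : ℝ := gradSq α 0 ^ (1 / 6 : ℝ) with hr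
  have hr0 : 0 ≤ r := Real.rpow_nonneg hG0 _
  have hr6 : r ^ 6 = gradSq α 0 := by
    rw [hr, ← Real.rpow_natCast, ← Real.rpow_mul hG0]
    norm_num
  set s : ℝ := √Λ
  have hs0 : 0 ≤ s := Real.sqrt_nonneg _
  have hs2 : s ^ 2 = Λ := Real.sq_sqrt hΛ0
  have hρ2 : Λ ≤ (s + r) ^ 2 := by rw [← hs2]; gcongr; linarith
  have hρ3 : ∀ x : ℝ, x ^ 2 ≤ gradSq α 0 → |x| ≤ (s + r) ^ 3 := fun x hx => by
    have h1 : |x| ≤ r ^ 3 := abs_le_of_sq_le_sq (by rw [← pow_mul, hr6]; exact hx) (by positivity)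
    refine h1.trans ?_
    gcongr
    linarith
  have hab := abs_le_coordLambda hc'.toIsG2On h0 hg.std
  have hgr := sq_le_gradSq α 0
  have hjet := hj Ω' α (s + r) hc' h0 hg (by positivity)
    (fun J => (hab.1 J).trans (hαΛ.le.trans hρ2)) (fun J => (hab.2 J).trans (hαΛ.le.trans hρ2))
    (fun a J => hρ3 _ (hgr.1 a J)) (fun a J => hρ3 _ (hgr.2 a J))
  have hmain := hb Ω' α 0 (K * (s + r)) hc' h0 (by positivity) hg.std hjet
  have hlmax : IsLocalMax (lambdaSq α) 0 := by
    have h1 : Filter.Tendsto F (nhds 0) (nhds y) := by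
      have := (hF.diffAt h0).continuousAt.tendsto
      rwa [hF0] at this
    filter_upwards [h1.eventually hmax, hF.isOpen_source.mem_nhds h0] with z hz hz'
    rw [hsq t ht z hz', hsq t ht 0 h0, hF0]
    exact pow_le_pow_left₀ (Real.sqrt_nonneg _) hz 2
  have hlap : lap (lambdaSq α) 0 ≤ 0 := Finset.sum_nonpos fun a _ =>
    pderiv_pderiv_nonpos hc'.isOpen h0 (dp_lambdaSq.contDiffOn hc') hlmax a
  rw [hαΛ, ← hr6] at hmain
  -- The power mean inequality `(s + r)⁴ ≤ 8 (s⁴ + r⁴)`.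
  have h4 : (s + r) ^ 4 ≤ 8 * (Λ ^ 2 + (r ^ 2) ^ 2) := by
    rw [← hs2]
    nlinarith [sq_nonneg (s - r), sq_nonneg (s + r), sq_nonneg (s ^ 2 - r ^ 2),
      mul_nonneg hs0 hr0, sq_nonneg (s ^ 2 + r ^ 2), mul_nonneg (sq_nonneg (s - r))
      (sq_nonneg (s + r)), mul_nonneg (sq_nonneg (s - r)) (sq_nonneg (s - r))]
  have h5 : C * (K * (s + r)) ^ 4 * Λ ≤ D * (Λ ^ 2 + (r ^ 2) ^ 2) * Λ := by
    have : C * (K * (s + r)) ^ 4 * Λ = C * K ^ 4 * Λ * (s + r) ^ 4 := by ring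
    rw [this]
    calc _ ≤ C * K ^ 4 * Λ * (8 * (Λ ^ 2 + (r ^ 2) ^ 2)) := by gcongr
      _ = _ := by rw [hD]; ring
  have h6 := absorb_gradient hD0 hΛ0 (sq_nonneg r)
  have h7 : (r ^ 2) ^ 3 = r ^ 6 := by ring
  rw [h7] at h6
  linarith

end

section

/-! ### Locality -/

section Congr

variable {Ω : Set E7} {φ φ' : CoordTensor 3} {y : E7}

theorem metric_congr (h : φ' y = φ y) : metric φ' y = metric φ y := by
  simp only [metric, volCoeff, bForm, h]

theorem contract_congr (h : φ' y = φ y) {k : ℕ} (a b : (Fin k → Fin 7) → ℝ) :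
    contract φ' y a b = contract φ y a b := by
  simp only [contract, metricInv, metric_congr h]

theorem psi_congr (h : φ' y = φ y) : psi φ' y = psi φ y := by
  ext J
  simp only [psi, hodgeStar, contract_congr h, h, volCoeff, bForm]

theorem christoffel_congr (hΩ : IsOpen Ω) (h : ∀ z ∈ Ω, φ' z = φ z) (k i j : Fin 7) :
    ∀ z ∈ Ω, christoffel φ' k i j z = christoffel φ k i j z := fun z hz => by
  have e : ∀ a p l, pderiv a (fun w => metric φ' w p l) z = pderiv a (fun w => metric φ w p l) z :=
    fun a p l => pderiv_congr hΩ hz fun w hw => by rw [metric_congr (h w hw)]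
  simp only [christoffel, metricInv, metric_congr (h z hz), e]

theorem covDeriv_congr_structure (hΩ : IsOpen Ω) (h : ∀ z ∈ Ω, φ' z = φ z) {k : ℕ}
    {α α' : CoordTensor k} (hα : ∀ z ∈ Ω, α' z = α z) :
    ∀ z ∈ Ω, covDeriv φ' α' z = covDeriv φ α z := fun z hz => by
  ext J
  simp only [covDeriv, hα z hz, christoffel_congr hΩ h _ _ _ z hz]
  rw [pderiv_congr hΩ hz fun w hw => by rw [hα w hw]]

theorem torsion_congr (hΩ : IsOpen Ω) (h : ∀ z ∈ Ω, φ' z = φ z) :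
    ∀ z ∈ Ω, torsion φ' z = torsion φ z := fun z hz => by
  ext J
  simp only [torsion, covDeriv_congr_structure hΩ h h z hz, psi_congr (h z hz),
    contract_congr (h z hz)]

theorem riemann_congr (hΩ : IsOpen Ω) (h : ∀ z ∈ Ω, φ' z = φ z) :
    ∀ z ∈ Ω, riemann φ' z = riemann φ z := fun z hz => by
  have e : ∀ a k i j, pderiv a (christoffel φ' k i j) z = pderiv a (christoffel φ k i j) z :=
    fun a k i j => pderiv_congr hΩ hz (christoffel_congr hΩ h k i j)
  ext J
  simp only [riemann, e, christoffel_congr hΩ h _ _ _ z hz, metric_congr (h z hz)]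

theorem coordLambda_congr (hΩ : IsOpen Ω) (hy : y ∈ Ω) (h : ∀ z ∈ Ω, φ' z = φ z) :
    coordLambda φ' y = coordLambda φ y := by
  rw [coordLambda, coordLambda, covDeriv_congr_structure hΩ h (torsion_congr hΩ h) y hy,
    riemann_congr hΩ h y hy, contract_congr (h y hy), contract_congr (h y hy)]

end Congr

/-! ### The standard form -/

/-- The components of `e^i ∧ e^j ∧ e^k`. -/
def wedgeZ (i j k a b c : Fin 7) : ℤ :=
  deltaZ i a * deltaZ j b * deltaZ k c - deltaZ i a * deltaZ k b * deltaZ j c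
    - deltaZ j a * deltaZ i b * deltaZ k c + deltaZ j a * deltaZ k b * deltaZ i c
    + deltaZ k a * deltaZ i b * deltaZ j c - deltaZ k a * deltaZ j b * deltaZ i c

/-- The check that the numeral in `crossTable` encodes the standard form of the theorem. -/
theorem phiZ_eq_wedgeZ : ∀ a b c : Fin 7, phiZ a b c = wedgeZ 0 1 2 a b c + wedgeZ 0 3 4 a b c
    + wedgeZ 0 5 6 a b c + wedgeZ 1 3 5 a b c - wedgeZ 1 4 6 a b c - wedgeZ 2 3 6 a b c
    - wedgeZ 2 4 5 a b c := by
  decide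

theorem sum_wedgeZ (i j k : Fin 7) (u v w : E7) :
    ∑ a, ∑ b, ∑ c, (wedgeZ i j k a b c : ℝ) * (u a * v b * w c) = wedge3 i j k u v w := by
  have h : ∀ p q r : Fin 7, ∑ a, ∑ b, ∑ c, (dl p a * dl q b * dl r c) * (u a * v b * w c) =
      u p * v q * w r := fun p q r => by
    simp [dl, ite_mul, Finset.sum_ite_eq]
  have e : ∀ a b c, (wedgeZ i j k a b c : ℝ) * (u a * v b * w c) =
      (dl i a * dl j b * dl k c) * (u a * v b * w c) - (dl i a * dl k b * dl j c) * (u a * v b * w c)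
      - (dl j a * dl i b * dl k c) * (u a * v b * w c) + (dl j a * dl k b * dl i c) * (u a * v b * w c)
      + (dl k a * dl i b * dl j c) * (u a * v b * w c)
      - (dl k a * dl j b * dl i c) * (u a * v b * w c) := fun a b c => by
    simp only [wedgeZ]
    push_cast
    simp only [cast_deltaZ]
    ring
  simp only [e, Finset.sum_add_distrib, Finset.sum_sub_distrib, h]
  simp [wedge3, Matrix.det_fin_three]

theorem stdForm_eq_sum (u v w : E7) :
    stdForm u v w = ∑ I : Fin 3 → Fin 7, std I * (u (I 0) * v (I 1) * w (I 2)) := by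
  rw [sum_index3]
  have e : ∀ a b c : Fin 7, std ![a, b, c] * (u (![a, b, c] 0) * v (![a, b, c] 1) *
      w (![a, b, c] 2)) = (phiZ a b c : ℝ) * (u a * v b * w c) := fun a b c => rfl
  simp only [e, phiZ_eq_wedgeZ]
  push_cast
  simp only [add_mul, sub_mul, Finset.sum_add_distrib, Finset.sum_sub_distrib, sum_wedgeZ]
  rfl

/-! ### Components in charts -/

section Charts

/-- The domain of the change of coordinates from `e` to `e'`. -/
def overlap {M : Type*} [TopologicalSpace M] (e e' : OpenPartialHomeomorph M E7) : Set E7 :=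
  (e.symm.trans e').source

theorem mem_overlap {M : Type*} [TopologicalSpace M] {e e' : OpenPartialHomeomorph M E7} {y : E7} :
    y ∈ overlap e e' ↔ y ∈ e.target ∧ e.symm y ∈ e'.source := by
  simp [overlap]

theorem threeForm_congr {M : Type*} [TopologicalSpace M] [ChartedSpace E7 M] (η : ThreeForm M)
    {x x' : M} (h : x = x') (v : Fin 3 → E7) : η x v = η x' v := by
  subst h; rfl

variable {M : Type*} [TopologicalSpace M] [ChartedSpace E7 M] [IsManifold (𝓡 7) ∞ M]
  {e e' : OpenPartialHomeomorph M E7} {η : ThreeForm M} {y : E7}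

theorem isManifold_one : IsManifold (𝓡 7) 1 M := IsManifold.of_le (n := ∞) (by simp)

theorem mdifferentiable_chart_of_mem (he : e ∈ atlas E7 M) : e.MDifferentiable (𝓡 7) (𝓡 7) :=
  haveI : IsManifold (𝓡 7) 1 M := isManifold_one
  mdifferentiable_of_mem_atlas he

theorem mfderiv_symm_injective (he : e ∈ atlas E7 M) (hy : y ∈ e.target) :
    Function.Injective (mfderiv (𝓡 7) (𝓡 7) e.symm y) :=
  (mdifferentiable_chart_of_mem he).symm.mfderiv_injective hy

theorem clm_eq_sum_single (D : E7 →L[ℝ] E7) (v : E7) :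
    D v = ∑ a, v a • D (EuclideanSpace.single a 1) := by
  conv_lhs => rw [sum_coord_single v]
  simp only [map_sum, map_smul]

theorem det_ne_zero_of_injective {B : E7 →ₗ[ℝ] E7} (hB : Function.Injective B)
    {A : Matrix (Fin 7) (Fin 7) ℝ} (hA : ∀ a j, A a j = B (EuclideanSpace.single j 1) a) :
    A.det ≠ 0 := by
  intro h
  obtain ⟨v, hv, hAv⟩ := Matrix.exists_mulVec_eq_zero_iff.2 h
  refine hv ?_
  have h1 : B (WithLp.toLp 2 v) = 0 := by
    rw [sum_coord_single (WithLp.toLp 2 v), map_sum]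
    ext a
    have := congrFun hAv a
    simp only [Matrix.mulVec, dotProduct, hA, Pi.zero_apply] at this
    simp only [map_smul, WithLp.ofLp_sum, WithLp.ofLp_smul, Finset.sum_apply, Pi.smul_apply,
      smul_eq_mul, WithLp.ofLp_zero, Pi.zero_apply]
    rw [← this]
    exact Finset.sum_congr rfl fun j _ => mul_comm _ _
  have h2 : WithLp.toLp 2 v = (0 : E7) := hB (h1.trans (map_zero B).symm)
  ext a
  exact congrArg (fun x : E7 => x a) h2

theorem components_pos (he : e ∈ atlas E7 M) (hy : y ∈ e.target)
    (hη : IsPositiveAt η (e.symm y)) :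
    ∃ A : Matrix (Fin 7) (Fin 7) ℝ, A.det ≠ 0 ∧ components e η y = pullT A std := by
  obtain ⟨u, hu⟩ := hη
  set B : E7 →ₗ[ℝ] E7 := u.toLinearMap ∘ₗ (mfderiv (𝓡 7) (𝓡 7) e.symm y).toLinearMap
  have hB : Function.Injective B := u.injective.comp (mfderiv_symm_injective he hy)
  refine ⟨Matrix.of fun a j => B (EuclideanSpace.single j 1) a,
    det_ne_zero_of_injective hB fun _ _ => rfl, ?_⟩
  ext J
  rw [components, hu, stdForm_eq_sum, pullT]
  refine Finset.sum_congr rfl fun I _ => ?_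
  rw [Fin.prod_univ_three]
  rfl

theorem multilinear_expand {E : Type*} [AddCommGroup E] [Module ℝ E] {k : ℕ}
    (f : MultilinearMap ℝ (fun _ : Fin k => E) ℝ) (A : Matrix (Fin 7) (Fin 7) ℝ) (w : Fin 7 → E)
    (J : Fin k → Fin 7) : f (fun r => ∑ a, A a (J r) • w a) =
      pullT A (fun I => f fun r => w (I r)) J := by
  rw [MultilinearMap.map_sum, pullT]
  refine Finset.sum_congr rfl fun I _ => ?_
  rw [MultilinearMap.map_smul_univ, smul_eq_mul, mul_comm]

theorem jac_eq_fderiv {F : E7 → E7} (hF : DifferentiableAt ℝ F y) (a j : Fin 7) :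
    jac F y a j = fderiv ℝ F y (EuclideanSpace.single j 1) a := by
  have h := ((EuclideanSpace.proj a : E7 →L[ℝ] ℝ).hasFDerivAt.comp y hF.hasFDerivAt).fderiv
  change fderiv ℝ ((EuclideanSpace.proj a : E7 →L[ℝ] ℝ) ∘ F) y _ = _
  rw [h]
  rfl

theorem mdifferentiableAt_transition (he : e ∈ atlas E7 M) (he' : e' ∈ atlas E7 M)
    (hy : y ∈ overlap e e') : DifferentiableAt ℝ (e' ∘ e.symm) y := by
  rw [mem_overlap] at hy
  exact (((mdifferentiable_chart_of_mem he').mdifferentiableAt hy.2).comp y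
    ((mdifferentiable_chart_of_mem he).symm.mdifferentiableAt hy.1)).differentiableAt

theorem mfderiv_symm_eq (he : e ∈ atlas E7 M) (he' : e' ∈ atlas E7 M) (hy : y ∈ overlap e e')
    (v : E7) : (mfderiv (𝓡 7) (𝓡 7) e.symm y v : E7) =
      mfderiv (𝓡 7) (𝓡 7) e'.symm ((e' ∘ e.symm) y) (fderiv ℝ (e' ∘ e.symm) y v) := by
  have hd := mdifferentiableAt_transition he he' hy
  have hyo := mem_overlap.1 hy
  have hF : HasMFDerivAt (𝓡 7) (𝓡 7) (e' ∘ e.symm) y (fderiv ℝ (e' ∘ e.symm) y) :=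
    hd.hasFDerivAt.hasMFDerivAt
  have ht : (e' ∘ e.symm) y ∈ e'.symm.source := e'.map_source hyo.2
  have h' := ((mdifferentiable_chart_of_mem he').symm.mdifferentiableAt ht).hasMFDerivAt
  have hc := h'.comp y hF
  have heq : (e.symm : E7 → M) =ᶠ[nhds y] e'.symm ∘ (e' ∘ e.symm) := by
    filter_upwards [(e.symm.trans e').open_source.mem_nhds hy] with z hz
    exact (e'.left_inv (mem_overlap.1 hz).2).symm
  have := (hc.congr_of_eventuallyEq heq).mfderiv
  rw [this]
  rfl

/-- Near `y`, `e.symm` is `e'.symm` composed with the transition map. The chain rule expands the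
coordinate vectors of `e` in those of `e'`, with the Jacobian as coefficients, and multilinearity
gives the pullback. -/
theorem components_transition (he : e ∈ atlas E7 M) (he' : e' ∈ atlas E7 M)
    (hy : y ∈ overlap e e') : components e η y = pullF (e' ∘ e.symm) (components e' η) y := by
  have hd := mdifferentiableAt_transition he he' hy
  ext J
  have hx : e.symm y = e'.symm ((e' ∘ e.symm) y) := (e'.left_inv (mem_overlap.1 hy).2).symm
  have hv : ∀ j, (coordVector e y j : E7) =
      ∑ a, jac (e' ∘ e.symm) y a j • (coordVector e' ((e' ∘ e.symm) y) a : E7) := by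
    intro j
    refine (mfderiv_symm_eq he he' hy _).trans ((clm_eq_sum_single
      (mfderiv (𝓡 7) (𝓡 7) e'.symm ((e' ∘ e.symm) y)) _).trans ?_)
    refine Finset.sum_congr rfl fun a _ => ?_
    rw [jac_eq_fderiv hd]
    rfl
  refine (threeForm_congr η hx _).trans ?_
  have := multilinear_expand (η (e'.symm ((e' ∘ e.symm) y))).toMultilinearMap
    (jac (e' ∘ e.symm) y) (fun a => coordVector e' ((e' ∘ e.symm) y) a) J
  rw [pullF]
  refine Eq.trans ?_ this
  change (η (e'.symm ((e' ∘ e.symm) y))) _ = (η (e'.symm ((e' ∘ e.symm) y))) _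
  congr 1
  ext1 r
  exact hv (J r)

theorem isChange_transition (he : e ∈ atlas E7 M) (he' : e' ∈ atlas E7 M) :
    IsChange (e' ∘ e.symm) (overlap e e') e'.target where
  isOpen_source := (e.symm.trans e').open_source
  isOpen_target := e'.open_target
  smooth := by
    have h1 := contMDiffOn_of_mem_maximalAtlas (I := 𝓡 7) (n := ∞)
      (IsManifold.subset_maximalAtlas he')
    have h2 := contMDiffOn_symm_of_mem_maximalAtlas (I := 𝓡 7) (n := ∞)
      (IsManifold.subset_maximalAtlas he)
    exact contMDiffOn_iff_contDiffOn.1 (h1.comp (h2.mono fun z hz => (mem_overlap.1 hz).1)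
      fun z hz => (mem_overlap.1 hz).2)
  maps := fun z hz => e'.map_source (mem_overlap.1 hz).2
  det_ne_zero := fun z hz => by
    have hd := mdifferentiableAt_transition he he' hz
    refine det_ne_zero_of_injective (B := (fderiv ℝ (e' ∘ e.symm) z).toLinearMap)
      (fun v w hvw => ?_) fun a j => jac_eq_fderiv hd a j
    refine mfderiv_symm_injective he (mem_overlap.1 hz).1 ?_
    refine (mfderiv_symm_eq he he' hz v).trans (Eq.trans ?_ (mfderiv_symm_eq he he' hz w).symm)
    exact congrArg (mfderiv (𝓡 7) (𝓡 7) e'.symm ((e' ∘ e.symm) z)) hvw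

/-- `Λ` may be computed in any chart. -/
theorem Lambda_eq (hη : ∀ e ∈ atlas E7 M, IsG2On e.target (components e η))
    (he : e ∈ atlas E7 M) {x : M} (hx : x ∈ e.source) :
    Lambda η x = coordLambda (components e η) (e x) := by
  set e₀ := chartAt E7 x
  have he₀ : e₀ ∈ atlas E7 M := chart_mem_atlas E7 x
  have hx₀ : x ∈ e₀.source := mem_chart_source E7 x
  have hy : e₀ x ∈ overlap e₀ e := mem_overlap.2 ⟨e₀.map_source hx₀, by rwa [e₀.left_inv hx₀]⟩
  have hc := isChange_transition he₀ he
  change coordLambda (components e₀ η) (e₀ x) = _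
  rw [coordLambda_congr hc.isOpen_source hy fun z hz => components_transition he₀ he hz,
    coordLambda_pullF hc (hη e he) hy, Function.comp, e₀.left_inv hx₀]

end Charts

end

section

/-! ### The flow on a compact manifold -/

section Flow

theorem Lambda_nonneg {M : Type*} [TopologicalSpace M] [ChartedSpace E7 M] (η : ThreeForm M)
    (x : M) : 0 ≤ Lambda η x := Real.sqrt_nonneg _

theorem LambdaSup_nonneg {M : Type*} [TopologicalSpace M] [ChartedSpace E7 M] (η : ThreeForm M) :
    0 ≤ LambdaSup η :=
  Real.iSup_nonneg fun x => Lambda_nonneg η x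

variable {M : Type*} [TopologicalSpace M] [ChartedSpace E7 M] [IsManifold (𝓡 7) ∞ M]
  {e : OpenPartialHomeomorph M E7} {ε : ℝ} {φ : ℝ → ThreeForm M}

theorem IsLaplacianFlow.isClosedG2On (h : IsLaplacianFlow ε φ) (he : e ∈ atlas E7 M) {t : ℝ}
    (ht : t ∈ Set.Icc 0 ε) : IsClosedG2On e.target (components e (φ t)) where
  isOpen := e.open_target
  smooth := fun J => (h.smooth e he J).comp (contDiffOn_const.prodMk contDiffOn_id)
    fun _ hy => ⟨ht, hy⟩
  pos := fun _ hy => components_pos he hy (h.positive t ht _)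
  closed := h.closed t ht e he

theorem extD_zero_of_forall {Ω : Set E7} (hΩ : IsOpen Ω) {k : ℕ} {α : CoordTensor k}
    (h : ∀ z ∈ Ω, ∀ J, α z J = 0) {y : E7} (hy : y ∈ Ω) (J : Fin (k + 1) → Fin 7) :
    extD α y J = 0 := by
  simp only [extD]
  refine Finset.sum_eq_zero fun s _ => ?_
  rw [pderiv_congr hΩ hy fun z hz => h z hz _, pderiv_const, mul_zero]

theorem codiff_zero_of_forall {Ω : Set E7} (hΩ : IsOpen Ω) (φ : CoordTensor 3) {k l : ℕ}
    (hkl : k + 1 + l = 7) {α : CoordTensor (k + 1)} (h : ∀ z ∈ Ω, ∀ J, α z J = 0) {y : E7}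
    (hy : y ∈ Ω) (J : Fin k → Fin 7) : codiff φ hkl α y J = 0 := by
  have h1 : ∀ z ∈ Ω, ∀ J, hodgeStar φ hkl α z J = 0 := fun z hz J => by
    simp [hodgeStar, contract, h z hz]
  have h2 := extD_zero_of_forall hΩ h1 hy
  simp only [codiff]
  rw [hodgeStar]
  simp [contract, h2]

/-- Closedness on the whole chart kills `d* d φ`, leaving the velocity `d d* φ`. The time interval
is open because two-sided time derivatives are needed. -/
theorem IsLaplacianFlow.isG2Flow (h : IsLaplacianFlow ε φ) (he : e ∈ atlas E7 M) :
    IsG2Flow (Set.Ioo 0 ε) e.target (fun t => components e (φ t)) where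
  isOpen_time := isOpen_Ioo
  smooth := fun J => (h.smooth e he J).mono (Set.prod_mono Set.Ioo_subset_Icc_self subset_rfl)
  structureAt := fun t ht => h.isClosedG2On he (Set.Ioo_subset_Icc_self ht)
  evolution := fun t ht y hy J => by
    have ht' := Set.Ioo_subset_Icc_self ht
    have h1 := (h.evolution t ht' e he y hy J).hasDerivAt (Icc_mem_nhds ht.1 ht.2)
    refine h1.congr_deriv ?_
    rw [hodgeLaplacian, codiff_zero_of_forall e.open_target _ _
      (fun z hz J => h.closed t ht' e he z hz J) hy, add_zero]
    rfl

theorem IsLaplacianFlow.Lambda_eq (h : IsLaplacianFlow ε φ) (he : e ∈ atlas E7 M) {t : ℝ}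
    (ht : t ∈ Set.Icc 0 ε) {x : M} (hx : x ∈ e.source) :
    Lambda (φ t) x = coordLambda (components e (φ t)) (e x) :=
  G2.Lambda_eq (fun _ he => (h.isClosedG2On he ht).toIsG2On) he hx

/-- `Λ` is continuous in space and time. -/
theorem IsLaplacianFlow.continuousOn_Lambda (h : IsLaplacianFlow ε φ) (hε : 0 < ε) :
    ContinuousOn (fun p : ℝ × M => Lambda (φ p.1) p.2) (Set.Icc 0 ε ×ˢ Set.univ) := by
  rintro ⟨t, x⟩ ⟨ht, -⟩
  set e := chartAt E7 x
  have he : e ∈ atlas E7 M := chart_mem_atlas E7 x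
  have hx : x ∈ e.source := mem_chart_source E7 x
  have h1 : ContinuousOn (fun p : ℝ × E7 => lambdaSq (components e (φ p.1)) p.2)
      (Set.Icc 0 ε ×ˢ e.target) :=
    (dp_lambdaSq.contDiffOn_time (φ := fun t => components e (φ t)) (uniqueDiffOn_Icc hε)
      e.open_target (fun J => h.smooth e he J) fun t ht => h.isClosedG2On he ht).continuousOn
  have h2 : ContinuousOn (fun p : ℝ × M => (p.1, e p.2)) (Set.Icc 0 ε ×ˢ e.source) :=
    continuousOn_fst.prodMk (e.continuousOn.comp continuousOn_snd fun p hp => hp.2)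
  have h3 : ContinuousOn (fun p : ℝ × M => √(lambdaSq (components e (φ p.1)) (e p.2)))
      (Set.Icc 0 ε ×ˢ e.source) :=
    (h1.comp h2 fun p hp => ⟨hp.1, e.map_source hp.2⟩).sqrt
  have h4 : ContinuousOn (fun p : ℝ × M => Lambda (φ p.1) p.2) (Set.Icc 0 ε ×ˢ e.source) :=
    h3.congr fun p hp => h.Lambda_eq he hp.1 hp.2
  have h5 := h4 (t, x) ⟨ht, hx⟩
  refine h5.mono_of_mem_nhdsWithin ?_
  have : (Set.univ : Set ℝ) ×ˢ e.source ∈ nhds (t, x) :=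
    (isOpen_univ.prod e.open_source).mem_nhds ⟨trivial, hx⟩
  refine Filter.mem_of_superset (inter_mem_nhdsWithin _ this) ?_
  rintro ⟨s, z⟩ ⟨hs, hz⟩
  exact ⟨hs.1, hz.2⟩

theorem HasDerivAt.nonneg_of_left {f : ℝ → ℝ} {d a : ℝ} (h : HasDerivAt f d a)
    (hf : ∀ᶠ s in nhdsWithin a (Set.Iio a), f s ≤ f a) : 0 ≤ d := by
  have h1 : Filter.Tendsto (slope f a) (nhdsWithin a (Set.Iio a)) (nhds d) :=
    (hasDerivAt_iff_tendsto_slope.1 h).mono_left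
      (nhdsWithin_mono a fun s (hs : s < a) => hs.ne)
  refine ge_of_tendsto h1 ?_
  filter_upwards [hf, self_mem_nhdsWithin] with s hs hsa
  rw [slope_def_field]
  exact div_nonneg_of_nonpos (by linarith) (sub_nonpos.2 (le_of_lt hsa))

/-- Comparison of `Λ` with a solution of the associated ordinary differential equation. -/
theorem IsLaplacianFlow.Lambda_lt [CompactSpace M] (h : IsLaplacianFlow ε φ) (hε : 0 < ε)
    {C κ L T : ℝ} (hC : ∀ (I : Set ℝ) (Ω : Set E7) (φ : ℝ → CoordTensor 3) (t : ℝ) (y : E7),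
      IsG2Flow I Ω φ → t ∈ I → y ∈ Ω → IsLocalMax (coordLambda (φ t)) y →
      ∃ d, HasDerivAt (fun s => coordLambda (φ s) y ^ 2) d t ∧ d ≤ C * coordLambda (φ t) y ^ 3)
    (hκ : C < 2 * κ) (hκ0 : 0 < κ) (hL : 0 < L) (h0 : ∀ x, Lambda (φ 0) x < L) (hT : T < ε)
    (hT' : κ * L * T < 1) :
    ∀ t ∈ Set.Icc 0 T, ∀ x, Lambda (φ t) x < L / (1 - κ * L * t) := by
  -- The solution of `b' = κ b²` with `b 0 = L`. It is finite up to time `T` because `κ L T < 1`.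
  set b : ℝ → ℝ := fun t => L / (1 - κ * L * t) with hb
  have hpos : ∀ t ≤ T, 0 < 1 - κ * L * t := fun t ht => by
    have : κ * L * t ≤ κ * L * T := by gcongr
    linarith
  have hbpos : ∀ t ≤ T, 0 < b t := fun t ht => div_pos hL (hpos t ht)
  have hbder : ∀ t ≤ T, HasDerivAt b (κ * b t ^ 2) t := fun t ht => by
    have h1 : HasDerivAt (fun t => 1 - κ * L * t) (-(κ * L)) t := by
      simpa using ((hasDerivAt_id t).const_mul (κ * L)).const_sub 1
    have h2 := (hasDerivAt_const t L).div h1 (hpos t ht).ne'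
    refine h2.congr_deriv ?_
    have := (hpos t ht).ne'
    simp only [hb]
    field_simp
    ring
  by_contra! hcon
  obtain ⟨t₁, ht₁, x₁, hx₁⟩ := hcon
  have hcont := (h.continuousOn_Lambda hε).mono
    (Set.prod_mono (Set.Icc_subset_Icc_right hT.le) (subset_refl Set.univ))
  -- The set where the comparison fails. By continuity and compactness of `M` it is compact, so a
  -- first failing time exists; there `Λ` equals `b` at some point, and that point is a spatial
  -- maximum.
  set S : Set (ℝ × M) := (Set.Icc 0 T ×ˢ Set.univ) ∩
    (fun p : ℝ × M => Lambda (φ p.1) p.2 - b p.1) ⁻¹' Set.Ici 0 with hS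
  have hbc : ContinuousOn (fun p : ℝ × M => b p.1) (Set.Icc 0 T ×ˢ Set.univ) := fun p hp =>
    ((hbder p.1 hp.1.2).continuousAt.comp (f := Prod.fst) continuousAt_fst).continuousWithinAt
  obtain ⟨K, hK, hKS⟩ := continuousOn_iff_isClosed.1 (hcont.sub hbc) (Set.Ici 0) isClosed_Ici
  have hScomp : IsCompact S := by
    have e : S = (Set.Icc 0 T ×ˢ Set.univ) ∩ K := by
      rw [hS, Set.inter_comm]
      exact hKS.trans (Set.inter_comm _ _)
    rw [e]
    exact (isCompact_Icc.prod isCompact_univ).inter_right hK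
  obtain ⟨⟨t₀, x₀⟩, hmem, hmin⟩ := hScomp.exists_isMinOn (f := Prod.fst)
    ⟨(t₁, x₁), ⟨ht₁, trivial⟩, sub_nonneg.2 hx₁⟩ continuousOn_fst
  have ht₀ : t₀ ∈ Set.Icc 0 T := hmem.1.1
  have hge : b t₀ ≤ Lambda (φ t₀) x₀ := sub_nonneg.1 hmem.2
  have hlt : ∀ s ∈ Set.Ico 0 t₀, ∀ x, Lambda (φ s) x < b s := by
    intro s hs x
    by_contra! hcon
    have : t₀ ≤ s := hmin (a := (s, x))
      ⟨⟨⟨hs.1, hs.2.le.trans ht₀.2⟩, trivial⟩, sub_nonneg.2 hcon⟩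
    exact absurd hs.2 (not_lt.2 this)
  have ht₀pos : 0 < t₀ := by
    rcases ht₀.1.eq_or_lt with h1 | h1
    · subst h1
      have := h0 x₀
      simp only [hb, mul_zero, sub_zero, div_one] at hge
      linarith
    · exact h1
  have htε : t₀ ∈ Set.Ioo 0 ε := ⟨ht₀pos, ht₀.2.trans_lt hT⟩
  have htε' := Set.Ioo_subset_Icc_self htε
  have hle : ∀ x, Lambda (φ t₀) x ≤ b t₀ := by
    intro x
    have hc1 : ContinuousWithinAt (fun s => Lambda (φ s) x) (Set.Ico 0 t₀) t₀ :=
      (h.continuousOn_Lambda hε (t₀, x) ⟨htε', trivial⟩).comp (f := fun s : ℝ => (s, x))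
        (by fun_prop) fun s hs => ⟨⟨hs.1, hs.2.le.trans htε'.2⟩, trivial⟩
    have hc2 : ContinuousWithinAt b (Set.Ico 0 t₀) t₀ :=
      (hbder t₀ ht₀.2).continuousAt.continuousWithinAt
    have hcl : t₀ ∈ closure (Set.Ico 0 t₀) := by
      rw [closure_Ico ht₀pos.ne]
      exact ⟨ht₀pos.le, le_rfl⟩
    exact ContinuousWithinAt.closure_le hcl hc1 hc2 fun s hs => (hlt s hs x).le
  have heq : Lambda (φ t₀) x₀ = b t₀ := le_antisymm (hle x₀) hge
  set e := chartAt E7 x₀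
  have he : e ∈ atlas E7 M := chart_mem_atlas E7 x₀
  have hx : x₀ ∈ e.source := mem_chart_source E7 x₀
  have hmax : IsLocalMax (coordLambda (components e (φ t₀))) (e x₀) := by
    filter_upwards [e.open_target.mem_nhds (e.map_source hx)] with z hz
    have h1 := h.Lambda_eq he htε' (e.map_target hz)
    rw [e.right_inv hz] at h1
    rw [← h1, ← h.Lambda_eq he htε' hx, heq]
    exact hle _
  obtain ⟨d, hd, hdle⟩ := hC _ _ _ t₀ (e x₀) (h.isG2Flow he) htε (e.map_source hx) hmax
  rw [← h.Lambda_eq he htε' hx, heq] at hdle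
  -- `Λ² - b²` vanishes at the first contact and is nonpositive just before, so its derivative is
  -- nonnegative. But the derivative is at most `C b³ - 2 κ b³ < 0`.
  have hder := hd.sub ((hbder t₀ ht₀.2).pow 2)
  have hnn := HasDerivAt.nonneg_of_left hder (by
    filter_upwards [Ioo_mem_nhdsLT ht₀pos] with s hs
    have hs' : s ∈ Set.Icc 0 ε := ⟨hs.1.le, hs.2.le.trans htε'.2⟩
    simp only [Pi.sub_apply, Pi.pow_apply]
    rw [← h.Lambda_eq he hs' hx, ← h.Lambda_eq he htε' hx, heq, sub_self, sub_nonpos]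
    exact pow_le_pow_left₀ (Lambda_nonneg _ _) (hlt s ⟨hs.1.le, hs.2⟩ x₀).le 2)
  have hb3 : 0 < b t₀ ^ 3 := pow_pos (hbpos t₀ ht₀.2) 3
  have : C * b t₀ ^ 3 < 2 * κ * b t₀ ^ 3 := by gcongr
  norm_num at hnn
  nlinarith

theorem IsLaplacianFlow.bddAbove_Lambda [CompactSpace M] (h : IsLaplacianFlow ε φ) (hε : 0 < ε)
    {t : ℝ} (ht : t ∈ Set.Icc 0 ε) : BddAbove (Set.range (Lambda (φ t))) := by
  have hc : Continuous (Lambda (φ t)) := by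
    rw [← continuousOn_univ]
    exact (h.continuousOn_Lambda hε).comp (f := fun x : M => (t, x)) (by fun_prop)
      fun x _ => ⟨ht, trivial⟩
  exact (isCompact_range hc).bddAbove

/-- The comparison needs a positive initial bound strictly above `Λ(0)`. Using `Λ(0) + δ` and
letting `δ` tend to zero also covers `Λ(0) = 0`. -/
theorem IsLaplacianFlow.Lambda_le [CompactSpace M] (h : IsLaplacianFlow ε φ) (hε : 0 < ε)
    {C κ : ℝ} (hC : ∀ (I : Set ℝ) (Ω : Set E7) (φ : ℝ → CoordTensor 3) (t : ℝ) (y : E7),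
      IsG2Flow I Ω φ → t ∈ I → y ∈ Ω → IsLocalMax (coordLambda (φ t)) y →
      ∃ d, HasDerivAt (fun s => coordLambda (φ s) y ^ 2) d t ∧ d ≤ C * coordLambda (φ t) y ^ 3)
    (hκ : C < 2 * κ) (hκ0 : 0 < κ) {t : ℝ} (ht0 : 0 ≤ t) (htε : t < ε)
    (ht : 4 * κ * LambdaSup (φ 0) * t ≤ 1) (x : M) :
    Lambda (φ t) x ≤ 2 * LambdaSup (φ 0) := by
  have hS := LambdaSup_nonneg (φ 0)
  have key : ∀ δ : ℝ, 0 < δ → 4 * κ * δ * t ≤ 1 →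
      Lambda (φ t) x ≤ 2 * (LambdaSup (φ 0) + δ) := by
    intro δ hδ hδt
    have h1 : κ * (LambdaSup (φ 0) + δ) * t ≤ 1 / 2 := by linarith
    have h2 := h.Lambda_lt hε hC hκ hκ0 (by linarith : 0 < LambdaSup (φ 0) + δ)
      (fun x => by
        have := le_ciSup (h.bddAbove_Lambda hε ⟨le_rfl, hε.le⟩) x
        have h3 : Lambda (φ 0) x ≤ LambdaSup (φ 0) := this
        linarith) htε (by linarith) t ⟨ht0, le_rfl⟩ x
    refine h2.le.trans ?_
    rw [div_le_iff₀ (by linarith)]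
    nlinarith
  refine le_of_forall_pos_le_add fun η hη => ?_
  -- The second bound keeps `4 κ δ t ≤ 1`. With the hypothesis on `t` this gives `κ (Λ(0) + δ) t ≤ 1
  -- / 2`, so the denominator of the comparison function is at least `1 / 2`.
  set δ := min (η / 2) (1 / (4 * κ * (t + 1))) with hδ
  have hd0 : 0 < δ := by positivity
  have hδt : 4 * κ * δ * t ≤ 1 := by
    have h1 : δ ≤ 1 / (4 * κ * (t + 1)) := min_le_right _ _
    rw [le_div_iff₀ (by positivity)] at h1
    nlinarith [mul_pos hκ0 hd0]
  have := key δ hd0 hδt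
  have h1 : δ ≤ η / 2 := min_le_left _ _
  linarith

/-- The comparison works strictly before `ε`, so the endpoint `t = ε` is reached by continuity of
`Λ` from the left. -/
theorem IsLaplacianFlow.LambdaSup_le [CompactSpace M] (h : IsLaplacianFlow ε φ) (hε : 0 < ε)
    {C κ : ℝ} (hC : ∀ (I : Set ℝ) (Ω : Set E7) (φ : ℝ → CoordTensor 3) (t : ℝ) (y : E7),
      IsG2Flow I Ω φ → t ∈ I → y ∈ Ω → IsLocalMax (coordLambda (φ t)) y →
      ∃ d, HasDerivAt (fun s => coordLambda (φ s) y ^ 2) d t ∧ d ≤ C * coordLambda (φ t) y ^ 3)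
    (hκ : C < 2 * κ) (hκ0 : 0 < κ) {t : ℝ} (ht0 : 0 ≤ t) (htε : t ≤ ε)
    (ht : 4 * κ * LambdaSup (φ 0) * t ≤ 1) : LambdaSup (φ t) ≤ 2 * LambdaSup (φ 0) := by
  have hS := LambdaSup_nonneg (φ 0)
  refine Real.iSup_le (fun x => ?_) (by positivity)
  rcases htε.lt_or_eq with hlt | rfl
  · exact h.Lambda_le hε hC hκ hκ0 ht0 hlt ht x
  have hc1 : ContinuousWithinAt (fun s => Lambda (φ s) x) (Set.Ico 0 t) t :=
    (h.continuousOn_Lambda hε (t, x) ⟨⟨ht0, le_rfl⟩, trivial⟩).comp (f := fun s : ℝ => (s, x))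
      (by fun_prop) fun s hs => ⟨⟨hs.1, hs.2.le⟩, trivial⟩
  have hcl : t ∈ closure (Set.Ico 0 t) := by
    rw [closure_Ico hε.ne]
    exact ⟨ht0, le_rfl⟩
  refine ContinuousWithinAt.closure_le hcl hc1 continuousWithinAt_const fun s hs => ?_
  refine h.Lambda_le hε hC hκ hκ0 hs.1 hs.2 (le_trans ?_ ht) x
  have := hs.2.le
  gcongr

end Flow

end

end G2

end

/-! ### The doubling-time estimate -/

theorem proposition4p1 :
    ∃ C : ℝ, 0 < C ∧
      ∀ (M : Type*) [TopologicalSpace M] [ChartedSpace (EuclideanSpace ℝ (Fin 7)) M]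
        [IsManifold (𝓡 7) ∞ M] [CompactSpace M] [T2Space M]
        (ε : ℝ) (φ : ℝ → G2.ThreeForm M),
        0 < ε → G2.IsLaplacianFlow ε φ →
          ∀ t : ℝ, 0 ≤ t → t ≤ ε → C * G2.LambdaSup (φ 0) * t ≤ 1 →
            G2.LambdaSup (φ t) ≤ 2 * G2.LambdaSup (φ 0) := by
  obtain ⟨C, hC0, hC⟩ := G2.exists_reaction_bound
  -- Here `κ = C + 1`, which is positive and satisfies `C < 2 κ` also when `C = 0`; the doubling
  -- constant is `4 κ`.
  refine ⟨4 * (C + 1), by positivity, fun M _ _ _ _ _ ε φ hε h t ht0 htε ht => ?_⟩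
  exact h.LambdaSup_le hε hC (by linarith) (by positivity) ht0 htε ht
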